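/- Let $P\ge 1$ be an integer, $p=\lfloor P/2\rfloor$, and let $q=e^{\hbar}$ with $\hbar\in\mathbb C$ be not a root of unity; write $q^x=e^{\hbar x}$ and $[x]_q=\frac{q^x-q^{-x}}{q-q^{-1}}$. Let $l\in\{0,1\}$, $N=2l+2+P$, $\mathfrak g=\mathfrak{so}(N)$, let $\varepsilon_{1-l},\dots,\varepsilon_{p+1}$ be the standard orthonormal basis of $\mathfrak h^*$, and number the simple roots $\alpha_{1-l},\dots,\alpha_{p+1}$: $\alpha_i=\varepsilon_i-\varepsilon_{i+1}$ for $i\le p$, and $\alpha_{p+1}=\varepsilon_{p+1}$ for odd $P$, $\alpha_{p+1}=\varepsilon_p+\varepsilon_{p+1}$ for even $P$. Let $U_q(\mathfrak g)$ be the quantum group generated by $e_\alpha,f_\alpha,q^{\pm h_\alpha}$ with $[e_\alpha,f_\beta]=\delta_{\alpha\beta}[h_\alpha]_q$ for all simple $\alpha,\beta$, and $U_q(\mathfrak g_-)$ its subalgebra generated by all $f_\alpha$. Let $\mathfrak l=\mathfrak h+\mathfrak{so}(P)$ be the Levi subalgebra whose simple roots are those orthogonal to $\varepsilon_i$ for $i\le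 1$, let $\lambda$ be a weight with $\lambda_i=(\lambda,\varepsilon_i)=0$ for all $i\geq 2$, let $M_\lambda$ be the parabolic Verma module with canonical generator $v_\lambda$, and $U^-_{\mathfrak l}=U_q(\mathfrak g_-)/U_q(\mathfrak g_-)\mathfrak l_-$, where $\mathfrak l_-$ stands for the $f_\alpha$ with $\alpha$ a simple root of $\mathfrak l$. The brackets $[\;\cdot\;]_\mu$ around a module denote the subspace of weight $\mu$. Let $\Delta e_\alpha=e_\alpha\otimes 1+q^{h_\alpha}\otimes e_\alpha$, and let $w_1,\dots,w_N$ be the standard weight basis of the natural module $\mathbb C^N$, $w_1$ being the highest weight vector. An element $y\in M_\lambda$ is a generating coefficient of weight $\mu$ if it is the coefficient at $w_1$ in the expansion $u=\sum_j w_j\otimes y_j$ of a singular vector $u\in\mathbb C^N\otimes M_\lambda$ (a non-zero weight vector annihilated by all $e_\alpha$) whose weight is $\mu$ plus the weight of $w_1$. Write $f_i=f_{\alpha_i}$. For $1\le m\le p+1$ put, for odd $P$, $$\phi_m=(f_m f_{m-1}\cdots f_1)(f_{m+1}f_{m+2}\cdots f_{p+1})(f_{p+1}f_p\cdots f_1),$$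 and for even $P$ $$\phi_m=(f_m\cdots f_1)(f_{m+1}\cdots f_{p-1})f_pf_{p+1}(f_{p-1}\cdots f_1)\quad(m\le p-1),$$ $$\phi_p=f_p(f_{p-1}\cdots f_1)f_{p+1}(f_{p-1}\cdots f_1),\qquad \phi_{p+1}=f_{p+1}(f_{p-1}\cdots f_1)f_p(f_{p-1}\cdots f_1).$$ For $l=1$ put $\phi^1_m=f_0\phi_m$, $\phi^3_m=\phi_mf_0$, and let $\phi^2_m$ be obtained from $\phi_m$ by inserting $f_0$ immediately to the left of its rightmost factor. Let $I$ be the set of all $(i,m)$ with $1\le i\le 3$, $1\le m\le p+1$, except that $(1,p+1)$ and $(3,p+1)$ are omitted if $P$ is even. Let $d=p+1$ for odd $P$ and $d=p$ for even $P$. **Case $l=1$.** The (images of the) $\phi^i_m$, $(i,m)\in I$, form a basis of $[U^-_{\mathfrak l}]_{-\varepsilon_0-\varepsilon_1}$. Put $f^{(P)}_{\varepsilon_0+\varepsilon_1}=\sum_{(i,m)\in I}A^i_m\phi^i_m$, where $$A^1_m=(-1)^{m+1}[\lambda_1+P-m]_q[\lambda_1+\tfrac P2]_q,\qquad A^3_m=(-1)^{m+1}[\lambda_1+m-1]_q[\lambda_1+\tfrac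 P2-1]_q,$$ $$A^2_m=(-1)^m\bigl(q^{m-\frac P2}+q^{-m+\frac P2}\bigr)[\lambda_1+\tfrac P2-1]_q[\lambda_1+\tfrac P2]_q,$$ except that for even $P$ one puts $A^2_p=A^2_{p+1}=(-1)^p[\lambda_1+\tfrac P2-1]_q[\lambda_1+\tfrac P2]_q$. Then, for every $\lambda$, an element of $M_\lambda$ is a generating coefficient of weight $\lambda-\varepsilon_0-\varepsilon_1$ if and only if it is a non-zero scalar multiple of $f^{(P)}_{\varepsilon_0+\varepsilon_1}v_\lambda$. **Case $l=0$.** For every $\lambda$, the vectors $\phi_mv_\lambda$, $1\le m\le d$, form a basis of $[M_\lambda]_{\lambda-2\varepsilon_1}$, and, with $A_m=(-1)^{m-1}[\frac P2-m+1]_q$ and $f^{(P)}_{2\varepsilon_1}=\sum_{m=1}^{d}A_m\phi_m$, an element of $M_\lambda$ is a generating coefficient of weight $\lambda-2\varepsilon_1$ if and only if it is a non-zero scalar multiple of $f^{(P)}_{2\varepsilon_1}v_\lambda$. -/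

import Mathlib

open scoped TensorProduct

noncomputable section

namespace QuantumSO

/-- The power `q ^ x = exp (hb * x)`, where `q = exp hb`. -/
def qpow (hb x : ℂ) : ℂ := Complex.exp (hb * x)

/-- The `q`-number `[x]_q = (q ^ x - q ^ (-x)) / (q - q ^ (-1))`. -/
def qnum (hb x : ℂ) : ℂ :=
  (qpow hb x - qpow hb (-x)) / (qpow hb 1 - qpow hb (-1))

/-- Coordinates, in the orthonormal basis of the `ε`'s, of the simple roots of `so(N)`. With
`n = N / 2` they are `ε_i - ε_{i+1}` for all `i` but the last one, and the last one is `ε_{n-1}`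
for odd `N` and `ε_{n-2} + ε_{n-1}` for even `N` (coordinates are numbered from `0`). -/
def simpleRoot (N : ℕ) (i : Fin (N / 2)) : Fin (N / 2) → ℤ := fun j =>
  if (i : ℕ) + 1 < N / 2 then
    (if j = i then 1 else if (j : ℕ) = i + 1 then -1 else 0)
  else if Odd N then
    (if j = i then 1 else 0)
  else
    (if j = i ∨ (j : ℕ) + 1 = i then 1 else 0)

/-- The inner product of two simple roots. -/
def gram (N : ℕ) (i j : Fin (N / 2)) : ℤ := ∑ k, simpleRoot N i k * simpleRoot N j k

/-- The inner product of a simple root with a weight. -/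
def pairing (N : ℕ) (i : Fin (N / 2)) (μ : Fin (N / 2) → ℂ) : ℂ :=
  ∑ k, (simpleRoot N i k : ℂ) * μ k

/-- The weight with a single coordinate `1`, at position `k`, and the other coordinates `0`. -/
def eps (N : ℕ) (k : ℕ) : Fin (N / 2) → ℂ := fun j => if (j : ℕ) = k then 1 else 0

/-- Generators of the quantized enveloping algebra: `e_α`, `f_α`, `q ^ h_α` and `q ^ (-h_α)`. -/
inductive Gen (N : ℕ) : Type
  | e (i : Fin (N / 2)) : Gen N
  | f (i : Fin (N / 2)) : Gen N
  | k (i : Fin (N / 2)) : Gen N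
  | kinv (i : Fin (N / 2)) : Gen N

/-- The corresponding generator of the free algebra. -/
abbrev gen {N : ℕ} (g : Gen N) : FreeAlgebra ℂ (Gen N) := FreeAlgebra.ι ℂ g

/-- Defining relations of the quantized enveloping algebra of `so(N)`. As the squared lengths of
the simple roots are `2` or `1`, the Serre relations come in the three forms listed: for
orthogonal roots, for a repeated long root, and for a repeated short root. -/
inductive Rel (N : ℕ) (hb : ℂ) : FreeAlgebra ℂ (Gen N) → FreeAlgebra ℂ (Gen N) → Prop
  | k_kinv (i) : Rel N hb (gen (.k i) * gen (.kinv i)) 1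
  | kinv_k (i) : Rel N hb (gen (.kinv i) * gen (.k i)) 1
  | k_k (i j) : Rel N hb (gen (.k i) * gen (.k j)) (gen (.k j) * gen (.k i))
  | k_e (i j) : Rel N hb (gen (.k i) * gen (.e j))
      (qpow hb (gram N i j) • (gen (.e j) * gen (.k i)))
  | k_f (i j) : Rel N hb (gen (.k i) * gen (.f j))
      (qpow hb (-(gram N i j)) • (gen (.f j) * gen (.k i)))
  | e_f (i j) : Rel N hb (gen (.e i) * gen (.f j) - gen (.f j) * gen (.e i))
      (if i = j then (qpow hb 1 - qpow hb (-1))⁻¹ • (gen (.k i) - gen (.kinv i)) else 0)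
  | serre_e_orth (i j) (h : gram N i j = 0) :
      Rel N hb (gen (.e i) * gen (.e j)) (gen (.e j) * gen (.e i))
  | serre_e_long (i j) (h : gram N i j = -1) (hi : gram N i i = 2) :
      Rel N hb (gen (.e i) ^ 2 * gen (.e j)
        - qnum hb 2 • (gen (.e i) * gen (.e j) * gen (.e i))
        + gen (.e j) * gen (.e i) ^ 2) 0
  | serre_e_short (i j) (h : gram N i j = -1) (hi : gram N i i = 1) :
      Rel N hb (gen (.e i) ^ 3 * gen (.e j)
        - (qnum hb 2 + 1) • (gen (.e i) ^ 2 * gen (.e j) * gen (.e i))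
        + (qnum hb 2 + 1) • (gen (.e i) * gen (.e j) * gen (.e i) ^ 2)
        - gen (.e j) * gen (.e i) ^ 3) 0
  | serre_f_orth (i j) (h : gram N i j = 0) :
      Rel N hb (gen (.f i) * gen (.f j)) (gen (.f j) * gen (.f i))
  | serre_f_long (i j) (h : gram N i j = -1) (hi : gram N i i = 2) :
      Rel N hb (gen (.f i) ^ 2 * gen (.f j)
        - qnum hb 2 • (gen (.f i) * gen (.f j) * gen (.f i))
        + gen (.f j) * gen (.f i) ^ 2) 0
  | serre_f_short (i j) (h : gram N i j = -1) (hi : gram N i i = 1) :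
      Rel N hb (gen (.f i) ^ 3 * gen (.f j)
        - (qnum hb 2 + 1) • (gen (.f i) ^ 2 * gen (.f j) * gen (.f i))
        + (qnum hb 2 + 1) • (gen (.f i) * gen (.f j) * gen (.f i) ^ 2)
        - gen (.f j) * gen (.f i) ^ 3) 0

/-- The quantum group `U_q(so(N))` with `q = exp hb`. -/
def Uq (N : ℕ) (hb : ℂ) : Type := RingQuot (Rel N hb)

/-- The ring structure of the quotient. -/
def ringUq (N : ℕ) (hb : ℂ) : Ring (Uq N hb) := RingQuot.instRing (Rel N hb)

instance instRingUq (N : ℕ) (hb : ℂ) : Ring (Uq N hb) := ringUq N hb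

instance instAlgebraUq (N : ℕ) (hb : ℂ) : Algebra ℂ (Uq N hb) :=
  RingQuot.instAlgebra (Rel N hb)

/-- The quotient map from the free algebra. -/
def mkUq (N : ℕ) (hb : ℂ) : FreeAlgebra ℂ (Gen N) →ₐ[ℂ] Uq N hb :=
  RingQuot.mkAlgHom ℂ (Rel N hb)

/-- The generators in `U_q(so(N))`. -/
def uq (N : ℕ) (hb : ℂ) (g : Gen N) : Uq N hb := mkUq N hb (gen g)

/-- The subalgebra `U_q(g_-)` generated by the negative Chevalley generators. -/
abbrev UqNeg (N : ℕ) (hb : ℂ) : Subalgebra ℂ (Uq N hb) :=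
  Algebra.adjoin ℂ (Set.range fun i : Fin (N / 2) => uq N hb (.f i))

/-- The simple roots of the Levi subalgebra `h + so(P)`, `N = 2 * l + 2 + P`: those that are
orthogonal to the first `l + 1` basis weights. -/
def IsLevi (N l : ℕ) (i : Fin (N / 2)) : Prop :=
  ∀ j : Fin (N / 2), (j : ℕ) ≤ l → simpleRoot N i j = 0

/-- The left ideal of `U_q(g_-)` generated by the `f_α` with `α` a simple root of the Levi
subalgebra. -/
def leviIdeal (N l : ℕ) (hb : ℂ) : Submodule (UqNeg N hb) (UqNeg N hb) :=
  Submodule.span (UqNeg N hb) {x | ∃ i, IsLevi N l i ∧ (x : Uq N hb) = uq N hb (.f i)}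

/-- The quotient `U_l^- = U_q(g_-) / U_q(g_-) l_-`. -/
abbrev ULevi (N l : ℕ) (hb : ℂ) : Type := (UqNeg N hb) ⧸ (leviIdeal N l hb)

/-- The elements of weight `μ` in `U_q(g_-)`, with respect to the adjoint action of the Cartan
subalgebra. -/
def negWeightSpace (N : ℕ) (hb : ℂ) (μ : Fin (N / 2) → ℂ) : Submodule ℂ (UqNeg N hb) where
  carrier := {x | ∀ i, uq N hb (.k i) * (x : Uq N hb) =
    qpow hb (pairing N i μ) • ((x : Uq N hb) * uq N hb (.k i))}
  add_mem' := by
    intro x y hx hy i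
    simp only [Set.mem_ofPred_eq] at hx hy
    simp only [Subalgebra.coe_add, mul_add, add_mul, hx i, hy i, smul_add]
  zero_mem' := by
    intro i
    simp
  smul_mem' := by
    intro c x hx i
    simp only [Set.mem_ofPred_eq] at hx
    simp only [Subalgebra.coe_smul, mul_smul_comm, smul_mul_assoc, hx i]
    rw [smul_comm]

/-- The weight space `[U_l^-]_μ`. -/
def leviWeightSpace (N l : ℕ) (hb : ℂ) (μ : Fin (N / 2) → ℂ) : Submodule ℂ (ULevi N l hb) :=
  (negWeightSpace N hb μ).map ((leviIdeal N l hb).mkQ.restrictScalars ℂ)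

/-- The left ideal of `U_q(so(N))` whose quotient is the parabolic Verma module of highest
weight `lam`. -/
def vermaIdeal (N l : ℕ) (hb : ℂ) (lam : Fin (N / 2) → ℂ) :
    Submodule (Uq N hb) (Uq N hb) :=
  Submodule.span (Uq N hb) ({x | ∃ i, x = uq N hb (.e i)}
    ∪ {x | ∃ i, x = uq N hb (.k i) - algebraMap ℂ (Uq N hb) (qpow hb (pairing N i lam))}
    ∪ {x | ∃ i, IsLevi N l i ∧ x = uq N hb (.f i)})

/-- The parabolic Verma module `M_lam`. -/
abbrev Verma (N l : ℕ) (hb : ℂ) (lam : Fin (N / 2) → ℂ) : Type :=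
  (Uq N hb) ⧸ (vermaIdeal N l hb lam)

/-- The canonical generator of the parabolic Verma module. -/
def vermaGen (N l : ℕ) (hb : ℂ) (lam : Fin (N / 2) → ℂ) : Verma N l hb lam :=
  (vermaIdeal N l hb lam).mkQ 1

section Modules

variable (N : ℕ) (hb : ℂ) (M : Type) [AddCommGroup M] [Module ℂ M] [Module (Uq N hb) M]
  [IsScalarTower ℂ (Uq N hb) M]

/-- The action of a generator on a module, as a linear map. -/
def genAct (g : Gen N) : M →ₗ[ℂ] M where
  toFun y := uq N hb g • y
  map_add' := smul_add _
  map_smul' := fun c y => by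
    rw [RingHom.id_apply, ← algebraMap_smul (Uq N hb) c y, smul_smul, ← Algebra.commutes,
      ← smul_smul, algebraMap_smul]

/-- The subspace of weight `μ` of a module. -/
def weightSpace (μ : Fin (N / 2) → ℂ) : Submodule ℂ M :=
  ⨅ i, LinearMap.ker (genAct N hb M (.k i) - qpow hb (pairing N i μ) • LinearMap.id)

/-- The coordinates of the weight of the `j`-th standard basis vector of the natural
representation: `ε_0, …, ε_{n-1}, (0), -ε_{n-1}, …, -ε_0`. -/
def natWeight (j : Fin N) : Fin (N / 2) → ℂ := fun k =>
  if (j : ℕ) = k then 1 else if (j : ℕ) + k + 1 = N then -1 else 0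

/-- The source `b` in the matrix `E_{a b} - E_{b' a'}` of `e_α` in the natural representation,
where `α` is the difference of the weights of the basis vectors `a` and `b`, and
`j' = N - 1 - j`. -/
def natSource (i : Fin (N / 2)) : Fin N := ⟨i + 1, by have := i.isLt; omega⟩

/-- The target `a` in the matrix `E_{a b} - E_{b' a'}` of `e_α` in the natural representation. -/
def natTarget (i : Fin (N / 2)) : Fin N :=
  ⟨if (i : ℕ) + 1 < N / 2 ∨ Odd N then i else i - 1, by have := i.isLt; split_ifs <;> omega⟩

/-- The matrix of `e_α` in the natural representation on `ℂ ^ N`. -/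
def natE (i : Fin (N / 2)) : Matrix (Fin N) (Fin N) ℂ :=
  Matrix.single (natTarget N i) (natSource N i) 1
    - Matrix.single (natSource N i).rev (natTarget N i).rev 1

/-- The matrix of `q ^ h_α` in the natural representation on `ℂ ^ N`. -/
def natK (i : Fin (N / 2)) : Matrix (Fin N) (Fin N) ℂ :=
  Matrix.diagonal fun j => qpow hb (pairing N i (natWeight N j))

/-- The action of `e_α` on `ℂ ^ N ⊗ M`, with the coproduct `Δ e_α = e_α ⊗ 1 + q ^ h_α ⊗ e_α`. -/
def tensorE (i : Fin (N / 2)) : ((Fin N → ℂ) ⊗[ℂ] M) →ₗ[ℂ] ((Fin N → ℂ) ⊗[ℂ] M) :=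
  TensorProduct.map (Matrix.toLin' (natE N i)) LinearMap.id
    + TensorProduct.map (Matrix.toLin' (natK N hb i)) (genAct N hb M (.e i))

/-- The action of `q ^ h_α` on `ℂ ^ N ⊗ M`. -/
def tensorK (i : Fin (N / 2)) : ((Fin N → ℂ) ⊗[ℂ] M) →ₗ[ℂ] ((Fin N → ℂ) ⊗[ℂ] M) :=
  TensorProduct.map (Matrix.toLin' (natK N hb i)) (genAct N hb M (.k i))

/-- Singular vectors of weight `ν` in `ℂ ^ N ⊗ M`: non-zero weight vectors annihilated by all
the `e_α`. -/
def IsSingular (ν : Fin (N / 2) → ℂ) (u : (Fin N → ℂ) ⊗[ℂ] M) : Prop :=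
  u ≠ 0 ∧ (∀ i, tensorK N hb M i u = qpow hb (pairing N i ν) • u) ∧ ∀ i, tensorE N hb M i u = 0

/-- `y` is a generating coefficient of weight `μ`: the coefficient at the first basis vector `w`
of `ℂ ^ N`, in the expansion over the standard basis, of a singular vector (whose weight is `μ`
plus the weight of `w`). -/
def IsGeneratingCoefficient (μ : Fin (N / 2) → ℂ) (y : M) : Prop :=
  ∃ Y : Fin N → M, (∀ j : Fin N, (j : ℕ) = 0 → Y j = y) ∧
    IsSingular N hb M (μ + eps N 0) (∑ j, (Pi.single j (1 : ℂ) : Fin N → ℂ) ⊗ₜ[ℂ] Y j)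

end Modules

/-- The list `k, k - 1, …, 1`. -/
def desc (k : ℕ) : List ℕ := (List.range' 1 k).reverse

/-- The list `a, a + 1, …, b` (empty if `b < a`). -/
def asc (a b : ℕ) : List ℕ := List.range' a (b + 1 - a)

/-- The sequence of indices of the monomial `φ_m`, `1 ≤ m ≤ p + 1`, where `p = P / 2`. -/
def phiWord (P m : ℕ) : List ℕ :=
  if Odd P then
    desc m ++ asc (m + 1) (P / 2 + 1) ++ desc (P / 2 + 1)
  else if m < P / 2 then
    desc m ++ asc (m + 1) (P / 2 - 1) ++ [P / 2, P / 2 + 1] ++ desc (P / 2 - 1)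
  else if m = P / 2 then
    [P / 2] ++ desc (P / 2 - 1) ++ [P / 2 + 1] ++ desc (P / 2 - 1)
  else
    [P / 2 + 1] ++ desc (P / 2 - 1) ++ [P / 2] ++ desc (P / 2 - 1)

/-- The sequence of indices of the monomial `φ^i_m`, `1 ≤ i ≤ 3`: the index `0` is put in front
of `φ_m` for `i = 1`, just before the last factor of `φ_m` for `i = 2`, and after `φ_m` for
`i = 3`. -/
def phiWord' (P i m : ℕ) : List ℕ :=
  if i = 1 then 0 :: phiWord P m
  else if i = 2 then (phiWord P m).dropLast ++ [0] ++ (phiWord P m).drop ((phiWord P m).length - 1)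
  else phiWord P m ++ [0]

/-- The generator `f_{α_m}` where the simple roots are numbered by `1 - l, …, p + 1`
(and `0` for other `m`, which do not occur). -/
def negGen (N l : ℕ) (hb : ℂ) (m : ℕ) : UqNeg N hb :=
  if h : m + l - 1 < N / 2 then
    ⟨uq N hb (.f ⟨m + l - 1, h⟩), Algebra.subset_adjoin ⟨_, rfl⟩⟩
  else 0

/-- The product of the `f_{α_m}` along a sequence of indices `m`. -/
def negMonomial (N l : ℕ) (hb : ℂ) (w : List ℕ) : UqNeg N hb := (w.map (negGen N l hb)).prod

/-- The monomial `φ_m` in the negative part of `U_q(so(P + 2))`. -/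
def phi (P : ℕ) (hb : ℂ) (m : ℕ) : UqNeg (P + 2) hb := negMonomial (P + 2) 0 hb (phiWord P m)

/-- The monomial `φ^i_m` in the negative part of `U_q(so(P + 4))`; here `x = (i, m)`. -/
def phi' (P : ℕ) (hb : ℂ) (x : ℕ × ℕ) : UqNeg (P + 4) hb :=
  negMonomial (P + 4) 1 hb (phiWord' P x.1 x.2)

/-- The indices `m = 1, …, d` of the `φ_m`, where `d = p + 1` for odd `P` and `d = p` for
even `P`. -/
def indices0 (P : ℕ) : Finset ℕ := Finset.Icc 1 ((P + 1) / 2)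

/-- The indices `(i, m)` of the `φ^i_m`: here `1 ≤ i ≤ 3` and `1 ≤ m ≤ p + 1`, where `m = p + 1`
is omitted for `i = 1, 3` if `P` is even. -/
def indices1 (P : ℕ) : Finset (ℕ × ℕ) :=
  (Finset.Icc 1 3 ×ˢ Finset.Icc 1 (P / 2 + 1)).filter
    fun x => Odd P ∨ x.2 ≤ P / 2 ∨ x.1 = 2

/-- The coefficients `A_m` in the case `l = 0`. -/
def coeff0 (P : ℕ) (hb : ℂ) (m : ℕ) : ℂ :=
  (-1) ^ (m - 1) * qnum hb ((P : ℂ) / 2 - m + 1)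

/-- The coefficients `A^i_m` in the case `l = 1`, with `a = λ_1`. -/
def coeff1 (P : ℕ) (hb a : ℂ) (x : ℕ × ℕ) : ℂ :=
  if x.1 = 1 then
    (-1) ^ (x.2 + 1) * qnum hb (a + P - x.2) * qnum hb (a + (P : ℂ) / 2)
  else if x.1 = 2 then
    if Even P ∧ P / 2 ≤ x.2 then
      (-1) ^ (P / 2) * qnum hb (a + (P : ℂ) / 2 - 1) * qnum hb (a + (P : ℂ) / 2)
    else
      (-1) ^ x.2 * (qpow hb (x.2 - (P : ℂ) / 2) + qpow hb (-x.2 + (P : ℂ) / 2))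
        * qnum hb (a + (P : ℂ) / 2 - 1) * qnum hb (a + (P : ℂ) / 2)
  else
    (-1) ^ (x.2 + 1) * qnum hb (a + x.2 - 1) * qnum hb (a + (P : ℂ) / 2 - 1)

/-- The element `f_{2ε_1}^{(P)} = ∑ A_m φ_m`. -/
def dynRoot0 (P : ℕ) (hb : ℂ) : UqNeg (P + 2) hb :=
  ∑ m ∈ indices0 P, coeff0 P hb m • phi P hb m

/-- The element `f_{ε_0+ε_1}^{(P)} = ∑ A^i_m φ^i_m`, with `a = λ_1`. -/
def dynRoot1 (P : ℕ) (hb a : ℂ) : UqNeg (P + 4) hb :=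
  ∑ x ∈ indices1 P, coeff1 P hb a x • phi' P hb x

end QuantumSO

end

/-!
# Generating coefficients of singular vectors in `ℂ ^ N ⊗ M_λ` for `so(N)`

Write `P = 2r + 1 + δ` with `δ ∈ {0, 1}`, so that `p + 1 = r + 1 + δ` and the simple roots are numbered from
`1 - l` to `r + 1 + δ`.

**Reduction to raising operators.** The coefficients `y_j` of a singular vector are tied together by the equations
`Δ e_i u = 0`. The first of them, `y`, is annihilated by every `e_i` that does not map another basis vector to
`w_1`, and it determines the other `y_j`, which arise from it by raising operators (`eq_zero_of_first`,
`IsGeneratingCoefficient.necessary`). Conversely, a nonzero weight vector of the weight in question that is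
annihilated by these `e_i` generates a string of vectors shaped like the natural representation
(`exists_eString`, `exists_eString_one`), and such a string is the family of coefficients of a singular vector
(`EString.isGeneratingCoefficient`). It remains to find the vectors annihilated by the `e_i` with `i ≥ 2` for
`l = 0`, and by those with `i ≥ 1` for `l = 1`, apart from the small values of `P`.

**Spanning.** A weight space of `M_λ` is spanned by the words in the `f_i` with a given content, applied to the
generator `v_λ` (`verma_mem_span_perm`). The generator is annihilated by the `f_i` of `so(P)`, and by the Serre
relations the words of `f_i`, `i ≥ 2`, act on `f_1 v_λ` as on the highest weight vector of the natural
representation of `so(P)`. This reduces every word to normal forms (`app_mem_span_nf`), which for the two weights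
at hand are the `φ_m` and the `φ^i_m` (`app_mem_span_phiWord`, `app_mem_span_phiWord'`).

**The equations.** On combinations of the `φ_m` the vanishing under `e_i`, `i ≥ 2`, is a three-term recurrence for the
coefficients, with a boundary condition at the end of the diagram. Its solutions are multiples of one explicit sequence
of `q`-numbers for `l = 0`; for `l = 1`, where the three copies `φ^1_m`, `φ^2_m`, `φ^3_m` are coupled, they form
a family with three parameters (`SolOne.exists_par`). The vanishing under `e_1` leaves one parameter for every value
of `λ_1`, because consecutive `q`-numbers do not both vanish (`exists_scalar`). This gives the `A^i_m`.

**Independence of `λ`.** To read equations off from vectors one needs linear independence, which is hard to see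
directly for special `λ`. But whether a combination of words annihilates the generator does not depend on `λ`: it
does so only if it lies in the left ideal generated by the Levi part (`mem_leviIdeal_of_smul_eq_zero`,
`verma_wRel`). For the proof `U_q(g)` acts on the quotient of the space of all words by the Serre relations and
by the words that end in a letter of the Levi subalgebra, for every `λ`. So it suffices to argue for convenient
weights: `λ_1 = 2` for `l = 0`, and `(λ_0, λ_1) = (2, 1), (3, 2)` for `l = 1`. There the test vectors are
detected by raising operators. A relation between the `φ^i_m` is in particular annihilated by all `e_i` for both
of the last two weights, hence is a multiple of both vectors of coefficients; as these are not proportional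
(`coeff1_not_proportional`), it is trivial.
-/

noncomputable section

namespace QuantumSO

/-! ### The Serre relations and the natural representation of `so(P)` on words -/

section

section Words

variable {M : Type*} [AddCommGroup M] [Module ℂ M]

/-- The product `f_{w_1} f_{w_2} ⋯` of a family of operators along a word `w`. -/
def app (f : ℕ → M →ₗ[ℂ] M) : List ℕ → M →ₗ[ℂ] M
  | [] => LinearMap.id
  | a :: w => f a ∘ₗ app f w

variable (f : ℕ → M →ₗ[ℂ] M)

@[simp] theorem app_nil (x : M) : app f [] x = x := rfl

@[simp] theorem app_cons (a : ℕ) (w : List ℕ) (x : M) : app f (a :: w) x = f a (app f w x) := rfl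

@[simp] theorem app_append (u w : List ℕ) (x : M) : app f (u ++ w) x = app f u (app f w x) := by
  induction u with
  | nil => rfl
  | cons a u ih => simp [ih]

theorem app_comm (c : M →ₗ[ℂ] M) (w : List ℕ) (h : ∀ a ∈ w, ∀ x, c (f a x) = f a (c x)) (x : M) :
    c (app f w x) = app f w (c x) := by
  induction w with
  | nil => rfl
  | cons a w ih =>
    simp only [app_cons]
    rw [h a (by simp), ih fun b hb => h b (by simp [hb])]

/-- The list `k, k - 1, …, 2`. -/
def dn (k : ℕ) : List ℕ := (List.range' 2 (k - 1)).reverse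

theorem dn_one : dn 1 = [] := rfl

theorem dn_succ (k : ℕ) (hk : 1 ≤ k) : dn (k + 1) = (k + 1) :: dn k := by
  obtain ⟨j, rfl⟩ := Nat.exists_eq_add_of_le hk
  simp only [dn]
  rw [show 1 + j + 1 - 1 = j + 1 by omega, show 1 + j - 1 = j by omega, List.range'_concat]
  simp; omega

theorem desc_zero : desc 0 = [] := rfl

theorem desc_succ (k : ℕ) : desc (k + 1) = (k + 1) :: desc k := by
  simp only [desc]
  rw [List.range'_concat]
  simp; omega

theorem desc_eq_dn (k : ℕ) (hk : 1 ≤ k) : desc k = dn k ++ [1] := by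
  induction k, hk using Nat.le_induction with
  | base => rfl
  | succ k hk ih => rw [desc_succ, ih, dn_succ k hk]; rfl

theorem asc_cons (a b : ℕ) (h : a ≤ b) : asc a b = a :: asc (a + 1) b := by
  simp only [asc]
  rw [show b + 1 - a = (b + 1 - (a + 1)) + 1 by omega, List.range'_succ]

theorem asc_empty (a b : ℕ) (h : b < a) : asc a b = [] := by
  simp only [asc]
  rw [show b + 1 - a = 0 by omega]; rfl

theorem mem_dn {k a : ℕ} : a ∈ dn k ↔ 2 ≤ a ∧ a ≤ k := by
  simp [dn, List.mem_range'_1]; omega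

theorem mem_desc {k a : ℕ} : a ∈ desc k ↔ 1 ≤ a ∧ a ≤ k := by
  simp [desc, List.mem_range'_1]; omega

theorem mem_asc {b c a : ℕ} : a ∈ asc b c ↔ b ≤ a ∧ a ≤ c := by
  simp [asc, List.mem_range'_1]; omega

theorem count_range' (a b n : ℕ) :
    (List.range' b n).count a = if b ≤ a ∧ a < b + n then 1 else 0 := by
  split_ifs with h
  · exact List.count_eq_one_of_mem (List.nodup_range' (step := 1)) (List.mem_range'_1.2 h)
  · exact List.count_eq_zero.2 fun h' => h (List.mem_range'_1.1 h')

theorem count_dn (k a : ℕ) : (dn k).count a = if 2 ≤ a ∧ a ≤ k then 1 else 0 := by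
  rw [dn, List.count_reverse, count_range']; congr 1; simp; omega

theorem count_desc (k a : ℕ) : (desc k).count a = if 1 ≤ a ∧ a ≤ k then 1 else 0 := by
  rw [desc, List.count_reverse, count_range']; congr 1; simp; omega

theorem count_asc (b c a : ℕ) : (asc b c).count a = if b ≤ a ∧ a ≤ c then 1 else 0 := by
  rw [asc, count_range']; congr 1; simp; omega

theorem length_dn (k : ℕ) : (dn k).length = k - 1 := by simp [dn]

theorem length_desc (k : ℕ) : (desc k).length = k := by simp [desc]

theorem length_asc (a b : ℕ) : (asc a b).length = b + 1 - a := by simp [asc]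

/-- The word of `f_{m+1} ⋯ f_r f_s f_{s'} f_r ⋯ f_2`, where `s = r + 1` and `s' = r + 1 + δ`. -/
def up (r δ m : ℕ) : List ℕ := asc (m + 1) r ++ (r + 1) :: (r + 1 + δ) :: dn r

theorem up_self (r δ : ℕ) : up r δ r = (r + 1) :: (r + 1 + δ) :: dn r := by
  rw [up, asc_empty _ _ (by omega)]; rfl

theorem up_cons (r δ m : ℕ) (h : m < r) : up r δ m = (m + 1) :: up r δ (m + 1) := by
  rw [up, asc_cons _ _ (by omega)]; rfl

theorem count_up (r δ m a : ℕ) : (up r δ m).count a =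
    (if m + 1 ≤ a ∧ a ≤ r then 1 else 0) + (if r + 1 = a then 1 else 0)
      + (if r + 1 + δ = a then 1 else 0) + (if 2 ≤ a ∧ a ≤ r then 1 else 0) := by
  simp only [up, List.count_append, List.count_cons, count_asc, count_dn, beq_iff_eq]
  ring

end Words

/-- Adjacency in the Dynkin diagram: the nodes `0, …, r` form a chain, and the end nodes `r + 1`
and `r + 1 + δ` (a single node if `δ = 0`) are attached to `r`. Only pairs directed away from the
node `0` are included. -/
def Adj (r δ i j : ℕ) : Prop := (i + 1 = j ∧ j ≤ r + 1) ∨ (i = r ∧ j = r + 1 + δ)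

/-- Operators `f_0, …, f_{r+1+δ}` that satisfy the Serre relations of type `B` (`δ = 0`) or `D`
(`δ = 1`). Here `P = 2r + 1 + δ`, and `c` stands for `[2]_q`. For `l = 0` there is no node `0`, and
`f_0 = 0`. -/
structure FSys {M : Type*} [AddCommGroup M] [Module ℂ M] (c : ℂ) (r δ : ℕ)
    (f : ℕ → M →ₗ[ℂ] M) : Prop where
  c_ne : c ≠ 0
  c_ne' : c + 1 ≠ 0
  hδ : δ = 0 ∨ δ = 1
  comm : ∀ i j x, i < r → i + 1 < j → j ≤ r + 1 + δ → f i (f j x) = f j (f i x)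
  comm_end : ∀ x, f (r + 1) (f (r + 1 + δ) x) = f (r + 1 + δ) (f (r + 1) x)
  serre : ∀ i j x, Adj r δ i j ∨ Adj r δ j i → (δ = 1 ∨ i ≤ r) →
    f i (f i (f j x)) = c • f i (f j (f i x)) - f j (f i (f i x))
  serre_short : δ = 0 → ∀ x, f (r + 1) (f (r + 1) (f (r + 1) (f r x))) =
    (c + 1) • f (r + 1) (f (r + 1) (f r (f (r + 1) x)))
      - (c + 1) • f (r + 1) (f r (f (r + 1) (f (r + 1) x)))
      + f r (f (r + 1) (f (r + 1) (f (r + 1) x)))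

namespace FSys

variable {M : Type*} [AddCommGroup M] [Module ℂ M] {c : ℂ} {r δ : ℕ} {f : ℕ → M →ₗ[ℂ] M}
  (h : FSys c r δ f)

include h

theorem comm_of {i j : ℕ} (hi : i ≤ r + 1 + δ) (hj : j ≤ r + 1 + δ) (h1 : ¬ Adj r δ i j)
    (h2 : ¬ Adj r δ j i) (x : M) : f i (f j x) = f j (f i x) := by
  have hδ := h.hδ
  unfold Adj at h1 h2
  rcases lt_trichotomy i j with hij | rfl | hij
  · by_cases hr : i < r
    · exact h.comm i j x hr (by omega) hj
    · obtain ⟨rfl, rfl⟩ : i = r + 1 ∧ j = r + 1 + δ := by omega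
      exact h.comm_end x
  · rfl
  · by_cases hr : j < r
    · exact (h.comm j i x hr (by omega) hi).symm
    · obtain ⟨rfl, rfl⟩ : j = r + 1 ∧ i = r + 1 + δ := by omega
      exact (h.comm_end x).symm

/-- If `f_j x = 0` and `f_i² x = 0` for a long root `α_i` next to `α_j`, then
`f_i f_j f_i x = 0`. -/
theorem serre_mid {i j : ℕ} (ha : Adj r δ i j ∨ Adj r δ j i) (hi : δ = 1 ∨ i ≤ r) {x : M}
    (h1 : f i (f i (f j x)) = 0) (h2 : f i (f i x) = 0) : f i (f j (f i x)) = 0 := by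
  have := h.serre i j x ha hi
  rw [h1, h2, map_zero, sub_zero] at this
  exact (smul_eq_zero.1 this.symm).resolve_left h.c_ne

/-- A vector on which the `f_i`, `i ≥ 2`, act as on the highest weight vector of the natural
representation of `so(P)`. -/
structure VType (c : ℂ) (r δ : ℕ) (f : ℕ → M →ₗ[ℂ] M) (t : M) : Prop where
  zero : ∀ i, 2 ≤ i → i ≤ r + 1 + δ → ¬ Adj r δ 1 i → f i t = 0
  sq : ∀ i, 2 ≤ i → Adj r δ 1 i → (δ = 1 ∨ i ≤ r) → f i (f i t) = 0
  cube : r = 1 → δ = 0 → f 2 (f 2 (f 2 t)) = 0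

omit h in
theorem VType.add_smul {t u : M} (ht : VType c r δ f t) (hu : VType c r δ f u) (a b : ℂ) :
    VType c r δ f (a • t + b • u) where
  zero i h1 h2 h3 := by simp [ht.zero i h1 h2 h3, hu.zero i h1 h2 h3]
  sq i h1 h2 h3 := by simp [ht.sq i h1 h2 h3, hu.sq i h1 h2 h3]
  cube h1 h2 := by simp [ht.cube h1 h2, hu.cube h1 h2]

/-- If `u` is annihilated by the `f_i`, `i ≥ 2`, then `f_1 u` is of natural type, by the Serre relations. -/
theorem vType_f_one (hr : 1 ≤ r) {u : M} (hu : ∀ i, 2 ≤ i → i ≤ r + 1 + δ → f i u = 0) :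
    VType c r δ f (f 1 u) := by
  have hδ := h.hδ
  refine ⟨fun i h1 h2 h3 => ?_, fun i h1 h2 h3 => ?_, fun h1 h2 => ?_⟩
  · rw [h.comm_of h2 (by omega) (by unfold Adj; omega) h3, hu i h1 h2, map_zero]
  · have hi : i ≤ r + 1 + δ := by unfold Adj at h2; omega
    rw [h.serre i 1 u (Or.inr h2) h3, hu i h1 hi]; simp
  · subst h1
    rw [h.serre_short h2 u, hu 2 le_rfl (by omega)]; simp

theorem vType_f_zero (hr : 1 ≤ r) {t : M} (ht : VType c r δ f t) : VType c r δ f (f 0 t) := by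
  have hδ := h.hδ
  have hc : ∀ i, 2 ≤ i → i ≤ r + 1 + δ → ∀ x, f i (f 0 x) = f 0 (f i x) := fun i h1 h2 x =>
    (h.comm 0 i x hr (by omega) h2).symm
  refine ⟨fun i h1 h2 h3 => ?_, fun i h1 h2 h3 => ?_, fun h1 h2 => ?_⟩
  · rw [hc i h1 h2, ht.zero i h1 h2 h3, map_zero]
  · have hi : i ≤ r + 1 + δ := by unfold Adj at h2; omega
    rw [hc i h1 hi, hc i h1 hi, ht.sq i h1 h2 h3, map_zero]
  · rw [hc 2 le_rfl (by omega), hc 2 le_rfl (by omega), hc 2 le_rfl (by omega), ht.cube h1 h2,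
      map_zero]

section NaturalRep

variable {t : M} (ht : VType c r δ f t)

include ht

/-- The first half `t, f_2 t, f_3 f_2 t, …` of the weight basis of the natural representation: only
the neighbours of `k` further down the diagram act on `f_k ⋯ f_2 t` with a nonzero result. -/
theorem f_dn_zero {k : ℕ} (hk : 1 ≤ k) (hkr : k ≤ r) {i : ℕ} (hi : 2 ≤ i)
    (hi' : i ≤ r + 1 + δ) (ha : ¬ Adj r δ k i) : f i (app f (dn k) t) = 0 := by
  have hδ := h.hδ
  induction k using Nat.strong_induction_on generalizing i with
  | _ k ih =>
  obtain rfl | hk2 := Nat.eq_or_lt_of_le hk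
  · exact ht.zero i hi hi' ha
  obtain ⟨k, rfl⟩ : ∃ j, k = j + 1 := ⟨k - 1, by omega⟩
  rw [dn_succ k (by omega), app_cons]
  by_cases h1 : i = k + 1
  · subst h1
    obtain rfl | hk3 := Nat.eq_or_lt_of_le (show 1 ≤ k by omega)
    · exact ht.sq 2 le_rfl (by unfold Adj; omega) (Or.inr hkr)
    · obtain ⟨k, rfl⟩ : ∃ j, k = j + 1 := ⟨k - 1, by omega⟩
      rw [dn_succ k (by omega), app_cons, h.serre (k + 1 + 1) (k + 1) _
        (by unfold Adj; omega) (Or.inr hkr),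
        ih k (by omega) (by omega) (by omega) (by omega) (by omega) (by unfold Adj; omega)]
      simp
  by_cases h2 : i = k
  · subst h2
    obtain ⟨k, rfl⟩ : ∃ j, i = j + 1 := ⟨i - 1, by omega⟩
    rw [dn_succ k (by omega), app_cons]
    refine h.serre_mid (by unfold Adj; omega) (Or.inr (by omega)) ?_ ?_
    · rw [ih k (by omega) (by omega) (by omega) (by omega) (by omega) (by unfold Adj; omega)]
      simp
    · rw [← app_cons, ← dn_succ k (by omega)]
      exact ih (k + 1) (by omega) (by omega) (by omega) (by omega) (by omega)
        (by unfold Adj; omega)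
  · rw [h.comm_of hi' (by omega) (by unfold Adj; omega) (by unfold Adj at ha ⊢; omega),
      ih k (by omega) (by omega) (by omega) hi hi' (by unfold Adj; omega), map_zero]

/-- `f_j` squares to zero on the last vector before the middle when `α_j` is a long end root. -/
theorem f_end_sq (hr : 1 ≤ r) (hδ1 : δ = 1) {j : ℕ} (hj : r + 1 ≤ j) (hj' : j ≤ r + 1 + δ) :
    f j (f j (app f (dn r) t)) = 0 := by
  obtain rfl | hr2 := Nat.eq_or_lt_of_le hr
  · exact ht.sq j (by omega) (by unfold Adj; omega) (Or.inl hδ1)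
  · obtain ⟨k, rfl⟩ : ∃ j, r = j + 1 := ⟨r - 1, by omega⟩
    rw [dn_succ k (by omega), app_cons, h.serre j (k + 1) _ (by unfold Adj; omega)
      (Or.inl hδ1), h.f_dn_zero ht (by omega) (by omega) (by omega) hj'
        (by unfold Adj; omega)]
    simp

theorem f_end_cube (hr : 1 ≤ r) (hδ0 : δ = 0) :
    f (r + 1) (f (r + 1) (f (r + 1) (app f (dn r) t))) = 0 := by
  obtain rfl | hr2 := Nat.eq_or_lt_of_le hr
  · exact ht.cube rfl hδ0
  · obtain ⟨k, rfl⟩ : ∃ j, r = j + 1 := ⟨r - 1, by omega⟩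
    rw [dn_succ k (by omega), app_cons, h.serre_short hδ0, h.f_dn_zero ht (k := k)
      (i := k + 1 + 1) (by omega) (by omega) (by omega) (by omega) (by unfold Adj; omega)]
    simp

theorem f_mid_zero (hr : 1 ≤ r) {i j : ℕ} (hi : 2 ≤ i) (hi' : i ≤ r) (hj : r + 1 ≤ j)
    (hj' : j ≤ r + 1 + δ) : f i (f j (app f (dn r) t)) = 0 := by
  have hδ := h.hδ
  by_cases hir : i = r
  · subst hir
    obtain ⟨k, rfl⟩ : ∃ j, i = j + 1 := ⟨i - 1, by omega⟩
    rw [dn_succ k (by omega), app_cons]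
    refine h.serre_mid (by unfold Adj; omega) (Or.inr (by omega)) ?_ ?_
    · rw [h.f_dn_zero ht (by omega) (by omega) (by omega) (by omega) (by unfold Adj; omega)]
      simp
    · rw [← app_cons, ← dn_succ k (by omega)]
      exact h.f_dn_zero ht (by omega) (by omega) (by omega) (by omega) (by unfold Adj; omega)
  · rw [h.comm_of (by omega) hj' (by unfold Adj; omega) (by unfold Adj; omega),
      h.f_dn_zero ht (by omega) (by omega) (by omega) (by omega) (by unfold Adj; omega),
      map_zero]

theorem f_end_up_self (hr : 1 ≤ r) {j : ℕ} (hj : r + 1 ≤ j) (hj' : j ≤ r + 1 + δ) :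
    f j (app f (up r δ r) t) = 0 := by
  rw [up_self, app_cons, app_cons]
  rcases h.hδ with rfl | rfl
  · obtain rfl : j = r + 1 := by omega
    exact h.f_end_cube ht hr rfl
  · obtain rfl | rfl : j = r + 1 ∨ j = r + 1 + 1 := by omega
    · rw [h.comm_end, h.comm_end, h.f_end_sq ht hr rfl le_rfl (by omega), map_zero]
    · rw [← h.comm_end, h.f_end_sq ht hr rfl (by omega) (by omega), map_zero]

/-- The second half of the weight basis of the natural representation: only `f_m` acts on the vector of
the word `up r δ m` with a nonzero result. -/
theorem f_up_zero (hr : 1 ≤ r) {m : ℕ} (hm : 1 ≤ m) (hmr : m ≤ r) {i : ℕ} (hi : 2 ≤ i)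
    (hi' : i ≤ r + 1 + δ) (him : i ≠ m) : f i (app f (up r δ m) t) = 0 := by
  have hδ := h.hδ
  induction hn : r - m using Nat.strong_induction_on generalizing m i with
  | _ n ih =>
  subst hn
  obtain rfl | hmr' := Nat.eq_or_lt_of_le hmr
  · by_cases hir : i ≤ m
    · rw [up_self, app_cons, app_cons,
        h.comm_of (by omega) (by omega) (by unfold Adj; omega) (by unfold Adj; omega),
        h.f_mid_zero ht hr hi hir (by omega) le_rfl, map_zero]
    · exact h.f_end_up_self ht hr (by omega) hi'
  rw [up_cons _ _ _ hmr', app_cons]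
  by_cases h1 : i = m + 1
  · subst h1
    obtain rfl | hm2 := Nat.eq_or_lt_of_le (show m + 1 ≤ r by omega)
    · rw [up_self, app_cons, app_cons, h.serre _ _ _ (by unfold Adj; omega) (Or.inr le_rfl),
        h.f_mid_zero ht hr hi le_rfl (by omega) le_rfl]
      simp
    · rw [up_cons _ _ _ hm2, app_cons, h.serre _ _ _ (by unfold Adj; omega) (Or.inr hmr'),
        ih _ (by omega) (by omega) (by omega) hi hi' (by omega) rfl]
      simp
  by_cases h2 : Adj r δ (m + 1) i
  · obtain rfl | hm2 := Nat.eq_or_lt_of_le (show m + 1 ≤ r by omega)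
    · have hj : m + 1 + 1 ≤ i := by unfold Adj at h2; omega
      rcases h.hδ with rfl | rfl
      · obtain rfl : i = m + 1 + 1 := by omega
        rw [up_self, app_cons, app_cons]
        have h4 := h.serre_short rfl (app f (dn (m + 1)) t)
        rw [h.f_dn_zero ht (by omega) le_rfl (by omega) (by omega) (by unfold Adj; omega),
          h.f_end_cube ht hr rfl, h.f_mid_zero ht hr (by omega) le_rfl le_rfl le_rfl] at h4
        simp only [map_zero, smul_zero, add_zero, zero_sub] at h4
        exact (smul_eq_zero.1 (neg_eq_zero.1 h4.symm)).resolve_left h.c_ne'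
      · rw [up_self, app_cons, app_cons]
        obtain rfl | rfl : i = m + 1 + 1 ∨ i = m + 1 + 1 + 1 := by omega
        · refine h.serre_mid (by unfold Adj; omega) (Or.inl rfl) ?_ ?_
          · rw [h.f_mid_zero ht hr (by omega) le_rfl (by omega) (by omega)]; simp
          · rw [h.comm_end, h.comm_end, h.f_end_sq ht hr rfl (by omega) (by omega), map_zero]
        · rw [h.comm_end]
          refine h.serre_mid (by unfold Adj; omega) (Or.inl rfl) ?_ ?_
          · rw [h.f_mid_zero ht hr (by omega) le_rfl (by omega) (by omega)]; simp
          · rw [← h.comm_end, ← h.comm_end, h.f_end_sq ht hr rfl (by omega) (by omega), map_zero]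
    · obtain rfl : i = m + 1 + 1 := by unfold Adj at h2; omega
      rw [up_cons _ _ _ hm2, app_cons]
      refine h.serre_mid (by unfold Adj; omega) (Or.inr hm2) ?_ ?_
      · rw [ih _ (by omega) (by omega) (by omega) (by omega) (by omega) (by omega) rfl]; simp
      · rw [← app_cons, ← up_cons _ _ _ hm2]
        exact ih _ (by omega) (by omega) (by omega) hi hi' (by omega) rfl
  · rw [h.comm_of hi' (by omega) (by unfold Adj; omega) h2,
      ih _ (by omega) (by omega) (by omega) hi hi' (by omega) rfl, map_zero]

end NaturalRep

end FSys

end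

/-! ### Exchange rules and left multiplication of normal forms -/

section

namespace FSys

variable {M : Type*} [AddCommGroup M] [Module ℂ M] {c : ℂ} {r δ : ℕ} {f : ℕ → M →ₗ[ℂ] M}
  (h : FSys c r δ f)

include h

/-- A rule for moving `f_i` across `f_1` in `f_i f_1 t`, for the neighbours `i ≥ 2` of `1`. -/
def Exch (r δ : ℕ) (f : ℕ → M →ₗ[ℂ] M) (t τ σ : M) : Prop :=
  ∀ i, 2 ≤ i → Adj r δ 1 i → f i (f 1 t) = f 1 (f i τ) + f 0 (f 1 (f i σ))

/-- The exchange rule for `f_i f_1² u`: it is the Serre relation for `α_1` and `α_i`, since `f_i u = 0`. -/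
theorem exch_one (hr : 1 ≤ r) {u : M} (hu : ∀ i, 2 ≤ i → i ≤ r + 1 + δ → f i u = 0) :
    Exch r δ f (f 1 u) (c • f 1 u) 0 := by
  intro i hi ha
  have hi' : i ≤ r + 1 + δ := by unfold Adj at ha; omega
  have := h.serre 1 i u (Or.inl ha) (Or.inr hr)
  rw [hu i hi hi'] at this
  simp only [map_zero] at this
  rw [← sub_eq_zero.1 this.symm]
  simp

/-- The exchange rule for `f_i f_1 f_0 f_1 u`: apply `f_i` to the Serre relation for `α_1` and `α_0`,
use the rule for `f_i f_1²`, and cancel the factor `[2]`. -/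
theorem exch_zero_one (hr : 1 ≤ r) {u : M} (hu : ∀ i, 2 ≤ i → i ≤ r + 1 + δ → f i u = 0) :
    Exch r δ f (f 0 (f 1 u)) (f 1 (f 0 u)) (f 1 u) := by
  intro i hi ha
  have hi' : i ≤ r + 1 + δ := by unfold Adj at ha; omega
  have hc : ∀ x, f i (f 0 x) = f 0 (f i x) := fun x => (h.comm 0 i x hr (by omega) hi').symm
  have e1 := h.serre 1 0 u (by unfold Adj; omega) (Or.inr hr)
  have e2 := h.exch_one hr hu i hi ha
  have e3 := h.exch_one hr (u := f 0 u) (fun j hj hj' => by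
    rw [← h.comm 0 j u hr (by omega) hj', hu j hj hj', map_zero]) i hi ha
  have e4 : c • f 1 (f 0 (f 1 u)) = f 1 (f 1 (f 0 u)) + f 0 (f 1 (f 1 u)) := by rw [e1]; abel
  have e5 := congrArg (f i) e4
  simp only [map_smul, map_zero, add_zero, map_add] at e2 e3 e5
  rw [e3, hc, e2, map_smul, ← smul_add] at e5
  exact smul_right_injective M h.c_ne e5

theorem comm_desc {k i : ℕ} (hk : k < i) (hi : i ≤ r + 1 + δ) (hkr : k ≤ r)
    (ha : ¬ Adj r δ k i) (x : M) : f i (app f (desc k) x) = app f (desc k) (f i x) := by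
  have hδ := h.hδ
  refine app_comm f _ _ (fun a hm y => ?_) x
  rw [mem_desc] at hm
  exact h.comm_of hi (by omega) (by unfold Adj; omega)
    (by unfold Adj at ha ⊢; intro hh; apply ha; obtain rfl : a = k := by omega
        exact hh) y

/-- The exchange rule is carried along the chain: with `Q_k = (f_k ⋯ f_1)(f_k ⋯ f_2) t` one has
`[2] Q_{k+1} = f_{k+1}² Q_k`, and the Serre relation for `α_{k+1}` and `α_i` moves `f_i` across
`f_{k+1}²`. -/
theorem exch_dn {t τ σ : M} (ht : VType c r δ f t) (he : Exch r δ f t τ σ) {k : ℕ} (hk : 1 ≤ k)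
    (hkr : k ≤ r) {i : ℕ} (hi : 2 ≤ i) (ha : Adj r δ k i) :
    f i (app f (desc k) (app f (dn k) t)) =
      app f (desc k) (f i (app f (dn k) τ)) + f 0 (app f (desc k) (f i (app f (dn k) σ))) := by
  have hδ := h.hδ
  induction k, hk using Nat.le_induction generalizing i with
  | base => exact he i hi ha
  | succ k hk ih =>
    have hi' : i ≤ r + 1 + δ := by unfold Adj at ha; omega
    have hki : k + 1 < i := by unfold Adj at ha; omega
    have nadj : ¬ Adj r δ k i := by unfold Adj at ha ⊢; omega
    have hc0 : ∀ j, 2 ≤ j → j ≤ r + 1 + δ → ∀ x, f j (f 0 x) = f 0 (f j x) := fun j h1 h2 x =>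
      (h.comm 0 j x (by omega) (by omega) h2).symm
    set Q := app f (desc k) (app f (dn k) t) with hQ
    obtain ⟨n, rfl⟩ : ∃ n, k = n + 1 := ⟨k - 1, by omega⟩
    -- `[2] Q_{k+1} = f_{k+1}² Q_k`
    have h1 : c • app f (desc (n + 1 + 1)) (app f (dn (n + 1 + 1)) t) =
        f (n + 1 + 1) (f (n + 1 + 1) Q) := by
      have h2 : f (n + 1 + 1) (f (n + 1 + 1) (app f (dn (n + 1)) t)) = 0 := by
        rw [← app_cons, ← dn_succ (n + 1) (by omega)]
        exact h.f_dn_zero ht (by omega) (by omega) (by omega) (by omega) (by unfold Adj; omega)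
      have h3 := h.serre (n + 1 + 1) (n + 1) (app f (desc n) (app f (dn (n + 1)) t))
        (by unfold Adj; omega) (Or.inr (by omega))
      have h4 : ∀ x, f (n + 1 + 1) (app f (desc n) x) = app f (desc n) (f (n + 1 + 1) x) :=
        fun x => h.comm_desc (by omega) (by omega) (by omega) (by unfold Adj; omega) x
      rw [h4, h4, h2, map_zero, map_zero, sub_zero] at h3
      rw [hQ, desc_succ, desc_succ, dn_succ (n + 1) (by omega), app_cons, app_cons, app_cons,
        app_cons, h3]
    have h5 := h.serre (n + 1 + 1) i Q (Or.inl ha) (Or.inr (by omega))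
    have h6 : f i Q = 0 := by
      rw [hQ, h.comm_desc (by omega) hi' (by omega) nadj,
        h.f_dn_zero ht (by omega) (by omega) hi hi' nadj, map_zero]
    rw [h6, ← h1] at h5
    simp only [map_zero, map_smul] at h5
    have h7 : f i (app f (desc (n + 1 + 1)) (app f (dn (n + 1 + 1)) t)) =
        f (n + 1 + 1) (f i (f (n + 1 + 1) Q)) :=
      (smul_right_injective M h.c_ne (sub_eq_zero.1 h5.symm)).symm
    rw [h7, ih (by omega) (by omega) (by unfold Adj; omega), map_add, map_add,
      hc0 i hi hi', hc0 (n + 1 + 1) (by omega) (by omega),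
      h.comm_desc (by omega) hi' (by omega) nadj, h.comm_desc (by omega) hi' (by omega) nadj,
      desc_succ (n + 1), dn_succ (n + 1) (by omega)]
    rfl

/-- The words `w` such that the vectors `w t` form the weight basis of the natural representation
of `so(P)` with highest weight vector `t`. -/
inductive IsV (r δ : ℕ) : List ℕ → Prop
  | low (j) (h1 : 1 ≤ j) (h2 : j ≤ r) : IsV r δ (dn j)
  | mid (i) (hi : i = r + 1 ∨ i = r + 1 + δ) : IsV r δ (i :: dn r)
  | up (m) (h1 : 1 ≤ m) (h2 : m ≤ r) : IsV r δ (up r δ m)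

/-- Pairs of words `z`, `w` whose products `z w t` span the part of degree two in `f_1` of the
module, in the weights that are not below `-2 ε_1`. -/
inductive IsPair (r δ : ℕ) : List ℕ → List ℕ → Prop
  | low (k j) (h1 : 1 ≤ k) (h2 : k ≤ j) (h3 : j ≤ r) : IsPair r δ (desc k) (dn j)
  | mid (k i) (h1 : 1 ≤ k) (h2 : k ≤ r) (hi : i = r + 1 ∨ i = r + 1 + δ) :
      IsPair r δ (desc k) (i :: dn r)
  | up (k m) (h1 : 1 ≤ k) (h2 : k ≤ m) (h3 : m ≤ r) : IsPair r δ (desc k) (up r δ m)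
  | fin : IsPair r δ ((r + 1) :: desc r) ((r + 1 + δ) :: dn r)
  | fin' : IsPair r δ ((r + 1 + δ) :: desc r) ((r + 1) :: dn r)

/-- The action of `f_i` on the middle of the natural representation gives zero or the word `up r δ r`. -/
theorem mid_step (hr : 1 ≤ r) {i j : ℕ} (hj : j = r + 1 ∨ j = r + 1 + δ) (hi : 2 ≤ i)
    (hi' : i ≤ r + 1 + δ) :
    (∀ t, VType c r δ f t → f i (app f (j :: dn r) t) = 0) ∨
    (r + 1 ≤ i ∧ (up r δ r).Perm (i :: j :: dn r) ∧
      ∀ t, f i (app f (j :: dn r) t) = app f (up r δ r) t) := by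
  have hδ := h.hδ
  by_cases hir : i ≤ r
  · exact Or.inl fun t ht => h.f_mid_zero ht hr hi hir (by omega) (by omega)
  · by_cases hij : δ = 1 ∧ i = j
    · obtain ⟨hd, rfl⟩ := hij
      exact Or.inl fun t ht => h.f_end_sq ht hr hd (by omega) (by omega)
    · right
      refine ⟨by omega, ?_, fun t => ?_⟩
      · rw [up_self]
        by_cases h1 : i = r + 1
        · obtain rfl : j = r + 1 + δ := by omega
          rw [h1]
        · obtain ⟨rfl, rfl⟩ : i = r + 1 + δ ∧ j = r + 1 := by omega
          exact List.Perm.swap ..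
      · rw [up_self]
        by_cases h1 : i = r + 1
        · obtain rfl : j = r + 1 + δ := by omega
          rw [h1]; rfl
        · obtain ⟨rfl, rfl⟩ : i = r + 1 + δ ∧ j = r + 1 := by omega
          exact (h.comm_end _).symm

/-- The action of `f_i`, `i ≥ 2`, on the weight basis of the natural representation. -/
theorem v_step (hr : 1 ≤ r) {w : List ℕ} (hw : IsV r δ w) {i : ℕ} (hi : 2 ≤ i)
    (hi' : i ≤ r + 1 + δ) :
    (∀ t, VType c r δ f t → f i (app f w t) = 0) ∨
    ∃ w', IsV r δ w' ∧ w'.Perm (i :: w) ∧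
      ∀ t, f i (app f w t) = app f w' t := by
  have hδ := h.hδ
  cases hw with
  | low j h1 h2 =>
    by_cases ha : Adj r δ j i
    · right
      by_cases hij : i ≤ r
      · obtain rfl : i = j + 1 := by unfold Adj at ha; omega
        exact ⟨dn (j + 1), .low _ (by omega) hij, by rw [dn_succ j h1], fun t => by
          rw [dn_succ j h1]; rfl⟩
      · obtain rfl : j = r := by unfold Adj at ha; omega
        exact ⟨i :: dn j, .mid _ (by omega), List.Perm.refl _, fun t => rfl⟩
    · exact Or.inl fun t ht => h.f_dn_zero ht h1 h2 hi hi' ha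
  | mid j hj =>
    rcases h.mid_step hr hj hi hi' with h0 | ⟨-, hp, he⟩
    · exact Or.inl h0
    · exact Or.inr ⟨_, .up _ hr le_rfl, hp, he⟩
  | up m h1 h2 =>
    by_cases him : i = m
    · subst him
      obtain ⟨k, rfl⟩ : ∃ k, i = k + 1 := ⟨i - 1, by omega⟩
      exact Or.inr ⟨up r δ k, .up _ (by omega) (by omega), by rw [up_cons _ _ k (by omega)],
        fun t => by rw [up_cons _ _ k (by omega)]; rfl⟩
    · exact Or.inl fun t ht => h.f_up_zero ht hr h1 h2 hi hi' him

/-- The action of `f_i`, `i ≥ 2`, on `z w t` for a pair of words `z`, `w`: the result is zero, or the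
vector of another pair, or, when the diagonal `z = f_k ⋯ f_1`, `w = f_k ⋯ f_2` is crossed, the sum
of two such vectors given by the exchange rule. The bound on the number of letters `i` excludes the
weights in which further words would be needed. -/
theorem pair_step (hr : 1 ≤ r) {z w : List ℕ} (hw : IsPair r δ z w) {i : ℕ} (hi : 2 ≤ i)
    (hi' : i ≤ r + 1 + δ)
    (hb : z.count i + w.count i + 1 ≤ if i ≤ r then 2 else 2 - δ) :
    (∀ t, VType c r δ f t → f i (app f z (app f w t)) = 0) ∨
    (∃ z' w', IsPair r δ z' w' ∧ (z' ++ w').Perm (i :: (z ++ w)) ∧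
      ∀ t, f i (app f z (app f w t)) = app f z' (app f w' t)) ∨
    ∃ z' w', IsPair r δ z' w' ∧ (z' ++ w').Perm (i :: (z ++ w)) ∧
      ∀ t τ σ, VType c r δ f t → Exch r δ f t τ σ →
        f i (app f z (app f w t)) = app f z' (app f w' τ) + f 0 (app f z' (app f w' σ)) := by
  have hδ := h.hδ
  cases hw with
  | low k j h1 h2 h3 =>
    rw [count_desc, count_dn] at hb
    have hki : k < i := by by_contra; split_ifs at hb <;> omega
    by_cases ha : Adj r δ k i
    · by_cases hkj : k = j
      · subst hkj
        right; right
        by_cases hir : i ≤ r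
        · obtain rfl : i = k + 1 := by unfold Adj at ha; omega
          refine ⟨desc k, dn (k + 1), .low _ _ h1 (by omega) hir, ?_, fun t τ σ ht he => ?_⟩
          · rw [dn_succ k h1]; exact List.perm_middle
          · rw [h.exch_dn ht he h1 h3 hi ha, dn_succ k h1]; rfl
        · obtain rfl : k = r := by unfold Adj at ha; omega
          exact ⟨desc k, i :: dn k, .mid _ _ h1 le_rfl (by omega), List.perm_middle,
            fun t τ σ ht he => h.exch_dn ht he h1 h3 hi ha⟩
      · right; left
        obtain rfl : i = k + 1 := by unfold Adj at ha; omega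
        exact ⟨desc (k + 1), dn j, .low _ _ (by omega) (by omega) h3, by rw [desc_succ]; rfl,
          fun t => by rw [desc_succ]; rfl⟩
    · have hc := fun x => h.comm_desc hki hi' (by omega) ha x
      by_cases ha' : Adj r δ j i
      · right; left
        by_cases hir : i ≤ r
        · obtain rfl : i = j + 1 := by unfold Adj at ha'; omega
          exact ⟨desc k, dn (j + 1), .low _ _ h1 (by omega) hir,
            by rw [dn_succ j (by omega)]; exact List.perm_middle,
            fun t => by rw [hc, dn_succ j (by omega)]; rfl⟩
        · obtain rfl : j = r := by unfold Adj at ha'; omega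
          exact ⟨desc k, i :: dn j, .mid _ _ h1 h2 (by omega), List.perm_middle,
            fun t => by rw [hc]; rfl⟩
      · left
        intro t ht
        rw [hc, h.f_dn_zero ht (by omega) h3 hi hi' ha', map_zero]
  | mid k j h1 h2 hj =>
    rw [count_desc, List.count_cons, count_dn] at hb
    have hki : k < i := by by_contra; split_ifs at hb <;> omega
    by_cases ha : Adj r δ k i
    · right; left
      by_cases hir : i ≤ r
      · obtain rfl : i = k + 1 := by unfold Adj at ha; omega
        exact ⟨desc (k + 1), j :: dn r, .mid _ _ (by omega) hir hj, by rw [desc_succ]; rfl,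
          fun t => by rw [desc_succ]; rfl⟩
      · obtain rfl : k = r := by unfold Adj at ha; omega
        have hij : ¬ (δ = 1 ∧ i = j) := by
          rintro ⟨hd, rfl⟩
          simp [hir] at hb; omega
        by_cases hi1 : i = k + 1
        · obtain rfl : j = k + 1 + δ := by omega
          subst hi1
          exact ⟨_, _, .fin, List.Perm.refl _, fun t => rfl⟩
        · obtain ⟨rfl, rfl⟩ : i = k + 1 + δ ∧ j = k + 1 := by omega
          exact ⟨_, _, .fin', List.Perm.refl _, fun t => rfl⟩
    · have hc := fun x => h.comm_desc hki hi' h2 ha x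
      rcases h.mid_step hr hj hi hi' with h0 | ⟨-, hp, he⟩
      · exact Or.inl fun t ht => by rw [hc, h0 t ht, map_zero]
      · right; left
        exact ⟨desc k, up r δ r, .up _ _ h1 h2 le_rfl,
          (List.Perm.append_left _ hp).trans List.perm_middle, fun t => by rw [hc, he]⟩
  | up k m h1 h2 h3 =>
    rw [count_desc, count_up] at hb
    have hki : k < i := by by_contra; split_ifs at hb <;> omega
    have hir : i ≤ r := by by_contra; split_ifs at hb <;> omega
    have hkm : k ≠ m := by rintro rfl; split_ifs at hb <;> omega
    have him : i ≤ m := by by_contra; split_ifs at hb <;> omega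
    by_cases ha : i = k + 1
    · subst ha
      right; left
      exact ⟨desc (k + 1), up r δ m, .up _ _ (by omega) (by omega) h3, by rw [desc_succ]; rfl,
        fun t => by rw [desc_succ]; rfl⟩
    · have hc := fun x => h.comm_desc hki hi' (by omega) (by unfold Adj; omega) x
      by_cases hm : i = m
      · subst hm
        right; left
        obtain ⟨n, rfl⟩ : ∃ n, i = n + 1 := ⟨i - 1, by omega⟩
        exact ⟨desc k, up r δ n, .up _ _ h1 (by omega) (by omega),
          by rw [up_cons _ _ n (by omega)]; exact List.perm_middle,
          fun t => by rw [hc, up_cons _ _ n (by omega)]; rfl⟩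
      · left
        intro t ht
        rw [hc, h.f_up_zero ht hr (by omega) h3 hi hi' hm, map_zero]
  | fin =>
    rw [List.count_cons, List.count_cons, count_desc, count_dn] at hb
    simp only [beq_iff_eq] at hb
    split_ifs at hb <;> omega
  | fin' =>
    rw [List.count_cons, List.count_cons, count_desc, count_dn] at hb
    simp only [beq_iff_eq] at hb
    split_ifs at hb <;> omega

/-- The three words that precede the action of the Levi subalgebra in the case `l = 1`. -/
def IsB (b : List ℕ) : Prop := b = [1] ∨ b = [0, 1] ∨ b = [1, 0]

/-- Words that span the part of the module in which `f_0` occurs at most once, `f_1` at most twice,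
in the weights that are not below `-ε_0 - ε_1`. -/
inductive NF (r δ : ℕ) : List ℕ → Prop
  | nil : NF r δ []
  | zero : NF r δ [0]
  | one (w b) (hw : IsV r δ w) (hb : IsB b) : NF r δ (w ++ b)
  | two (z w b) (hw : IsPair r δ z w) (hb : IsB b) : NF r δ (z ++ (w ++ b))
  | two0 (z w) (hw : IsPair r δ z w) : NF r δ (0 :: (z ++ (w ++ [1])))

omit [AddCommGroup M] [Module ℂ M] h in
theorem IsV.two_le {w : List ℕ} (hr : 1 ≤ r) (hw : IsV r δ w) :
    ∀ a ∈ w, 2 ≤ a ∧ a ≤ r + 1 + δ := by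
  cases hw with
  | low j h1 h2 => intro a ha; rw [mem_dn] at ha; omega
  | mid i hi => intro a ha; rw [List.mem_cons, mem_dn] at ha; omega
  | up m h1 h2 =>
    intro a ha
    rw [QuantumSO.up, List.mem_append, List.mem_cons, List.mem_cons, mem_dn, mem_asc] at ha; omega

end FSys

end

/-! ### Reduction of words to normal forms -/

section

namespace FSys

variable {M : Type*} [AddCommGroup M] [Module ℂ M] {c : ℂ} {r δ : ℕ} {f : ℕ → M →ₗ[ℂ] M}
  (h : FSys c r δ f)

theorem IsPair.one_mem {z w : List ℕ} (hr : 1 ≤ r) (hw : IsPair r δ z w) : z.count 1 = 1 := by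
  cases hw with
  | fin => rw [List.count_cons, count_desc]; simp [hr]; omega
  | fin' => rw [List.count_cons, count_desc]; simp [hr]; omega
  | _ => rw [count_desc, if_pos (by omega)]

theorem IsB.cases_count {b : List ℕ} (hb : IsB b) : b.count 1 = 1 ∧ (b = [1] ∨ b.count 0 = 1) := by
  rcases hb with rfl | rfl | rfl <;> simp

/-- The largest number of times each letter is allowed to occur. -/
def maxCount (r δ a : ℕ) : ℕ := if a = 0 then 1 else if a ≤ r then 2 else 2 - δ

section
include h

/-- The vectors `f_1 v`, `f_0 f_1 v` and `f_1 f_0 v` are of natural type. -/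
theorem vType_isB (hr : 1 ≤ r) {v : M} (hv : ∀ i, 2 ≤ i → i ≤ r + 1 + δ → f i v = 0)
    {b : List ℕ} (hb : IsB b) : VType c r δ f (app f b v) := by
  rcases hb with rfl | rfl | rfl
  · exact h.vType_f_one hr hv
  · exact h.vType_f_zero hr (h.vType_f_one hr hv)
  · refine h.vType_f_one hr fun i hi hi' => ?_
    rw [app_cons, app_nil, ← h.comm 0 i v hr (by omega) hi', hv i hi hi', map_zero]

/-- The exchange rules for `f_1 v`, `f_0 f_1 v` and `f_1 f_0 v`. Only the one for `f_0 f_1 v` leads to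
different vectors. -/
theorem exch_isB (hr : 1 ≤ r) {v : M} (hv : ∀ i, 2 ≤ i → i ≤ r + 1 + δ → f i v = 0)
    {b : List ℕ} (hb : IsB b) : (b ≠ [0, 1] ∧ Exch r δ f (app f b v) (c • app f b v) 0) ∨
      (b = [0, 1] ∧ Exch r δ f (app f b v) (app f [1, 0] v) (app f [1] v)) := by
  rcases hb with rfl | rfl | rfl
  · exact Or.inl ⟨by simp, h.exch_one hr hv⟩
  · exact Or.inr ⟨rfl, h.exch_zero_one hr hv⟩
  · refine Or.inl ⟨by simp, h.exch_one hr fun i hi hi' => ?_⟩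
    rw [app_cons, app_nil, ← h.comm 0 i v hr (by omega) hi', hv i hi hi', map_zero]

/-- Left multiplication of a normal form by a letter gives a combination of normal forms. -/
theorem nf_step (hr : 1 ≤ r) {v : M} (hv : ∀ i, 2 ≤ i → i ≤ r + 1 + δ → f i v = 0) {u : List ℕ}
    (hu : NF r δ u) {i : ℕ} (hi' : i ≤ r + 1 + δ)
    (hb : ∀ a, (i :: u).count a ≤ maxCount r δ a) :
    f i (app f u v) ∈
      Submodule.span ℂ {x | ∃ u', NF r δ u' ∧ u'.Perm (i :: u) ∧ x = app f u' v} := by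
  have hc0 : ∀ j, 2 ≤ j → j ≤ r + 1 + δ → ∀ x, f j (f 0 x) = f 0 (f j x) := fun j h1 h2 x =>
    (h.comm 0 j x (by omega) (by omega) h2).symm
  have of_eq : ∀ u', NF r δ u' → u'.Perm (i :: u) → f i (app f u v) = app f u' v →
      f i (app f u v) ∈
        Submodule.span ℂ {x | ∃ u', NF r δ u' ∧ u'.Perm (i :: u) ∧ x = app f u' v} :=
    fun u' h1 h2 h3 => Submodule.subset_span ⟨u', h1, h2, h3⟩
  have of_zero : f i (app f u v) = 0 → f i (app f u v) ∈
        Submodule.span ℂ {x | ∃ u', NF r δ u' ∧ u'.Perm (i :: u) ∧ x = app f u' v} :=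
    fun h0 => h0 ▸ Submodule.zero_mem _
  have hb0 := hb 0
  have hb1 := hb 1
  have hbi := hb i
  have hi3 : i = 0 ∨ i = 1 ∨ 2 ≤ i := by omega
  have m0 : maxCount r δ 0 = 1 := rfl
  have m1 : maxCount r δ 1 = 2 := by simp [maxCount, hr]
  have mi : 2 ≤ i → maxCount r δ i = if i ≤ r then 2 else 2 - δ := fun h2 => by
    simp [maxCount, show i ≠ 0 by omega]
  rw [m0] at hb0
  rw [m1] at hb1
  cases hu with
  | nil =>
    rcases hi3 with rfl | rfl | hi
    · exact of_eq [0] .zero (List.Perm.refl _) rfl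
    · exact of_eq [1] (.one (dn 1) [1] (.low 1 le_rfl hr) (Or.inl rfl)) (List.Perm.refl _) rfl
    · exact of_zero (hv i hi hi')
  | zero =>
    rcases hi3 with rfl | rfl | hi
    · simp at hb0
    · exact of_eq [1, 0] (.one (dn 1) [1, 0] (.low 1 le_rfl hr) (Or.inr (Or.inr rfl)))
        (List.Perm.refl _) rfl
    · exact of_zero (by rw [app_cons, app_nil, hc0 i hi hi', hv i hi hi', map_zero])
  | one w b hw hB =>
    rcases hi3 with rfl | rfl | hi
    · obtain rfl : b = [1] := by
        refine hB.cases_count.2.resolve_right fun hh => ?_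
        rw [List.count_cons, List.count_append, hh] at hb0
        simp at hb0
      refine of_eq (w ++ [0, 1]) (.one _ _ hw (Or.inr (Or.inl rfl))) List.perm_middle ?_
      rw [app_append, app_append, app_comm f (f 0) w fun a ha x =>
        (hc0 a (hw.two_le hr a ha).1 (hw.two_le hr a ha).2 x).symm]
      rfl
    · refine of_eq (desc 1 ++ (w ++ b)) (.two _ _ _ ?_ hB) (List.Perm.refl _) rfl
      cases hw with
      | low j h1 h2 => exact .low 1 j le_rfl h1 h2
      | mid j hj => exact .mid 1 j le_rfl hr hj
      | up m h1 h2 => exact .up 1 m le_rfl h1 h2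
    · rw [app_append] at of_zero of_eq ⊢
      rcases h.v_step hr hw hi hi' with h0 | ⟨w', hw', hp, he⟩
      · exact of_zero (h0 _ (h.vType_isB hr hv hB))
      · exact of_eq (w' ++ b) (.one _ _ hw' hB) (hp.append_right b)
          (by rw [he, app_append])
  | two z w b hw hB =>
    rcases hi3 with rfl | rfl | hi
    · obtain rfl : b = [1] := by
        refine hB.cases_count.2.resolve_right fun hh => ?_
        rw [List.count_cons, List.count_append, List.count_append, hh] at hb0
        simp at hb0
      exact of_eq _ (.two0 z w hw) (List.Perm.refl _) rfl
    · rw [List.count_cons, List.count_append, List.count_append, hw.one_mem hr,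
        hB.cases_count.1] at hb1
      simp at hb1
    · rw [List.count_cons, List.count_append, List.count_append, mi hi] at hbi
      simp only [beq_self_eq_true, if_true] at hbi
      rw [app_append, app_append] at of_zero of_eq ⊢
      have perm : ∀ {z' w' : List ℕ}, (z' ++ w').Perm (i :: (z ++ w)) →
          ∀ {b' : List ℕ}, b'.Perm b → (z' ++ (w' ++ b')).Perm (i :: (z ++ (w ++ b))) := by
        intro z' w' hp b' hb'
        simpa using hp.append hb'
      rcases h.pair_step hr hw hi hi' (by omega) with h0 | ⟨z', w', hw', hp, he⟩ |
        ⟨z', w', hw', hp, he⟩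
      · exact of_zero (h0 _ (h.vType_isB hr hv hB))
      · exact of_eq (z' ++ (w' ++ b)) (.two _ _ _ hw' hB) (perm hp (List.Perm.refl _))
          (by rw [he, app_append, app_append])
      · rcases h.exch_isB hr hv hB with ⟨-, hx⟩ | ⟨rfl, hx⟩
        · rw [he _ _ _ (h.vType_isB hr hv hB) hx]
          simp only [map_smul, map_zero, add_zero]
          refine Submodule.smul_mem _ _ (Submodule.subset_span
            ⟨z' ++ (w' ++ b), .two _ _ _ hw' hB, perm hp (List.Perm.refl _), ?_⟩)
          rw [app_append, app_append]
        · rw [he _ _ _ (h.vType_isB hr hv hB) hx]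
          refine Submodule.add_mem _ (Submodule.subset_span
            ⟨z' ++ (w' ++ [1, 0]), .two _ _ _ hw' (Or.inr (Or.inr rfl)),
              perm hp (List.Perm.swap ..), ?_⟩) (Submodule.subset_span
            ⟨0 :: (z' ++ (w' ++ [1])), .two0 _ _ hw', ?_, ?_⟩)
          · rw [app_append, app_append]
          · refine List.Perm.trans ?_ (perm hp (List.Perm.refl [0, 1]))
            rw [← List.append_assoc, ← List.append_assoc]
            exact List.perm_middle.symm
          · rw [app_cons f 0, app_append, app_append]
  | two0 z w hw =>
    rcases hi3 with rfl | rfl | hi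
    · simp [List.count_append] at hb0
    · rw [List.count_cons, List.count_cons, List.count_append, List.count_append,
        hw.one_mem hr] at hb1
      simp at hb1
    · rw [List.count_cons, List.count_cons, List.count_append, List.count_append, mi hi] at hbi
      simp only [beq_self_eq_true, if_true] at hbi
      have hB : IsB [1] := Or.inl rfl
      rw [app_cons, hc0 i hi hi', app_append, app_append] at of_zero of_eq ⊢
      have perm : ∀ {z' w' : List ℕ}, (z' ++ w').Perm (i :: (z ++ w)) →
          (0 :: (z' ++ (w' ++ [1]))).Perm (i :: 0 :: (z ++ (w ++ [1]))) := by
        intro z' w' hp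
        refine List.Perm.trans (List.Perm.cons 0 ?_) (List.Perm.swap ..)
        simpa using hp.append_right [1]
      rcases h.pair_step hr hw hi hi' (by omega) with h0 | ⟨z', w', hw', hp, he⟩ |
        ⟨z', w', hw', hp, he⟩
      · exact of_zero (by rw [h0 _ (h.vType_isB hr hv hB), map_zero])
      · exact of_eq _ (.two0 _ _ hw') (perm hp) (by rw [he, app_cons f 0, app_append, app_append])
      · rcases h.exch_isB hr hv hB with ⟨-, hx⟩ | ⟨h01, -⟩
        · rw [he _ _ _ (h.vType_isB hr hv hB) hx]
          simp only [map_smul, map_zero, add_zero]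
          refine Submodule.smul_mem _ _ (Submodule.subset_span
            ⟨_, .two0 _ _ hw', perm hp, ?_⟩)
          rw [app_cons f 0, app_append, app_append]
        · simp at h01

/-- Words are reduced to normal forms with the same letters. -/
theorem app_mem_span_nf (hr : 1 ≤ r) {v : M} (hv : ∀ i, 2 ≤ i → i ≤ r + 1 + δ → f i v = 0)
    (w : List ℕ) (hw : ∀ a ∈ w, a ≤ r + 1 + δ) (hb : ∀ a, w.count a ≤ maxCount r δ a) :
    app f w v ∈ Submodule.span ℂ {x | ∃ u, NF r δ u ∧ u.Perm w ∧ x = app f u v} := by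
  induction w with
  | nil => exact Submodule.subset_span ⟨[], .nil, List.Perm.refl _, rfl⟩
  | cons i w ih =>
    have h1 := ih (fun a ha => hw a (by simp [ha])) fun a =>
      (List.count_le_count_cons).trans (hb a)
    rw [app_cons]
    have h2 : f i (app f w v) ∈ (Submodule.span ℂ
        {x | ∃ u, NF r δ u ∧ u.Perm w ∧ x = app f u v}).map (f i) := ⟨_, h1, rfl⟩
    rw [Submodule.map_span] at h2
    refine Submodule.span_le.2 ?_ h2
    rintro _ ⟨_, ⟨u, hu, hp, rfl⟩, rfl⟩
    have hp' : (i :: u).Perm (i :: w) := hp.cons i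
    refine Submodule.span_mono ?_ (h.nf_step hr hv hu (hw i (by simp))
      fun a => (hp'.count_eq a).trans_le (hb a))
    rintro _ ⟨u', h1, h2, rfl⟩
    exact ⟨u', h1, h2.trans hp', rfl⟩

/-- For two different end nodes the two words of maximal degree agree. -/
theorem fin_eq (hr : 1 ≤ r) (hδ : δ = 1) {t : M} (ht : VType c r δ f t)
    (he : Exch r δ f t (c • t) 0) :
    f (r + 1 + δ) (app f (desc r) (f (r + 1) (app f (dn r) t))) =
      f (r + 1) (app f (desc r) (f (r + 1 + δ) (app f (dn r) t))) := by
  have h1 := h.exch_dn ht he hr le_rfl (i := r + 1) (by omega) (by unfold Adj; omega)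
  have h2 := h.exch_dn ht he hr le_rfl (i := r + 1 + δ) (by omega) (by unfold Adj; omega)
  simp only [map_smul, map_zero, add_zero] at h1 h2
  have h3 := h.comm_end (app f (desc r) (app f (dn r) t))
  rw [h1, h2, map_smul, map_smul] at h3
  exact (smul_right_injective M h.c_ne h3).symm

end

/-- A normal form of maximal degree is the word of one of the `φ_m`. -/
theorem IsPair.of_length (hr : 1 ≤ r) {z w : List ℕ} (hw : IsPair r δ z w)
    (hl : 2 * r + 1 ≤ z.length + w.length) :
    (∃ m, 1 ≤ m ∧ m ≤ r ∧ z = desc m ∧ w = QuantumSO.up r δ m) ∨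
    (z = (r + 1) :: desc r ∧ w = (r + 1 + δ) :: dn r) ∨
    (z = (r + 1 + δ) :: desc r ∧ w = (r + 1) :: dn r) := by
  cases hw with
  | low k j h1 h2 h3 => rw [length_desc, length_dn] at hl; omega
  | mid k j h1 h2 => rw [length_desc, List.length_cons, length_dn] at hl; omega
  | up k m h1 h2 h3 =>
    rw [length_desc, QuantumSO.up, List.length_append, List.length_cons, List.length_cons, length_dn,
      length_asc] at hl
    obtain rfl : k = m := by omega
    exact Or.inl ⟨k, h1, h3, rfl, rfl⟩
  | fin => exact Or.inr (Or.inl ⟨rfl, rfl⟩)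
  | fin' => exact Or.inr (Or.inr ⟨rfl, rfl⟩)

end FSys

/-- The word of `φ_m` is `z w 1` for the pair `(z, w)` given here. -/
def phiPair (r δ m : ℕ) : List ℕ × List ℕ :=
  if m ≤ r then (desc m, up r δ m)
  else if m = r + 1 then ((r + 1) :: desc r, (r + 1 + δ) :: dn r)
  else ((r + 1 + δ) :: desc r, (r + 1) :: dn r)

/-- For `P = 2r + 1 + δ`, the word of `φ_m` is a pair of words followed by the letter `1`. -/
theorem phiWord_eq {r δ m : ℕ} (hr : 1 ≤ r) (hδ : δ = 0 ∨ δ = 1) (hm : 1 ≤ m)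
    (hm' : m ≤ r + 1 + δ) :
    phiWord (2 * r + 1 + δ) m = (phiPair r δ m).1 ++ ((phiPair r δ m).2 ++ [1]) := by
  have hd := desc_eq_dn r hr
  rcases hδ with rfl | rfl
  · have ho : Odd (2 * r + 1 + 0) := ⟨r, rfl⟩
    have hp : (2 * r + 1 + 0) / 2 = r := by omega
    rw [phiWord, if_pos ho, hp, phiPair]
    by_cases hmr : m ≤ r
    · rw [if_pos hmr, up, desc_succ r, hd]
      have : asc (m + 1) (r + 1) = asc (m + 1) r ++ [r + 1] := by
        simp only [asc]
        rw [show r + 1 + 1 - (m + 1) = (r + 1 - (m + 1)) + 1 by omega, List.range'_concat]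
        simp; omega
      rw [this]; simp
    · obtain rfl : m = r + 1 := by omega
      rw [if_neg hmr, if_pos rfl, asc_empty _ _ (by omega), desc_succ r]
      simp [hd]
  · have ho : ¬ Odd (2 * r + 1 + 1) := by
      rw [Nat.not_odd_iff_even]; exact ⟨r + 1, by ring⟩
    have hp : (2 * r + 1 + 1) / 2 = r + 1 := by omega
    rw [phiWord, if_neg ho, hp, phiPair]
    by_cases hmr : m ≤ r
    · rw [if_pos (by omega), if_pos hmr, up, show r + 1 - 1 = r by omega]
      simp [hd]
    · rw [if_neg (by omega), if_neg hmr]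
      by_cases h1 : m = r + 1
      · rw [if_pos h1, if_pos h1]
        simp [hd]
      · rw [if_neg h1, if_neg h1]
        simp [hd]

end

/-! ### The raising operators on the natural representation of `so(P)` -/

section

/-- The `k`-th basis vector of the space of weights. -/
def ep (k : ℕ) : ℕ → ℂ := fun j => if j = k then 1 else 0

/-- The inner product of a weight with the simple root `α_i`; the last node is `r + 1 + δ`. -/
def pr (r δ i : ℕ) (μ : ℕ → ℂ) : ℂ :=
  if i ≤ r + δ then μ i - μ (i + 1) else if δ = 0 then μ i else μ (i - 1) + μ i

/-- The simple root `α_j`. -/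
def al (r δ j : ℕ) : ℕ → ℂ :=
  if j ≤ r + δ then ep j - ep (j + 1) else if δ = 0 then ep j else ep (j - 1) + ep j

theorem qnum_zero (hb : ℂ) : qnum hb 0 = 0 := by simp [qnum]

/-- Operators `e_i`, `f_j` and weight spaces `W μ` that satisfy the relations between the positive
and the negative generators, for the `e_i` with `i ≥ lo`. The first node is `lo = 1 - l`. -/
structure ESys {M : Type*} [AddCommGroup M] [Module ℂ M] (hb : ℂ) (lo r δ : ℕ)
    (f e : ℕ → M →ₗ[ℂ] M) (W : (ℕ → ℂ) → Submodule ℂ M) : Prop where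
  toF : FSys (qnum hb 2) r δ f
  one : qnum hb 1 = 1
  ef : ∀ i j x, lo ≤ i → i ≤ r + 1 + δ → j ≤ r + 1 + δ → i ≠ j → e i (f j x) = f j (e i x)
  efd : ∀ i μ x, lo ≤ i → i ≤ r + 1 + δ → x ∈ W μ →
    e i (f i x) = f i (e i x) + qnum hb (pr r δ i μ) • x
  wf : ∀ j μ x, lo ≤ j → j ≤ r + 1 + δ → x ∈ W μ → f j x ∈ W (μ - al r δ j)

namespace ESys

variable {M : Type*} [AddCommGroup M] [Module ℂ M] {hb : ℂ} {lo r δ : ℕ}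
  {f e : ℕ → M →ₗ[ℂ] M} {W : (ℕ → ℂ) → Submodule ℂ M}

/-- A vector of weight `ν + ε_2`, where `ν` is orthogonal to the Levi subalgebra `so(P)`, that is a
highest weight vector of a natural representation of `so(P)`. -/
structure SingT (hb : ℂ) (r δ : ℕ) (f e : ℕ → M →ₗ[ℂ] M) (W : (ℕ → ℂ) → Submodule ℂ M)
    (ν : ℕ → ℂ) (t : M) : Prop where
  vType : FSys.VType (qnum hb 2) r δ f t
  e_zero : ∀ i, 2 ≤ i → i ≤ r + 1 + δ → e i t = 0
  wt : t ∈ W (ν + ep 2)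
  ν_zero : ∀ i, 2 ≤ i → ν i = 0

variable (h : ESys hb lo r δ f e W)
include h

theorem efd' {i : ℕ} {μ : ℕ → ℂ} {x : M} {a : ℂ} (hl : lo ≤ i) (hi : i ≤ r + 1 + δ)
    (hx : x ∈ W μ) (ha : pr r δ i μ = a) : e i (f i x) = f i (e i x) + qnum hb a • x := by
  rw [h.efd i μ x hl hi hx, ha]

theorem wf' {j : ℕ} {μ μ' : ℕ → ℂ} {x : M} (hl : lo ≤ j) (hj : j ≤ r + 1 + δ) (hx : x ∈ W μ)
    (ha : μ - al r δ j = μ') : f j x ∈ W μ' := ha ▸ h.wf j μ x hl hj hx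

theorem wf_chain {j : ℕ} {μ ν : ℕ → ℂ} {x : M} (hl : lo ≤ j) (hj : j ≤ r + δ)
    (hx : x ∈ W μ) (hμ : μ = ν + ep j) : f j x ∈ W (ν + ep (j + 1)) :=
  h.wf' hl (by omega) hx (by rw [hμ, al, if_pos hj]; abel)

section Sing

variable {ν : ℕ → ℂ} {t : M} (hlo : lo ≤ 1) (hr : 1 ≤ r) (ht : SingT hb r δ f e W ν t)
include hlo hr ht

omit hr in
theorem wt_dn {k : ℕ} (hk : 1 ≤ k) (hkr : k ≤ r) : app f (dn k) t ∈ W (ν + ep (k + 1)) := by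
  induction k, hk using Nat.le_induction with
  | base => exact ht.wt
  | succ k hk ih =>
    rw [dn_succ k hk, app_cons]
    exact h.wf_chain (by omega) (by omega) (ih (by omega)) rfl

theorem wt_mid_zero (hδ : δ = 0) : f (r + 1) (app f (dn r) t) ∈ W ν :=
  h.wf' (by omega) (by omega) (h.wt_dn hlo ht hr le_rfl)
    (by rw [al, if_neg (by omega), if_pos hδ]; abel)

theorem wt_mid_one (hδ : δ = 1) : f (r + 1) (app f (dn r) t) ∈ W (ν + ep (r + 2)) :=
  h.wf_chain (by omega) (by omega) (h.wt_dn hlo ht hr le_rfl) rfl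

theorem wt_mid_one' (hδ : δ = 1) : f (r + 1 + δ) (app f (dn r) t) ∈ W (ν - ep (r + 2)) :=
  h.wf' (by omega) (by omega) (h.wt_dn hlo ht hr le_rfl)
    (by rw [al, if_neg (by omega), if_neg (by omega), hδ,
          show r + 1 + 1 - 1 = r + 1 by omega, show r + 2 = r + 1 + 1 by omega]; abel)

theorem wt_up {m : ℕ} (hm : 1 ≤ m) (hmr : m ≤ r) : app f (up r δ m) t ∈ W (ν - ep (m + 1)) := by
  induction hn : r - m using Nat.strong_induction_on generalizing m with
  | _ n ih =>
  subst hn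
  obtain rfl | hmr' := Nat.eq_or_lt_of_le hmr
  · rw [up_self, app_cons, app_cons]
    rcases h.toF.hδ with hδ | hδ
    · subst hδ
      exact h.wf' (by omega) (by omega) (h.wt_mid_zero hlo hr ht rfl)
        (by rw [al, if_neg (by omega), if_pos rfl])
    · refine h.wf' (by omega) (by omega) (h.wt_mid_one' hlo hr ht hδ) ?_
      rw [al, if_pos (by omega)]; abel
  · rw [up_cons _ _ _ hmr', app_cons]
    refine h.wf' (by omega) (by omega) (ih _ (by omega) (by omega) hmr' rfl) ?_
    rw [al, if_pos (by omega)]; abel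

omit hr in
/-- The action of the raising operators on the first half of the weight basis of the natural
representation. -/
theorem e_dn {k : ℕ} (hk : 1 ≤ k) (hkr : k ≤ r) {i : ℕ} (hi : 2 ≤ i) (hi' : i ≤ r + 1 + δ) :
    e i (app f (dn k) t) = if i = k then app f (dn (k - 1)) t else 0 := by
  induction k, hk using Nat.le_induction with
  | base => rw [if_neg (by omega)]; exact ht.e_zero i hi hi'
  | succ k hk ih =>
    have ih := ih (by omega)
    rw [dn_succ k hk, app_cons]
    by_cases hik : i = k + 1
    · subst hik
      rw [if_pos rfl, h.efd' (a := 1) (by omega) hi' (h.wt_dn hlo ht hk (by omega)), ih,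
        if_neg (by omega), h.one]
      · simp
      · rw [pr, if_pos (by omega)]
        simp [ep, ht.ν_zero (k + 1) hi, ht.ν_zero (k + 1 + 1) (by omega)]
    · rw [if_neg hik, h.ef _ _ _ (by omega) hi' (by omega) hik, ih]
      split_ifs with hik'
      · subst hik'
        exact h.toF.f_dn_zero ht.vType (by omega) (by omega) (by omega) (by omega)
          (by unfold Adj; omega)
      · simp

/-- The action of the raising operators on the middle of the natural representation. -/
theorem e_mid {i j : ℕ} (hi : 2 ≤ i) (hi' : i ≤ r + 1 + δ) (hj : j = r + 1 ∨ j = r + 1 + δ) :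
    e i (f j (app f (dn r) t)) = if i = j then app f (dn r) t else 0 := by
  by_cases hij : i = j
  · subst hij
    rw [if_pos rfl, h.efd' (a := 1) (by omega) hi' (h.wt_dn hlo ht hr le_rfl),
      h.e_dn hlo ht hr le_rfl hi hi', if_neg (by omega), h.one]
    · simp
    · have hν := ht.ν_zero (r + 1) (by omega)
      have hν' := ht.ν_zero (r + 1 + 1) (by omega)
      rw [pr]
      rcases h.toF.hδ with rfl | rfl
      · obtain rfl : i = r + 1 := by omega
        simp [ep, hν]
      · rcases hj with rfl | rfl
        · simp [ep, hν, hν']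
        · simp [ep, hν, hν']
  · rw [if_neg hij, h.ef _ _ _ (by omega) hi' (by omega) hij, h.e_dn hlo ht hr le_rfl hi hi']
    split_ifs with hir
    · subst hir
      exact h.toF.f_dn_zero ht.vType (by omega) (by omega) (by omega) (by omega)
        (by unfold Adj; omega)
    · simp

theorem e_up_self {i : ℕ} (hi : 2 ≤ i) (hi' : i ≤ r + 1 + δ) :
    e i (app f (up r δ r) t) = if i = r + 1 then f (r + 1 + δ) (app f (dn r) t)
      else if i = r + 1 + δ then f (r + 1) (app f (dn r) t) else 0 := by
  rw [up_self, app_cons, app_cons]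
  rcases h.toF.hδ with rfl | rfl
  · by_cases hir : i = r + 1
    · subst hir
      rw [if_pos rfl, h.efd' (a := 0) (by omega) hi' (h.wt_mid_zero hlo hr ht rfl),
        h.e_mid hlo hr ht hi hi' (Or.inl rfl), if_pos rfl, qnum_zero]
      · simp
      · rw [pr, if_neg (by omega), if_pos rfl, ht.ν_zero _ (by omega)]
    · rw [if_neg hir, if_neg hir, h.ef _ _ _ (by omega) hi' (by omega) hir,
        h.e_mid hlo hr ht hi hi' (Or.inl rfl), if_neg hir, map_zero]
  · by_cases hir : i = r + 1
    · subst hir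
      rw [if_pos rfl, h.efd' (a := 1) (by omega) hi' (h.wt_mid_one' hlo hr ht rfl),
        h.e_mid hlo hr ht hi hi' (Or.inr rfl), if_neg (by omega), h.one]
      · simp
      · rw [pr, if_pos (by omega)]
        simp [ep, ht.ν_zero (r + 1) (by omega), ht.ν_zero (r + 1 + 1) (by omega)]
    · rw [if_neg hir, h.ef _ _ _ (by omega) hi' (by omega) hir,
        h.e_mid hlo hr ht hi hi' (Or.inr rfl)]
      split_ifs <;> simp

/-- The action of the raising operators on the second half of the weight basis. -/
theorem e_up {m : ℕ} (hm : 1 ≤ m) (hmr : m < r) {i : ℕ} (hi : 2 ≤ i) (hi' : i ≤ r + 1 + δ) :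
    e i (app f (up r δ m) t) = if i = m + 1 then app f (up r δ (m + 1)) t else 0 := by
  induction hn : r - m using Nat.strong_induction_on generalizing m i with
  | _ n ih =>
  subst hn
  have e0 : e (m + 1) (app f (up r δ (m + 1)) t) = 0 := by
    obtain rfl | hmr2 := Nat.eq_or_lt_of_le (Nat.succ_le_of_lt hmr)
    · rw [h.e_up_self hlo hr ht (by omega) (by omega), if_neg (by omega), if_neg (by omega)]
    · rw [ih _ (by omega) (by omega) hmr2 (by omega) (by omega) rfl, if_neg (by omega)]
  have e1 : i ≠ m + 1 → f (m + 1) (e i (app f (up r δ (m + 1)) t)) = 0 := by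
    intro him
    obtain rfl | hmr2 := Nat.eq_or_lt_of_le (Nat.succ_le_of_lt hmr)
    · rw [h.e_up_self hlo hr ht hi hi']
      split_ifs
      · exact h.toF.f_mid_zero ht.vType hr (by omega) le_rfl (by omega) le_rfl
      · exact h.toF.f_mid_zero ht.vType hr (by omega) le_rfl le_rfl (by omega)
      · simp
    · rw [ih _ (by omega) (by omega) hmr2 hi hi' rfl]
      split_ifs with him'
      · exact h.toF.f_up_zero ht.vType hr (by omega) (by omega) (by omega) (by omega) (by omega)
      · simp
  rw [up_cons _ _ _ hmr, app_cons]
  by_cases him : i = m + 1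
  · subst him
    rw [if_pos rfl, h.efd' (a := 1) (by omega) hi' (h.wt_up hlo hr ht (by omega) (by omega)),
      e0, h.one]
    · simp
    · rw [pr, if_pos (by omega)]
      simp [ep, ht.ν_zero (m + 1) hi, ht.ν_zero (m + 1 + 1) (by omega)]
  · rw [if_neg him, h.ef _ _ _ (by omega) hi' (by omega) him, e1 him]

end Sing

section Desc

variable (hlo : lo ≤ 1)
include hlo

theorem wt_desc {k : ℕ} (hkr : k ≤ r) {μ : ℕ → ℂ} {y : M} (hy : y ∈ W μ) :
    app f (desc k) y ∈ W (μ - ep 1 + ep (k + 1)) := by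
  induction k with
  | zero => simpa [desc_zero] using hy
  | succ k ih =>
    rw [desc_succ, app_cons]
    exact h.wf_chain (by omega) (by omega) (ih (by omega)) rfl

/-- For `i > k`, the operator `e_i` commutes with `f_k ⋯ f_1`. -/
theorem e_desc_gt {k i : ℕ} (hki : k < i) (hi : 1 ≤ i) (hi' : i ≤ r + 1 + δ)
    (y : M) : e i (app f (desc k) y) = app f (desc k) (e i y) :=
  app_comm f _ _ (fun a ha x => by
    rw [mem_desc] at ha
    exact h.ef _ _ _ (by omega) hi' (by omega) (by omega)) y

theorem e_desc_self {k : ℕ} (hk : 1 ≤ k) (hkr : k ≤ r) {μ : ℕ → ℂ} {y : M} (hy : y ∈ W μ)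
    (he : e k y = 0) {a : ℂ} (ha : pr r δ k (μ - ep 1 + ep k) = a) :
    e k (app f (desc k) y) = qnum hb a • app f (desc (k - 1)) y := by
  obtain ⟨k, rfl⟩ : ∃ n, k = n + 1 := ⟨k - 1, by omega⟩
  rw [desc_succ, app_cons, h.efd' (by omega) (by omega) (h.wt_desc hlo (by omega) hy) ha,
    h.e_desc_gt hlo (by omega) (by omega) (by omega), he]
  simp

theorem e_desc_pred {k : ℕ} (hk : 1 ≤ k) (hkr : k + 1 ≤ r) {μ : ℕ → ℂ} {y : M} (hy : y ∈ W μ)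
    (he : e k y = 0) {a : ℂ} (ha : pr r δ k (μ - ep 1 + ep k) = a) :
    e k (app f (desc (k + 1)) y) = qnum hb a • app f (desc (k - 1)) (f (k + 1) y) := by
  rw [desc_succ, app_cons, h.ef _ _ _ (by omega) (by omega) (by omega) (by omega),
    h.e_desc_self hlo hk (by omega) hy he ha, map_smul,
    h.toF.comm_desc (by omega) (by omega) (by omega) (by unfold Adj; omega)]

/-- For `i < k`, the result of moving `e_i` across `f_k ⋯ f_1` contains `f_{i+1}` next to the vector `y`. -/
theorem e_desc_lt {k i : ℕ} (hi : 1 ≤ i) (hik : i + 1 ≤ k) (hkr : k ≤ r) {μ : ℕ → ℂ} {y : M}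
    (hy : y ∈ W μ) (he : e i y = 0) (hf : f (i + 1) y = 0) : e i (app f (desc k) y) = 0 := by
  induction k, hik using Nat.le_induction with
  | base => rw [h.e_desc_pred hlo hi hkr hy he rfl, hf]; simp
  | succ k hk ih =>
    rw [desc_succ, app_cons, h.ef _ _ _ (by omega) (by omega) (by omega) (by omega),
      ih (by omega), map_zero]

end Desc

end ESys

end

/-! ### The raising operators on the vectors `φ_m t` -/

section

section Vectors

variable {M : Type*} [AddCommGroup M] [Module ℂ M]

/-- The vector `φ_m t`, where the last factor `f_1` of `φ_m` is replaced by the vector `t`. -/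
def phiV (f : ℕ → M →ₗ[ℂ] M) (r δ m : ℕ) : M →ₗ[ℂ] M :=
  app f (phiPair r δ m).1 ∘ₗ app f (phiPair r δ m).2

/-- The vector to which `e_i`, `2 ≤ i ≤ r`, maps the `φ_m t`. -/
def zV (f : ℕ → M →ₗ[ℂ] M) (r δ i : ℕ) : M →ₗ[ℂ] M :=
  app f (desc (i - 1)) ∘ₗ app f (up r δ i)

/-- The vector to which `e_i` maps the `φ_m t`, where `i` and `j` are the end nodes. -/
def zE (f : ℕ → M →ₗ[ℂ] M) (r j : ℕ) : M →ₗ[ℂ] M :=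
  app f (desc r) ∘ₗ app f (j :: dn r)

/-- The linear combination `∑ a_m φ_m t`. -/
def phiSum (f : ℕ → M →ₗ[ℂ] M) (r δ : ℕ) (a : ℕ → ℂ) (t : M) : M :=
  ∑ m ∈ Finset.Icc 1 (r + 1 + δ), a m • phiV f r δ m t

end Vectors

/-- The coefficients `a_m`, `m ≤ r`, followed by the sum of the remaining ones. -/
def fold (r δ : ℕ) (a : ℕ → ℂ) (m : ℕ) : ℂ :=
  if m ≤ r then a m else a (r + 1) + if δ = 1 then a (r + 2) else 0

namespace ESys

variable {M : Type*} [AddCommGroup M] [Module ℂ M] {hb : ℂ} {lo r δ : ℕ}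
  {f e : ℕ → M →ₗ[ℂ] M} {W : (ℕ → ℂ) → Submodule ℂ M}

variable (h : ESys hb lo r δ f e W)
include h

variable {ν : ℕ → ℂ} {t : M} (hlo : lo ≤ 1) (hr : 1 ≤ r) (ht : SingT hb r δ f e W ν t)
include hlo hr ht

theorem wt_mid_pr {j : ℕ} (hj : j = r + 1 ∨ j = r + 1 + δ) :
    ∃ μ : ℕ → ℂ, f j (app f (dn r) t) ∈ W μ ∧ ∀ i, i ≤ r + 1 → μ i = ν i := by
  rcases h.toF.hδ with hδ | hδ
  · obtain rfl : j = r + 1 := by omega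
    exact ⟨ν, h.wt_mid_zero hlo hr ht hδ, fun _ _ => rfl⟩
  · rcases hj with rfl | rfl
    · exact ⟨_, h.wt_mid_one hlo hr ht hδ, fun i hi => by simp [ep, show i ≠ r + 2 by omega]⟩
    · exact ⟨_, h.wt_mid_one' hlo hr ht hδ, fun i hi => by simp [ep, show i ≠ r + 2 by omega]⟩

/-- The operator `e_i`, `2 ≤ i ≤ r`, maps all the `φ_m t` to multiples of one vector: the factors are
those of the three-term recurrence, `1`, `[2]`, `1` for `m = i - 1, i, i + 1`. -/
theorem e_phi {i m : ℕ} (hi : 2 ≤ i) (hi' : i ≤ r) (hm : 1 ≤ m) (hm' : m ≤ r + 1 + δ) :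
    e i (phiV f r δ m t) = ((if i = m then qnum hb 2 else 0) + (if i = m + 1 then 1 else 0) +
      (if m = i + 1 ∨ (i = r ∧ r < m) then 1 else 0)) • zV f r δ i t := by
  have hδ := h.toF.hδ
  have hν := ht.ν_zero
  simp only [phiV, zV, LinearMap.comp_apply]
  by_cases hmr : m ≤ r
  · have hw := h.wt_up hlo hr ht hm hmr
    have hu : e i (app f (up r δ m) t) =
        if i = m + 1 then app f (up r δ (m + 1)) t else 0 := by
      obtain rfl | hmr' := Nat.eq_or_lt_of_le hmr
      · rw [h.e_up_self hlo hr ht hi (by omega), if_neg (by omega), if_neg (by omega),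
          if_neg (by omega)]
      · exact h.e_up hlo hr ht hm hmr' hi (by omega)
    simp only [phiPair, if_pos hmr]
    rcases lt_trichotomy i m with him | rfl | him
    · rw [if_neg (by omega), if_neg (by omega)]
      rw [if_neg (by omega)] at hu
      by_cases him' : m = i + 1
      · subst him'
        rw [if_pos (by omega), h.e_desc_pred hlo (by omega) hmr hw hu (a := 1), h.one]
        · obtain ⟨n, rfl⟩ : ∃ n, i = n + 1 := ⟨i - 1, by omega⟩
          rw [up_cons _ _ (n + 1) hmr]
          simp
        · rw [pr, if_pos (by omega)]
          simp [ep, hν i hi, hν (i + 1) (by omega), show i ≠ 1 by omega, show i ≠ 0 by omega,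
            show i ≠ i + 1 + 1 by omega]
      · rw [if_neg (by omega), h.e_desc_lt hlo (by omega) (by omega) hmr hw hu]
        · simp
        · exact h.toF.f_up_zero ht.vType hr hm hmr (by omega) (by omega) (by omega)
    · rw [if_pos rfl, if_neg (by omega), if_neg (by omega)]
      rw [if_neg (by omega)] at hu
      rw [h.e_desc_self hlo (by omega) hmr hw hu (a := 2)]
      · simp
      · rw [pr, if_pos (by omega)]
        simp [ep, hν i hi, hν (i + 1) (by omega), show i ≠ 1 by omega, show i ≠ 0 by omega]
        norm_num
    · rw [h.e_desc_gt hlo him (by omega) (by omega), hu, if_neg (show i ≠ m by omega),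
        if_neg (show ¬ (m = i + 1 ∨ i = r ∧ r < m) by omega)]
      by_cases h1 : i = m + 1
      · subst h1; simp
      · rw [if_neg h1, if_neg h1]; simp
  · obtain ⟨j, j', hj, hj', hjj, hp⟩ : ∃ j j', (j = r + 1 ∨ j = r + 1 + δ) ∧
        (j' = r + 1 ∨ j' = r + 1 + δ) ∧
        (∀ x, f j (f j' x) = f (r + 1) (f (r + 1 + δ) x)) ∧
        phiPair r δ m = (j :: desc r, j' :: dn r) := by
      by_cases h1 : m = r + 1
      · exact ⟨_, _, Or.inl rfl, Or.inr rfl, fun x => rfl, by rw [phiPair, if_neg hmr, if_pos h1]⟩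
      · exact ⟨_, _, Or.inr rfl, Or.inl rfl, fun x => (h.toF.comm_end x).symm,
          by rw [phiPair, if_neg hmr, if_neg h1]⟩
    obtain ⟨μ, hμ, hμ'⟩ := h.wt_mid_pr hlo hr ht hj'
    have hz : e i (f j' (app f (dn r) t)) = 0 := by
      rw [h.e_mid hlo hr ht hi (by omega) hj', if_neg (by omega)]
    rw [hp]
    simp only [app_cons]
    rw [if_neg (by omega), if_neg (by omega), h.ef _ _ _ (by omega) (by omega) (by omega)
      (by omega)]
    obtain rfl | hir := Nat.eq_or_lt_of_le hi'
    · rw [if_pos (by omega), h.e_desc_self hlo (by omega) le_rfl hμ hz (a := 1), h.one, up_self]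
      · have := h.toF.comm_desc (k := i - 1) (i := j) (by omega) (by omega) (by omega)
          (by unfold Adj; omega)
        simp [this, hjj]
      · rw [pr, if_pos (by omega)]
        simp [ep, hν i hi, hν (i + 1) (by omega), show i ≠ 1 by omega, show i ≠ 0 by omega,
          hμ' i (by omega), hμ' (i + 1) le_rfl]
    · rw [if_neg (by omega), h.e_desc_lt hlo (by omega) (by omega) le_rfl hμ hz]
      · simp
      · exact h.toF.f_mid_zero ht.vType hr (by omega) hir (by omega) (by omega)

/-- An end node `e_i` annihilates the `φ_m t` with `m < r`. -/
theorem e_end_phi_lt {i m : ℕ} (hi : i = r + 1 ∨ i = r + 1 + δ) (hm : 1 ≤ m) (hm' : m < r) :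
    e i (phiV f r δ m t) = 0 := by
  simp only [phiV, LinearMap.comp_apply, phiPair, if_pos hm'.le]
  rw [h.e_desc_gt hlo (by omega) (by omega) (by omega),
    h.e_up hlo hr ht hm hm' (by omega) (by omega), if_neg (by omega), map_zero]

theorem e_end_phi_self {i j : ℕ}
    (hij : i = r + 1 ∧ j = r + 1 + δ ∨ i = r + 1 + δ ∧ j = r + 1) :
    e i (phiV f r δ r t) = zE f r j t := by
  simp only [phiV, LinearMap.comp_apply, phiPair, if_pos le_rfl, zE]
  rw [h.e_desc_gt hlo (by omega) (by omega) (by omega),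
    h.e_up_self hlo hr ht (by omega) (by omega)]
  congr 1
  rcases hij with ⟨rfl, rfl⟩ | ⟨rfl, rfl⟩
  · simp
  · rcases h.toF.hδ with rfl | rfl <;> simp

theorem e_end_phi_short (hδ : δ = 0) :
    e (r + 1) (phiV f r δ (r + 1) t) =
      zE f r (r + 1) t + f (r + 1) (app f (desc r) (app f (dn r) t)) := by
  subst hδ
  simp only [phiV, LinearMap.comp_apply, phiPair, if_neg (show ¬ r + 1 ≤ r by omega), if_pos, zE,
    app_cons, Nat.add_zero]
  have hw := h.wt_desc hlo le_rfl (h.wt_mid_zero hlo hr ht rfl)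
  rw [h.efd' (a := 1) (by omega) (by omega) hw,
    h.e_desc_gt hlo (by omega) (by omega) (by omega),
    h.e_mid hlo hr ht (by omega) (by omega) (Or.inl rfl), if_pos rfl, h.one, one_smul, add_comm]
  rw [pr, if_neg (by omega), if_pos rfl]
  simp [ep, ht.ν_zero (r + 1) (by omega), show r ≠ 0 by omega]

theorem e_end_phi_same (hδ : δ = 1) {i j m : ℕ}
    (hij : i = r + 1 ∧ j = r + 2 ∧ m = r + 1 ∨ i = r + 2 ∧ j = r + 1 ∧ m = r + 2) :
    e i (phiV f r δ m t) = qnum hb 2 • zE f r j t := by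
  subst hδ
  have hp : phiPair r 1 m = (i :: desc r, j :: dn r) := by
    rw [phiPair, if_neg (by omega)]
    split_ifs <;> rcases hij with ⟨rfl, rfl, rfl⟩ | ⟨rfl, rfl, rfl⟩ <;> first | rfl | omega
  have hj : j = r + 1 ∨ j = r + 1 + 1 := by omega
  have hν := ht.ν_zero (r + 1) (by omega)
  have hν' := ht.ν_zero (r + 1 + 1) (by omega)
  simp only [phiV, LinearMap.comp_apply, hp, zE, app_cons]
  have key : ∀ μ : ℕ → ℂ, f j (app f (dn r) t) ∈ W μ →
      pr r 1 i (μ - ep 1 + ep (r + 1)) = 2 →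
      e i (f i (app f (desc r) (f j (app f (dn r) t)))) =
        qnum hb 2 • app f (desc r) (f j (app f (dn r) t)) := by
    intro μ hμ h2
    rw [h.efd' (by omega) (by omega) (h.wt_desc hlo le_rfl hμ) h2,
      h.e_desc_gt hlo (by omega) (by omega) (by omega),
      h.e_mid hlo hr ht (by omega) (by omega) hj, if_neg (by omega)]
    simp
  rcases hij with ⟨rfl, rfl, rfl⟩ | ⟨rfl, rfl, rfl⟩
  · refine key _ (h.wt_mid_one' hlo hr ht rfl) ?_
    rw [pr, if_pos (by omega)]
    simp [ep, hν, hν', show r ≠ 0 by omega]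
    norm_num
  · refine key _ (h.wt_mid_one hlo hr ht rfl) ?_
    rw [pr, if_neg (by omega), if_neg (by omega)]
    simp [ep, hν, hν', show r ≠ 0 by omega]
    norm_num

theorem e_end_phi_other (hδ : δ = 1) {i j m : ℕ}
    (hij : i = r + 1 ∧ j = r + 2 ∧ m = r + 2 ∨ i = r + 2 ∧ j = r + 1 ∧ m = r + 1) :
    e i (phiV f r δ m t) = f j (app f (desc r) (app f (dn r) t)) := by
  subst hδ
  have hp : phiPair r 1 m = (j :: desc r, i :: dn r) := by
    rw [phiPair, if_neg (by omega)]
    split_ifs <;> rcases hij with ⟨rfl, rfl, rfl⟩ | ⟨rfl, rfl, rfl⟩ <;> first | rfl | omega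
  simp only [phiV, LinearMap.comp_apply, hp, app_cons]
  rw [h.ef _ _ _ (by omega) (by omega) (by omega) (by omega),
    h.e_desc_gt hlo (by omega) (by omega) (by omega),
    h.e_mid hlo hr ht (by omega) (by omega) (by omega), if_pos rfl]

omit hr ht in
theorem e_one_app (ht1 : ∀ i, 2 ≤ i → i ≤ r + 1 + δ → f i (e 1 t) = 0) {w : List ℕ}
    (hw : ∀ a ∈ w, 2 ≤ a ∧ a ≤ r + 1 + δ) (hne : w ≠ []) : e 1 (app f w t) = 0 := by
  rw [app_comm f (e 1) w fun a ha x => h.ef _ _ _ hlo (by omega) (hw a ha).2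
    (by have := (hw a ha).1; omega)]
  obtain ⟨w', a, rfl⟩ : ∃ w' a, w = w' ++ [a] := ⟨_, _, (List.dropLast_append_getLast hne).symm⟩
  rw [app_append, app_cons, app_nil, ht1 a (hw a (by simp)).1 (hw a (by simp)).2, map_zero]

/-- The action of `e_1` on the `φ_m t`. -/
theorem e_one_phi (ht1 : ∀ i, 2 ≤ i → i ≤ r + 1 + δ → f i (e 1 t) = 0) {m : ℕ} (hm : 1 ≤ m)
    (hm' : m ≤ r + 1 + δ) :
    e 1 (phiV f r δ m t) = ((if 1 = m then qnum hb (ν 1 + 1) else 0) +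
      (if m = 2 ∨ (1 = r ∧ r < m) then qnum hb (ν 1) else 0)) • app f (up r δ 1) t := by
  have hδ := h.toF.hδ
  simp only [phiV, LinearMap.comp_apply]
  by_cases hmr : m ≤ r
  · have hw := h.wt_up hlo hr ht hm hmr
    have hu : e 1 (app f (up r δ m) t) = 0 :=
      h.e_one_app hlo ht1 ((FSys.IsV.up m hm hmr).two_le hr) (by simp [up])
    simp only [phiPair, if_pos hmr]
    by_cases h1 : m = 1
    · subst h1
      rw [if_pos rfl, if_neg (by omega), h.e_desc_self hlo le_rfl hmr hw hu (a := ν 1 + 1)]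
      · simp [desc_zero]
      · rw [pr, if_pos (by omega)]
        simp [ep, ht.ν_zero 2 le_rfl]
    by_cases h2 : m = 2
    · subst h2
      rw [if_neg (by omega), if_pos (Or.inl rfl),
        h.e_desc_pred hlo le_rfl hmr hw hu (a := ν 1), up_cons _ _ 1 hmr]
      · simp [desc_zero]
      · rw [pr, if_pos (by omega)]
        simp [ep, ht.ν_zero 2 le_rfl]
    · rw [if_neg (by omega), if_neg (by omega), h.e_desc_lt hlo le_rfl (by omega) hmr hw hu]
      · simp
      · exact h.toF.f_up_zero ht.vType hr hm hmr (by omega) (by omega) (by omega)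
  · obtain ⟨j, j', hj, hj', hjj, hp⟩ : ∃ j j', (j = r + 1 ∨ j = r + 1 + δ) ∧
        (j' = r + 1 ∨ j' = r + 1 + δ) ∧
        (∀ x, f j (f j' x) = f (r + 1) (f (r + 1 + δ) x)) ∧
        phiPair r δ m = (j :: desc r, j' :: dn r) := by
      by_cases h1 : m = r + 1
      · exact ⟨_, _, Or.inl rfl, Or.inr rfl, fun x => rfl, by rw [phiPair, if_neg hmr, if_pos h1]⟩
      · exact ⟨_, _, Or.inr rfl, Or.inl rfl, fun x => (h.toF.comm_end x).symm,
          by rw [phiPair, if_neg hmr, if_neg h1]⟩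
    obtain ⟨μ, hμ, hμ'⟩ := h.wt_mid_pr hlo hr ht hj'
    have hz : e 1 (f j' (app f (dn r) t)) = 0 :=
      h.e_one_app hlo ht1 (w := j' :: dn r) ((FSys.IsV.mid j' hj').two_le hr) (by simp)
    rw [hp]
    simp only [app_cons]
    rw [if_neg (by omega), h.ef _ _ _ (by omega) (by omega) (by omega) (by omega)]
    obtain rfl | hir := Nat.eq_or_lt_of_le hr
    · rw [if_pos (by omega), h.e_desc_self hlo (by omega) le_rfl hμ hz (a := ν 1), up_self]
      · simp [desc_zero, hjj]
      · rw [pr, if_pos (by omega)]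
        simp [ep, ht.ν_zero 2 le_rfl, hμ' 1 (by omega), hμ' 2 le_rfl]
    · rw [if_neg (by omega), h.e_desc_lt hlo le_rfl (by omega) le_rfl hμ hz]
      · simp
      · exact h.toF.f_mid_zero ht.vType hr (by omega) hir (by omega) (by omega)

end ESys

end

/-! ### `q`-numbers and solutions of the three-term recurrence -/

section

/-- `q = exp hb` is not a root of unity. -/
def NotRoot (hb : ℂ) : Prop := ∀ k : ℕ, 0 < k → Complex.exp hb ^ k ≠ 1

theorem qpow_add (hb x y : ℂ) : qpow hb (x + y) = qpow hb x * qpow hb y := by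
  simp [qpow, mul_add, Complex.exp_add]

theorem qpow_zero (hb : ℂ) : qpow hb 0 = 1 := by simp [qpow]

theorem qpow_ne (hb x : ℂ) : qpow hb x ≠ 0 := Complex.exp_ne_zero _

theorem qpow_neg (hb x : ℂ) : qpow hb (-x) = (qpow hb x)⁻¹ := by
  simp [qpow, Complex.exp_neg]

theorem qpow_nat (hb : ℂ) (n : ℕ) : qpow hb n = Complex.exp hb ^ n := by
  rw [qpow, mul_comm, Complex.exp_nat_mul]

section
variable {hb : ℂ} (hq : NotRoot hb)
include hq

theorem NotRoot.int {n : ℤ} (h : qpow hb n = 1) : n = 0 := by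
  by_contra hn
  obtain ⟨m, rfl | rfl⟩ := n.eq_nat_or_neg
  · refine hq m (by omega) ?_
    rw [← qpow_nat]; simpa using h
  · refine hq m (by omega) ?_
    rw [Int.cast_neg, qpow_neg, inv_eq_one] at h
    rw [← qpow_nat]; simpa using h

theorem NotRoot.nat {n : ℕ} (h : qpow hb n = 1) : n = 0 := by
  have := hq.int (n := n) (by simpa using h)
  exact_mod_cast this

theorem NotRoot.ne_inv : qpow hb 1 - qpow hb (-1) ≠ 0 := by
  intro h
  have h2 : qpow hb ((2 : ℕ) : ℂ) = 1 := by
    rw [show ((2 : ℕ) : ℂ) = 1 + 1 by norm_num, qpow_add]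
    nth_rewrite 1 [sub_eq_zero.1 h]
    rw [← qpow_add, neg_add_cancel, qpow_zero]
  exact absurd (hq.nat h2) (by norm_num)

theorem NotRoot.qnum_eq_zero {x : ℂ} (h : qnum hb x = 0) : qpow hb (2 * x) = 1 := by
  rw [qnum, div_eq_zero_iff, or_iff_left hq.ne_inv, sub_eq_zero] at h
  rw [two_mul, qpow_add]
  nth_rewrite 1 [h]
  rw [← qpow_add, neg_add_cancel, qpow_zero]

/-- Half-integral `q`-numbers do not vanish. -/
theorem NotRoot.qnum_half {n : ℕ} (hn : 0 < n) : qnum hb ((n : ℂ) / 2) ≠ 0 := fun h => by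
  have := hq.qnum_eq_zero h
  rw [mul_div_cancel₀ _ (two_ne_zero)] at this
  exact hn.ne' (hq.nat this)

theorem NotRoot.qnum_nat {n : ℕ} (hn : 0 < n) : qnum hb (n : ℂ) ≠ 0 := by
  have := hq.qnum_half (n := 2 * n) (by omega)
  push_cast at this
  rwa [mul_div_cancel_left₀ _ (two_ne_zero)] at this

theorem NotRoot.qnum_one : qnum hb 1 = 1 := div_self hq.ne_inv

/-- Consecutive `q`-numbers do not both vanish, as `q² ≠ 1`. -/
theorem NotRoot.qnum_succ {x : ℂ} (h : qnum hb x = 0) : qnum hb (x + 1) ≠ 0 := fun h' => by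
  have h1 := hq.qnum_eq_zero h
  have h2 := hq.qnum_eq_zero h'
  rw [mul_add, qpow_add, h1, one_mul] at h2
  have : qpow hb ((2 : ℕ) : ℂ) = 1 := by rw [← h2]; norm_num
  exact absurd (hq.nat this) (by norm_num)

theorem NotRoot.qpow_add_ne {n : ℕ} (hn : 0 < n) (x : ℂ) (hx : 2 * x = n) :
    qpow hb x + qpow hb (-x) ≠ 0 := fun h => by
  have h1 : qpow hb (2 * x) = -1 := by
    rw [two_mul, qpow_add]
    nth_rewrite 1 [eq_neg_of_add_eq_zero_left h]
    rw [neg_mul, ← qpow_add, neg_add_cancel, qpow_zero]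
  have h2 : qpow hb ((2 * n : ℕ) : ℂ) = 1 := by
    rw [Nat.cast_mul, ← hx, show ((2 : ℕ) : ℂ) * (2 * x) = 2 * x + 2 * x by push_cast; ring,
      qpow_add, h1]
    norm_num
  exact absurd (hq.nat h2) (by omega)

theorem NotRoot.qnum_two : qnum hb 2 = qpow hb 1 + qpow hb (-1) := by
  rw [qnum, div_eq_iff hq.ne_inv, show (2 : ℂ) = 1 + 1 by norm_num, neg_add, qpow_add, qpow_add]
  ring

theorem NotRoot.qnum_two_add_one : qnum hb 2 + 1 ≠ 0 := by
  have h := hq.qnum_half (n := 3) (by norm_num)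
  intro h2
  apply h
  have h3 : qnum hb (((3 : ℕ) : ℂ) / 2) = (qnum hb 2 + 1) * qnum hb (1 / 2) := by
    rw [hq.qnum_two, qnum, qnum, ← mul_div_assoc]
    congr 1
    have e1 : qpow hb 1 = qpow hb (1 / 2) * qpow hb (1 / 2) := by rw [← qpow_add]; norm_num
    have e3 : qpow hb (((3 : ℕ) : ℂ) / 2) = qpow hb (1 / 2) * qpow hb (1 / 2) * qpow hb (1 / 2) := by
      rw [← qpow_add, ← qpow_add]; norm_num
    simp only [qpow_neg, e1, e3]
    have := qpow_ne hb (1 / 2)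
    field_simp
    ring
  rw [h3, h2, zero_mul]

end

section Identities

theorem qnum_neg (hb x : ℂ) : qnum hb (-x) = - qnum hb x := by
  rw [qnum, qnum, neg_neg]; ring

theorem qnum_add (hb x y : ℂ) :
    qnum hb (x + y) = qpow hb x * qnum hb y + qpow hb (-y) * qnum hb x := by
  rw [qnum, qnum, qnum, ← mul_div_assoc, ← mul_div_assoc, ← add_div]
  congr 1
  rw [neg_add, qpow_add, qpow_add]; ring

/-- The three-term recurrence `[x + 1] + [x - 1] = [2][x]`. -/
theorem qnum_add_one_add (hb x : ℂ) (hq : NotRoot hb) :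
    qnum hb (x + 1) + qnum hb (x - 1) = qnum hb 2 * qnum hb x := by
  rw [hq.qnum_two, sub_eq_add_neg, qnum, qnum, qnum, ← add_div, ← mul_div_assoc]
  congr 1
  simp only [neg_add, neg_neg, qpow_add]; ring

/-- `[x + 1][y + 1] - [x][y] = [x + y + 1]`. -/
theorem qnum_mul_sub (hb x y : ℂ) (hq : NotRoot hb) :
    qnum hb (x + 1) * qnum hb (y + 1) - qnum hb x * qnum hb y = qnum hb (x + y + 1) := by
  have hd := hq.ne_inv
  have h1 := qpow_ne hb 1
  have hx := qpow_ne hb x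
  have hy := qpow_ne hb y
  rw [qnum, qnum, qnum, qnum, qnum, div_mul_div_comm, div_mul_div_comm, ← sub_div,
    div_eq_div_iff (mul_ne_zero hd hd) hd, ← mul_assoc]
  congr 1
  simp only [neg_add, qpow_add, qpow_neg]
  field_simp
  ring

end Identities

section Sequences

variable (hb : ℂ) (P : ℂ)

/-- The solution `(-1)^{m-1} [P/2 - m + 1]_q` of the homogeneous recurrence. -/
def seqG (m : ℕ) : ℂ := -(-1) ^ m * qnum hb (P / 2 - m + 1)

/-- The coefficients of the words `φ^2_m`, up to a common factor. -/
def seqE (m : ℕ) : ℂ := (-1) ^ m * (qpow hb (m - P / 2) + qpow hb (-m + P / 2))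

/-- The solution `(-1)^{m-1} q^{m-1-P/2}` of the homogeneous recurrence, which satisfies the boundary
condition with the inhomogeneity given by `seqE`. -/
def seqH (m : ℕ) : ℂ := -(-1) ^ m * qpow hb (m - 1 - P / 2)

variable {hb P} (hq : NotRoot hb)
include hq

theorem seqG_rec (i : ℕ) :
    seqG hb P i + qnum hb 2 * seqG hb P (i + 1) + seqG hb P (i + 2) = 0 := by
  have := qnum_add_one_add hb (P / 2 - (i + 1 : ℕ) + 1) hq
  simp only [seqG]
  rw [show P / 2 - (i : ℂ) + 1 = P / 2 - ((i + 1 : ℕ) : ℂ) + 1 + 1 by push_cast; ring,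
    show P / 2 - ((i + 2 : ℕ) : ℂ) + 1 = P / 2 - ((i + 1 : ℕ) : ℂ) + 1 - 1 by push_cast; ring,
    pow_add, pow_add]
  linear_combination -(-1) ^ i * this

theorem seqE_rec (i : ℕ) :
    seqE hb P i + qnum hb 2 * seqE hb P (i + 1) + seqE hb P (i + 2) = 0 := by
  simp only [seqE]
  generalize P / 2 = p
  rw [hq.qnum_two]
  simp only [sub_eq_add_neg, Nat.cast_add, Nat.cast_one, Nat.cast_ofNat, neg_add]
  rw [show (2 : ℂ) = 1 + 1 by norm_num, neg_add]
  simp only [qpow_add, pow_add]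
  have h1 : qpow hb 1 * qpow hb (-1) = 1 := by rw [← qpow_add, add_neg_cancel, qpow_zero]
  linear_combination (-(-1) ^ i * (qpow hb i * qpow hb (-p) + qpow hb (-i) * qpow hb p)) * h1

theorem seqH_rec (i : ℕ) :
    seqH hb P i + qnum hb 2 * seqH hb P (i + 1) + seqH hb P (i + 2) = 0 := by
  simp only [seqH]
  generalize P / 2 = p
  rw [hq.qnum_two]
  simp only [sub_eq_add_neg, Nat.cast_add, Nat.cast_one, Nat.cast_ofNat]
  rw [show (2 : ℂ) = 1 + 1 by norm_num]
  simp only [qpow_add, pow_add]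
  have h1 : qpow hb 1 * qpow hb (-1) = 1 := by rw [← qpow_add, add_neg_cancel, qpow_zero]
  linear_combination ((-1) ^ i * (qpow hb i * qpow hb (-1) * qpow hb (-p))) * h1

theorem seqG_odd (r : ℕ) (hP : P = 2 * r + 1) :
    seqG hb P r + (1 + qnum hb 2) * seqG hb P (r + 1) = 0 := by
  have := seqG_rec (P := P) hq r
  have h2 : seqG hb P (r + 2) = seqG hb P (r + 1) := by
    simp only [seqG]
    rw [hP, show (2 * (r : ℂ) + 1) / 2 - ((r + 2 : ℕ) : ℂ) + 1 = -(1 / 2) by push_cast; ring,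
      show (2 * (r : ℂ) + 1) / 2 - ((r + 1 : ℕ) : ℂ) + 1 = 1 / 2 by push_cast; ring, qnum_neg]
    ring
  rw [h2] at this
  linear_combination this

theorem seqG_even (r : ℕ) (hP : P = 2 * r + 2) :
    seqG hb P r + qnum hb 2 * seqG hb P (r + 1) = 0 := by
  have := seqG_rec (P := P) hq r
  have h2 : seqG hb P (r + 2) = 0 := by
    simp only [seqG]
    rw [hP, show (2 * (r : ℂ) + 2) / 2 - ((r + 2 : ℕ) : ℂ) + 1 = 0 by push_cast; ring, qnum_zero]
    ring
  rw [h2] at this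
  linear_combination this

omit hq in
theorem seqE_odd (r : ℕ) (hP : P = 2 * r + 1) : seqE hb P r + seqE hb P (r + 1) = 0 := by
  simp only [seqE]
  rw [hP, show (r : ℂ) - (2 * (r : ℂ) + 1) / 2 = -(1 / 2) by ring,
    show -(r : ℂ) + (2 * (r : ℂ) + 1) / 2 = 1 / 2 by ring,
    show ((r + 1 : ℕ) : ℂ) - (2 * (r : ℂ) + 1) / 2 = 1 / 2 by push_cast; ring,
    show -((r + 1 : ℕ) : ℂ) + (2 * (r : ℂ) + 1) / 2 = -(1 / 2) by push_cast; ring]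
  ring

theorem seqE_even (r : ℕ) (hP : P = 2 * r + 2) :
    seqE hb P r + qnum hb 2 * (seqE hb P (r + 1) / 2) = 0 := by
  have := seqE_rec (P := P) hq r
  have h2 : seqE hb P (r + 2) = seqE hb P r := by
    simp only [seqE]
    rw [hP, show (r : ℂ) - (2 * (r : ℂ) + 2) / 2 = -1 by ring,
      show -(r : ℂ) + (2 * (r : ℂ) + 2) / 2 = 1 by ring,
      show ((r + 2 : ℕ) : ℂ) - (2 * (r : ℂ) + 2) / 2 = 1 by push_cast; ring,
      show -((r + 2 : ℕ) : ℂ) + (2 * (r : ℂ) + 2) / 2 = -1 by push_cast; ring]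
    ring
  rw [h2] at this
  linear_combination this / 2

theorem seqH_odd (r : ℕ) (hP : P = 2 * r + 1) :
    seqH hb P r + (1 + qnum hb 2) * seqH hb P (r + 1) + seqE hb P (r + 1) = 0 := by
  simp only [seqH, seqE]
  rw [hP, show (r : ℂ) - 1 - (2 * (r : ℂ) + 1) / 2 = -1 + -(1 / 2) by ring,
    show ((r + 1 : ℕ) : ℂ) - 1 - (2 * (r : ℂ) + 1) / 2 = -(1 / 2) by push_cast; ring,
    show ((r + 1 : ℕ) : ℂ) - (2 * (r : ℂ) + 1) / 2 = 1 / 2 by push_cast; ring,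
    show -((r + 1 : ℕ) : ℂ) + (2 * (r : ℂ) + 1) / 2 = -(1 / 2) by push_cast; ring,
    hq.qnum_two, qpow_add]
  have h1 : qpow hb 1 * qpow hb (-(1 / 2)) = qpow hb (1 / 2) := by rw [← qpow_add]; norm_num
  linear_combination (-1) ^ r * h1

theorem seqH_even (r : ℕ) (hP : P = 2 * r + 2) :
    seqH hb P r + qnum hb 2 * seqH hb P (r + 1) + seqE hb P (r + 1) / 2 = 0 := by
  simp only [seqH, seqE]
  rw [hP, show (r : ℂ) - 1 - (2 * (r : ℂ) + 2) / 2 = -1 + -1 by ring,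
    show ((r + 1 : ℕ) : ℂ) - 1 - (2 * (r : ℂ) + 2) / 2 = -1 by push_cast; ring,
    show ((r + 1 : ℕ) : ℂ) - (2 * (r : ℂ) + 2) / 2 = 0 by push_cast; ring,
    show -((r + 1 : ℕ) : ℂ) + (2 * (r : ℂ) + 2) / 2 = 0 by push_cast; ring,
    hq.qnum_two, qpow_add, qpow_zero]
  have h1 : qpow hb 1 * qpow hb (-1) = 1 := by rw [← qpow_add, add_neg_cancel, qpow_zero]
  linear_combination (-1) ^ r * h1

theorem seqG_last_ne {r δ : ℕ} (hP : P = 2 * r + 1 + δ) : seqG hb P (r + 1) ≠ 0 := by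
  have := hq.qnum_half (n := 1 + δ) (by omega)
  rw [seqG, hP, show (2 * (r : ℂ) + 1 + δ) / 2 - ((r + 1 : ℕ) : ℂ) + 1 = ((1 + δ : ℕ) : ℂ) / 2 by
    push_cast; ring]
  exact mul_ne_zero (by simp) this

theorem seqE_last_ne {r δ : ℕ} (hP : P = 2 * r + 1 + δ) (hδ : δ = 0 ∨ δ = 1) :
    seqE hb P (r + 1) ≠ 0 := by
  rw [seqE, hP, show -((r + 1 : ℕ) : ℂ) + (2 * (r : ℂ) + 1 + δ) / 2 =
    -(((r + 1 : ℕ) : ℂ) - (2 * (r : ℂ) + 1 + δ) / 2) by ring]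
  refine mul_ne_zero (by simp) ?_
  rcases hδ with rfl | rfl
  · exact hq.qpow_add_ne (n := 1) one_pos _ (by push_cast; ring)
  · rw [show ((r + 1 : ℕ) : ℂ) - (2 * (r : ℂ) + 1 + (1 : ℕ)) / 2 = 0 by push_cast; ring]
    simp [qpow_zero]

/-- The contribution of `seqG` to the coefficients of `e_1`. -/
theorem seqG_one (a : ℂ) :
    qnum hb (a + 1) * seqG hb P 1 + qnum hb a * seqG hb P 2 = qnum hb (a + P / 2) := by
  have := qnum_mul_sub hb a (P / 2 - 1) hq
  simp only [seqG]
  rw [show P / 2 - ((1 : ℕ) : ℂ) + 1 = P / 2 - 1 + 1 by push_cast; ring,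
    show P / 2 - ((2 : ℕ) : ℂ) + 1 = P / 2 - 1 by push_cast; ring,
    show a + P / 2 = a + (P / 2 - 1) + 1 by ring]
  linear_combination this

/-- The contribution of `seqH` to the second of the two coefficients of `e_1`. -/
theorem seqH_one (a : ℂ) :
    qnum hb (a + 1) * seqH hb P 1 + qnum hb a * seqH hb P 2 = qpow hb (-(a + P / 2)) := by
  have h1 := qnum_add hb 1 a
  simp only [seqH]
  rw [show ((1 : ℕ) : ℂ) - 1 - P / 2 = -(P / 2) by push_cast; ring,
    show ((2 : ℕ) : ℂ) - 1 - P / 2 = 1 + -(P / 2) by push_cast; ring, neg_add, qpow_add, qpow_add,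
    add_comm a 1, h1, hq.qnum_one]
  ring

/-- The combined contribution of `seqH` and `seqE` to the first of the two coefficients of `e_1`. -/
theorem seqHE_one (a : ℂ) :
    (qnum hb a * seqH hb P 1 + qnum hb (a - 1) * seqH hb P 2) +
      (qnum hb (a + 1) * seqE hb P 1 + qnum hb a * seqE hb P 2) =
      - qpow hb (a + P / 2 - 1) := by
  have h1 := seqH_one (P := P) hq (a - 1)
  rw [sub_add_cancel] at h1
  rw [h1]
  simp only [seqE]
  have hd := hq.ne_inv
  have g1 := qpow_ne hb 1
  have ga := qpow_ne hb a
  have gp := qpow_ne hb (P / 2)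
  generalize P / 2 = p at *
  rw [qnum, qnum, div_mul_eq_mul_div, div_mul_eq_mul_div, ← add_div, ← eq_sub_iff_add_eq',
    div_eq_iff hd]
  have e2 : qpow hb 2 = qpow hb 1 * qpow hb 1 := by rw [← qpow_add]; norm_num
  simp only [neg_add, qpow_add, qpow_neg, sub_eq_add_neg, neg_neg, Nat.cast_one,
    Nat.cast_ofNat, e2]
  field_simp
  ring

omit hq in
/-- The three sequences combine to the coefficients `A^1_m`. -/
theorem coeff_one_eq (b : ℂ) (m : ℕ) :
    qpow hb b * seqG hb P m + qnum hb b * seqH hb P m = -(-1) ^ m * qnum hb (b + P / 2 - m + 1) := by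
  have := qnum_add hb b (P / 2 - m + 1)
  simp only [seqG, seqH]
  rw [show b + P / 2 - m + 1 = b + (P / 2 - m + 1) by ring, this,
    show -(P / 2 - (m : ℂ) + 1) = m - 1 - P / 2 by ring]
  ring

omit hq in
/-- The three sequences combine to the coefficients `A^3_m`. -/
theorem coeff_three_eq (b : ℂ) (m : ℕ) :
    - qpow hb (-b) * seqG hb P m + qnum hb b * seqH hb P m =
      -(-1) ^ m * qnum hb (b - P / 2 + m - 1) := by
  have := qnum_add hb (-b) (P / 2 - m + 1)
  simp only [seqG, seqH]
  rw [show b - P / 2 + m - 1 = -(-b + (P / 2 - m + 1)) by ring, qnum_neg, this, qnum_neg,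
    show -(P / 2 - (m : ℂ) + 1) = m - 1 - P / 2 by ring]
  ring

end Sequences

end

/-! ### Linear combinations of the `φ_m t` and highest weight vectors -/

section

/-- Backward uniqueness for the three-term recurrence. -/
theorem rec_zero {r : ℕ} {c : ℂ} {d : ℕ → ℂ}
    (hrec : ∀ i, 2 ≤ i → i ≤ r → d (i - 1) + c * d i + d (i + 1) = 0) (h0 : d r = 0)
    (h1 : d (r + 1) = 0) {m : ℕ} (hm : 1 ≤ m) (hm' : m ≤ r + 1) : d m = 0 := by
  obtain ⟨n, hn⟩ : ∃ n, n = r + 1 - m := ⟨_, rfl⟩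
  induction n using Nat.strong_induction_on generalizing m with
  | _ n ih =>
  subst hn
  by_cases hmr : m = r + 1
  · rw [hmr, h1]
  by_cases hmr' : m = r
  · rw [hmr', h0]
  have := hrec (m + 1) (by omega) (by omega)
  rw [ih (r + 1 - (m + 1)) (by omega) (by omega) (by omega) rfl,
    ih (r + 1 - (m + 1 + 1)) (by omega) (by omega) (by omega) rfl, Nat.add_sub_cancel] at this
  simpa using this

theorem sum_fold {r δ i : ℕ} (hδ : δ = 0 ∨ δ = 1) (hi : 1 ≤ i) (hir : i ≤ r) (a : ℕ → ℂ) :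
    ∑ m ∈ Finset.Icc 1 (r + 1 + δ), a m * (if m = i + 1 ∨ (i = r ∧ r < m) then 1 else 0) =
      fold r δ a (i + 1) := by
  by_cases hir' : i < r
  · rw [fold, if_pos (by omega), Finset.sum_eq_single (i + 1)]
    · simp
    · intro b _ hb
      rw [if_neg (by omega), mul_zero]
    · intro h
      simp at h; omega
  · obtain rfl : i = r := by omega
    rw [fold, if_neg (by omega)]
    have : ∀ n, ∑ m ∈ Finset.Icc 1 n, a m * (if m = i + 1 ∨ (i = i ∧ i < m) then 1 else 0) =
        ∑ m ∈ Finset.Icc (i + 1) n, a m := by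
      intro n
      simp only [mul_ite, mul_one, mul_zero]
      rw [← Finset.sum_filter]
      refine Finset.sum_congr ?_ fun _ _ => rfl
      ext x
      simp only [Finset.mem_filter, Finset.mem_Icc, true_and]
      omega
    rw [this]
    rcases hδ with rfl | rfl
    · simp
    · rw [Finset.sum_Icc_succ_top (by omega)]
      simp

namespace ESys

variable {M : Type*} [AddCommGroup M] [Module ℂ M] {hb : ℂ} {lo r δ : ℕ}
  {f e : ℕ → M →ₗ[ℂ] M} {W : (ℕ → ℂ) → Submodule ℂ M}

variable (h : ESys hb lo r δ f e W)

section Sums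

include h
variable {ν : ℕ → ℂ} {t : M} (hlo : lo ≤ 1) (hr : 1 ≤ r) (ht : SingT hb r δ f e W ν t)
include hlo hr ht

/-- The coefficient of `e_i ∑ a_m φ_m t` is the left hand side of the three-term recurrence at `i`. -/
theorem e_phiSum (a : ℕ → ℂ) {i : ℕ} (hi : 2 ≤ i) (hi' : i ≤ r) :
    e i (phiSum f r δ a t) =
      (a (i - 1) + qnum hb 2 * a i + fold r δ a (i + 1)) • zV f r δ i t := by
  have hδ := h.toF.hδ
  rw [phiSum, map_sum, ← sum_fold hδ (by omega) hi' a]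
  have : a (i - 1) + qnum hb 2 * a i = ∑ m ∈ Finset.Icc 1 (r + 1 + δ),
      a m * ((if i = m then qnum hb 2 else 0) + if i = m + 1 then 1 else 0) := by
    simp only [mul_add, Finset.sum_add_distrib, mul_ite, mul_zero, mul_one]
    rw [Finset.sum_ite_eq, if_pos (by simp; omega), Finset.sum_eq_single (i - 1)]
    · rw [if_pos (by omega)]; ring
    · intro b _ hb
      rw [if_neg (by omega)]
    · intro h
      simp at h; omega
  rw [this, ← Finset.sum_add_distrib, Finset.sum_smul]
  refine Finset.sum_congr rfl fun m hm => ?_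
  rw [Finset.mem_Icc] at hm
  rw [map_smul, h.e_phi hlo hr ht hi hi' hm.1 hm.2, smul_smul, ← mul_add]

theorem e_one_phiSum (ht1 : ∀ i, 2 ≤ i → i ≤ r + 1 + δ → f i (e 1 t) = 0) (a : ℕ → ℂ) :
    e 1 (phiSum f r δ a t) =
      (qnum hb (ν 1 + 1) * a 1 + qnum hb (ν 1) * fold r δ a 2) • app f (up r δ 1) t := by
  have hδ := h.toF.hδ
  rw [phiSum, map_sum, ← sum_fold hδ le_rfl hr a]
  have : qnum hb (ν 1 + 1) * a 1 = ∑ m ∈ Finset.Icc 1 (r + 1 + δ),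
      a m * (if 1 = m then qnum hb (ν 1 + 1) else 0) := by
    simp only [mul_ite, mul_zero]
    rw [Finset.sum_ite_eq, if_pos (by simp; omega), mul_comm]
  rw [this, Finset.mul_sum, ← Finset.sum_add_distrib, Finset.sum_smul]
  refine Finset.sum_congr rfl fun m hm => ?_
  rw [Finset.mem_Icc] at hm
  rw [map_smul, h.e_one_phi hlo hr ht ht1 hm.1 hm.2, smul_smul]
  congr 1
  split_ifs <;> ring

theorem e_phiSum_short (hδ : δ = 0) {τ σ : M} (hx : FSys.Exch r δ f t τ σ) (a : ℕ → ℂ) :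
    e (r + 1) (phiSum f r δ a t) = a r • zE f r (r + 1) t +
      a (r + 1) • (zE f r (r + 1) t + (zE f r (r + 1) τ + f 0 (zE f r (r + 1) σ))) := by
  have h1 := h.e_end_phi_self hlo hr ht (Or.inl ⟨rfl, rfl⟩)
  have h2 := h.e_end_phi_short hlo hr ht hδ
  rw [h.toF.exch_dn ht.vType hx hr le_rfl (by omega) (by unfold Adj; omega)] at h2
  subst hδ
  rw [phiSum, map_sum, Nat.add_zero, Finset.sum_Icc_succ_top (by omega),
    ← Finset.sum_subset (s₁ := {r}) (by simp; omega), Finset.sum_singleton, map_smul, map_smul,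
    h1, h2]
  · rfl
  · intro m hm hm'
    simp at hm hm'
    rw [map_smul, h.e_end_phi_lt hlo hr ht (Or.inl rfl) hm.1 (by omega), smul_zero]

theorem e_phiSum_long (hδ : δ = 1) {i j m m' : ℕ}
    (hij : i = r + 1 ∧ j = r + 2 ∧ m = r + 1 ∧ m' = r + 2 ∨
      i = r + 2 ∧ j = r + 1 ∧ m = r + 2 ∧ m' = r + 1)
    {τ σ : M} (hx : FSys.Exch r δ f t τ σ) (a : ℕ → ℂ) :
    e i (phiSum f r δ a t) = (a r + qnum hb 2 * a m) • zE f r j t +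
      a m' • (zE f r j τ + f 0 (zE f r j σ)) := by
  have h1 := h.e_end_phi_self (i := i) (j := j) hlo hr ht (by omega)
  have h2 := h.e_end_phi_same (i := i) (j := j) (m := m) hlo hr ht hδ (by omega)
  have h3 := h.e_end_phi_other (i := i) (j := j) (m := m') hlo hr ht hδ (by omega)
  rw [h.toF.exch_dn ht.vType hx hr le_rfl (i := j) (by omega) (by unfold Adj; omega)] at h3
  subst hδ
  have h4 : e i (a (r + 1) • phiV f r 1 (r + 1) t) + e i (a (r + 1 + 1) • phiV f r 1 (r + 1 + 1) t)
      = e i (a m • phiV f r 1 m t) + e i (a m' • phiV f r 1 m' t) := by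
    rcases hij with ⟨-, -, rfl, rfl⟩ | ⟨-, -, rfl, rfl⟩
    · rfl
    · rw [add_comm]
  rw [phiSum, map_sum, Finset.sum_Icc_succ_top (by omega), Finset.sum_Icc_succ_top (by omega),
    add_assoc, h4,
    ← Finset.sum_subset (s₁ := {r}) (by simp; omega), Finset.sum_singleton, map_smul, map_smul,
    map_smul, h1, h2, h3]
  · simp only [zE, LinearMap.comp_apply, app_cons]
    module
  · intro m hm hm'
    simp at hm hm'
    rw [map_smul, h.e_end_phi_lt hlo hr ht (by omega) hm.1 (by omega), smul_zero]

/-- A highest weight vector of a natural representation can be recovered from every vector of the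
weight basis. -/
theorem eq_zero_of_isV {w : List ℕ} (hw : FSys.IsV r δ w) (h0 : app f w t = 0) : t = 0 := by
  have hδ := h.toF.hδ
  have h1 : ∀ k, 1 ≤ k → k ≤ r → app f (dn k) t = 0 → t = 0 := by
    intro k hk
    induction k, hk using Nat.le_induction with
    | base => exact fun _ h => h
    | succ k hk ih =>
      intro hkr h0
      have := h.e_dn hlo ht (by omega) hkr (i := k + 1) (by omega) (by omega)
      rw [h0, map_zero, if_pos rfl] at this
      exact ih (by omega) this.symm
  have h2 : ∀ j, (j = r + 1 ∨ j = r + 1 + δ) → app f (j :: dn r) t = 0 → t = 0 := by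
    intro j hj h0
    have := h.e_mid hlo hr ht (i := j) (by omega) (by omega) hj
    rw [← app_cons, h0, map_zero, if_pos rfl] at this
    exact h1 r hr le_rfl this.symm
  cases hw with
  | low j hj hj' => exact h1 j hj hj' h0
  | mid j hj => exact h2 j hj h0
  | up m hm hmr =>
    induction hn : r - m using Nat.strong_induction_on generalizing m with
    | _ n ih =>
    subst hn
    obtain rfl | hmr' := Nat.eq_or_lt_of_le hmr
    · have := h.e_up_self hlo hr ht (i := m + 1) (by omega) (by omega)
      rw [h0, map_zero, if_pos rfl] at this
      exact h2 _ (Or.inr rfl) this.symm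
    · have := h.e_up hlo hr ht hm hmr' (i := m + 1) (by omega) (by omega)
      rw [h0, map_zero, if_pos rfl] at this
      exact ih _ (by omega) (m + 1) (by omega) hmr' this.symm rfl

end Sums

/-- Pairs of an index `k` and a word `w` that describe the vectors `f_k ⋯ f_1 w t` of weight above
`-2 ε_1`. -/
def Low (r δ k : ℕ) (w : List ℕ) : Prop :=
  (∃ i, k < i ∧ i ≤ r ∧ w = up r δ i) ∨ (k ≤ r ∧ ∃ j, (j = r + 1 ∨ j = r + 1 + δ) ∧ w = j :: dn r)

theorem Low.isV {k : ℕ} {w : List ℕ} (hw : Low r δ k w) : FSys.IsV r δ w := by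
  rcases hw with ⟨i, h1, h2, rfl⟩ | ⟨-, j, hj, rfl⟩
  · exact .up i (by omega) h2
  · exact .mid j hj

theorem Low.mono {k k' : ℕ} {w : List ℕ} (hw : Low r δ k w) (hk : k' ≤ k) : Low r δ k' w := by
  rcases hw with ⟨i, h1, h2, rfl⟩ | ⟨h1, j, hj, rfl⟩
  · exact Or.inl ⟨i, by omega, h2, rfl⟩
  · exact Or.inr ⟨by omega, j, hj, rfl⟩

section Low

include h
variable {ν : ℕ → ℂ} {t : M} (hlo : lo ≤ 1) (hr : 1 ≤ r) (ht : SingT hb r δ f e W ν t)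
include hlo hr ht

theorem low_wt {k : ℕ} {w : List ℕ} (hw : Low r δ k w) :
    ∃ μ : ℕ → ℂ, app f w t ∈ W μ ∧ ∀ i, i ≤ k + 1 → μ i = ν i := by
  rcases hw with ⟨i, h1, h2, rfl⟩ | ⟨h1, j, hj, rfl⟩
  · exact ⟨_, h.wt_up hlo hr ht (by omega) h2,
      fun i' hi' => by simp [ep, show i' ≠ i + 1 by omega]⟩
  · obtain ⟨μ, h2, h3⟩ := h.wt_mid_pr hlo hr ht hj
    exact ⟨μ, h2, fun i hi => h3 i (by omega)⟩

theorem e_low {k : ℕ} {w : List ℕ} (hw : Low r δ k w) (hk : 2 ≤ k) :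
    e k (app f (desc k) (app f w t)) = app f (desc (k - 1)) (app f w t) := by
  obtain ⟨μ, hμ, hμ'⟩ := h.low_wt hlo hr ht hw
  have hkr : k ≤ r := by rcases hw with ⟨i, h1, h2, -⟩ | ⟨h1, -⟩ <;> omega
  have he : e k (app f w t) = 0 := by
    rcases hw with ⟨i, h1, h2, rfl⟩ | ⟨h1, j, hj, rfl⟩
    · obtain rfl | h2' := Nat.eq_or_lt_of_le h2
      · rw [h.e_up_self hlo hr ht hk (by omega), if_neg (by omega), if_neg (by omega)]
      · rw [h.e_up hlo hr ht (by omega) h2' hk (by omega), if_neg (by omega)]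
    · rw [app_cons, h.e_mid hlo hr ht hk (by omega) hj, if_neg (by omega)]
  rw [h.e_desc_self hlo (by omega) hkr hμ he (a := 1), h.one, one_smul]
  rw [pr, if_pos (by omega)]
  simp [ep, hμ' k (by omega), hμ' (k + 1) le_rfl, ht.ν_zero k hk, ht.ν_zero (k + 1) (by omega),
    show k ≠ 1 by omega, show k ≠ 0 by omega]

theorem e_one_low (ht1 : ∀ i, 2 ≤ i → i ≤ r + 1 + δ → f i (e 1 t) = 0) {w : List ℕ}
    (hw : Low r δ 1 w) : e 1 (f 1 (app f w t)) = qnum hb (ν 1) • app f w t := by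
  obtain ⟨μ, hμ, hμ'⟩ := h.low_wt hlo hr ht hw
  rw [h.efd' (a := ν 1) hlo (by omega) hμ, h.e_one_app hlo ht1 (hw.isV.two_le hr)]
  · simp
  · rcases hw with ⟨i, h1, h2, rfl⟩ | ⟨h1, j, hj, rfl⟩ <;> simp [up]
  · rw [pr, if_pos (by omega), hμ' 1 (by omega), hμ' 2 le_rfl, ht.ν_zero 2 le_rfl, sub_zero]

end Low

/-- A highest weight vector of weight `μ`, annihilated by the `f_i` of the Levi subalgebra `so(P)`. For
`r = 0` this subalgebra has no simple roots. -/
structure HW (lo r δ : ℕ) (f e : ℕ → M →ₗ[ℂ] M) (W : (ℕ → ℂ) → Submodule ℂ M)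
    (μ : ℕ → ℂ) (v : M) : Prop where
  wt : v ∈ W μ
  e_zero : ∀ i, lo ≤ i → i ≤ r + 1 + δ → e i v = 0
  f_zero : 1 ≤ r → ∀ i, 2 ≤ i → i ≤ r + 1 + δ → f i v = 0
  μ_zero : ∀ i, 2 ≤ i → μ i = 0

section Tops

include h
variable {μ : ℕ → ℂ} {v : M}

theorem singT_one (hlo : lo ≤ 1) (hr : 1 ≤ r) (hv : HW lo r δ f e W μ v) :
    SingT hb r δ f e W (μ - ep 1) (f 1 v) where
  vType := h.toF.vType_f_one hr (hv.f_zero hr)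
  e_zero i hi hi' := by
    rw [h.ef _ _ _ (by omega) hi' (by omega) (by omega), hv.e_zero i (by omega) hi', map_zero]
  wt := h.wf' hlo (by omega) hv.wt (by rw [al, if_pos (by omega)]; abel)
  ν_zero i hi := by simp [ep, hv.μ_zero i hi, show i ≠ 1 by omega]

theorem e_one_one (hlo : lo ≤ 1) (hr : 1 ≤ r) (hv : HW lo r δ f e W μ v) :
    e 1 (f 1 v) = qnum hb (μ 1) • v := by
  rw [h.efd' (a := μ 1) hlo (by omega) hv.wt, hv.e_zero 1 hlo (by omega)]
  · simp
  · rw [pr, if_pos (by omega), hv.μ_zero 2 le_rfl, sub_zero]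

theorem f_e_one_one (hlo : lo ≤ 1) (hr : 1 ≤ r) (hv : HW lo r δ f e W μ v) (i : ℕ) (hi : 2 ≤ i)
    (hi' : i ≤ r + 1 + δ) : f i (e 1 (f 1 v)) = 0 := by
  rw [h.e_one_one hlo hr hv, map_smul, (hv.f_zero hr) i hi hi', smul_zero]

/-- `f_0 v` is a highest weight vector with respect to the `e_i`, `i ≥ 1`. -/
theorem hw_zero (hr : 1 ≤ r) (hlo : lo = 0) (hv : HW lo r δ f e W μ v) :
    HW 1 r δ f e W (μ - ep 0 + ep 1) (f 0 v) where
  wt := h.wf' (by omega) (by omega) hv.wt (by rw [al, if_pos (by omega)]; abel)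
  e_zero i hi hi' := by
    rw [h.ef _ _ _ (by omega) hi' (by omega) (by omega), hv.e_zero i (by omega) hi', map_zero]
  f_zero _ i hi hi' := by
    rw [← h.toF.comm 0 i v hr (by omega) hi', (hv.f_zero hr) i hi hi', map_zero]
  μ_zero i hi := by simp [ep, hv.μ_zero i hi, show i ≠ 1 by omega, show i ≠ 0 by omega]

theorem up_lo (hlo : lo ≤ 1) : ESys hb 1 r δ f e W where
  toF := h.toF
  one := h.one
  ef i j x hi := h.ef i j x (by omega)
  efd i μ x hi := h.efd i μ x (by omega)
  wf j μ x hj := h.wf j μ x (by omega)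

theorem singT_zero (hr : 1 ≤ r) (hlo : lo = 0) {ν : ℕ → ℂ} {t : M}
    (ht : SingT hb r δ f e W ν t) : SingT hb r δ f e W (ν - ep 0 + ep 1) (f 0 t) where
  vType := h.toF.vType_f_zero hr ht.vType
  e_zero i hi hi' := by
    rw [h.ef _ _ _ (by omega) hi' (by omega) (by omega), ht.e_zero i hi hi', map_zero]
  wt := h.wf' (by omega) (by omega) ht.wt (by rw [al, if_pos (by omega)]; abel)
  ν_zero i hi := by simp [ep, ht.ν_zero i hi, show i ≠ 1 by omega, show i ≠ 0 by omega]

end Tops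

theorem SingT.add_smul {ν : ℕ → ℂ} {t u : M} (ht : SingT hb r δ f e W ν t)
    (hu : SingT hb r δ f e W ν u) (a b : ℂ) : SingT hb r δ f e W ν (a • t + b • u) where
  vType := ht.vType.add_smul hu.vType a b
  e_zero i h1 h2 := by simp [ht.e_zero i h1 h2, hu.e_zero i h1 h2]
  wt := Submodule.add_mem _ (Submodule.smul_mem _ _ ht.wt) (Submodule.smul_mem _ _ hu.wt)
  ν_zero := ht.ν_zero

end ESys

end

/-! ### Annihilation by the `e_i`, `i ≥ 2`, as conditions on the coefficients -/

section

theorem fold_of_le {r δ : ℕ} {a : ℕ → ℂ} {m : ℕ} (ha : δ = 1 → a (r + 2) = 0) (hm : m ≤ r + 1) :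
    fold r δ a m = a m := by
  rw [fold]
  split_ifs with h1 h2
  · rfl
  · rw [ha h2, add_zero]; congr 1; omega
  · rw [add_zero]; congr 1; omega

/-- The conditions on the coefficients `a_m` under which `∑ a_m φ_m v` is annihilated by the `e_i`
with `i ≥ 2`. -/
structure SolZero (c : ℂ) (r δ : ℕ) (a : ℕ → ℂ) : Prop where
  chain : ∀ i, 2 ≤ i → i ≤ r → a (i - 1) + c * a i + fold r δ a (i + 1) = 0
  end_short : δ = 0 → a r + (1 + c) * a (r + 1) = 0
  end_long : δ = 1 → a r + c * a (r + 1) = 0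

/-- The conditions on the coefficients under which
`f_0 ∑ a_m φ_m v + ∑ b_m φ_m f_1⁻¹ f_0 f_1 v + ∑ d_m φ_m f_0 v` is annihilated by the `e_i`
with `i ≥ 2`. -/
structure SolOne (c : ℂ) (r δ : ℕ) (a b d : ℕ → ℂ) : Prop where
  rec_a : ∀ i, 2 ≤ i → i ≤ r → a (i - 1) + c * a i + fold r δ a (i + 1) = 0
  rec_b : ∀ i, 2 ≤ i → i ≤ r → b (i - 1) + c * b i + fold r δ b (i + 1) = 0
  rec_d : ∀ i, 2 ≤ i → i ≤ r → d (i - 1) + c * d i + fold r δ d (i + 1) = 0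
  end_short : δ = 0 → a r + (1 + c) * a (r + 1) + b (r + 1) = 0 ∧ b r + b (r + 1) = 0 ∧
    d r + (1 + c) * d (r + 1) + b (r + 1) = 0
  end_long : δ = 1 → a r + c * a (r + 1) + b (r + 1) = 0 ∧ b r + c * b (r + 1) = 0 ∧
    d r + c * d (r + 1) + b (r + 1) = 0 ∧ b (r + 2) = b (r + 1)

section Coefficients

variable {hb : ℂ} (hq : NotRoot hb) {r δ : ℕ} {P : ℂ} (hP : P = 2 * r + 1 + δ)
  (hδ : δ = 0 ∨ δ = 1)
include hq hP hδ

omit hδ in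
theorem SolZero.of_seq {a : ℕ → ℂ} (hr : 1 ≤ r) (ha : δ = 1 → a (r + 2) = 0) (κ : ℂ)
    (h : ∀ m, 1 ≤ m → m ≤ r + 1 → a m = κ * seqG hb P m) : SolZero (qnum hb 2) r δ a where
  chain i hi hi' := by
    obtain ⟨j, rfl⟩ : ∃ j, i = j + 1 := ⟨i - 1, by omega⟩
    rw [fold_of_le ha (by omega), Nat.add_sub_cancel, h j (by omega) (by omega),
      h _ (by omega) (by omega), h _ (by omega) (by omega)]
    linear_combination κ * seqG_rec (P := P) hq j
  end_short h0 := by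
    rw [h r hr (by omega), h (r + 1) (by omega) le_rfl]
    linear_combination κ * seqG_odd hq r (P := P) (by rw [hP, h0]; push_cast; ring)
  end_long h1 := by
    rw [h r hr (by omega), h (r + 1) (by omega) le_rfl]
    linear_combination κ * seqG_even hq r (P := P) (by rw [hP, h1]; push_cast; ring)

/-- By backward uniqueness for the recurrence, the solutions form the line spanned by `seqG`, the
sequence of the `A_m`. The scale is fixed at `m = r + 1`, where `seqG` does not vanish. -/
theorem SolZero.exists_seq {a : ℕ → ℂ} (ha : δ = 1 → a (r + 2) = 0)
    (h : SolZero (qnum hb 2) r δ a) :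
    ∃ κ : ℂ, ∀ m, 1 ≤ m → m ≤ r + 1 → a m = κ * seqG hb P m := by
  have hG := seqG_last_ne hq hP
  refine ⟨a (r + 1) / seqG hb P (r + 1), fun m hm hm' => ?_⟩
  set κ := a (r + 1) / seqG hb P (r + 1) with hκ
  have hκ' : a (r + 1) = κ * seqG hb P (r + 1) := by rw [hκ, div_mul_cancel₀ _ hG]
  have key : a m - κ * seqG hb P m = 0 := by
    refine rec_zero (r := r) (c := qnum hb 2) (d := fun m => a m - κ * seqG hb P m)
      (fun i hi hi' => ?_) ?_ ?_ hm hm'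
    · have h1 := h.chain i hi hi'
      obtain ⟨j, rfl⟩ : ∃ j, i = j + 1 := ⟨i - 1, by omega⟩
      rw [fold_of_le ha (by omega)] at h1
      simp only [Nat.add_sub_cancel] at h1 ⊢
      linear_combination h1 - κ * seqG_rec (P := P) hq j
    · rcases hδ with h0 | h0
      · have := h.end_short h0
        linear_combination this - κ * seqG_odd hq r (P := P) (by rw [hP, h0]; push_cast; ring) -
          (1 + qnum hb 2) * hκ'
      · have := h.end_long h0
        linear_combination this - κ * seqG_even hq r (P := P) (by rw [hP, h0]; push_cast; ring) -
          qnum hb 2 * hκ'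
    · rw [hκ', sub_self]
  exact sub_eq_zero.1 key

/-- The coefficients `a`, `b`, `d` in terms of three parameters: `b` is `γ seqE`, where for even `P` the
last value is divided equally between `φ^2_{r+1}` and `φ^2_{r+2}`. -/
structure ParOne (hb P : ℂ) (r δ : ℕ) (a b d : ℕ → ℂ) (x γ y : ℂ) : Prop where
  a_eq : ∀ m, 1 ≤ m → m ≤ r + 1 → a m = x * seqG hb P m + γ * seqH hb P m
  b_eq : ∀ m, 1 ≤ m → m ≤ r → b m = γ * seqE hb P m
  b_last : δ = 0 → b (r + 1) = γ * seqE hb P (r + 1)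
  b_last' : δ = 1 → b (r + 1) = γ * (seqE hb P (r + 1) / 2) ∧
    b (r + 2) = γ * (seqE hb P (r + 1) / 2)
  d_eq : ∀ m, 1 ≤ m → m ≤ r + 1 → d m = y * seqG hb P m + γ * seqH hb P m

omit hq hP hδ in
theorem ParOne.fold_b {a b d : ℕ → ℂ} {x γ y : ℂ} (hδ : δ = 0 ∨ δ = 1)
    (h : ParOne hb P r δ a b d x γ y) {m : ℕ} (hm : 1 ≤ m) (hm' : m ≤ r + 1) :
    fold r δ b m = γ * seqE hb P m := by
  rw [fold]
  split_ifs with h1 h2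
  · exact h.b_eq m hm h1
  · obtain rfl : m = r + 1 := by omega
    rw [(h.b_last' h2).1, (h.b_last' h2).2]; ring
  · obtain rfl : m = r + 1 := by omega
    rw [h.b_last (by omega), add_zero]

theorem SolOne.of_par {a b d : ℕ → ℂ} {x γ y : ℂ} (hr : 1 ≤ r) (ha : δ = 1 → a (r + 2) = 0)
    (hd : δ = 1 → d (r + 2) = 0) (h : ParOne hb P r δ a b d x γ y) :
    SolOne (qnum hb 2) r δ a b d where
  rec_a i hi hi' := by
    obtain ⟨j, rfl⟩ : ∃ j, i = j + 1 := ⟨i - 1, by omega⟩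
    rw [fold_of_le ha (by omega), Nat.add_sub_cancel, h.a_eq j (by omega) (by omega),
      h.a_eq _ (by omega) (by omega), h.a_eq _ (by omega) (by omega)]
    linear_combination x * seqG_rec (P := P) hq j + γ * seqH_rec (P := P) hq j
  rec_d i hi hi' := by
    obtain ⟨j, rfl⟩ : ∃ j, i = j + 1 := ⟨i - 1, by omega⟩
    rw [fold_of_le hd (by omega), Nat.add_sub_cancel, h.d_eq j (by omega) (by omega),
      h.d_eq _ (by omega) (by omega), h.d_eq _ (by omega) (by omega)]
    linear_combination y * seqG_rec (P := P) hq j + γ * seqH_rec (P := P) hq j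
  rec_b i hi hi' := by
    obtain ⟨j, rfl⟩ : ∃ j, i = j + 1 := ⟨i - 1, by omega⟩
    rw [h.fold_b hδ (by omega) (by omega), Nat.add_sub_cancel, h.b_eq j (by omega) (by omega),
      h.b_eq _ (by omega) (by omega)]
    linear_combination γ * seqE_rec (P := P) hq j
  end_short h0 := by
    have hP' : P = 2 * r + 1 := by rw [hP, h0]; push_cast; ring
    rw [h.b_last h0, h.b_eq r hr le_rfl, h.a_eq r hr (by omega), h.a_eq (r + 1) (by omega) le_rfl,
      h.d_eq r hr (by omega), h.d_eq (r + 1) (by omega) le_rfl]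
    refine ⟨?_, ?_, ?_⟩
    · linear_combination x * seqG_odd hq r hP' + γ * seqH_odd hq r hP'
    · linear_combination γ * seqE_odd r hP'
    · linear_combination y * seqG_odd hq r hP' + γ * seqH_odd hq r hP'
  end_long h1 := by
    have hP' : P = 2 * r + 2 := by rw [hP, h1]; push_cast; ring
    rw [(h.b_last' h1).1, (h.b_last' h1).2, h.b_eq r hr le_rfl, h.a_eq r hr (by omega),
      h.a_eq (r + 1) (by omega) le_rfl, h.d_eq r hr (by omega), h.d_eq (r + 1) (by omega) le_rfl]
    refine ⟨?_, ?_, ?_, rfl⟩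
    · linear_combination x * seqG_even hq r hP' + γ * seqH_even hq r hP'
    · linear_combination γ * seqE_even hq r hP'
    · linear_combination y * seqG_even hq r hP' + γ * seqH_even hq r hP'

/-- A solution of the recurrence for the outer coefficients is determined by the middle ones and
one parameter. -/
theorem SolOne.exists_seq_outer {a b : ℕ → ℂ} {γ : ℂ} (ha : δ = 1 → a (r + 2) = 0)
    (hrec : ∀ i, 2 ≤ i → i ≤ r → a (i - 1) + qnum hb 2 * a i + fold r δ a (i + 1) = 0)
    (h0 : δ = 0 → a r + (1 + qnum hb 2) * a (r + 1) + b (r + 1) = 0 ∧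
      b (r + 1) = γ * seqE hb P (r + 1))
    (h1 : δ = 1 → a r + qnum hb 2 * a (r + 1) + b (r + 1) = 0 ∧
      b (r + 1) = γ * (seqE hb P (r + 1) / 2)) :
    ∃ x, ∀ m, 1 ≤ m → m ≤ r + 1 → a m = x * seqG hb P m + γ * seqH hb P m := by
  have hG := seqG_last_ne hq hP
  refine ⟨(a (r + 1) - γ * seqH hb P (r + 1)) / seqG hb P (r + 1), fun m hm hm' => ?_⟩
  set x := (a (r + 1) - γ * seqH hb P (r + 1)) / seqG hb P (r + 1) with hx
  have hx' : a (r + 1) - γ * seqH hb P (r + 1) = x * seqG hb P (r + 1) := by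
    rw [hx, div_mul_cancel₀ _ hG]
  have key : a m - x * seqG hb P m - γ * seqH hb P m = 0 := by
    refine rec_zero (r := r) (c := qnum hb 2)
      (d := fun m => a m - x * seqG hb P m - γ * seqH hb P m) (fun i hi hi' => ?_) ?_ ?_ hm hm'
    · have h1 := hrec i hi hi'
      obtain ⟨j, rfl⟩ : ∃ j, i = j + 1 := ⟨i - 1, by omega⟩
      rw [fold_of_le ha (by omega)] at h1
      simp only [Nat.add_sub_cancel] at h1 ⊢
      linear_combination h1 - x * seqG_rec (P := P) hq j - γ * seqH_rec (P := P) hq j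
    · rcases hδ with hh | hh
      · have hP' : P = 2 * r + 1 := by rw [hP, hh]; push_cast; ring
        obtain ⟨e1, e2⟩ := h0 hh
        linear_combination e1 - x * seqG_odd hq r hP' - γ * seqH_odd hq r hP' -
          (1 + qnum hb 2) * hx' - e2
      · have hP' : P = 2 * r + 2 := by rw [hP, hh]; push_cast; ring
        obtain ⟨e1, e2⟩ := h1 hh
        linear_combination e1 - x * seqG_even hq r hP' - γ * seqH_even hq r hP' -
          qnum hb 2 * hx' - e2
    · linear_combination hx'
  linear_combination key

/-- The solutions for `l = 1` form the three-parameter family `ParOne`. -/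
theorem SolOne.exists_par {a b d : ℕ → ℂ} (ha : δ = 1 → a (r + 2) = 0)
    (hd : δ = 1 → d (r + 2) = 0) (h : SolOne (qnum hb 2) r δ a b d) :
    ∃ x γ y, ParOne hb P r δ a b d x γ y := by
  have hE := seqE_last_ne hq hP hδ
  obtain ⟨γ, hγ⟩ : ∃ γ, fold r δ b (r + 1) = γ * seqE hb P (r + 1) :=
    ⟨_, (div_mul_cancel₀ _ hE).symm⟩
  have hb0 : δ = 0 → b (r + 1) = γ * seqE hb P (r + 1) := fun h0 => by
    rw [← hγ, fold, if_neg (by omega), if_neg (by omega), add_zero]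
  have hb1 : δ = 1 → b (r + 1) = γ * (seqE hb P (r + 1) / 2) := fun h1 => by
    rw [fold, if_neg (by omega), if_pos h1, (h.end_long h1).2.2.2] at hγ
    linear_combination hγ / 2
  obtain ⟨x, hx⟩ := SolOne.exists_seq_outer hq hP hδ ha h.rec_a (γ := γ) (b := b)
    (fun h0 => ⟨(h.end_short h0).1, hb0 h0⟩) (fun h1 => ⟨(h.end_long h1).1, hb1 h1⟩)
  obtain ⟨y, hy⟩ := SolOne.exists_seq_outer hq hP hδ hd h.rec_d (γ := γ) (b := b)
    (fun h0 => ⟨(h.end_short h0).2.2, hb0 h0⟩) (fun h1 => ⟨(h.end_long h1).2.2.1, hb1 h1⟩)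
  have key : ∀ m, 1 ≤ m → m ≤ r + 1 → fold r δ b m - γ * seqE hb P m = 0 := by
    intro m hm hm'
    refine rec_zero (r := r) (c := qnum hb 2) (d := fun m => fold r δ b m - γ * seqE hb P m)
      (fun i hi hi' => ?_) ?_ ?_ hm hm'
    · have h1 := h.rec_b i hi hi'
      obtain ⟨j, rfl⟩ : ∃ j, i = j + 1 := ⟨i - 1, by omega⟩
      simp only [Nat.add_sub_cancel] at h1 ⊢
      rw [show fold r δ b j = b j by rw [fold, if_pos (by omega)],
        show fold r δ b (j + 1) = b (j + 1) by rw [fold, if_pos (by omega)]]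
      linear_combination h1 - γ * seqE_rec (P := P) hq j
    · rw [show fold r δ b r = b r by rw [fold, if_pos (by omega)]]
      rcases hδ with hh | hh
      · have hP' : P = 2 * r + 1 := by rw [hP, hh]; push_cast; ring
        linear_combination (h.end_short hh).2.1 - γ * seqE_odd r hP' - hb0 hh
      · have hP' : P = 2 * r + 2 := by rw [hP, hh]; push_cast; ring
        linear_combination (h.end_long hh).2.1 - γ * seqE_even hq r hP' - qnum hb 2 * hb1 hh
    · rw [hγ, sub_self]
  refine ⟨x, γ, y, ⟨hx, fun m hm hm' => ?_, hb0, fun h1 => ⟨hb1 h1, ?_⟩, hy⟩⟩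
  · have := key m hm (by omega)
    rw [fold, if_pos hm'] at this
    exact sub_eq_zero.1 this
  · rw [(h.end_long h1).2.2.2, hb1 h1]

end Coefficients

/-- Linear independence of three vectors. -/
def Indep3 {M : Type*} [AddCommGroup M] [Module ℂ M] (x y z : M) : Prop :=
  ∀ α β γ : ℂ, α • x + β • y + γ • z = 0 → α = 0 ∧ β = 0 ∧ γ = 0

namespace ESys

variable {M : Type*} [AddCommGroup M] [Module ℂ M] {hb : ℂ} {lo r δ : ℕ}
  {f e : ℕ → M →ₗ[ℂ] M} {W : (ℕ → ℂ) → Submodule ℂ M}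

variable (h : ESys hb lo r δ f e W)
variable {μ : ℕ → ℂ} {v : M}

include h

section Zero
variable (hlo : lo ≤ 1) (hr : 1 ≤ r) (hv : HW lo r δ f e W μ v)
include hlo hr hv

theorem phiSum_zero_of_sol {a : ℕ → ℂ} (ha : δ = 1 → a (r + 2) = 0)
    (hs : SolZero (qnum hb 2) r δ a) {i : ℕ} (hi : 2 ≤ i) (hi' : i ≤ r + 1 + δ) :
    e i (phiSum f r δ a (f 1 v)) = 0 := by
  have ht := h.singT_one hlo hr hv
  have hx := h.toF.exch_one hr (hv.f_zero hr)
  by_cases hir : i ≤ r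
  · rw [h.e_phiSum hlo hr ht a hi hir, hs.chain i hi hir, zero_smul]
  rcases h.toF.hδ with h0 | h0
  · obtain rfl : i = r + 1 := by omega
    rw [h.e_phiSum_short hlo hr ht h0 hx a]
    simp only [map_smul, map_zero, add_zero]
    have := hs.end_short h0
    refine Eq.trans (b := (a r + (1 + qnum hb 2) * a (r + 1)) • zE f r (r + 1) (f 1 v))
      (by module) (by rw [this, zero_smul])
  · have := hs.end_long h0
    obtain rfl | rfl : i = r + 1 ∨ i = r + 2 := by omega
    · rw [h.e_phiSum_long hlo hr ht h0 (Or.inl ⟨rfl, rfl, rfl, rfl⟩) hx a, this, ha h0]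
      simp
    · rw [h.e_phiSum_long hlo hr ht h0 (Or.inr ⟨rfl, rfl, rfl, rfl⟩) hx a, ha h0]
      simp only [map_smul, map_zero, add_zero, mul_zero]
      refine Eq.trans (b := (a r + qnum hb 2 * a (r + 1)) • zE f r (r + 1) (f 1 v))
        (by module) (by rw [this, zero_smul])

/-- Necessity of the conditions `SolZero`, provided that the vectors `zV` and `zE` whose coefficients
are the left hand sides do not vanish. -/
theorem sol_of_phiSum_zero {a : ℕ → ℂ} (ha : δ = 1 → a (r + 2) = 0)
    (hz : ∀ i, 2 ≤ i → i ≤ r → zV f r δ i (f 1 v) ≠ 0)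
    (hz' : zE f r (r + 1 + δ) (f 1 v) ≠ 0)
    (hs : ∀ i, 2 ≤ i → i ≤ r + 1 + δ → e i (phiSum f r δ a (f 1 v)) = 0) :
    SolZero (qnum hb 2) r δ a where
  chain i hi hi' := by
    have := hs i hi (by omega)
    rw [h.e_phiSum hlo hr (h.singT_one hlo hr hv) a hi hi'] at this
    exact (smul_eq_zero.1 this).resolve_right (hz i hi hi')
  end_short h0 := by
    have := hs (r + 1) (by omega) (by omega)
    rw [h.e_phiSum_short hlo hr (h.singT_one hlo hr hv) h0 (h.toF.exch_one hr (hv.f_zero hr)) a] at this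
    simp only [map_smul, map_zero, add_zero] at this
    subst h0
    refine (smul_eq_zero.1 (?_ : _ • zE f r (r + 1) (f 1 v) = 0)).resolve_right hz'
    rw [← this]
    module
  end_long h0 := by
    have := hs (r + 1) (by omega) (by omega)
    rw [h.e_phiSum_long hlo hr (h.singT_one hlo hr hv) h0 (Or.inl ⟨rfl, rfl, rfl, rfl⟩)
      (h.toF.exch_one hr (hv.f_zero hr)) a, ha h0] at this
    subst h0
    simp only [zero_smul, add_zero] at this
    exact (smul_eq_zero.1 this).resolve_right hz'

end Zero

section One
variable (hlo : lo = 0) (hr : 1 ≤ r) (hv : HW lo r δ f e W μ v)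

/-- The general linear combination of the `φ^i_m v`. -/
def _root_.QuantumSO.phiThree (f : ℕ → M →ₗ[ℂ] M) (r δ : ℕ) (a b d : ℕ → ℂ) (v : M) : M :=
  f 0 (phiSum f r δ a (f 1 v)) + phiSum f r δ b (f 0 (f 1 v)) + phiSum f r δ d (f 1 (f 0 v))

include hlo hr hv

theorem tops : SingT hb r δ f e W (μ - ep 1) (f 1 v) ∧ SingT hb r δ f e W (μ - ep 0) (f 0 (f 1 v)) ∧
    SingT hb r δ f e W (μ - ep 0) (f 1 (f 0 v)) := by
  have h1 := h.singT_one (by omega) hr hv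
  refine ⟨h1, ?_, ?_⟩
  · have := h.singT_zero hr hlo h1
    convert this using 1
    abel
  · have := (h.up_lo (by omega)).singT_one le_rfl hr (h.hw_zero hr hlo hv)
    convert this using 1
    abel

theorem f_zero_zero (i : ℕ) (hi : 2 ≤ i) (hi' : i ≤ r + 1 + δ) : f i (f 0 v) = 0 :=
  (h.hw_zero hr hlo hv).f_zero hr i hi hi'

theorem e_phiThree (a b d : ℕ → ℂ) {i : ℕ} (hi : 2 ≤ i) (hi' : i ≤ r) :
    e i (phiThree f r δ a b d v) =
      (a (i - 1) + qnum hb 2 * a i + fold r δ a (i + 1)) • f 0 (zV f r δ i (f 1 v)) +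
      (b (i - 1) + qnum hb 2 * b i + fold r δ b (i + 1)) • zV f r δ i (f 0 (f 1 v)) +
      (d (i - 1) + qnum hb 2 * d i + fold r δ d (i + 1)) • zV f r δ i (f 1 (f 0 v)) := by
  obtain ⟨t1, t2, t3⟩ := h.tops hlo hr hv
  rw [phiThree, map_add, map_add, h.ef i 0 _ (by omega) (by omega) (by omega) (by omega),
    h.e_phiSum (by omega) hr t1 a hi hi', h.e_phiSum (by omega) hr t2 b hi hi',
    h.e_phiSum (by omega) hr t3 d hi hi', map_smul]

theorem e_phiThree_short (h0 : δ = 0) (a b d : ℕ → ℂ) :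
    e (r + 1) (phiThree f r δ a b d v) =
      (a r + (1 + qnum hb 2) * a (r + 1) + b (r + 1)) • f 0 (zE f r (r + 1) (f 1 v)) +
      (b r + b (r + 1)) • zE f r (r + 1) (f 0 (f 1 v)) +
      (d r + (1 + qnum hb 2) * d (r + 1) + b (r + 1)) • zE f r (r + 1) (f 1 (f 0 v)) := by
  obtain ⟨t1, t2, t3⟩ := h.tops hlo hr hv
  rw [phiThree, map_add, map_add, h.ef _ 0 _ (by omega) (by omega) (by omega) (by omega),
    h.e_phiSum_short (by omega) hr t1 h0 (h.toF.exch_one hr (hv.f_zero hr)),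
    h.e_phiSum_short (by omega) hr t2 h0 (h.toF.exch_zero_one hr (hv.f_zero hr)),
    h.e_phiSum_short (by omega) hr t3 h0 (h.toF.exch_one hr (h.f_zero_zero hlo hr hv))]
  simp only [map_add, map_smul, map_zero, add_zero]
  module

theorem e_phiThree_long (h0 : δ = 1) {i j m m' : ℕ}
    (hij : i = r + 1 ∧ j = r + 2 ∧ m = r + 1 ∧ m' = r + 2 ∨
      i = r + 2 ∧ j = r + 1 ∧ m = r + 2 ∧ m' = r + 1) (a b d : ℕ → ℂ) :
    e i (phiThree f r δ a b d v) =
      (a r + qnum hb 2 * (a m + a m') + b m') • f 0 (zE f r j (f 1 v)) +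
      (b r + qnum hb 2 * b m) • zE f r j (f 0 (f 1 v)) +
      (d r + qnum hb 2 * (d m + d m') + b m') • zE f r j (f 1 (f 0 v)) := by
  obtain ⟨t1, t2, t3⟩ := h.tops hlo hr hv
  rw [phiThree, map_add, map_add, h.ef _ 0 _ (by omega) (by omega) (by omega) (by omega),
    h.e_phiSum_long (by omega) hr t1 h0 hij (h.toF.exch_one hr (hv.f_zero hr)),
    h.e_phiSum_long (by omega) hr t2 h0 hij (h.toF.exch_zero_one hr (hv.f_zero hr)),
    h.e_phiSum_long (by omega) hr t3 h0 hij (h.toF.exch_one hr (h.f_zero_zero hlo hr hv))]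
  simp only [map_add, map_smul, map_zero, add_zero]
  module

theorem e_one_phiThree (a b d : ℕ → ℂ) :
    e 1 (phiThree f r δ a b d v) =
      (qnum hb (μ 1) * a 1 + qnum hb (μ 1 - 1) * fold r δ a 2 +
        (qnum hb (μ 1 + 1) * b 1 + qnum hb (μ 1) * fold r δ b 2)) •
          app f (up r δ 1) (f 0 (f 1 v)) +
      (qnum hb (μ 1 + 1) * d 1 + qnum hb (μ 1) * fold r δ d 2) •
          app f (up r δ 1) (f 1 (f 0 v)) := by
  obtain ⟨t1, t2, t3⟩ := h.tops hlo hr hv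
  have hu : f 0 (app f (up r δ 1) (f 1 v)) = app f (up r δ 1) (f 0 (f 1 v)) := by
    refine app_comm f _ _ (fun a ha x => ?_) _
    have := (FSys.IsV.up (δ := δ) 1 le_rfl hr).two_le hr a ha
    exact h.toF.comm 0 a x hr (by omega) (by omega)
  have e1 := h.e_one_one (by omega) hr hv
  have e2 := (h.up_lo (by omega)).e_one_one le_rfl hr (h.hw_zero hr hlo hv)
  rw [phiThree, map_add, map_add, h.ef _ 0 _ (by omega) (by omega) (by omega) (by omega),
    h.e_one_phiSum (by omega) hr t1 (h.f_e_one_one (by omega) hr hv),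
    h.e_one_phiSum (by omega) hr t2, h.e_one_phiSum (by omega) hr t3, map_smul, hu]
  · simp only [Pi.sub_apply, ep, if_pos, if_neg (show (1 : ℕ) ≠ 0 by omega), sub_add_cancel,
      sub_zero]
    module
  · intro i hi hi'
    rw [e2, map_smul, h.f_zero_zero hlo hr hv i hi hi', smul_zero]
  · intro i hi hi'
    rw [h.ef _ _ _ (by omega) (by omega) (by omega) (by omega), e1, map_smul, map_smul,
      h.f_zero_zero hlo hr hv i hi hi', smul_zero]

theorem phiThree_zero_of_sol {a b d : ℕ → ℂ} (ha : δ = 1 → a (r + 2) = 0)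
    (hd : δ = 1 → d (r + 2) = 0) (hs : SolOne (qnum hb 2) r δ a b d) {i : ℕ} (hi : 2 ≤ i)
    (hi' : i ≤ r + 1 + δ) : e i (phiThree f r δ a b d v) = 0 := by
  by_cases hir : i ≤ r
  · rw [h.e_phiThree hlo hr hv a b d hi hir, hs.rec_a i hi hir, hs.rec_b i hi hir,
      hs.rec_d i hi hir]
    simp
  rcases h.toF.hδ with h0 | h0
  · obtain rfl : i = r + 1 := by omega
    obtain ⟨h1, h2, h3⟩ := hs.end_short h0
    rw [h.e_phiThree_short hlo hr hv h0, h1, h2, h3]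
    simp
  · obtain ⟨h1, h2, h3, h4⟩ := hs.end_long h0
    obtain rfl | rfl : i = r + 1 ∨ i = r + 2 := by omega
    · rw [h.e_phiThree_long hlo hr hv h0 (Or.inl ⟨rfl, rfl, rfl, rfl⟩), h4, ha h0, hd h0, add_zero,
        add_zero, h1, h2, h3]
      simp
    · rw [h.e_phiThree_long hlo hr hv h0 (Or.inr ⟨rfl, rfl, rfl, rfl⟩), h4, ha h0, hd h0, zero_add,
        zero_add, h1, h2, h3]
      simp

/-- Necessity of the conditions `SolOne`, provided that the three versions of the vectors `zV` and `zE`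
whose coefficients are the left hand sides are linearly independent. -/
theorem sol_of_phiThree_zero {a b d : ℕ → ℂ} (ha : δ = 1 → a (r + 2) = 0)
    (hd : δ = 1 → d (r + 2) = 0)
    (hz : ∀ i, 2 ≤ i → i ≤ r →
      Indep3 (f 0 (zV f r δ i (f 1 v))) (zV f r δ i (f 0 (f 1 v))) (zV f r δ i (f 1 (f 0 v))))
    (hz' : ∀ j, (j = r + 1 ∨ j = r + 1 + δ) →
      Indep3 (f 0 (zE f r j (f 1 v))) (zE f r j (f 0 (f 1 v))) (zE f r j (f 1 (f 0 v))))
    (hs : ∀ i, 2 ≤ i → i ≤ r + 1 + δ → e i (phiThree f r δ a b d v) = 0) :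
    SolOne (qnum hb 2) r δ a b d := by
  have key := fun i hi (hi' : i ≤ r) =>
    hz i hi hi' _ _ _ ((h.e_phiThree hlo hr hv a b d hi hi').symm.trans (hs i hi (by omega)))
  refine ⟨fun i hi hi' => (key i hi hi').1, fun i hi hi' => (key i hi hi').2.1,
    fun i hi hi' => (key i hi hi').2.2, fun h0 => ?_, fun h0 => ?_⟩
  · exact hz' _ (Or.inl rfl) _ _ _
      ((h.e_phiThree_short hlo hr hv h0 a b d).symm.trans (hs _ (by omega) (by omega)))
  · obtain ⟨h1, h2, h3⟩ := hz' (r + 2) (by omega) _ _ _ ((h.e_phiThree_long hlo hr hv h0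
      (Or.inl ⟨rfl, rfl, rfl, rfl⟩) a b d).symm.trans (hs _ (by omega) (by omega)))
    obtain ⟨h4, h5, h6⟩ := hz' (r + 1) (by omega) _ _ _ ((h.e_phiThree_long hlo hr hv h0
      (Or.inr ⟨rfl, rfl, rfl, rfl⟩) a b d).symm.trans (hs _ (by omega) (by omega)))
    have h7 : b (r + 2) = b (r + 1) := mul_left_cancel₀ h.toF.c_ne (by linear_combination h5 - h2)
    rw [h7, ha h0] at h1
    rw [h7, hd h0] at h3
    exact ⟨by linear_combination h1, h2, by linear_combination h3, h7⟩

end One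
end ESys

end

/-! ### Nonvanishing and independence of the test vectors -/

section

namespace ESys

variable {M : Type*} [AddCommGroup M] [Module ℂ M] {hb : ℂ} {lo r δ : ℕ}
  {f e : ℕ → M →ₗ[ℂ] M} {W : (ℕ → ℂ) → Submodule ℂ M}

variable (h : ESys hb lo r δ f e W)
variable {μ : ℕ → ℂ} {v : M}

include h

/-- The raising operators `e_k, …, e_2` detect the vectors `f_k ⋯ f_1 w t`. -/
theorem low_descent (hlo : lo ≤ 1) (hr : 1 ≤ r) {ν ν' ν'' : ℕ → ℂ} {t t' t'' : M}
    (ht : SingT hb r δ f e W ν t)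
    (ht' : SingT hb r δ f e W ν' t') (ht'' : SingT hb r δ f e W ν'' t'')
    (g : M →ₗ[ℂ] M) (hg : ∀ i, 2 ≤ i → i ≤ r + 1 + δ → ∀ x, e i (g x) = g (e i x))
    {k : ℕ} (hk : 1 ≤ k) {w : List ℕ} (hw : Low r δ k w) {α β γ : ℂ}
    (h0 : α • g (app f (desc k) (app f w t)) + β • app f (desc k) (app f w t') +
      γ • app f (desc k) (app f w t'') = 0) :
    α • g (f 1 (app f w t)) + β • f 1 (app f w t') + γ • f 1 (app f w t'') = 0 := by
  induction k, hk using Nat.le_induction with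
  | base => exact h0
  | succ k hk ih =>
    have hkr : k + 1 ≤ r := by rcases hw with ⟨i, h1, h2, -⟩ | ⟨h1, -⟩ <;> omega
    refine ih (hw.mono (by omega)) ?_
    have := congrArg (e (k + 1)) h0
    simpa only [map_add, map_smul, map_zero, hg _ (show 2 ≤ k + 1 by omega)
      (show k + 1 ≤ r + 1 + δ by omega), h.e_low hlo hr ht hw (by omega),
      h.e_low hlo hr ht' hw (by omega), h.e_low hlo hr ht'' hw (by omega),
      Nat.add_sub_cancel] using this

/-- The operators `e_k, …, e_2` map `f_k ⋯ f_1 w f_1 v` to `f_1 w f_1 v`, and `e_1` maps this to a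
multiple of `w f_1 v`, a vector of a natural representation of `so(P)` whose highest weight vector
`f_1 v` is nonzero. -/
theorem low_ne_zero (hlo : lo ≤ 1) (hr : 1 ≤ r) (hv : HW lo r δ f e W μ v) (hv0 : v ≠ 0)
    (h1 : qnum hb (μ 1) ≠ 0) (h2 : qnum hb (μ 1 - 1) ≠ 0) {k : ℕ} (hk : 1 ≤ k) {w : List ℕ}
    (hw : Low r δ k w) : app f (desc k) (app f w (f 1 v)) ≠ 0 := by
  intro h0
  have ht := h.singT_one hlo hr hv
  have h3 := h.low_descent hlo hr ht ht ht LinearMap.id (fun _ _ _ _ => rfl) hk hw (α := 1)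
    (β := 0) (γ := 0) (by simp [h0])
  simp only [one_smul, zero_smul, add_zero, LinearMap.id_apply] at h3
  have h4 := h.e_one_low hlo hr ht (h.f_e_one_one hlo hr hv) (hw.mono hk)
  rw [h3, map_zero] at h4
  have h5 := (smul_eq_zero.1 h4.symm).resolve_left (by simpa [ep] using h2)
  have h6 := h.eq_zero_of_isV hlo hr ht hw.isV h5
  have h7 := h.e_one_one hlo hr hv
  rw [h6, map_zero] at h7
  exact hv0 ((smul_eq_zero.1 h7.symm).resolve_left h1)

theorem up_ne_zero (hlo : lo ≤ 1) (hr : 1 ≤ r) (hv : HW lo r δ f e W μ v) (hv0 : v ≠ 0)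
    (h1 : qnum hb (μ 1) ≠ 0) : app f (up r δ 1) (f 1 v) ≠ 0 := by
  intro h0
  have h6 := h.eq_zero_of_isV hlo hr (h.singT_one hlo hr hv) (.up 1 le_rfl hr) h0
  have h7 := h.e_one_one hlo hr hv
  rw [h6, map_zero] at h7
  exact hv0 ((smul_eq_zero.1 h7.symm).resolve_left h1)

omit h in
theorem low_up {i : ℕ} (hi : 2 ≤ i) (hi' : i ≤ r) : Low r δ (i - 1) (up r δ i) :=
  Or.inl ⟨i, by omega, hi', rfl⟩

omit h in
theorem low_end {j : ℕ} (hj : j = r + 1 ∨ j = r + 1 + δ) : Low r δ r (j :: dn r) :=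
  Or.inr ⟨le_rfl, j, hj, rfl⟩

/-- The vectors `f_0 f_1 v` and `f_1 f_0 v` are linearly independent for suitable weights. -/
theorem tops_indep (hlo : lo = 0) (hv : HW lo r δ f e W μ v)
    (hv0 : v ≠ 0)
    (h1 : qnum hb (μ 1) ≠ 0) (h2 : qnum hb (μ 0 - μ 1) ≠ 0)
    (h3 : qnum hb (μ 0 - μ 1) * qnum hb (μ 1) -
      qnum hb (μ 0 - μ 1 + 1) * qnum hb (μ 1 + 1) ≠ 0) {j : ℕ} (hj : j = 1 ∨ r = 0 ∧ j = 1 + δ)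
    {α β : ℂ} (h0 : α • f 0 (f j v) + β • f j (f 0 v) = 0) : α = 0 ∧ β = 0 := by
  subst hlo
  have hδ := h.toF.hδ
  have p0 : pr r δ 0 μ = μ 0 - μ 1 := by rw [pr, if_pos (by omega)]
  have pj : pr r δ j μ = μ 1 := by
    by_cases hr : 1 ≤ r
    · rw [pr, if_pos (by omega), show j = 1 by omega, hv.μ_zero 2 le_rfl, sub_zero]
    obtain rfl : r = 0 := by omega
    rcases hδ with rfl | rfl
    · obtain rfl : j = 1 := by omega
      rw [pr, if_neg (by omega), if_pos rfl]
    · rcases hj with rfl | ⟨-, rfl⟩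
      · rw [pr, if_pos (by omega), hv.μ_zero 2 le_rfl, sub_zero]
      · rw [pr, if_neg (by omega), if_neg (by omega), hv.μ_zero 2 le_rfl, add_zero]
  have aj : pr r δ 0 (μ - al r δ j) = μ 0 - μ 1 + 1 ∧ pr r δ j (μ - al r δ 0) = μ 1 + 1 := by
    have : pr r δ j (μ - al r δ 0) = pr r δ j μ + 1 := by
      rw [pr, pr, al, if_pos (by omega : 0 ≤ r + δ)]
      split_ifs <;> (rcases hj with rfl | ⟨hh, rfl⟩) <;> simp_all [ep] <;> ring
    rw [this, pj]
    refine ⟨?_, rfl⟩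
    rw [pr, if_pos (by omega), al]
    split_ifs <;> (rcases hj with rfl | ⟨hh, rfl⟩) <;> simp_all [ep] <;> ring
  have hjr : j ≤ r + 1 + δ := by omega
  have w0 := h.wf 0 μ v le_rfl (by omega) hv.wt
  have wj := h.wf j μ v (by omega) hjr hv.wt
  have z0 := hv.e_zero 0 le_rfl (by omega)
  have zj := hv.e_zero j (by omega) hjr
  have a0 : e 0 (f 0 v) = qnum hb (μ 0 - μ 1) • v := by
    rw [h.efd' le_rfl (by omega) hv.wt p0, z0, map_zero, zero_add]
  have a1 : e j (f j v) = qnum hb (μ 1) • v := by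
    rw [h.efd' (by omega) hjr hv.wt pj, zj, map_zero, zero_add]
  -- Apply `e_0` and `e_j` to the relation: this gives two linear equations for `α` and `β`, whose
  -- determinant is nonzero by `h3`.
  have b0 := congrArg (e 0) h0
  have b1 := congrArg (e j) h0
  rw [map_add, map_smul, map_smul, h.efd' le_rfl (by omega) wj aj.1,
    h.ef 0 j _ le_rfl (by omega) hjr (by omega), h.ef 0 j _ le_rfl (by omega) hjr (by omega), z0, a0,
    map_zero, map_zero, zero_add, map_smul, map_zero] at b0
  rw [map_add, map_smul, map_smul, h.efd' (by omega) hjr w0 aj.2,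
    h.ef j 0 _ (by omega) hjr (by omega) (by omega), h.ef j 0 _ (by omega) hjr (by omega) (by omega),
    zj, a1, map_zero, map_zero, zero_add, map_smul, map_zero] at b1
  have n0 : f 0 v ≠ 0 := fun hh => by
    rw [hh, map_zero] at a0
    exact hv0 ((smul_eq_zero.1 a0.symm).resolve_left h2)
  have nj : f j v ≠ 0 := fun hh => by
    rw [hh, map_zero] at a1
    exact hv0 ((smul_eq_zero.1 a1.symm).resolve_left h1)
  have c0 := (smul_eq_zero.1 (show (α * qnum hb (μ 0 - μ 1 + 1) + β * qnum hb (μ 0 - μ 1)) •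
    f j v = 0 by rw [← b0]; module)).resolve_right nj
  have c1 := (smul_eq_zero.1 (show (α * qnum hb (μ 1) + β * qnum hb (μ 1 + 1)) •
    f 0 v = 0 by rw [← b1]; module)).resolve_right n0
  have d0 : α * (qnum hb (μ 0 - μ 1) * qnum hb (μ 1) -
      qnum hb (μ 0 - μ 1 + 1) * qnum hb (μ 1 + 1)) = 0 := by
    linear_combination qnum hb (μ 0 - μ 1) * c1 - qnum hb (μ 1 + 1) * c0
  have d1 := (mul_eq_zero.1 d0).resolve_right h3
  rw [d1, zero_mul, zero_add] at c0
  exact ⟨d1, (mul_eq_zero.1 c0).resolve_right h2⟩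

/-- A linear relation between the three versions of a test vector satisfies two linear equations,
obtained by applying the `e_k, …, e_1`. -/
theorem low_relation (hlo : lo = 0) (hr : 1 ≤ r) (hv : HW lo r δ f e W μ v) (hv0 : v ≠ 0)
    (h1 : qnum hb (μ 1) ≠ 0) (h2 : qnum hb (μ 0 - μ 1) ≠ 0)
    (h3 : qnum hb (μ 0 - μ 1) * qnum hb (μ 1) -
      qnum hb (μ 0 - μ 1 + 1) * qnum hb (μ 1 + 1) ≠ 0) {k : ℕ} (hk : 1 ≤ k) {w : List ℕ}
    (hw : Low r δ k w) {α β γ : ℂ}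
    (h0 : α • f 0 (app f (desc k) (app f w (f 1 v))) + β • app f (desc k) (app f w (f 0 (f 1 v))) +
      γ • app f (desc k) (app f w (f 1 (f 0 v))) = 0) :
    α * qnum hb (μ 1 - 1) + β * qnum hb (μ 1) = 0 ∧ γ = 0 := by
  have hδ := h.toF.hδ
  obtain ⟨t1, t2, t3⟩ := h.tops hlo hr hv
  have h4 := h.low_descent (by omega) hr t1 t2 t3 (f 0)
    (fun i hi hi' x => h.ef i 0 x (by omega) hi' (by omega) (by omega)) hk hw h0
  have hw1 := hw.mono hk
  have hu : f 0 (app f w (f 1 v)) = app f w (f 0 (f 1 v)) := by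
    refine app_comm f _ _ (fun a ha x => ?_) _
    have := hw.isV.two_le hr a ha
    exact h.toF.comm 0 a x hr (by omega) (by omega)
  have e1 := h.e_one_one (by omega) hr hv
  have e2 := (h.up_lo (by omega)).e_one_one le_rfl hr (h.hw_zero hr hlo hv)
  have h5 := congrArg (e 1) h4
  rw [map_add, map_add, map_smul, map_smul, map_smul,
    h.ef 1 0 _ (by omega) (by omega) (by omega) (by omega),
    h.e_one_low (by omega) hr t1 (h.f_e_one_one (by omega) hr hv) hw1,
    h.e_one_low (by omega) hr t2 ?_ hw1, h.e_one_low (by omega) hr t3 ?_ hw1, map_zero, map_smul,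
    hu] at h5
  · have h6 : app f w ((α * qnum hb (μ 1 - 1) + β * qnum hb (μ 1)) • f 0 (f 1 v) +
        (γ * qnum hb (μ 1)) • f 1 (f 0 v)) = 0 := by
      rw [map_add, map_smul, map_smul, ← h5]
      simp only [Pi.sub_apply, ep, if_pos, if_neg (show (1 : ℕ) ≠ 0 by omega), sub_zero]
      module
    have h7 := h.eq_zero_of_isV (by omega) hr (t2.add_smul t3 _ _) hw.isV h6
    obtain ⟨h8, h9⟩ := h.tops_indep hlo hv hv0 h1 h2 h3 (Or.inl rfl) h7
    exact ⟨h8, (mul_eq_zero.1 h9).resolve_right h1⟩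
  · intro i hi hi'
    rw [e2, map_smul, h.f_zero_zero hlo hr hv i hi hi', smul_zero]
  · intro i hi hi'
    rw [h.ef _ _ _ (by omega) (by omega) (by omega) (by omega), e1, map_smul, map_smul,
      h.f_zero_zero hlo hr hv i hi hi', smul_zero]

/-- The two vectors to which `e_1` maps the `φ^i_m v` are linearly independent. -/
theorem up_relation (hlo : lo = 0) (hr : 1 ≤ r) (hv : HW lo r δ f e W μ v) (hv0 : v ≠ 0)
    (h1 : qnum hb (μ 1) ≠ 0) (h2 : qnum hb (μ 0 - μ 1) ≠ 0)
    (h3 : qnum hb (μ 0 - μ 1) * qnum hb (μ 1) -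
      qnum hb (μ 0 - μ 1 + 1) * qnum hb (μ 1 + 1) ≠ 0) {β γ : ℂ}
    (h0 : β • app f (up r δ 1) (f 0 (f 1 v)) + γ • app f (up r δ 1) (f 1 (f 0 v)) = 0) :
    β = 0 ∧ γ = 0 := by
  obtain ⟨t1, t2, t3⟩ := h.tops hlo hr hv
  have h4 : app f (up r δ 1) (β • f 0 (f 1 v) + γ • f 1 (f 0 v)) = 0 := by
    rw [map_add, map_smul, map_smul, h0]
  exact h.tops_indep hlo hv hv0 h1 h2 h3 (Or.inl rfl)
    (h.eq_zero_of_isV (by omega) hr (t2.add_smul t3 _ _) (.up 1 le_rfl hr) h4)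

end ESys

end

/-! ### Uniqueness and linear independence for `l = 0` -/

section

section Words

variable {M : Type*} [AddCommGroup M] [Module ℂ M]

/-- The linear combination `∑ A_m φ_m v` over the basis indices. -/
def combZero (P : ℕ) (A : ℕ → ℂ) (f : ℕ → M →ₗ[ℂ] M) (v : M) : M :=
  ∑ m ∈ indices0 P, A m • app f (phiWord P m) v

/-- The linear combination `∑ A^i_m φ^i_m v` over the basis indices. -/
def combOne (P : ℕ) (A : ℕ × ℕ → ℂ) (f : ℕ → M →ₗ[ℂ] M) (v : M) : M :=
  ∑ x ∈ indices1 P, A x • app f (phiWord' P x.1 x.2) v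

variable {r δ : ℕ} (f : ℕ → M →ₗ[ℂ] M) (v : M)

theorem app_phiWord (hr : 1 ≤ r) (hδ : δ = 0 ∨ δ = 1) {m : ℕ} (hm : 1 ≤ m) (hm' : m ≤ r + 1 + δ) :
    app f (phiWord (2 * r + 1 + δ) m) v = phiV f r δ m (f 1 v) := by
  rw [phiWord_eq hr hδ hm hm', app_append, app_append]
  rfl

theorem app_phiWord_one (hr : 1 ≤ r) (hδ : δ = 0 ∨ δ = 1) {m : ℕ} (hm : 1 ≤ m)
    (hm' : m ≤ r + 1 + δ) :
    app f (phiWord' (2 * r + 1 + δ) 1 m) v = f 0 (phiV f r δ m (f 1 v)) := by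
  rw [phiWord', if_pos rfl, app_cons, app_phiWord f v hr hδ hm hm']

theorem app_phiWord_two (hr : 1 ≤ r) (hδ : δ = 0 ∨ δ = 1) {m : ℕ} (hm : 1 ≤ m)
    (hm' : m ≤ r + 1 + δ) :
    app f (phiWord' (2 * r + 1 + δ) 2 m) v = phiV f r δ m (f 0 (f 1 v)) := by
  rw [phiWord', if_neg (by omega), if_pos rfl, phiWord_eq hr hδ hm hm', ← List.append_assoc,
    List.dropLast_concat, List.length_append, List.length_singleton, Nat.add_sub_cancel,
    List.drop_left, app_append, app_append, app_append]
  rfl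

theorem app_phiWord_three (hr : 1 ≤ r) (hδ : δ = 0 ∨ δ = 1) {m : ℕ} (hm : 1 ≤ m)
    (hm' : m ≤ r + 1 + δ) :
    app f (phiWord' (2 * r + 1 + δ) 3 m) v = phiV f r δ m (f 1 (f 0 v)) := by
  rw [phiWord', if_neg (by omega), if_neg (by omega), app_append, app_phiWord f _ hr hδ hm hm']
  rfl

theorem half_eq {r δ : ℕ} (hδ : δ = 0 ∨ δ = 1) : (2 * r + 1 + δ) / 2 = r + δ := by omega

theorem indices0_eq (hδ : δ = 0 ∨ δ = 1) : indices0 (2 * r + 1 + δ) = Finset.Icc 1 (r + 1) := by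
  rw [indices0]; congr 1; omega

theorem mem_indices1 (hδ : δ = 0 ∨ δ = 1) {x : ℕ × ℕ} : x ∈ indices1 (2 * r + 1 + δ) ↔
    (1 ≤ x.1 ∧ x.1 ≤ 3) ∧ (1 ≤ x.2 ∧ x.2 ≤ r + 1 + δ) ∧ (x.2 ≤ r + 1 ∨ x.1 = 2) := by
  rw [indices1, Finset.mem_filter, Finset.mem_product, Finset.mem_Icc, Finset.mem_Icc,
    Nat.odd_iff, half_eq hδ]
  omega

omit [Module ℂ M] in
theorem sum_indices1 (hδ : δ = 0 ∨ δ = 1) (F : ℕ × ℕ → M) :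
    ∑ x ∈ indices1 (2 * r + 1 + δ), F x =
      (∑ m ∈ Finset.Icc 1 (r + 1 + δ), if m ≤ r + 1 then F (1, m) else 0) +
      (∑ m ∈ Finset.Icc 1 (r + 1 + δ), F (2, m)) +
      ∑ m ∈ Finset.Icc 1 (r + 1 + δ), if m ≤ r + 1 then F (3, m) else 0 := by
  have h3 : Finset.Icc 1 3 = {1, 2, 3} := rfl
  rw [indices1, Finset.sum_filter, Finset.sum_product, h3, Finset.sum_insert (by simp),
    Finset.sum_insert (by simp), Finset.sum_singleton, half_eq hδ, ← add_assoc,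
    show r + δ + 1 = r + 1 + δ by omega]
  refine congrArg₂ _ (congrArg₂ _ ?_ ?_) ?_ <;> refine Finset.sum_congr rfl fun m hm => ?_
  · rw [Finset.mem_Icc] at hm
    refine if_congr ?_ rfl rfl
    simp only [Nat.odd_iff]; omega
  · simp
  · rw [Finset.mem_Icc] at hm
    refine if_congr ?_ rfl rfl
    simp only [Nat.odd_iff]; omega

/-- The outer coefficients, extended by zero. -/
def cut (r : ℕ) (a : ℕ → ℂ) (m : ℕ) : ℂ := if m ≤ r + 1 then a m else 0

theorem combZero_eq (hr : 1 ≤ r) (hδ : δ = 0 ∨ δ = 1) (A : ℕ → ℂ) :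
    combZero (2 * r + 1 + δ) A f v = phiSum f r δ (cut r A) (f 1 v) := by
  rw [combZero, phiSum, indices0_eq hδ]
  have : ∀ m ∈ Finset.Icc 1 (r + 1), A m • app f (phiWord (2 * r + 1 + δ) m) v =
      cut r A m • phiV f r δ m (f 1 v) := fun m hm => by
    rw [Finset.mem_Icc] at hm
    rw [cut, if_pos hm.2, app_phiWord f v hr hδ hm.1 (by omega)]
  rw [Finset.sum_congr rfl this]
  refine Finset.sum_subset (Finset.Icc_subset_Icc le_rfl (by omega)) fun m _ hm => ?_
  simp only [Finset.mem_Icc] at *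
  rw [cut, if_neg (by omega), zero_smul]

/-- In the form `phiThree` the coefficients with `m = r + 2` that are omitted from the index set for
even `P` are set to zero. -/
theorem combOne_eq (hr : 1 ≤ r) (hδ : δ = 0 ∨ δ = 1) (A : ℕ × ℕ → ℂ) :
    combOne (2 * r + 1 + δ) A f v = phiThree f r δ (cut r fun m => A (1, m)) (fun m => A (2, m))
      (cut r fun m => A (3, m)) v := by
  rw [combOne, phiThree, sum_indices1 hδ, phiSum, phiSum, phiSum, map_sum]
  refine congrArg₂ _ (congrArg₂ _ ?_ ?_) ?_ <;> refine Finset.sum_congr rfl fun m hm => ?_ <;>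
    rw [Finset.mem_Icc] at hm
  · rw [app_phiWord_one f v hr hδ hm.1 hm.2, cut]
    split_ifs <;> simp
  · rw [app_phiWord_two f v hr hδ hm.1 hm.2]
  · rw [app_phiWord_three f v hr hδ hm.1 hm.2, cut]
    split_ifs <;> simp

end Words

/-- Every linear relation between the words applied to `v` holds for the words applied to `v'`. -/
def WRel {M M' : Type*} [AddCommGroup M] [Module ℂ M] [AddCommGroup M'] [Module ℂ M']
    (f : ℕ → M →ₗ[ℂ] M) (v : M) (f' : ℕ → M' →ₗ[ℂ] M') (v' : M') : Prop :=
  ∀ c : List ℕ →₀ ℂ, Finsupp.linearCombination ℂ (fun w => app f w v) c = 0 →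
    Finsupp.linearCombination ℂ (fun w => app f' w v') c = 0

section WRel

variable {M M' : Type*} [AddCommGroup M] [Module ℂ M] [AddCommGroup M'] [Module ℂ M']
  {f : ℕ → M →ₗ[ℂ] M} {v : M} {f' : ℕ → M' →ₗ[ℂ] M'} {v' : M'} (h : WRel f v f' v')
include h

theorem WRel.sum {ι : Type*} (s : Finset ι) (A : ι → ℂ) (w : ι → List ℕ)
    (h0 : ∑ i ∈ s, A i • app f (w i) v = 0) : ∑ i ∈ s, A i • app f' (w i) v' = 0 := by
  have := h (∑ i ∈ s, Finsupp.single (w i) (A i))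
  simp only [map_sum, Finsupp.linearCombination_single] at this
  exact this h0

theorem WRel.ne_zero {w : List ℕ} (h0 : app f' w v' ≠ 0) : app f w v ≠ 0 := fun h1 => by
  have := h.sum {()} (fun _ => 1) (fun _ => w) (by simpa using h1)
  simp only [Finset.sum_singleton, one_smul] at this
  exact h0 this

theorem WRel.three {w₁ w₂ w₃ : List ℕ} {α β γ : ℂ}
    (h0 : α • app f w₁ v + β • app f w₂ v + γ • app f w₃ v = 0) :
    α • app f' w₁ v' + β • app f' w₂ v' + γ • app f' w₃ v' = 0 := by
  have := h.sum Finset.univ ![α, β, γ] ![w₁, w₂, w₃] (by simpa [Fin.sum_univ_three] using h0)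
  simpa [Fin.sum_univ_three] using this

theorem WRel.two {w₁ w₂ : List ℕ} {α β : ℂ}
    (h0 : α • app f w₁ v + β • app f w₂ v = 0) :
    α • app f' w₁ v' + β • app f' w₂ v' = 0 := by
  have := h.sum Finset.univ ![α, β] ![w₁, w₂] (by simpa [Fin.sum_univ_two] using h0)
  simpa [Fin.sum_univ_two] using this

end WRel

open ESys

/-- A nonzero highest weight vector in a module over the quantum group. -/
structure Sys {M : Type*} [AddCommGroup M] [Module ℂ M] (hb : ℂ) (lo r δ : ℕ)
    (f e : ℕ → M →ₗ[ℂ] M) (W : (ℕ → ℂ) → Submodule ℂ M) (μ : ℕ → ℂ) (v : M) : Prop where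
  toE : ESys hb lo r δ f e W
  hv : HW lo r δ f e W μ v
  ne : v ≠ 0
  nr : NotRoot hb

section Zero

variable {M M' : Type*} [AddCommGroup M] [Module ℂ M] [AddCommGroup M'] [Module ℂ M']
  {hb : ℂ} {lo r δ : ℕ} {f e : ℕ → M →ₗ[ℂ] M} {W : (ℕ → ℂ) → Submodule ℂ M} {μ : ℕ → ℂ} {v : M}
  {f' e' : ℕ → M' →ₗ[ℂ] M'} {W' : (ℕ → ℂ) → Submodule ℂ M'} {μ' : ℕ → ℂ} {v' : M'}
  (h : Sys hb lo r δ f e W μ v) (hlo : lo ≤ 1)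
include h hlo

omit [AddCommGroup M] [Module ℂ M] h hlo in
theorem coeff0_eq (P : ℕ) {m : ℕ} (hm : 1 ≤ m) : coeff0 P hb m = seqG hb P m := by
  obtain ⟨k, rfl⟩ : ∃ k, m = k + 1 := ⟨m - 1, by omega⟩
  rw [coeff0, seqG, pow_succ, Nat.add_sub_cancel]
  ring

omit h hlo in
theorem cut_last {a : ℕ → ℂ} : δ = 1 → cut r a (r + 2) = 0 := fun _ => by
  rw [cut, if_neg (by omega)]

/-- The vector `∑ A_m φ_m v` is annihilated by the `e_i`, `i ≥ 2`. -/
theorem zero_kill (hr : 1 ≤ r) {i : ℕ} (hi : 2 ≤ i) (hi' : i ≤ r + 1 + δ) :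
    e i (combZero (2 * r + 1 + δ) (coeff0 (2 * r + 1 + δ) hb) f v) = 0 := by
  have hδ := h.toE.toF.hδ
  rw [combZero_eq f v hr hδ]
  refine h.toE.phiSum_zero_of_sol hlo hr h.hv cut_last ?_ hi hi'
  refine SolZero.of_seq h.nr (P := (2 * r + 1 + δ : ℕ)) (by push_cast; ring) hr cut_last 1
    fun m hm hm' => ?_
  rw [cut, if_pos hm', coeff0_eq _ hm, one_mul]

/-- A combination of the `φ_m v` annihilated by the `e_i`, `i ≥ 2`, is a multiple of `∑ A_m φ_m v`. The
vectors that detect the recurrence are nonzero for every weight: this can be checked for the weight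
with `λ_1 = 2`, as the linear relations between words do not depend on the weight. -/
theorem zero_unique (h' : Sys hb lo r δ f' e' W' μ' v') (hμ : μ' 1 = 2) (hw : WRel f v f' v')
    {A : ℕ → ℂ} (hA : 1 ≤ r → ∀ i, 2 ≤ i → i ≤ r + 1 + δ →
      e i (combZero (2 * r + 1 + δ) A f v) = 0) :
    ∃ κ : ℂ, ∀ m ∈ indices0 (2 * r + 1 + δ), A m = κ * coeff0 (2 * r + 1 + δ) hb m := by
  have hδ := h.toE.toF.hδ
  have hq := h.nr
  rw [indices0_eq hδ]
  rcases Nat.eq_zero_or_pos r with rfl | hr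
  · have h0 : coeff0 (2 * 0 + 1 + δ) hb 1 ≠ 0 := by
      rw [coeff0_eq _ le_rfl]
      exact seqG_last_ne (r := 0) hq (by push_cast; ring)
    refine ⟨A 1 / coeff0 (2 * 0 + 1 + δ) hb 1, fun m hm => ?_⟩
    rw [Finset.mem_Icc] at hm
    obtain rfl : m = 1 := by omega
    rw [div_mul_cancel₀ _ h0]
  have q1 : qnum hb (μ' 1) ≠ 0 := by rw [hμ]; exact mod_cast hq.qnum_nat (n := 2) (by omega)
  have q2 : qnum hb (μ' 1 - 1) ≠ 0 := by
    rw [hμ, show (2 : ℂ) - 1 = (1 : ℕ) by norm_num]; exact hq.qnum_nat (by omega)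
  have hA := hA hr
  rw [combZero_eq f v hr hδ] at hA
  have hs := h.toE.sol_of_phiSum_zero hlo hr h.hv cut_last (fun i hi hi' => ?_) ?_ hA
  · obtain ⟨κ, hκ⟩ := SolZero.exists_seq hq (P := (2 * r + 1 + δ : ℕ)) (by push_cast; ring) hδ
      cut_last hs
    refine ⟨κ, fun m hm => ?_⟩
    rw [Finset.mem_Icc] at hm
    have := hκ m hm.1 hm.2
    rwa [cut, if_pos hm.2, ← coeff0_eq _ hm.1] at this
  · have := hw.ne_zero (w := desc (i - 1) ++ (up r δ i ++ [1])) (by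
      simpa using h'.toE.low_ne_zero hlo hr h'.hv h'.ne q1 q2 (by omega) (low_up hi hi'))
    simpa [zV] using this
  · have := hw.ne_zero (w := desc r ++ ((r + 1 + δ) :: dn r ++ [1])) (by
      simpa using h'.toE.low_ne_zero hlo hr h'.hv h'.ne q1 q2 hr (low_end (Or.inr rfl)))
    simpa [zE] using this

omit h hlo in
theorem wrel_refl : WRel f v f v := fun _ hc => hc

/-- The vectors `φ_m v` are linearly independent for a suitable weight. -/
theorem zero_indep_special (hμ : μ 1 = 2) {A : ℕ → ℂ}
    (hA : combZero (2 * r + 1 + δ) A f v = 0) {m : ℕ} (hm : m ∈ indices0 (2 * r + 1 + δ)) :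
    A m = 0 := by
  have hδ := h.toE.toF.hδ
  have hq := h.nr
  have q1 : qnum hb (2 : ℂ) ≠ 0 := mod_cast hq.qnum_nat (n := 2) (by omega)
  obtain ⟨κ, hκ⟩ := zero_unique h hlo h hμ wrel_refl (A := A)
    (fun _ i _ _ => by rw [hA, map_zero])
  suffices hκ0 : κ = 0 by rw [hκ m hm, hκ0, zero_mul]
  rw [indices0_eq hδ] at hκ
  rcases Nat.eq_zero_or_pos r with rfl | hr
  · have h0 : coeff0 (2 * 0 + 1 + δ) hb 1 ≠ 0 := by
      rw [coeff0_eq _ le_rfl]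
      exact seqG_last_ne (r := 0) hq (by push_cast; ring)
    suffices hA1 : A 1 = 0 by
      rw [hκ 1 (by simp)] at hA1
      exact (mul_eq_zero.1 hA1).resolve_right h0
    rw [combZero, indices0_eq hδ] at hA
    simp only [zero_add, Finset.Icc_self, Finset.sum_singleton] at hA
    refine (smul_eq_zero.1 hA).resolve_right ?_
    have hE := h.toE
    have z1 := h.hv.e_zero 1 hlo (by omega)
    have μ2 := h.hv.μ_zero 2 le_rfl
    rcases hδ with rfl | rfl
    · have : phiWord (2 * 0 + 1 + 0) 1 = [1, 1] := rfl
      have w1 := hE.wf 1 μ v hlo (by omega) h.hv.wt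
      have p1 : pr 0 0 1 (μ - al 0 0 1) = 1 := by
        rw [pr, if_neg (by omega), if_pos rfl, al, if_neg (by omega), if_pos rfl]
        simp [ep, hμ]; norm_num
      have p2 : pr 0 0 1 μ = 2 := by rw [pr, if_neg (by omega), if_pos rfl, hμ]
      intro h0
      rw [show phiWord (1 + 0) 1 = [1, 1] from this] at h0
      have e1 := congrArg (e 1) h0
      rw [app_cons, app_cons, app_nil, hE.efd' hlo (by omega) w1 p1,
        hE.efd' hlo (by omega) h.hv.wt p2, z1, map_zero, zero_add, map_smul, hq.qnum_one,
        map_zero, ← add_smul] at e1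
      have e2 := congrArg (e 1) ((smul_eq_zero.1 e1).resolve_left hq.qnum_two_add_one)
      rw [hE.efd' hlo (by omega) h.hv.wt p2, z1, map_zero, zero_add, map_zero] at e2
      exact h.ne ((smul_eq_zero.1 e2).resolve_left q1)
    · have : phiWord (2 * 0 + 1 + 1) 1 = [1, 2] := rfl
      have z2 := h.hv.e_zero 2 (by omega) (by omega)
      have w2 := hE.wf 2 μ v (by omega) (by omega) h.hv.wt
      have p1 : pr 0 1 1 (μ - al 0 1 2) = 2 := by
        rw [pr, al, if_pos (by omega), if_neg (by omega), if_neg (by omega)]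
        simp [ep, hμ, μ2]
      have p2 : pr 0 1 2 μ = 2 := by
        rw [pr, if_neg (by omega), if_neg (by omega), μ2, add_zero]; exact hμ
      intro h0
      rw [show phiWord (1 + 1) 1 = [1, 2] from this] at h0
      have e1 := congrArg (e 1) h0
      rw [app_cons, app_cons, app_nil, hE.efd' hlo (by omega) w2 p1,
        hE.ef 1 2 _ hlo (by omega) (by omega) (by omega), z1, map_zero, map_zero, zero_add,
        map_zero] at e1
      have e2 := congrArg (e 2) ((smul_eq_zero.1 e1).resolve_left q1)
      rw [hE.efd' (by omega) (by omega) h.hv.wt p2, z2, map_zero, zero_add, map_zero] at e2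
      exact h.ne ((smul_eq_zero.1 e2).resolve_left q1)
  · rw [combZero_eq f v hr hδ] at hA
    -- The solution is `κ` times the vector of coefficients, and for `λ_1 = 2` the operator `e_1` turns its
    -- vanishing into `κ [P / 2 + 1] = 0`.
    have h1 := h.toE.e_one_phiSum hlo hr (h.toE.singT_one hlo hr h.hv)
      (h.toE.f_e_one_one hlo hr h.hv) (cut r A)
    rw [hA, map_zero] at h1
    have h2 := (smul_eq_zero.1 h1.symm).resolve_right
      (h.toE.up_ne_zero hlo hr h.hv h.ne (by rwa [hμ]))
    have h3 := seqG_one (P := (2 * r + 1 + δ : ℕ)) hq 1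
    rw [fold_of_le cut_last (by omega), cut, cut, if_pos (by omega), if_pos (by omega),
      hκ 1 (by simp), hκ 2 (by simp; omega), coeff0_eq _ le_rfl,
      coeff0_eq _ one_le_two] at h2
    simp only [Pi.sub_apply, ep, if_pos, hμ, sub_add_cancel] at h2
    rw [show (2 : ℂ) - 1 = 1 by norm_num] at h2
    rw [show (1 : ℂ) + 1 = 2 by norm_num] at h3
    have h4 : κ * qnum hb (1 + ((2 * r + 1 + δ : ℕ) : ℂ) / 2) = 0 := by
      rw [← h3]
      linear_combination h2
    refine (mul_eq_zero.1 h4).resolve_right ?_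
    rw [show 1 + ((2 * r + 1 + δ : ℕ) : ℂ) / 2 = ((2 * r + 3 + δ : ℕ) : ℂ) / 2 by push_cast; ring]
    exact hq.qnum_half (by omega)

omit h in
/-- Linear independence of the `φ_m v` for every weight follows from that for `λ_1 = 2`. -/
theorem zero_indep (h' : Sys hb lo r δ f' e' W' μ' v') (hμ : μ' 1 = 2) (hw : WRel f v f' v')
    {A : ℕ → ℂ} (hA : combZero (2 * r + 1 + δ) A f v = 0) {m : ℕ}
    (hm : m ∈ indices0 (2 * r + 1 + δ)) : A m = 0 :=
  zero_indep_special h' hlo hμ (hw.sum _ _ _ hA) hm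

end Zero

end

/-! ### The coefficients `A^i_m` -/

section

open ESys

section Coefficients

variable {hb : ℂ} {r δ : ℕ} {P : ℕ}

theorem coeff1_one (a : ℂ) (m : ℕ) : coeff1 P hb a (1, m) =
    qnum hb (a + (P : ℂ) / 2) * qpow hb (a + (P : ℂ) / 2 - 1) * seqG hb P m +
      qnum hb (a + (P : ℂ) / 2 - 1) * qnum hb (a + (P : ℂ) / 2) * seqH hb P m := by
  have := coeff_one_eq (P := (P : ℂ)) (hb := hb) (a + (P : ℂ) / 2 - 1) m
  rw [show a + (P : ℂ) / 2 - 1 + P / 2 - m + 1 = a + P - m by ring] at this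
  simp only [coeff1, if_true, pow_succ]
  linear_combination -qnum hb (a + (P : ℂ) / 2) * this

theorem coeff1_three (a : ℂ) (m : ℕ) : coeff1 P hb a (3, m) =
    -qnum hb (a + (P : ℂ) / 2 - 1) * qpow hb (-(a + (P : ℂ) / 2)) * seqG hb P m +
      qnum hb (a + (P : ℂ) / 2 - 1) * qnum hb (a + (P : ℂ) / 2) * seqH hb P m := by
  have := coeff_three_eq (P := (P : ℂ)) (hb := hb) (a + (P : ℂ) / 2) m
  rw [show a + (P : ℂ) / 2 - P / 2 + m - 1 = a + m - 1 by ring] at this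
  simp only [coeff1, if_neg (show (3 : ℕ) ≠ 1 by omega), if_neg (show (3 : ℕ) ≠ 2 by omega),
    pow_succ]
  linear_combination -qnum hb (a + (P : ℂ) / 2 - 1) * this

theorem coeff1_two (a : ℂ) {m : ℕ} (h : ¬ (Even P ∧ P / 2 ≤ m)) : coeff1 P hb a (2, m) =
    qnum hb (a + (P : ℂ) / 2 - 1) * qnum hb (a + (P : ℂ) / 2) * seqE hb P m := by
  simp only [coeff1, if_neg (show (2 : ℕ) ≠ 1 by omega), if_true, if_neg h, seqE]
  ring

theorem coeff1_two' (a : ℂ) {m : ℕ} (hP : P = 2 * r + 2) (hm : r + 1 ≤ m) :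
    coeff1 P hb a (2, m) =
    qnum hb (a + (P : ℂ) / 2 - 1) * qnum hb (a + (P : ℂ) / 2) * (seqE hb P (r + 1) / 2) := by
  have h2 : P / 2 = r + 1 := by omega
  have h1 : Even P ∧ P / 2 ≤ m := ⟨⟨r + 1, by omega⟩, by omega⟩
  simp only [coeff1, if_neg (show (2 : ℕ) ≠ 1 by omega), if_true, if_pos h1, seqE]
  rw [h2, hP, show ((r + 1 : ℕ) : ℂ) - ((2 * r + 2 : ℕ) : ℂ) / 2 = 0 by push_cast; ring,
    show -((r + 1 : ℕ) : ℂ) + ((2 * r + 2 : ℕ) : ℂ) / 2 = 0 by push_cast; ring, qpow_zero]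
  ring

theorem coeff1_par (hP : P = 2 * r + 1 + δ) (a : ℂ) :
    ParOne hb P r δ (cut r fun m => coeff1 P hb a (1, m)) (fun m => coeff1 P hb a (2, m))
      (cut r fun m => coeff1 P hb a (3, m))
      (qnum hb (a + (P : ℂ) / 2) * qpow hb (a + (P : ℂ) / 2 - 1))
      (qnum hb (a + (P : ℂ) / 2 - 1) * qnum hb (a + (P : ℂ) / 2))
      (-qnum hb (a + (P : ℂ) / 2 - 1) * qpow hb (-(a + (P : ℂ) / 2))) where
  a_eq m _ hm := by rw [cut, if_pos hm, coeff1_one]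
  d_eq m _ hm := by rw [cut, if_pos hm, coeff1_three]
  b_eq m _ hm := coeff1_two a (by rw [Nat.even_iff]; omega)
  b_last h0 := coeff1_two a (by rw [Nat.even_iff]; omega)
  b_last' h1 := ⟨coeff1_two' a (by omega) le_rfl, coeff1_two' a (by omega) (by omega)⟩

/-- The proportionality of the solutions of the two equations that express the vanishing under
`e_1`. -/
theorem exists_scalar (hq : NotRoot hb) {β x γ y : ℂ} (h1 : x * qnum hb β = γ * qpow hb β)
    (h2 : y * qnum hb (β + 1) = -γ * qpow hb (-(β + 1))) :
    ∃ κ, x = κ * (qnum hb (β + 1) * qpow hb β) ∧ γ = κ * (qnum hb β * qnum hb (β + 1)) ∧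
      y = κ * (-qnum hb β * qpow hb (-(β + 1))) := by
  have n1 := qpow_ne hb β
  have n2 := qpow_ne hb (-(β + 1))
  -- The consecutive numbers `[β]` and `[β + 1]` do not both vanish, since `q` is not a root of unity.
  by_cases hβ : qnum hb β = 0
  · have h3 := hq.qnum_succ hβ
    rw [hβ, mul_zero] at h1
    have hγ : γ = 0 := (mul_eq_zero.1 h1.symm).resolve_right n1
    rw [hγ, neg_zero, zero_mul] at h2
    have hy : y = 0 := (mul_eq_zero.1 h2).resolve_right h3
    refine ⟨x / (qnum hb (β + 1) * qpow hb β), ?_, ?_, ?_⟩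
    · field_simp
    · rw [hβ, hγ]; ring
    · rw [hβ, hy]; ring
  by_cases hβ' : qnum hb (β + 1) = 0
  · rw [hβ', mul_zero] at h2
    have hγ : γ = 0 := by
      rw [eq_comm, mul_eq_zero, neg_eq_zero] at h2
      exact h2.resolve_right n2
    rw [hγ, zero_mul] at h1
    have hx : x = 0 := (mul_eq_zero.1 h1).resolve_right hβ
    refine ⟨y / (-qnum hb β * qpow hb (-(β + 1))), ?_, ?_, ?_⟩
    · rw [hβ', hx]; ring
    · rw [hβ', hγ]; ring
    · field_simp
  · refine ⟨γ / (qnum hb β * qnum hb (β + 1)), ?_, ?_, ?_⟩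
    · field_simp; linear_combination h1
    · field_simp
    · field_simp; linear_combination h2

/-- The coefficient vectors for `λ_1 = 1` and `λ_1 = 2` are not proportional. -/
theorem coeff1_not_proportional (hq : NotRoot hb) (hδ : δ = 0 ∨ δ = 1) (hP : P = 2 * r + 1 + δ)
    {A : ℕ × ℕ → ℂ} {κ κ' : ℂ} (h1 : ∀ x ∈ indices1 P, A x = κ * coeff1 P hb 1 x)
    (h2 : ∀ x ∈ indices1 P, A x = κ' * coeff1 P hb 2 x) : κ = 0 := by
  subst hP
  set P : ℕ := 2 * r + 1 + δ with hP
  have m1 : (1, r + 1) ∈ indices1 P := by rw [mem_indices1 hδ]; omega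
  have m2 : (2, r + 1) ∈ indices1 P := by rw [mem_indices1 hδ]; omega
  have a1 := (h1 _ m1).symm.trans (h2 _ m1)
  have a2 := (h1 _ m2).symm.trans (h2 _ m2)
  obtain ⟨E, hE, hE'⟩ : ∃ E : ℂ, E ≠ 0 ∧ ∀ a, coeff1 P hb a (2, r + 1) =
      qnum hb (a + (P : ℂ) / 2 - 1) * qnum hb (a + (P : ℂ) / 2) * E := by
    have hE := seqE_last_ne (P := (P : ℂ)) (r := r) hq (by rw [hP]; push_cast; ring) hδ
    rcases hδ with h0 | h0
    · exact ⟨_, hE, fun a => coeff1_two a (by rw [Nat.even_iff]; omega)⟩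
    · exact ⟨_, div_ne_zero hE two_ne_zero, fun a => coeff1_two' a (by omega) le_rfl⟩
  rw [hE', hE'] at a2
  simp only [coeff1, if_true] at a1
  have hX : ∀ a : ℂ, a + P - ((r + 1 : ℕ) : ℂ) = a - 1 + ((r + 1 + δ : ℕ) : ℂ) := fun a => by
    rw [hP]; push_cast; ring
  rw [hX, hX] at a1
  have hs : ((-1 : ℂ)) ^ (r + 1 + 1) ≠ 0 := by simp
  set X : ℂ := ((r + 1 + δ : ℕ) : ℂ) with hX
  set Y : ℂ := (P : ℂ) / 2 with hY
  rw [show (1 : ℂ) - 1 + X = X by ring, show (2 : ℂ) - 1 + X = X + 1 by ring,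
    show 1 + Y = Y + 1 by ring, show 2 + Y = Y + 2 by ring] at a1
  rw [show 1 + Y - 1 = Y by ring, show 2 + Y - 1 = Y + 1 by ring, show 1 + Y = Y + 1 by ring,
    show 2 + Y = Y + 2 by ring] at a2
  have b1 : qnum hb (Y + 1) ≠ 0 := by
    rw [show Y + 1 = ((P + 2 : ℕ) : ℂ) / 2 by rw [hY]; push_cast; ring]
    exact hq.qnum_half (by omega)
  have c2 : κ * qnum hb Y = κ' * qnum hb (Y + 2) :=
    mul_right_cancel₀ (mul_ne_zero b1 hE) (by linear_combination a2)
  have c1 : κ * qnum hb X * qnum hb (Y + 1) = κ' * qnum hb (X + 1) * qnum hb (Y + 2) :=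
    mul_left_cancel₀ hs (by linear_combination a1)
  -- The identity `[x + 1][y + 1] - [x][y] = [x + y + 1]` at `x = X`, `y = -(Y + 1)` eliminates `κ'`.
  have c3 := qnum_mul_sub hb X (-(Y + 1)) hq
  rw [show -(Y + 1) + 1 = -Y by ring, show X + -(Y + 1) + 1 = -(Y - X) by ring, qnum_neg, qnum_neg,
    qnum_neg] at c3
  have c4 : κ * qnum hb (Y - X) = 0 := by
    linear_combination κ * c3 + qnum hb (X + 1) * c2 - c1
  refine (mul_eq_zero.1 c4).resolve_right ?_
  rw [show Y - X = -(((1 + δ : ℕ) : ℂ) / 2) by rw [hY, hX, hP]; push_cast; ring, qnum_neg]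
  exact neg_ne_zero.2 (hq.qnum_half (by omega))

end Coefficients

end

/-! ### Uniqueness and linear independence for `l = 1` -/

section

open ESys

variable {M M' M'' : Type*} [AddCommGroup M] [Module ℂ M] [AddCommGroup M'] [Module ℂ M']
  [AddCommGroup M''] [Module ℂ M'']
  {hb : ℂ} {lo r δ : ℕ} {f e : ℕ → M →ₗ[ℂ] M} {W : (ℕ → ℂ) → Submodule ℂ M} {μ : ℕ → ℂ} {v : M}
  {f' e' : ℕ → M' →ₗ[ℂ] M'} {W' : (ℕ → ℂ) → Submodule ℂ M'} {μ' : ℕ → ℂ} {v' : M'}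
  {f'' e'' : ℕ → M'' →ₗ[ℂ] M''} {W'' : (ℕ → ℂ) → Submodule ℂ M''} {μ'' : ℕ → ℂ} {v'' : M''}

theorem pr_of_le {r δ i : ℕ} (h : i ≤ r + δ) (μ : ℕ → ℂ) : pr r δ i μ = μ i - μ (i + 1) := if_pos h
theorem al_of_le {r δ i : ℕ} (h : i ≤ r + δ) : al r δ i = ep i - ep (i + 1) := if_pos h
theorem pr_short {r : ℕ} (μ : ℕ → ℂ) : pr r 0 (r + 1) μ = μ (r + 1) := by
  rw [pr, if_neg (by omega), if_pos rfl]
theorem al_short {r : ℕ} : al r 0 (r + 1) = ep (r + 1) := by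
  rw [al, if_neg (by omega), if_pos rfl]
theorem pr_long {r : ℕ} (μ : ℕ → ℂ) : pr r 1 (r + 2) μ = μ (r + 1) + μ (r + 2) := by
  rw [pr, if_neg (by omega), if_neg (by omega)]; rfl
theorem al_long {r : ℕ} : al r 1 (r + 2) = ep (r + 1) + ep (r + 2) := by
  rw [al, if_neg (by omega), if_neg (by omega)]; rfl

section RankZero

variable (h : Sys hb 0 0 δ f e W μ v)
include h

/-- The action of `e_1` for `so(5)`. -/
theorem e_one_combOne_one (hδ : δ = 0) (A : ℕ × ℕ → ℂ) : e 1 (combOne 1 A f v) =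
    (A (1, 1) * (qnum hb (μ 1) + qnum hb (μ 1 - 1)) + A (2, 1) * qnum hb (μ 1)) • f 0 (f 1 v) +
    (A (2, 1) * qnum hb (μ 1) + A (3, 1) * (qnum hb (μ 1 + 1) + qnum hb (μ 1))) • f 1 (f 0 v) := by
  subst hδ
  have hs : combOne 1 A f v = A (1, 1) • f 0 (f 1 (f 1 v)) + A (2, 1) • f 1 (f 0 (f 1 v)) +
      A (3, 1) • f 1 (f 1 (f 0 v)) := by
    rw [combOne, sum_indices1 (r := 0) (δ := 0) (Or.inl rfl)]
    simp only [zero_add, Finset.Icc_self, Finset.sum_singleton, le_refl, if_true]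
    rfl
  have hE := h.toE
  have z := h.hv.e_zero 1 (by omega) (by omega)
  have w1 := hE.wf 1 μ v (by omega) (by omega) h.hv.wt
  have w0 := hE.wf 0 μ v (by omega) (by omega) h.hv.wt
  have w01 := hE.wf 0 _ _ (by omega) (by omega) w1
  have w10 := hE.wf 1 _ _ (by omega) (by omega) w0
  have c : ∀ x, e 1 (f 0 x) = f 0 (e 1 x) := fun x =>
    hE.ef 1 0 x (by omega) (by omega) (by omega) (by omega)
  have a1 : e 1 (f 1 v) = qnum hb (μ 1) • v := by
    rw [hE.efd' (by omega) (by omega) h.hv.wt (pr_short _), z, map_zero, zero_add]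
  have a2 : e 1 (f 1 (f 1 v)) = (qnum hb (μ 1) + qnum hb (μ 1 - 1)) • f 1 v := by
    rw [hE.efd' (a := μ 1 - 1) (by omega) (by omega) w1 (by rw [pr_short, al_short]; simp [ep]), a1,
      map_smul, ← add_smul]
  have a3 : e 1 (f 1 (f 0 v)) = qnum hb (μ 1 + 1) • f 0 v := by
    rw [hE.efd' (a := μ 1 + 1) (by omega) (by omega) w0
      (by rw [pr_short, al_of_le (by omega)]; simp [ep]), c, z, map_zero, map_zero, zero_add]
  have a4 : e 1 (f 1 (f 1 (f 0 v))) = (qnum hb (μ 1 + 1) + qnum hb (μ 1)) • f 1 (f 0 v) := by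
    rw [hE.efd' (a := μ 1) (by omega) (by omega) w10
      (by rw [pr_short, al_of_le (by omega), al_short]; simp [ep]), a3, map_smul, ← add_smul]
  have a5 : e 1 (f 1 (f 0 (f 1 v))) = qnum hb (μ 1) • f 1 (f 0 v) + qnum hb (μ 1) • f 0 (f 1 v) := by
    rw [hE.efd' (a := μ 1) (by omega) (by omega) w01
      (by rw [pr_short, al_short, al_of_le (by omega)]; simp [ep]), c, a1, map_smul, map_smul]
  rw [hs, map_add, map_add, map_smul, map_smul, map_smul, c, a2, a4, a5, map_smul]
  module

/-- The action of `e_1` and `e_2` for `so(6)`. -/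
theorem e_combOne_two (hδ : δ = 1) (A : ℕ × ℕ → ℂ) : e 1 (combOne 2 A f v) =
    (A (1, 1) * qnum hb (μ 1) + A (2, 1) * qnum hb (μ 1 + 1)) • f 0 (f 2 v) +
    (A (2, 2) * qnum hb (μ 1) + A (3, 1) * qnum hb (μ 1 + 1)) • f 2 (f 0 v) ∧
    e 2 (combOne 2 A f v) =
    (A (1, 1) * qnum hb (μ 1) + A (2, 2) * qnum hb (μ 1 + 1)) • f 0 (f 1 v) +
    (A (2, 1) * qnum hb (μ 1) + A (3, 1) * qnum hb (μ 1 + 1)) • f 1 (f 0 v) := by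
  subst hδ
  have hs : combOne 2 A f v = A (1, 1) • f 0 (f 1 (f 2 v)) +
      (A (2, 1) • f 1 (f 0 (f 2 v)) + A (2, 2) • f 2 (f 0 (f 1 v))) +
      A (3, 1) • f 1 (f 2 (f 0 v)) := by
    have hI : Finset.Icc 1 2 = ({1, 2} : Finset ℕ) := rfl
    rw [combOne, sum_indices1 (r := 0) (δ := 1) (Or.inr rfl)]
    simp only [zero_add, show 1 + 1 = 2 from rfl, hI]
    rw [Finset.sum_pair (by omega), Finset.sum_pair (by omega), Finset.sum_pair (by omega)]
    simp only [le_refl, if_true, show ¬ (2 ≤ 1) by omega, if_false, add_zero]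
    rfl
  have hE := h.toE
  have hμ := h.hv.μ_zero 2 le_rfl
  have z1 := h.hv.e_zero 1 (by omega) (by omega)
  have z2 := h.hv.e_zero 2 (by omega) (by omega)
  have w1 := hE.wf 1 μ v (by omega) (by omega) h.hv.wt
  have w2 := hE.wf 2 μ v (by omega) (by omega) h.hv.wt
  have w0 := hE.wf 0 μ v (by omega) (by omega) h.hv.wt
  have w01 := hE.wf 0 _ _ (by omega) (by omega) w1
  have w02 := hE.wf 0 _ _ (by omega) (by omega) w2
  have w10 := hE.wf 1 _ _ (by omega) (by omega) w0
  have w20 := hE.wf 2 _ _ (by omega) (by omega) w0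
  have c : ∀ i j, 0 < i → i ≤ 2 → j ≤ 2 → i ≠ j → ∀ x, e i (f j x) = f j (e i x) :=
    fun i j h0 h1 h2 h3 x => hE.ef i j x (by omega) (by omega) (by omega) h3
  have c10 := c 1 0 (by omega) (by omega) (by omega) (by omega)
  have c20 := c 2 0 (by omega) (by omega) (by omega) (by omega)
  have c12 := c 1 2 (by omega) (by omega) (by omega) (by omega)
  have c21 := c 2 1 (by omega) (by omega) (by omega) (by omega)
  have p2 : ∀ μ, pr 0 1 2 μ = μ 1 + μ 2 := fun μ => pr_long (r := 0) μ
  have al2 : al 0 1 2 = ep 1 + ep 2 := al_long (r := 0)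
  have a1 : e 1 (f 1 v) = qnum hb (μ 1) • v := by
    rw [hE.efd' (a := μ 1) (by omega) (by omega) h.hv.wt (by rw [pr_of_le (by omega), hμ, sub_zero]),
      z1, map_zero, zero_add]
  have a2 : e 2 (f 2 v) = qnum hb (μ 1) • v := by
    rw [hE.efd' (a := μ 1) (by omega) (by omega) h.hv.wt (by rw [p2, hμ, add_zero]),
      z2, map_zero, zero_add]
  have b1 : e 1 (f 1 (f 2 v)) = qnum hb (μ 1) • f 2 v := by
    rw [hE.efd' (a := μ 1) (by omega) (by omega) w2
      (by rw [pr_of_le (by omega), al2]; simp [ep, hμ]), c12, z1, map_zero, map_zero, zero_add]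
  have b2 : e 1 (f 1 (f 2 (f 0 v))) = qnum hb (μ 1 + 1) • f 2 (f 0 v) := by
    rw [hE.efd' (a := μ 1 + 1) (by omega) (by omega) w20
      (by rw [pr_of_le (by omega), al2, al_of_le (by omega)]; simp [ep, hμ]), c12, c10, z1, map_zero,
      map_zero, map_zero, zero_add]
  have b3 : e 1 (f 1 (f 0 (f 2 v))) = qnum hb (μ 1 + 1) • f 0 (f 2 v) := by
    rw [hE.efd' (a := μ 1 + 1) (by omega) (by omega) w02
      (by rw [pr_of_le (by omega), al2, al_of_le (by omega)]; simp [ep, hμ]), c10, c12, z1, map_zero,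
      map_zero, map_zero, zero_add]
  have b4 : e 2 (f 2 (f 0 (f 1 v))) = qnum hb (μ 1 + 1) • f 0 (f 1 v) := by
    rw [hE.efd' (a := μ 1 + 1) (by omega) (by omega) w01
      (by rw [p2, al_of_le (by omega), al_of_le (by omega)]; simp [ep, hμ]), c20, c21, z2, map_zero,
      map_zero, map_zero, zero_add]
  have b5 : e 2 (f 2 (f 0 v)) = qnum hb (μ 1 + 1) • f 0 v := by
    rw [hE.efd' (a := μ 1 + 1) (by omega) (by omega) w0
      (by rw [p2, al_of_le (by omega)]; simp [ep, hμ]), c20, z2, map_zero, map_zero, zero_add]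
  constructor
  · rw [hs]
    simp only [map_add, map_smul, c10, c12, b1, b2, b3, a1]
    module
  · rw [hs]
    simp only [map_add, map_smul, c20, c21, a2, b4, b5]
    module

end RankZero

/-- The words of the vectors to which `e_1` maps the `φ^i_m v`. -/
def topWord (r δ : ℕ) : List ℕ × List ℕ :=
  if r = 0 then ([0, 1 + δ], [1 + δ, 0]) else (up r δ 1 ++ [0, 1], up r δ 1 ++ [1, 0])

section Par

variable {P : ℂ} {a b d : ℕ → ℂ} {x γ y : ℂ}

/-- The first of the two coefficients of `e_1`, for coefficients of the form `ParOne`. -/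
theorem par_one (hq : NotRoot hb) (hr : 1 ≤ r) (hδ : δ = 0 ∨ δ = 1) (ha : δ = 1 → a (r + 2) = 0)
    (h : ParOne hb P r δ a b d x γ y) (t : ℂ) :
    qnum hb t * a 1 + qnum hb (t - 1) * fold r δ a 2 +
        (qnum hb (t + 1) * b 1 + qnum hb t * fold r δ b 2) =
      x * qnum hb (t + P / 2 - 1) - γ * qpow hb (t + P / 2 - 1) := by
  have h1 := seqG_one (P := P) hq (t - 1)
  have h2 := seqHE_one (P := P) hq t
  rw [sub_add_cancel, show t - 1 + P / 2 = t + P / 2 - 1 by ring] at h1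
  rw [fold_of_le ha (by omega), h.fold_b hδ (by omega) (by omega), h.b_eq 1 le_rfl hr,
    h.a_eq 1 (by omega) (by omega), h.a_eq 2 (by omega) (by omega)]
  linear_combination x * h1 + γ * h2

/-- The second of the two coefficients of `e_1`, for coefficients of the form `ParOne`. -/
theorem par_three (hq : NotRoot hb) (hr : 1 ≤ r) (hd : δ = 1 → d (r + 2) = 0)
    (h : ParOne hb P r δ a b d x γ y) (t : ℂ) :
    qnum hb (t + 1) * d 1 + qnum hb t * fold r δ d 2 =
      y * qnum hb (t + P / 2 - 1 + 1) + γ * qpow hb (-(t + P / 2 - 1 + 1)) := by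
  have h1 := seqG_one (P := P) hq t
  have h2 := seqH_one (P := P) hq t
  rw [fold_of_le hd (by omega), h.d_eq 1 (by omega) (by omega), h.d_eq 2 (by omega) (by omega),
    sub_add_cancel]
  linear_combination y * h1 + γ * h2

/-- The two coefficients of `e_1` for `P = 1`, where the recurrence is empty and the values at `m = 2`
are obtained from the boundary conditions. -/
theorem par_odd (hq : NotRoot hb) (h : ParOne hb 1 0 0 a b d x γ y) (t : ℂ) :
    a 1 * (qnum hb t + qnum hb (t - 1)) + b 1 * qnum hb t =
      x * qnum hb (t + 1 / 2 - 1) - γ * qpow hb (t + 1 / 2 - 1) ∧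
    b 1 * qnum hb t + d 1 * (qnum hb (t + 1) + qnum hb t) =
      y * qnum hb (t + 1 / 2 - 1 + 1) + γ * qpow hb (-(t + 1 / 2 - 1 + 1)) := by
  have h1 := seqG_one (P := 1) hq (t - 1)
  have h2 := seqHE_one (P := 1) hq t
  have h3 := seqG_one (P := 1) hq t
  have h4 := seqH_one (P := 1) hq t
  rw [sub_add_cancel, show t - 1 + 1 / 2 = t + 1 / 2 - 1 by ring] at h1
  have hP : (1 : ℂ) = 2 * (0 : ℕ) + 1 := by simp
  have g2 : seqG hb 1 2 = seqG hb 1 1 := by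
    linear_combination seqG_rec (P := 1) hq 0 - seqG_odd hq 0 hP
  have k2 : seqH hb 1 2 = seqH hb 1 1 + seqE hb 1 1 := by
    linear_combination seqH_rec (P := 1) hq 0 - seqH_odd hq 0 hP
  have e2 : seqE hb 1 2 = (1 - qnum hb 2) * seqE hb 1 1 := by
    linear_combination seqE_rec (P := 1) hq 0 - seqE_odd 0 hP
  have q := qnum_add_one_add hb t hq
  rw [h.a_eq 1 le_rfl le_rfl, h.d_eq 1 le_rfl le_rfl, h.b_last rfl, sub_add_cancel, zero_add]
  rw [g2] at h1 h3
  rw [k2, e2] at h2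
  rw [k2] at h4
  constructor
  · linear_combination x * h1 + γ * h2 - γ * seqE hb 1 1 * q
  · linear_combination y * h3 + γ * h4

/-- The two coefficients of `e_1` for `P = 2`. -/
theorem par_even (hq : NotRoot hb) (h : ParOne hb 2 0 1 a b d x γ y) (t : ℂ) :
    a 1 * qnum hb t + b 1 * qnum hb (t + 1) =
      x * qnum hb (t + 2 / 2 - 1) - γ * qpow hb (t + 2 / 2 - 1) ∧
    b 1 * qnum hb t + d 1 * qnum hb (t + 1) =
      y * qnum hb (t + 2 / 2 - 1 + 1) + γ * qpow hb (-(t + 2 / 2 - 1 + 1)) := by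
  have h1 := seqG_one (P := 2) hq (t - 1)
  have h2 := seqHE_one (P := 2) hq t
  have h3 := seqG_one (P := 2) hq t
  have h4 := seqH_one (P := 2) hq t
  rw [sub_add_cancel, show t - 1 + 2 / 2 = t + 2 / 2 - 1 by ring] at h1
  have hP : (2 : ℂ) = 2 * (0 : ℕ) + 2 := by simp
  have g2 : seqG hb 2 2 = 0 := by
    linear_combination seqG_rec (P := 2) hq 0 - seqG_even hq 0 hP
  have k2 : seqH hb 2 2 = seqE hb 2 1 / 2 := by
    linear_combination seqH_rec (P := 2) hq 0 - seqH_even hq 0 hP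
  have e2 : seqE hb 2 2 = - qnum hb 2 * (seqE hb 2 1 / 2) := by
    linear_combination seqE_rec (P := 2) hq 0 - seqE_even hq 0 hP
  have q := qnum_add_one_add hb t hq
  rw [h.a_eq 1 le_rfl le_rfl, h.d_eq 1 le_rfl le_rfl, (h.b_last' rfl).1, sub_add_cancel, zero_add]
  rw [g2] at h1 h3
  rw [k2, e2] at h2
  rw [k2] at h4
  constructor
  · linear_combination x * h1 + γ * h2 - γ * seqE hb 2 1 / 2 * q
  · linear_combination y * h3 + γ * h4

end Par

/-- For coefficients of the form `ParOne`, the vanishing under `e_1` amounts to two equations for the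
three parameters, with `β = λ_1 + P/2 - 1`. -/
theorem e_one_combOne (h : Sys hb 0 r δ f e W μ v) {A : ℕ × ℕ → ℂ} {x γ y : ℂ}
    (hp : ParOne hb (2 * r + 1 + δ : ℕ) r δ (cut r fun m => A (1, m)) (fun m => A (2, m))
      (cut r fun m => A (3, m)) x γ y) {β : ℂ}
    (hβ : β = μ 1 + ((2 * r + 1 + δ : ℕ) : ℂ) / 2 - 1) :
    e 1 (combOne (2 * r + 1 + δ) A f v) =
      (x * qnum hb β - γ * qpow hb β) • app f (topWord r δ).1 v +
      (y * qnum hb (β + 1) + γ * qpow hb (-(β + 1))) • app f (topWord r δ).2 v := by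
  have hδ := h.toE.toF.hδ
  subst hβ
  rcases Nat.eq_zero_or_pos r with rfl | hr
  · rw [topWord, if_pos rfl]
    rcases hδ with rfl | rfl
    · have := par_odd h.nr (by simpa using hp) (μ 1)
      rw [show 2 * 0 + 1 + 0 = 1 from rfl, e_one_combOne_one h rfl, Nat.cast_one, ← this.1, ← this.2]
      rfl
    · have := par_even h.nr (by simpa using hp) (μ 1)
      have hb12 : A (2, 2) = A (2, 1) := ((hp.b_last' rfl).2).trans ((hp.b_last' rfl).1).symm
      rw [show 2 * 0 + 1 + 1 = 2 from rfl, (e_combOne_two h rfl A).1, Nat.cast_ofNat, ← this.1,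
        ← this.2, hb12]
      rfl
  · rw [topWord, if_neg (by omega), combOne_eq f v hr hδ, h.toE.e_one_phiThree rfl hr h.hv,
      par_one h.nr hr hδ cut_last hp, par_three h.nr hr cut_last hp, app_append, app_append]
    rfl

/-- For `P = 2` the node `2` is on the same footing as the node `1`. -/
theorem e_two_combOne (h : Sys hb 0 0 1 f e W μ v) {A : ℕ × ℕ → ℂ} {x γ y : ℂ}
    (hp : ParOne hb (2 : ℕ) 0 1 (cut 0 fun m => A (1, m)) (fun m => A (2, m))
      (cut 0 fun m => A (3, m)) x γ y) {β : ℂ} (hβ : β = μ 1) :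
    e 2 (combOne 2 A f v) =
      (x * qnum hb β - γ * qpow hb β) • f 0 (f 1 v) +
      (y * qnum hb (β + 1) + γ * qpow hb (-(β + 1))) • f 1 (f 0 v) := by
  subst hβ
  have := par_even h.nr (by simpa using hp) (μ 1)
  have hb12 : A (2, 2) = A (2, 1) := ((hp.b_last' rfl).2).trans ((hp.b_last' rfl).1).symm
  rw [show μ 1 + 2 / 2 - 1 = μ 1 by ring] at this
  rw [(e_combOne_two h rfl A).2, ← this.1, ← this.2, hb12]
  rfl

/-- The vector `∑ A^i_m φ^i_m v` is annihilated by the `e_i`, `i ≥ 1`. -/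
theorem one_kill (h : Sys hb 0 r δ f e W μ v) {i : ℕ} (hi : 1 ≤ i) (hi' : i ≤ r + 1 + δ) :
    e i (combOne (2 * r + 1 + δ) (coeff1 (2 * r + 1 + δ) hb (μ 1)) f v) = 0 := by
  have hδ := h.toE.toF.hδ
  have hp := coeff1_par (hb := hb) (P := 2 * r + 1 + δ) (r := r) (δ := δ) rfl (μ 1)
  obtain rfl | hi2 := Nat.eq_or_lt_of_le hi
  · rw [e_one_combOne h hp rfl, sub_add_cancel]
    convert zero_add (0 : M) using 2
    · convert zero_smul ℂ _ using 2
      ring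
    · convert zero_smul ℂ _ using 2
      ring
  rcases Nat.eq_zero_or_pos r with rfl | hr
  · obtain ⟨rfl, rfl⟩ : i = 2 ∧ δ = 1 := by omega
    rw [show 2 * 0 + 1 + 1 = 2 from rfl] at hp ⊢
    rw [e_two_combOne h hp rfl]
    rw [show μ 1 + ((2 : ℕ) : ℂ) / 2 - 1 = μ 1 by push_cast; ring,
      show μ 1 + ((2 : ℕ) : ℂ) / 2 = μ 1 + 1 by push_cast; ring]
    convert zero_add (0 : M) using 2
    · convert zero_smul ℂ _ using 2
      ring
    · convert zero_smul ℂ _ using 2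
      ring
  · rw [combOne_eq f v hr hδ]
    exact h.toE.phiThree_zero_of_sol rfl hr h.hv cut_last cut_last
      (SolOne.of_par h.nr (by push_cast; ring) hδ hr cut_last cut_last hp) hi2 hi'

section Special

variable (h : Sys hb 0 r δ f e W μ v)
  (h' : Sys hb 0 r δ f' e' W' μ' v') (hμ0' : μ' 0 = 2) (hμ' : μ' 1 = 1) (hw' : WRel f v f' v')
include h h' hμ0' hμ' hw'

omit h in
omit hw' in
/-- The weight with `λ_0 = 2`, `λ_1 = 1` satisfies the assumptions of `tops_indep`. -/
theorem special_one : qnum hb (μ' 1) ≠ 0 ∧ qnum hb (μ' 0 - μ' 1) ≠ 0 ∧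
    qnum hb (μ' 0 - μ' 1) * qnum hb (μ' 1) -
      qnum hb (μ' 0 - μ' 1 + 1) * qnum hb (μ' 1 + 1) ≠ 0 := by
  have hq := h'.nr
  have h2 := qnum_mul_sub hb 1 1 hq
  rw [show μ' 0 - μ' 1 = 1 by rw [hμ0', hμ']; norm_num, hμ', ← neg_sub, h2, hq.qnum_one]
  refine ⟨one_ne_zero, one_ne_zero, neg_ne_zero.2 ?_⟩
  rw [show (1 : ℂ) + 1 + 1 = (3 : ℕ) by norm_num]
  exact hq.qnum_nat (by omega)

/-- The two vectors to which `e_1` maps the `φ^i_m v` are linearly independent for every weight, because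
they are so for one weight. -/
theorem topWord_indep {α β : ℂ}
    (h0 : α • app f (topWord r δ).1 v + β • app f (topWord r δ).2 v = 0) : α = 0 ∧ β = 0 := by
  obtain ⟨q1, q2, q3⟩ := special_one h' hμ0' hμ'
  have h1 := hw'.two h0
  rcases Nat.eq_zero_or_pos r with rfl | hr
  · rw [topWord, if_pos rfl] at h1
    exact h'.toE.tops_indep rfl h'.hv h'.ne q1 q2 q3 (Or.inr ⟨rfl, rfl⟩) h1
  · rw [topWord, if_neg (by omega), app_append, app_append] at h1
    exact h'.toE.up_relation rfl hr h'.hv h'.ne q1 q2 q3 h1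

variable (h'' : Sys hb 0 r δ f'' e'' W'' μ'' v'') (hμ0'' : μ'' 0 = 3) (hμ'' : μ'' 1 = 2)
  (hw'' : WRel f v f'' v'')
include h'' hμ0'' hμ'' hw''

/-- The three versions of a test vector are linearly independent for every weight. For `λ = (2, 1)` the
relation `α [λ_1 - 1] + β [λ_1] = 0`, `γ = 0` becomes `β = γ = 0`; for `λ = (3, 2)` it then gives
`α = 0`. -/
theorem low_indep (hr : 1 ≤ r) {k : ℕ} (hk : 1 ≤ k) {w : List ℕ} (hl : Low r δ k w) :
    Indep3 (f 0 (app f (desc k) (app f w (f 1 v)))) (app f (desc k) (app f w (f 0 (f 1 v))))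
      (app f (desc k) (app f w (f 1 (f 0 v)))) := by
  intro α β γ h0
  have hq := h.nr
  obtain ⟨q1, q2, q3⟩ := special_one h' hμ0' hμ'
  have k1 := hw'.three (w₁ := 0 :: (desc k ++ (w ++ [1]))) (w₂ := desc k ++ (w ++ [0, 1]))
    (w₃ := desc k ++ (w ++ [1, 0])) (α := α) (β := β) (γ := γ) (by simpa using h0)
  have k2 := hw''.three (w₁ := 0 :: (desc k ++ (w ++ [1]))) (w₂ := desc k ++ (w ++ [0, 1]))
    (w₃ := desc k ++ (w ++ [1, 0])) (α := α) (β := β) (γ := γ) (by simpa using h0)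
  simp only [app_cons, app_append, app_nil] at k1 k2
  obtain ⟨r1, r2⟩ := h'.toE.low_relation rfl hr h'.hv h'.ne q1 q2 q3 hk hl k1
  rw [hμ', sub_self, qnum_zero, mul_zero, zero_add, hq.qnum_one, mul_one] at r1
  have s1 : qnum hb (2 : ℂ) ≠ 0 := mod_cast hq.qnum_nat (n := 2) (by omega)
  have s2 := qnum_mul_sub hb 1 2 hq
  obtain ⟨t1, -⟩ := h''.toE.low_relation rfl hr h''.hv h''.ne (by rwa [hμ''])
    (by rw [hμ'', hμ0'', show (3 : ℂ) - 2 = 1 by norm_num, hq.qnum_one]; exact one_ne_zero)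
    (by
      rw [hμ'', hμ0'', show (3 : ℂ) - 2 = 1 by norm_num, ← neg_sub, s2,
        show (1 : ℂ) + 2 + 1 = (4 : ℕ) by norm_num]
      exact neg_ne_zero.2 (hq.qnum_nat (by omega))) hk hl k2
  rw [hμ'', r1, zero_mul, add_zero, show (2 : ℂ) - 1 = 1 by norm_num, hq.qnum_one, mul_one] at t1
  exact ⟨t1, r1, r2⟩

/-- The coefficients of a combination of the `φ^i_m v` that is annihilated by the `e_i`, `i ≥ 1`, belong
to the three-parameter family. -/
theorem exists_par_of_kill {A : ℕ × ℕ → ℂ} (hA : ∀ i, 1 ≤ i → i ≤ r + 1 + δ →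
      e i (combOne (2 * r + 1 + δ) A f v) = 0) :
    ∃ x γ y, ParOne hb (2 * r + 1 + δ : ℕ) r δ (cut r fun m => A (1, m)) (fun m => A (2, m))
      (cut r fun m => A (3, m)) x γ y := by
  have hδ := h.toE.toF.hδ
  have hq := h.nr
  rcases Nat.eq_zero_or_pos r with rfl | hr
  · have hG := seqG_last_ne (r := 0) (δ := δ) (P := (2 * 0 + 1 + δ : ℕ)) hq (by push_cast; ring)
    have hE := seqE_last_ne (r := 0) (δ := δ) (P := (2 * 0 + 1 + δ : ℕ)) hq (by push_cast; ring) hδ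
    rw [zero_add] at hG hE
    -- for `r = 0` every triple of coefficients is of the required form
    have main : ∀ γ : ℂ, (δ = 0 → A (2, 1) = γ * seqE hb (2 * 0 + 1 + δ : ℕ) 1) →
        (δ = 1 → A (2, 1) = γ * (seqE hb (2 * 0 + 1 + δ : ℕ) 1 / 2) ∧
          A (2, 2) = γ * (seqE hb (2 * 0 + 1 + δ : ℕ) 1 / 2)) →
        ∃ x γ y, ParOne hb (2 * 0 + 1 + δ : ℕ) 0 δ (cut 0 fun m => A (1, m)) (fun m => A (2, m))
          (cut 0 fun m => A (3, m)) x γ y := by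
      intro γ h0 h1
      refine ⟨(A (1, 1) - γ * seqH hb (2 * 0 + 1 + δ : ℕ) 1) / seqG hb (2 * 0 + 1 + δ : ℕ) 1, γ,
        (A (3, 1) - γ * seqH hb (2 * 0 + 1 + δ : ℕ) 1) / seqG hb (2 * 0 + 1 + δ : ℕ) 1,
        ⟨fun m hm hm' => ?_, fun m hm hm' => absurd hm (by omega), h0, h1, fun m hm hm' => ?_⟩⟩
      · obtain rfl : m = 1 := by omega
        rw [div_mul_cancel₀ _ hG, cut, if_pos (by omega)]
        ring
      · obtain rfl : m = 1 := by omega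
        rw [div_mul_cancel₀ _ hG, cut, if_pos (by omega)]
        ring
    rcases hδ with rfl | rfl
    · exact main (A (2, 1) / seqE hb (2 * 0 + 1 + 0 : ℕ) 1)
        (fun _ => by rw [div_mul_cancel₀ _ hE]) (by omega)
    -- for `P = 2` the vanishing under `e_1` and under `e_2` give `A^2_1 = A^2_2`
    · obtain ⟨c1, c2⟩ := e_combOne_two h rfl A
      obtain ⟨q1, q2, q3⟩ := special_one h' hμ0' hμ'
      have k1 := hA 1 le_rfl (by omega)
      have k2 := hA 2 (by omega) (by omega)
      rw [show 2 * 0 + 1 + 1 = 2 from rfl] at k1 k2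
      rw [c1] at k1
      rw [c2] at k2
      have i1 := h'.toE.tops_indep rfl h'.hv h'.ne q1 q2 q3 (j := 2) (by omega)
        (hw'.two (w₁ := [0, 2]) (w₂ := [2, 0]) k1)
      have i2 := h'.toE.tops_indep rfl h'.hv h'.ne q1 q2 q3 (j := 1) (by omega)
        (hw'.two (w₁ := [0, 1]) (w₂ := [1, 0]) k2)
      have d1 : (A (2, 1) - A (2, 2)) * qnum hb (μ 1 + 1) = 0 := by
        linear_combination i1.1 - i2.1
      have d2 : (A (2, 1) - A (2, 2)) * qnum hb (μ 1) = 0 := by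
        linear_combination i2.2 - i1.2
      have d3 : A (2, 1) - A (2, 2) = 0 := by
        by_cases hz : qnum hb (μ 1) = 0
        · exact (mul_eq_zero.1 d1).resolve_right (hq.qnum_succ hz)
        · exact (mul_eq_zero.1 d2).resolve_right hz
      have hE2 := div_ne_zero hE (two_ne_zero (α := ℂ))
      refine main (A (2, 1) / (seqE hb (2 * 0 + 1 + 1 : ℕ) 1 / 2)) (by omega) fun _ => ?_
      rw [div_mul_cancel₀ _ hE2]
      exact ⟨rfl, (sub_eq_zero.1 d3).symm⟩
  · rw [combOne_eq f v hr hδ] at hA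
    have hs := h.toE.sol_of_phiThree_zero rfl hr h.hv cut_last cut_last
      (fun i hi hi' => low_indep h h' hμ0' hμ' hw' h'' hμ0'' hμ'' hw'' hr (by omega)
        (low_up hi hi'))
      (fun j hj => low_indep h h' hμ0' hμ' hw' h'' hμ0'' hμ'' hw'' hr hr (low_end hj))
      (fun i hi hi' => hA i (by omega) hi')
    exact SolOne.exists_par hq (by push_cast; ring) hδ cut_last cut_last hs

/-- A combination of the `φ^i_m v` annihilated by the `e_i`, `i ≥ 1`, is a multiple of
`∑ A^i_m φ^i_m v`: the two equations given by `e_1` leave one of the three parameters free. -/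
theorem one_unique {A : ℕ × ℕ → ℂ} (hA : ∀ i, 1 ≤ i → i ≤ r + 1 + δ →
      e i (combOne (2 * r + 1 + δ) A f v) = 0) :
    ∃ κ : ℂ, ∀ x ∈ indices1 (2 * r + 1 + δ), A x = κ * coeff1 (2 * r + 1 + δ) hb (μ 1) x := by
  have hδ := h.toE.toF.hδ
  have hq := h.nr
  obtain ⟨x, γ, y, hp⟩ := exists_par_of_kill h h' hμ0' hμ' hw' h'' hμ0'' hμ'' hw'' hA
  have h1 := hA 1 le_rfl (by omega)
  rw [e_one_combOne h hp rfl] at h1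
  obtain ⟨k1, k2⟩ := topWord_indep h h' hμ0' hμ' hw' h1
  obtain ⟨κ, rfl, rfl, rfl⟩ := exists_scalar (γ := γ) (y := y) hq (sub_eq_zero.1 k1)
    (by linear_combination k2)
  rw [sub_add_cancel] at hp
  have hc := coeff1_par (hb := hb) (P := 2 * r + 1 + δ) (r := r) (δ := δ) rfl (μ 1)
  refine ⟨κ, fun ⟨i, m⟩ hx => ?_⟩
  rw [mem_indices1 hδ] at hx
  obtain ⟨⟨i1, i2⟩, ⟨m1, m2⟩, m3⟩ := hx
  simp only at i1 i2 m1 m2 m3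
  interval_cases i
  · have e1 := hp.a_eq m m1 (by omega)
    have e2 := hc.a_eq m m1 (by omega)
    rw [cut, if_pos (by omega)] at e1 e2
    rw [e1, e2]
    ring
  · by_cases hm : m ≤ r
    · rw [hp.b_eq m m1 hm, hc.b_eq m m1 hm]
      ring
    rcases hδ with h0 | h0
    · obtain rfl : m = r + 1 := by omega
      rw [hp.b_last h0, hc.b_last h0]
      ring
    · obtain rfl | rfl : m = r + 1 ∨ m = r + 2 := by omega
      · rw [(hp.b_last' h0).1, (hc.b_last' h0).1]
        ring
      · rw [(hp.b_last' h0).2, (hc.b_last' h0).2]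
        ring
  · have e1 := hp.d_eq m m1 (by omega)
    have e2 := hc.d_eq m m1 (by omega)
    rw [cut, if_pos (by omega)] at e1 e2
    rw [e1, e2]
    ring

end Special

/-- The vectors `φ^i_m v` are linearly independent: a relation would hold for all weights, and the
vectors of coefficients that belong to `λ_1 = 1` and `λ_1 = 2` are not proportional. -/
theorem one_indep (h' : Sys hb 0 r δ f' e' W' μ' v') (hμ0' : μ' 0 = 2) (hμ' : μ' 1 = 1)
    (hw' : WRel f v f' v') (h'' : Sys hb 0 r δ f'' e'' W'' μ'' v'') (hμ0'' : μ'' 0 = 3)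
    (hμ'' : μ'' 1 = 2) (hw'' : WRel f v f'' v'') (hw12 : WRel f' v' f'' v'')
    (hw21 : WRel f'' v'' f' v') {A : ℕ × ℕ → ℂ} (hA : combOne (2 * r + 1 + δ) A f v = 0)
    {x : ℕ × ℕ} (hx : x ∈ indices1 (2 * r + 1 + δ)) : A x = 0 := by
  have h1 : combOne (2 * r + 1 + δ) A f' v' = 0 := hw'.sum _ _ _ hA
  have h2 : combOne (2 * r + 1 + δ) A f'' v'' = 0 := hw''.sum _ _ _ hA
  obtain ⟨κ, k1⟩ := one_unique h' h' hμ0' hμ' wrel_refl h'' hμ0'' hμ'' hw12 (A := A)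
    fun i _ _ => by rw [h1, map_zero]
  obtain ⟨κ', k2⟩ := one_unique h'' h' hμ0' hμ' hw21 h'' hμ0'' hμ'' wrel_refl (A := A)
    fun i _ _ => by rw [h2, map_zero]
  rw [hμ'] at k1
  rw [hμ''] at k2
  rw [k1 x hx, coeff1_not_proportional h'.nr h'.toE.toF.hδ rfl k1 k2, zero_mul]

end

/-! ### Strings generated by the raising operators -/

section

open ESys

variable {M : Type*} [AddCommGroup M] [Module ℂ M]

/-- The coefficients of a singular vector in the tensor product with the natural representation, up
to factors: a string `D_k`, `m` and `m'`, `U_k` on which the `e_i` act as in the dual of the natural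
representation. The weights of the basis vectors are `ε_k` for `D_k`, `-ε_k` for `U_k`, and `0`
(`δ = 0`) or `ε_{r+2}`, `-ε_{r+2}` (`δ = 1`) for `m'` and `m`. -/
structure EString (lo k₀ r δ : ℕ) (e : ℕ → M →ₗ[ℂ] M) (D U : ℕ → M) (m m' : M) : Prop where
  e_D : ∀ i k, lo ≤ i → i ≤ r + 1 + δ → k₀ ≤ k → k ≤ r →
    e i (D k) = if i = k then D (k + 1) else 0
  e_D_last : ∀ i, lo ≤ i → i ≤ r + 1 + δ → i ≠ r + 1 → i ≠ r + 1 + δ → e i (D (r + 1)) = 0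
  e_D_end : e (r + 1) (D (r + 1)) = m'
  e_D_end' : e (r + 1 + δ) (D (r + 1)) = m
  e_m : ∀ i, lo ≤ i → i ≤ r + 1 + δ → e i m = if i = r + 1 then U (r + 1) else 0
  e_m' : ∀ i, lo ≤ i → i ≤ r + 1 + δ → e i m' = if i = r + 1 + δ then U (r + 1) else 0
  e_U : ∀ i k, lo ≤ i → i ≤ r + 1 + δ → k₀ ≤ k → k ≤ r →
    e i (U (k + 1)) = if i = k then U k else 0
  e_U_last : ∀ i, lo ≤ i → i ≤ r + 1 + δ → e i (U k₀) = 0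

variable {hb : ℂ} {lo r δ : ℕ} {f e : ℕ → M →ₗ[ℂ] M} {W : (ℕ → ℂ) → Submodule ℂ M}
  {μ : ℕ → ℂ} {v : M}

/-- A string for the nodes `i ≥ 1` is extended by one step at both ends; the last vector is zero. -/
theorem EString.extend {D U : ℕ → M} {m m' : M} (h : EString lo 1 r δ e D U m m')
    {y : M} (h0 : e 0 y = D 1) (hy : ∀ i, 1 ≤ i → i ≤ r + 1 + δ → e i y = 0) :
    EString lo 0 r δ e (fun k => if k = 0 then y else D k) (fun k => if k = 0 then 0 else U k)
      m m' where
  e_D i k hi hi' _ hk' := by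
    rcases Nat.eq_zero_or_pos k with rfl | hk
    · rcases Nat.eq_zero_or_pos i with rfl | hi0
      · simp [h0]
      · simp [hy i hi0 hi', show i ≠ 0 by omega]
    · simp [show k ≠ 0 by omega, h.e_D i k hi hi' hk hk']
  e_D_last i hi hi' h1 h2 := by simp [h.e_D_last i hi hi' h1 h2]
  e_D_end := by simp [h.e_D_end]
  e_D_end' := by simp [h.e_D_end']
  e_m i hi hi' := by simp [h.e_m i hi hi']
  e_m' i hi hi' := by simp [h.e_m' i hi hi']
  e_U i k hi hi' _ hk' := by
    rcases Nat.eq_zero_or_pos k with rfl | hk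
    · simp [h.e_U_last i hi hi']
    · simp [show k ≠ 0 by omega, h.e_U i k hi hi' hk hk']
  e_U_last i _ _ := by simp

variable (h : Sys hb lo r δ f e W μ v) (hlo : lo ≤ 1)
include h hlo

omit hlo in
theorem e_zero_app (h0 : lo = 0) {w : List ℕ} (hw : ∀ a ∈ w, 1 ≤ a ∧ a ≤ r + 1 + δ) :
    e 0 (app f w v) = 0 := by
  rw [app_comm f _ _ fun a ha x => h.toE.ef 0 a x (by omega) (by omega) (hw a ha).2
    (by have := (hw a ha).1; omega), h.hv.e_zero 0 (by omega) (by omega), map_zero]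

theorem e_app_one (hr : 1 ≤ r) {w : List ℕ} (hw : ∀ a ∈ w, 2 ≤ a ∧ a ≤ r + 1 + δ) (hne : w ≠ [])
    {i : ℕ} (hi : lo ≤ i) (hi1 : i ≤ 1) : e i (app f w (f 1 v)) = 0 := by
  rcases Nat.eq_zero_or_pos i with rfl | hi0
  · have := e_zero_app h (by omega) (w := w ++ [1]) fun a ha => by
      rw [List.mem_append, List.mem_singleton] at ha
      rcases ha with ha | rfl
      · have := hw a ha; omega
      · omega
    simpa using this
  · obtain rfl : i = 1 := by omega
    exact h.toE.e_one_app hlo (h.toE.f_e_one_one hlo hr h.hv) hw hne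

omit hlo in
theorem mem_phiWord {m a : ℕ} (hm : m ≤ r + 1 + δ) (hm1 : 1 ≤ m)
    (ha : a ∈ phiWord (2 * r + 1 + δ) m) : 1 ≤ a ∧ a ≤ r + 1 + δ := by
  have hδ := h.toE.toF.hδ
  rcases Nat.eq_zero_or_pos r with rfl | hr
  · rcases hδ with rfl | rfl
    · obtain rfl : m = 1 := by omega
      rw [show phiWord (2 * 0 + 1 + 0) 1 = [1, 1] from rfl] at ha
      simp at ha; omega
    · obtain rfl | rfl : m = 1 ∨ m = 2 := by omega
      · rw [show phiWord (2 * 0 + 1 + 1) 1 = [1, 2] from rfl] at ha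
        simp at ha; omega
      · rw [show phiWord (2 * 0 + 1 + 1) 2 = [2, 1] from rfl] at ha
        simp at ha; omega
  · rw [phiWord_eq hr hδ hm1 hm, phiPair] at ha
    split_ifs at ha <;> simp only [List.mem_append, List.mem_cons, mem_desc, mem_dn, up, mem_asc,
      List.not_mem_nil, or_false] at ha <;> omega

/-- A vector of weight `μ - 2 ε_1` annihilated by the `e_i`, `i ≥ 2`, generates a string. -/
theorem exists_eString {a : ℕ → ℂ} {z : M} (hz : z = ∑ m ∈ Finset.Icc 1 (r + 1 + δ),
      a m • app f (phiWord (2 * r + 1 + δ) m) v)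
    (hk : 1 ≤ r → ∀ i, 2 ≤ i → i ≤ r + 1 + δ → e i z = 0) :
    ∃ D U m m', D 1 = z ∧ EString lo 1 r δ e D U m m' := by
  have hδ := h.toE.toF.hδ
  have hz0 : lo = 0 → e 0 z = 0 := fun h0 => by
    rw [hz, map_sum]
    refine Finset.sum_eq_zero fun m hm => ?_
    rw [Finset.mem_Icc] at hm
    rw [map_smul, e_zero_app h h0 fun a ha => mem_phiWord h hm.2 hm.1 ha, smul_zero]
  have hE := h.toE
  have z1 := h.hv.e_zero 1 hlo (by omega)
  rcases Nat.eq_zero_or_pos r with rfl | hr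
  · rcases hδ with rfl | rfl
    · have w1 := hE.wf 1 μ v hlo (by omega) h.hv.wt
      have a1 : e 1 (f 1 v) = qnum hb (μ 1) • v := by
        rw [hE.efd' hlo (by omega) h.hv.wt (pr_short _), z1, map_zero, zero_add]
      have a2 : e 1 (f 1 (f 1 v)) = (qnum hb (μ 1) + qnum hb (μ 1 - 1)) • f 1 v := by
        rw [hE.efd' (a := μ 1 - 1) hlo (by omega) w1 (by rw [pr_short, al_short]; simp [ep]), a1,
          map_smul, ← add_smul]
      have hz' : z = a 1 • f 1 (f 1 v) := by
        rw [hz]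
        simp only [zero_add, Nat.add_zero, Finset.Icc_self, Finset.sum_singleton]
        rfl
      have a3 : e 1 z = (a 1 * (qnum hb (μ 1) + qnum hb (μ 1 - 1))) • f 1 v := by
        rw [hz', map_smul, a2, smul_smul]
      have c0 : lo = 0 → e 0 (f 1 v) = 0 := fun h0 => e_zero_app h h0 (w := [1]) (by simp)
      refine ⟨fun _ => z, fun _ => e 1 (e 1 z), e 1 z, e 1 z, rfl,
        ⟨fun i k h1 h2 h3 h4 => by omega, fun i h1 h2 h3 _ => ?_, rfl, rfl, fun i h1 h2 => ?_,
          fun i h1 h2 => ?_, fun i k h1 h2 h3 h4 => by omega, fun i h1 h2 => ?_⟩⟩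
      · obtain rfl : i = 0 := by omega
        exact hz0 (by omega)
      · rcases Nat.eq_zero_or_pos i with rfl | hi
        · simp [a3, c0 (by omega)]
        · obtain rfl : i = 1 := by omega
          simp
      · rcases Nat.eq_zero_or_pos i with rfl | hi
        · simp [a3, c0 (by omega)]
        · obtain rfl : i = 1 := by omega
          simp
      · rw [a3, map_smul, a1, map_smul, map_smul, h.hv.e_zero i h1 h2, smul_zero, smul_zero]
    · have hμ := h.hv.μ_zero 2 le_rfl
      have z2 := h.hv.e_zero 2 (by omega) (by omega)
      have w2 := hE.wf 2 μ v (by omega) (by omega) h.hv.wt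
      have w1 := hE.wf 1 μ v (by omega) (by omega) h.hv.wt
      have p2 : ∀ μ, pr 0 1 2 μ = μ 1 + μ 2 := fun μ => pr_long (r := 0) μ
      have al2 : al 0 1 2 = ep 1 + ep 2 := al_long (r := 0)
      have c12 : ∀ x, e 1 (f 2 x) = f 2 (e 1 x) := fun x =>
        hE.ef 1 2 x (by omega) (by omega) (by omega) (by omega)
      have c21 : ∀ x, e 2 (f 1 x) = f 1 (e 2 x) := fun x =>
        hE.ef 2 1 x (by omega) (by omega) (by omega) (by omega)
      have a1 : e 1 (f 1 v) = qnum hb (μ 1) • v := by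
        rw [hE.efd' (a := μ 1) hlo (by omega) h.hv.wt (by rw [pr_of_le (by omega), hμ, sub_zero]),
          z1, map_zero, zero_add]
      have a2 : e 2 (f 2 v) = qnum hb (μ 1) • v := by
        rw [hE.efd' (a := μ 1) (by omega) (by omega) h.hv.wt (by rw [p2, hμ, add_zero]),
          z2, map_zero, zero_add]
      have b1 : e 1 (f 1 (f 2 v)) = qnum hb (μ 1) • f 2 v := by
        rw [hE.efd' (a := μ 1) (by omega) (by omega) w2
          (by rw [pr_of_le (by omega), al2]; simp [ep, hμ]), c12, z1, map_zero, map_zero, zero_add]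
      have b2 : e 2 (f 2 (f 1 v)) = qnum hb (μ 1) • f 1 v := by
        rw [hE.efd' (a := μ 1) (by omega) (by omega) w1
          (by rw [p2, al_of_le (by omega)]; simp [ep, hμ]), c21, z2, map_zero, map_zero, zero_add]
      have hI : Finset.Icc 1 2 = ({1, 2} : Finset ℕ) := rfl
      have hz' : z = (a 1 + a 2) • f 1 (f 2 v) := by
        rw [hz]
        simp only [zero_add, show 1 + 1 = 2 from rfl, hI]
        rw [Finset.sum_pair (by omega), add_smul]
        have := hE.toF.comm_end v
        simp only [zero_add, show 1 + 1 = 2 from rfl] at this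
        rw [this]
        congr 1
        rw [← this]; rfl
      have a3 : e 1 z = ((a 1 + a 2) * qnum hb (μ 1)) • f 2 v := by
        rw [hz', map_smul, b1, smul_smul]
      have a4 : e 2 z = ((a 1 + a 2) * qnum hb (μ 1)) • f 1 v := by
        rw [hz', hE.toF.comm_end v, map_smul, b2, smul_smul]
      have c01 : lo = 0 → e 0 (f 1 v) = 0 := fun h0 => e_zero_app h h0 (w := [1]) (by simp)
      have c02 : lo = 0 → e 0 (f 2 v) = 0 := fun h0 => e_zero_app h h0 (w := [2]) (by simp)
      refine ⟨fun _ => z, fun _ => e 1 (e 2 z), e 2 z, e 1 z, rfl,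
        ⟨fun i k h1 h2 h3 h4 => by omega, fun i h1 h2 h3 _ => ?_, rfl, rfl, fun i h1 h2 => ?_,
          fun i h1 h2 => ?_, fun i k h1 h2 h3 h4 => by omega, fun i h1 h2 => ?_⟩⟩
      · obtain rfl : i = 0 := by omega
        exact hz0 (by omega)
      · obtain rfl | rfl | rfl : i = 0 ∨ i = 1 ∨ i = 2 := by omega
        · simp [a4, c01 (by omega)]
        · simp
        · simp [a4, c21, z2]
      · obtain rfl | rfl | rfl : i = 0 ∨ i = 1 ∨ i = 2 := by omega
        · simp [a3, c02 (by omega)]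
        · simp [a3, c12, z1]
        · simp [a3, a4, a1, a2]
      · rw [a4, map_smul, a1, map_smul, map_smul, h.hv.e_zero i h1 h2, smul_zero, smul_zero]
  · have ht := hE.singT_one hlo hr h.hv
    have hz' : z = phiSum f r δ a (f 1 v) := by
      rw [hz, phiSum]
      refine Finset.sum_congr rfl fun m hm => ?_
      rw [Finset.mem_Icc] at hm
      rw [app_phiWord f v hr hδ hm.1 hm.2]
    obtain ⟨κ, hκ⟩ : ∃ κ : ℂ, e 1 z = κ • app f (up r δ 1) (f 1 v) :=
      ⟨_, by rw [hz', hE.e_one_phiSum hlo hr ht (hE.f_e_one_one hlo hr h.hv)]⟩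
    have low_dn : ∀ k i, 2 ≤ k → k ≤ r → lo ≤ i → i ≤ 1 → e i (app f (dn k) (f 1 v)) = 0 :=
      fun k i h1 h2 h3 h4 => e_app_one h hlo hr ((FSys.IsV.low k (by omega) h2).two_le hr)
        (by obtain ⟨j, rfl⟩ : ∃ j, k = j + 1 := ⟨k - 1, by omega⟩
            rw [dn_succ j (by omega)]; simp) h3 h4
    have low_up : ∀ k i, 1 ≤ k → k ≤ r → lo ≤ i → i ≤ 1 → e i (app f (up r δ k) (f 1 v)) = 0 :=
      fun k i h1 h2 h3 h4 => e_app_one h hlo hr ((FSys.IsV.up k h1 h2).two_le hr)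
        (by simp [up]) h3 h4
    have mid : ∀ i j, (j = r + 1 ∨ j = r + 1 + δ) → lo ≤ i → i ≤ r + 1 + δ →
        e i (κ • f j (app f (dn r) (f 1 v))) = if i = j then κ • app f (dn r) (f 1 v) else 0 := by
      intro i j hj h1 h2
      by_cases hi : 2 ≤ i
      · rw [map_smul, hE.e_mid hlo hr ht hi h2 hj, smul_ite, smul_zero]
      · have := e_app_one h hlo hr (w := j :: dn r) ((FSys.IsV.mid j hj).two_le hr) (by simp) h1
          (by omega)
        rw [app_cons] at this
        rw [if_neg (by omega), map_smul, this, smul_zero]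
    -- The string consists of `z`, the vectors `κ up_k f_1 v`, the middle vectors, and `κ dn_k f_1 v`: up to the
    -- factor `κ` of `e_1 z` it is the natural representation of `so(P)` generated by `f_1 v`, with `z` and
    -- `κ e_1 f_1 v` at its ends.
    refine ⟨fun k => if k ≤ 1 then z else κ • app f (up r δ (k - 1)) (f 1 v),
      fun k => if k ≤ 1 then κ • e 1 (f 1 v) else κ • app f (dn (k - 1)) (f 1 v),
      κ • f (r + 1) (app f (dn r) (f 1 v)), κ • f (r + 1 + δ) (app f (dn r) (f 1 v)),
      if_pos le_rfl, ⟨fun i k h1 h2 h3 h4 => ?_, fun i h1 h2 h3 h4 => ?_, ?_, ?_,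
        fun i h1 h2 => ?_, fun i h1 h2 => ?_, fun i k h1 h2 h3 h4 => ?_, fun i h1 h2 => ?_⟩⟩
    · obtain rfl | hk2 := Nat.eq_or_lt_of_le h3
      · rw [if_pos le_rfl, if_neg (show ¬ 1 + 1 ≤ 1 by omega)]
        split_ifs with hi
        · rw [hi, hκ]
        · obtain rfl | hi2 : i = 0 ∨ 2 ≤ i := by omega
          · exact hz0 (by omega)
          · exact hk hr i hi2 h2
      · rw [if_neg (show ¬ k ≤ 1 by omega), if_neg (show ¬ k + 1 ≤ 1 by omega), map_smul]
        by_cases hi : 2 ≤ i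
        · rw [hE.e_up hlo hr ht (by omega) (by omega) hi h2, smul_ite, smul_zero,
            show k - 1 + 1 = k by omega, Nat.add_sub_cancel]
        · rw [low_up _ _ (by omega) (by omega) h1 (by omega), if_neg (by omega), smul_zero]
    · rw [if_neg (by omega), Nat.add_sub_cancel, map_smul]
      by_cases hi : 2 ≤ i
      · rw [hE.e_up_self hlo hr ht hi h2, if_neg h3, if_neg h4, smul_zero]
      · rw [low_up _ _ hr le_rfl h1 (by omega), smul_zero]
    · rw [if_neg (by omega), Nat.add_sub_cancel, map_smul,
        hE.e_up_self hlo hr ht (by omega) (by omega), if_pos rfl]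
    · rw [if_neg (by omega), Nat.add_sub_cancel, map_smul,
        hE.e_up_self hlo hr ht (by omega) le_rfl, if_pos rfl]
      rcases hδ with rfl | rfl
      · simp
      · simp
    · rw [mid i _ (Or.inl rfl) h1 h2, if_neg (show ¬ r + 1 ≤ 1 by omega), Nat.add_sub_cancel]
    · rw [mid i _ (Or.inr rfl) h1 h2, if_neg (show ¬ r + 1 ≤ 1 by omega), Nat.add_sub_cancel]
    · rw [if_neg (show ¬ k + 1 ≤ 1 by omega), Nat.add_sub_cancel, map_smul]
      obtain rfl | hk2 := Nat.eq_or_lt_of_le h3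
      · rw [if_pos le_rfl]
        split_ifs with hi
        · rw [hi]; rfl
        · obtain rfl | hi2 : i = 0 ∨ 2 ≤ i := by omega
          · have := e_zero_app h (by omega) (w := [1]) (by simp; omega)
            rw [app_cons, app_nil] at this
            rw [dn_one, app_nil, this, smul_zero]
          · rw [dn_one, app_nil, ht.e_zero i hi2 h2, smul_zero]
      · rw [if_neg (show ¬ k ≤ 1 by omega)]
        by_cases hi : 2 ≤ i
        · rw [hE.e_dn hlo ht (by omega) h4 hi h2, smul_ite, smul_zero]
        · rw [low_dn _ _ (by omega) h4 h1 (by omega), if_neg (by omega), smul_zero]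
    · rw [if_pos le_rfl, hE.e_one_one hlo hr h.hv, map_smul, map_smul, h.hv.e_zero i h1 h2,
        smul_zero, smul_zero]

omit hlo in
theorem exists_wt {w : List ℕ} (hw : ∀ a ∈ w, lo ≤ a ∧ a ≤ r + 1 + δ) :
    ∃ ν, app f w v ∈ W ν := by
  induction w with
  | nil => exact ⟨μ, h.hv.wt⟩
  | cons a w ih =>
    obtain ⟨ν, hν⟩ := ih fun b hb => hw b (List.mem_cons_of_mem _ hb)
    obtain ⟨h1, h2⟩ := hw a List.mem_cons_self
    exact ⟨_, h.toE.wf a ν _ h1 h2 hν⟩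

omit hlo in
theorem e_zero_word (h0 : lo = 0) {u w : List ℕ} (hu : ∀ a ∈ u, 1 ≤ a ∧ a ≤ r + 1 + δ)
    (hw : ∀ a ∈ w, 1 ≤ a ∧ a ≤ r + 1 + δ) :
    ∃ c : ℂ, e 0 (app f (u ++ 0 :: w) v) = c • app f (u ++ w) v := by
  obtain ⟨ν, hν⟩ := exists_wt h (w := w) fun a ha => ⟨by omega, (hw a ha).2⟩
  refine ⟨qnum hb (pr r δ 0 ν), ?_⟩
  rw [app_append, app_comm f _ _ fun a ha x => h.toE.ef 0 a x (by omega) (by omega) (hu a ha).2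
    (by have := (hu a ha).1; omega), app_cons, h.toE.efd' (by omega) (by omega) hν rfl,
    e_zero_app h h0 hw, map_zero, zero_add, map_smul, app_append]

omit hlo in
/-- The operator `e_0` removes the letter `0` from `φ^i_m v`, up to a factor. -/
theorem e_zero_phiWord' (h0 : lo = 0) {x : ℕ × ℕ} (hx : x ∈ indices1 (2 * r + 1 + δ)) :
    ∃ c : ℂ, e 0 (app f (phiWord' (2 * r + 1 + δ) x.1 x.2) v) =
      c • app f (phiWord (2 * r + 1 + δ) x.2) v := by
  rw [mem_indices1 h.toE.toF.hδ] at hx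
  obtain ⟨i, m⟩ := x
  have hm := fun a => mem_phiWord h (m := m) (a := a) hx.2.1.2 hx.2.1.1
  set w := phiWord (2 * r + 1 + δ) m with hw
  simp only at hx ⊢
  rw [phiWord']
  split_ifs
  · exact e_zero_word h h0 (u := []) (by simp) hm
  · have := e_zero_word h h0 (u := w.dropLast) (w := w.drop (w.length - 1))
      (fun a ha => hm a (List.dropLast_subset _ ha)) (fun a ha => hm a (List.drop_subset _ _ ha))
    rw [List.dropLast_eq_take, List.take_append_drop] at this
    rw [List.dropLast_eq_take, List.append_assoc, List.singleton_append]
    exact this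
  · have := e_zero_word h h0 (u := w) (w := []) hm (by simp)
    rwa [List.append_nil] at this

omit hlo in
/-- A vector of weight `μ - ε_0 - ε_1` annihilated by the `e_i`, `i ≥ 1`, generates a string. -/
theorem exists_eString_one (h0 : lo = 0)
    (hcomm : 1 ≤ r → ∀ i x, 2 ≤ i → i ≤ r + 1 + δ → e i (e 0 x) = e 0 (e i x)) {A : ℕ × ℕ → ℂ}
    (hk : ∀ i, 1 ≤ i → i ≤ r + 1 + δ → e i (combOne (2 * r + 1 + δ) A f v) = 0) :
    ∃ D U m m', D 0 = combOne (2 * r + 1 + δ) A f v ∧ EString lo 0 r δ e D U m m' := by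
  have hδ := h.toE.toF.hδ
  choose! c hc using fun x hx => e_zero_phiWord' h h0 (x := x) hx
  obtain ⟨D, U, m, m', hD, hs⟩ := exists_eString h (by omega)
    (a := fun m => ∑ x ∈ indices1 (2 * r + 1 + δ) with x.2 = m, A x * c x)
    (z := e 0 (combOne (2 * r + 1 + δ) A f v)) (by
      rw [combOne, map_sum, ← Finset.sum_fiberwise_of_maps_to (g := fun x : ℕ × ℕ => x.2)
        (t := Finset.Icc 1 (r + 1 + δ)) fun x hx => by
          rw [Finset.mem_Icc]; exact ((mem_indices1 hδ).1 hx).2.1]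
      refine Finset.sum_congr rfl fun m _ => ?_
      rw [Finset.sum_smul]
      refine Finset.sum_congr rfl fun x hx => ?_
      rw [Finset.mem_filter] at hx
      rw [map_smul, hc x hx.1, hx.2, smul_smul])
    (fun hr i hi hi' => by rw [hcomm hr i _ hi hi', hk i (by omega) hi', map_zero])
  exact ⟨_, _, m, m', by simp, hs.extend hD.symm hk⟩

end

/-! ### The Serre relations on the space of words -/

section

section SerreOps

variable {I V : Type*} [AddCommGroup V] [Module ℂ V]

/-- The operators on the left hand sides of the Serre relations, for a matrix `g` of inner products
of simple roots. -/
inductive SerreOp (g : I → I → ℤ) (c : ℂ) (F : I → V →ₗ[ℂ] V) : (V →ₗ[ℂ] V) → Prop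
  | orth (i j) (h : g i j = 0) : SerreOp g c F (F i * F j - F j * F i)
  | long (i j) (h : g i j = -1) (hi : g i i = 2) :
      SerreOp g c F (F i ^ 2 * F j - c • (F i * F j * F i) + F j * F i ^ 2)
  | short (i j) (h : g i j = -1) (hi : g i i = 1) :
      SerreOp g c F (F i ^ 3 * F j - (c + 1) • (F i ^ 2 * F j * F i)
        + (c + 1) • (F i * F j * F i ^ 2) - F j * F i ^ 3)

variable {hb : ℂ} (hq : NotRoot hb) {g : I → I → ℤ} (hg : ∀ i j, g i j = g j i) [DecidableEq I]
  {E F : I → V →ₗ[ℂ] V} {W : (I → ℂ) → Submodule ℂ V}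
  (hF : ∀ h j x, x ∈ W h → F j x ∈ W fun k => h k - g k j)
  (hc : ∀ h k l x, x ∈ W h → E k (F l x) = F l (E k x) + if k = l then qnum hb (h k) • x else 0)

include hF hc in
theorem comm_pow_two (h : I → ℂ) (k l : I) {x : V} (hx : x ∈ W h) : E k ((F l ^ 2) x) =
    (F l ^ 2) (E k x) +
      if k = l then (qnum hb (h k) + qnum hb (h k - g k k)) • F l x else 0 := by
  rw [pow_two, Module.End.mul_apply, hc _ k l _ (hF _ l _ hx), hc _ k l _ hx]
  split_ifs with hkl
  · subst hkl
    simp only [map_add, map_smul, Module.End.mul_apply]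
    module
  · simp

include hF hc in
theorem comm_pow_three (h : I → ℂ) (k l : I) {x : V} (hx : x ∈ W h) : E k ((F l ^ 3) x) =
    (F l ^ 3) (E k x) + if k = l then (qnum hb (h k) + qnum hb (h k - g k k) +
      qnum hb (h k - g k k - g k k)) • (F l ^ 2) x else 0 := by
  rw [pow_succ, Module.End.mul_apply, comm_pow_two hF hc _ k l (hF _ l _ hx), hc _ k l _ hx]
  split_ifs with hkl
  · subst hkl
    simp only [map_add, map_smul, Module.End.mul_apply, pow_two]
    module
  · simp

include hq hg hF hc in
/-- The operators `E_k` commute with the operators of the Serre relations for the `F_i`. -/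
theorem SerreOp.comm {S : V →ₗ[ℂ] V} (hS : SerreOp g (qnum hb 2) F S) {h : I → ℂ} {k : I} {x : V}
    (hx : x ∈ W h) : E k (S x) = S (E k x) := by
  have hF2 : ∀ h j x, x ∈ W h → (F j ^ 2) x ∈ W fun k => h k - g k j - g k j := fun h j x hx => by
    rw [pow_two]; exact hF _ j _ (hF _ j _ hx)
  have hF3 : ∀ h j x, x ∈ W h → (F j ^ 3) x ∈ W fun k => h k - g k j - g k j - g k j :=
    fun h j x hx => by rw [pow_succ]; exact hF2 _ j _ (hF _ j _ hx)
  have hc2 := comm_pow_two hF hc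
  have hc3 := comm_pow_three hF hc
  have q := fun x => qnum_add_one_add hb x hq
  cases hS with
  | orth i j h0 =>
    have h0' := (hg j i).trans h0
    simp only [LinearMap.sub_apply, Module.End.mul_apply, map_sub]
    rw [hc _ k i _ (hF _ j _ hx), hc _ k j _ (hF _ i _ hx), hc _ k i _ hx, hc _ k j _ hx]
    by_cases hi : k = i
    · by_cases hj : k = j
      · subst hi; subst hj; simp
      · subst hi; simp [hj, h0]
    · by_cases hj : k = j
      · subst hj; simp [hi, h0']
      · simp [hi, hj]
  | long i j h1 h2 =>
    have h1' := (hg j i).trans h1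
    have hij : i ≠ j := fun hh => by subst hh; omega
    simp only [LinearMap.sub_apply, LinearMap.add_apply, LinearMap.smul_apply, Module.End.mul_apply,
      map_sub, map_add, map_smul]
    rw [hc2 _ k i (hF _ j _ hx), hc _ k i _ (hF _ j _ (hF _ i _ hx)), hc _ k j _ (hF _ i _ hx),
      hc _ k j _ (hF2 _ i _ hx), hc2 _ k i hx, hc _ k i _ hx, hc _ k j _ hx]
    by_cases hi : k = i
    · subst hi
      have q1 := q (h k)
      have q2 := q (h k - 1)
      simp only [if_true, if_neg hij, h1, h2, add_zero, map_add, map_smul]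
      push_cast
      rw [show h k - -1 = h k + 1 by ring, show h k + 1 - 2 = h k - 1 by ring,
        show h k - 2 - -1 = h k - 1 by ring]
      rw [sub_add_cancel, show h k - 1 - 1 = h k - 2 by ring] at q2
      have q1' : qnum hb (h k + 1) = qnum hb 2 * qnum hb (h k) - qnum hb (h k - 1) := by
        linear_combination q1
      have q2' : qnum hb (h k - 2) = qnum hb 2 * qnum hb (h k - 1) - qnum hb (h k) := by
        linear_combination q2
      rw [q1', q2']
      module
    · by_cases hj : k = j
      · subst hj
        have q1 := q (h k + 1)
        simp only [if_true, if_neg hi, h1', add_zero, map_add, map_smul]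
        push_cast
        rw [show h k - -1 = h k + 1 by ring, show h k + 1 - -1 = h k + 1 + 1 by ring]
        rw [add_sub_cancel_right] at q1
        have q1' : qnum hb (h k + 1 + 1) = qnum hb 2 * qnum hb (h k + 1) - qnum hb (h k) := by
          linear_combination q1
        rw [q1']
        simp only [pow_two, Module.End.mul_apply]
        module
      · simp [hi, hj]
  | short i j h1 h2 =>
    have h1' := (hg j i).trans h1
    have hij : i ≠ j := fun hh => by subst hh; omega
    simp only [LinearMap.sub_apply, LinearMap.add_apply, LinearMap.smul_apply, Module.End.mul_apply,
      map_sub, map_add, map_smul]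
    rw [hc3 _ k i (hF _ j _ hx), hc2 _ k i (hF _ j _ (hF _ i _ hx)), hc _ k j _ (hF _ i _ hx),
      hc _ k i _ hx, hc _ k i _ (hF _ j _ (hF2 _ i _ hx)), hc _ k j _ (hF2 _ i _ hx), hc2 _ k i hx,
      hc _ k j _ (hF3 _ i _ hx), hc3 _ k i hx, hc _ k j _ hx]
    by_cases hi : k = i
    · subst hi
      have q1 := q (h k)
      have q2 := q (h k - 1)
      simp only [if_true, if_neg hij, h1, h2, add_zero, map_add, map_smul]
      push_cast
      simp only [sub_neg_eq_add, sub_add_cancel, add_sub_cancel_right]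
      rw [show h k - 1 - 1 = h k - 2 by ring]
      rw [sub_add_cancel, show h k - 1 - 1 = h k - 2 by ring] at q2
      have q1' : qnum hb (h k + 1) = qnum hb 2 * qnum hb (h k) - qnum hb (h k - 1) := by
        linear_combination q1
      have q2' : qnum hb (h k - 2) = qnum hb 2 * qnum hb (h k - 1) - qnum hb (h k) := by
        linear_combination q2
      rw [q1', q2']
      simp only [pow_two, Module.End.mul_apply]
      module
    · by_cases hj : k = j
      · subst hj
        have q1 := q (h k + 1)
        have q2 := q (h k + 1 + 1)
        simp only [if_true, if_neg hi, h1', add_zero, map_add, map_smul]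
        push_cast
        simp only [sub_neg_eq_add]
        rw [add_sub_cancel_right] at q1 q2
        have q1' : qnum hb (h k + 1 + 1) = qnum hb 2 * qnum hb (h k + 1) - qnum hb (h k) := by
          linear_combination q1
        have q2' : qnum hb (h k + 1 + 1 + 1) =
            qnum hb 2 * qnum hb (h k + 1 + 1) - qnum hb (h k + 1) := by
          linear_combination q2
        rw [q2', q1']
        simp only [pow_succ, pow_zero, one_mul, Module.End.mul_apply]
        module
      · simp [hi, hj]

end SerreOps

theorem gram_comm (N : ℕ) (i j : Fin (N / 2)) : gram N i j = gram N j i :=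
  Finset.sum_congr rfl fun _ _ => mul_comm _ _

section Words

variable (N : ℕ) (hb : ℂ) (p : Fin (N / 2) → ℂ)

/-- The space with a basis of words in the negative generators. -/
abbrev WordSpace := List (Fin (N / 2)) →₀ ℂ

/-- The exponents of the eigenvalues of the `q ^ h_α` on a word applied to a vector on which these
exponents are `p`. -/
def wordWt (w : List (Fin (N / 2))) (i : Fin (N / 2)) : ℂ := p i - (w.map fun c => (gram N i c : ℂ)).sum

/-- The weight spaces of the space of words. -/
def wordW (h : Fin (N / 2) → ℂ) : Submodule ℂ (WordSpace N) :=
  Finsupp.supported ℂ ℂ {w | wordWt N p w = h}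

/-- The generator `f_i` on words. -/
def wordF (i : Fin (N / 2)) : WordSpace N →ₗ[ℂ] WordSpace N := Finsupp.lmapDomain ℂ ℂ (List.cons i)

/-- The image of a word under the generator `e_i`. -/
def wordE₀ (i : Fin (N / 2)) : List (Fin (N / 2)) → WordSpace N
  | [] => 0
  | c :: w => wordF N c (wordE₀ i w) +
      if i = c then qnum hb (wordWt N p w i) • Finsupp.single w 1 else 0

/-- The generator `e_i` on words. -/
def wordE (i : Fin (N / 2)) : WordSpace N →ₗ[ℂ] WordSpace N :=
  Finsupp.linearCombination ℂ (wordE₀ N hb p i)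

/-- The generators `q ^ h_i` (`s = 1`) and `q ^ (- h_i)` (`s = -1`) on words. -/
def wordK (s : ℂ) (i : Fin (N / 2)) : WordSpace N →ₗ[ℂ] WordSpace N :=
  Finsupp.linearCombination ℂ fun w => qpow hb (s * wordWt N p w i) • Finsupp.single w 1

variable {N hb p}

theorem wordF_single (i : Fin (N / 2)) (w : List (Fin (N / 2))) (a : ℂ) :
    wordF N i (Finsupp.single w a) = Finsupp.single (i :: w) a := by simp [wordF]

theorem single_mem_wordW (w : List (Fin (N / 2))) (a : ℂ) :
    Finsupp.single w a ∈ wordW N p (wordWt N p w) :=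
  Finsupp.single_mem_supported _ _ rfl

/-- Induction over the elements of a weight space. -/
theorem wordW_induction {h : Fin (N / 2) → ℂ} {S : Submodule ℂ (WordSpace N)}
    (hS : ∀ w, wordWt N p w = h → Finsupp.single w 1 ∈ S) {x : WordSpace N}
    (hx : x ∈ wordW N p h) : x ∈ S := by
  rw [wordW, Finsupp.supported_eq_span_single] at hx
  refine (Submodule.span_le.2 ?_) hx
  rintro _ ⟨w, hw, rfl⟩
  exact hS w hw

theorem wordSpace_induction {S : Submodule ℂ (WordSpace N)}
    (hS : ∀ w, Finsupp.single w 1 ∈ S) (x : WordSpace N) : x ∈ S := by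
  have : x ∈ Finsupp.supported ℂ ℂ (Set.univ : Set (List (Fin (N / 2)))) := by
    rw [Finsupp.supported_univ]; trivial
  rw [Finsupp.supported_eq_span_single] at this
  refine (Submodule.span_le.2 ?_) this
  rintro _ ⟨w, -, rfl⟩
  exact hS w

theorem wordWt_cons (c : Fin (N / 2)) (w : List (Fin (N / 2))) :
    wordWt N p (c :: w) = fun i => wordWt N p w i - gram N i c := by
  funext i
  simp only [wordWt, List.map_cons, List.sum_cons]
  ring

theorem wordF_mem (h : Fin (N / 2) → ℂ) (j : Fin (N / 2)) (x : WordSpace N)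
    (hx : x ∈ wordW N p h) : wordF N j x ∈ wordW N p fun k => h k - gram N k j := by
  refine wordW_induction (S := (wordW N p fun k => h k - gram N k j).comap (wordF N j))
    (fun w hw => ?_) hx
  rw [Submodule.mem_comap, wordF_single]
  have := single_mem_wordW (p := p) (j :: w) 1
  rwa [wordWt_cons, hw] at this

theorem wordK_of_mem {s : ℂ} {h : Fin (N / 2) → ℂ} {x : WordSpace N} (hx : x ∈ wordW N p h)
    (i : Fin (N / 2)) : wordK N hb p s i x = qpow hb (s * h i) • x := by
  refine wordW_induction (S := LinearMap.eqLocus (wordK N hb p s i)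
    (qpow hb (s * h i) • LinearMap.id)) (fun w hw => ?_) hx
  rw [LinearMap.mem_eqLocus, wordK, Finsupp.linearCombination_single, one_smul, hw]
  rfl

theorem wordE_single_cons (i c : Fin (N / 2)) (w : List (Fin (N / 2))) :
    wordE N hb p i (Finsupp.single (c :: w) 1) = wordF N c (wordE N hb p i (Finsupp.single w 1)) +
      if i = c then qnum hb (wordWt N p w i) • Finsupp.single w 1 else 0 := by
  simp only [wordE, Finsupp.linearCombination_single, one_smul]
  rfl

theorem wordE_single_nil (i : Fin (N / 2)) : wordE N hb p i (Finsupp.single [] 1) = 0 := by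
  simp only [wordE, Finsupp.linearCombination_single, one_smul]
  rfl

/-- The relation between `e_k` and `f_l` holds for words, by definition of the action of `e_k`. -/
theorem wordE_comm (h : Fin (N / 2) → ℂ) (k l : Fin (N / 2)) (x : WordSpace N)
    (hx : x ∈ wordW N p h) : wordE N hb p k (wordF N l x) = wordF N l (wordE N hb p k x) +
      if k = l then qnum hb (h k) • x else 0 := by
  refine wordW_induction (S := LinearMap.eqLocus (wordE N hb p k ∘ₗ wordF N l)
    (wordF N l ∘ₗ wordE N hb p k + if k = l then qnum hb (h k) • LinearMap.id else 0))
    (fun w hw => ?_) hx |>.trans ?_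
  · rw [LinearMap.mem_eqLocus, LinearMap.comp_apply, wordF_single, wordE_single_cons, hw]
    split_ifs <;> simp
  · split_ifs <;> simp

theorem wordE_mem (h : Fin (N / 2) → ℂ) (j : Fin (N / 2)) (x : WordSpace N)
    (hx : x ∈ wordW N p h) : wordE N hb p j x ∈ wordW N p fun k => h k + gram N k j := by
  refine wordW_induction (S := (wordW N p fun k => h k + gram N k j).comap (wordE N hb p j))
    (fun w hw => ?_) hx
  rw [Submodule.mem_comap]
  clear hx
  induction w generalizing h with
  | nil => rw [wordE_single_nil]; exact zero_mem _
  | cons c w ih =>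
    rw [wordE_single_cons]
    subst hw
    refine add_mem ?_ ?_
    · convert wordF_mem _ c _ (ih (wordWt N p w) rfl) using 1
      rw [wordWt_cons]
      congr 1
      funext k
      ring
    · split_ifs with hj
      · subst hj
        refine Submodule.smul_mem _ _ ?_
        convert single_mem_wordW w 1 using 1
        rw [wordWt_cons]
        congr 1
        funext k
        ring
      · exact zero_mem _

end Words

end

/-! ### The module of words, and faithfulness of the action on the canonical generator -/

section

section WordModule

variable {N : ℕ} {hb : ℂ} {p : Fin (N / 2) → ℂ} (hq : NotRoot hb)

/-- The left multiplication by a word. -/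
def wordApp (N : ℕ) (w : List (Fin (N / 2))) : WordSpace N →ₗ[ℂ] WordSpace N :=
  (w.map (wordF N)).prod

theorem wordApp_cons (c : Fin (N / 2)) (w : List (Fin (N / 2))) (x : WordSpace N) :
    wordApp N (c :: w) x = wordF N c (wordApp N w x) := by
  simp [wordApp]

include hq

/-- The Serre relations for the `e_i` hold in the space of words. -/
theorem wordE_serre {S : WordSpace N →ₗ[ℂ] WordSpace N}
    (hS : SerreOp (gram N) (qnum hb 2) (wordE N hb p) S) : S = 0 := by
  have hnil : S (Finsupp.single [] 1) = 0 := by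
    cases hS <;> simp [pow_succ, wordE_single_nil]
  -- Exchange the roles of the `e_i` and the `f_i` and change the sign of the weights: `S` is then a Serre
  -- element in the lowering operators, and commutes with the raising operators `wordF`.
  have hcons : ∀ c x h, x ∈ wordW N p h → wordF N c (S x) = S (wordF N c x) := by
    intro c x h hx
    refine SerreOp.comm (E := wordF N) (W := fun h => wordW N p (-h)) hq (gram_comm N)
      (fun h j x hx => ?_) (fun h k l x hx => ?_) hS (h := -h) (by simpa using hx)
    · convert wordE_mem (hb := hb) _ j x hx using 1
      congr 1
      funext k
      simp only [Pi.neg_apply]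
      ring
    · rw [wordE_comm _ l k x hx]
      by_cases hkl : k = l
      · subst hkl
        simp only [if_true, Pi.neg_apply, qnum_neg, neg_smul]
        module
      · rw [if_neg hkl, if_neg (Ne.symm hkl), add_zero, add_zero]
  refine Finsupp.lhom_ext fun w a => ?_
  rw [← mul_one a, ← smul_eq_mul, ← Finsupp.smul_single, map_smul, LinearMap.zero_apply]
  suffices S (Finsupp.single w 1) = 0 by rw [this, smul_zero]
  induction w with
  | nil => exact hnil
  | cons c w ih =>
    rw [← wordF_single, ← hcons c _ _ (single_mem_wordW w 1), ih, map_zero]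

omit hq

/-- The space of relations: the two-sided Serre relations for the `f_i`, and the words that end in
a generator of the Levi subalgebra. -/
def wordJ (N l : ℕ) (hb : ℂ) : Submodule ℂ (WordSpace N) :=
  Submodule.span ℂ ({y | ∃ w S u, SerreOp (gram N) (qnum hb 2) (wordF N) S ∧
      y = wordApp N w (S (Finsupp.single u 1))} ∪
    {y | ∃ w c, IsLevi N l c ∧ y = wordApp N w (Finsupp.single [c] 1)})

variable {l : ℕ}

theorem wordF_wordJ (c : Fin (N / 2)) {x : WordSpace N} (hx : x ∈ wordJ N l hb) :
    wordF N c x ∈ wordJ N l hb := by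
  refine (Submodule.span_le (p := (wordJ N l hb).comap (wordF N c))).2 ?_ hx
  rintro _ (⟨w, S, u, hS, rfl⟩ | ⟨w, d, hd, rfl⟩)
  · exact Submodule.subset_span (Or.inl ⟨c :: w, S, u, hS, (wordApp_cons _ _ _).symm⟩)
  · exact Submodule.subset_span (Or.inr ⟨c :: w, d, hd, (wordApp_cons _ _ _).symm⟩)

theorem serre_mem_wordJ {S : WordSpace N →ₗ[ℂ] WordSpace N}
    (hS : SerreOp (gram N) (qnum hb 2) (wordF N) S) (x : WordSpace N) : S x ∈ wordJ N l hb :=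
  wordSpace_induction (S := (wordJ N l hb).comap S)
    (fun u => Submodule.subset_span (Or.inl ⟨[], S, u, hS, by simp [wordApp]⟩)) x

/-- The operators of the Serre relations map weight vectors to weight vectors. -/
theorem SerreOp.mem_wordW {S : WordSpace N →ₗ[ℂ] WordSpace N}
    (hS : SerreOp (gram N) (qnum hb 2) (wordF N) S) {h : Fin (N / 2) → ℂ} {x : WordSpace N}
    (hx : x ∈ wordW N p h) : ∃ h', S x ∈ wordW N p h' := by
  have key : ∀ {h h' : Fin (N / 2) → ℂ} {x : WordSpace N}, x ∈ wordW N p h → h = h' →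
      x ∈ wordW N p h' := fun hx e => e ▸ hx
  have hF := fun h j x (hx : x ∈ wordW N p h) => wordF_mem h j x hx
  cases hS with
  | orth i j h0 =>
    refine ⟨fun k => h k - gram N k i - gram N k j, sub_mem ?_ ?_⟩
    · exact key (hF _ i _ (hF _ j _ hx)) (by funext k; ring)
    · exact key (hF _ j _ (hF _ i _ hx)) (by funext k; ring)
  | long i j h1 h2 =>
    refine ⟨fun k => h k - gram N k i - gram N k i - gram N k j,
      add_mem (sub_mem ?_ (Submodule.smul_mem _ _ ?_)) ?_⟩ <;>
      simp only [pow_two, Module.End.mul_apply]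
    · exact key (hF _ i _ (hF _ i _ (hF _ j _ hx))) (by funext k; ring)
    · exact key (hF _ i _ (hF _ j _ (hF _ i _ hx))) (by funext k; ring)
    · exact key (hF _ j _ (hF _ i _ (hF _ i _ hx))) (by funext k; ring)
  | short i j h1 h2 =>
    refine ⟨fun k => h k - gram N k i - gram N k i - gram N k i - gram N k j,
      sub_mem (add_mem (sub_mem ?_ (Submodule.smul_mem _ _ ?_)) (Submodule.smul_mem _ _ ?_)) ?_⟩ <;>
      simp only [pow_succ, pow_zero, one_mul, Module.End.mul_apply]
    · exact key (hF _ i _ (hF _ i _ (hF _ i _ (hF _ j _ hx)))) (by funext k; ring)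
    · exact key (hF _ i _ (hF _ i _ (hF _ j _ (hF _ i _ hx)))) (by funext k; ring)
    · exact key (hF _ i _ (hF _ j _ (hF _ i _ (hF _ i _ hx)))) (by funext k; ring)
    · exact key (hF _ j _ (hF _ i _ (hF _ i _ (hF _ i _ hx)))) (by funext k; ring)

theorem wordApp_mem (w : List (Fin (N / 2))) {h : Fin (N / 2) → ℂ} {x : WordSpace N}
    (hx : x ∈ wordW N p h) : ∃ h', wordApp N w x ∈ wordW N p h' := by
  induction w with
  | nil => exact ⟨h, by simpa [wordApp] using hx⟩
  | cons c w ih =>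
    obtain ⟨h', hh⟩ := ih
    exact ⟨_, by rw [wordApp_cons]; exact wordF_mem h' c _ hh⟩

theorem wordE_wordApp {x : WordSpace N} {h : Fin (N / 2) → ℂ} (hx : x ∈ wordW N p h)
    (hxJ : x ∈ wordJ N l hb) (i : Fin (N / 2)) (hi : wordE N hb p i x ∈ wordJ N l hb)
    (w : List (Fin (N / 2))) :
    wordApp N w x ∈ wordJ N l hb ∧ wordE N hb p i (wordApp N w x) ∈ wordJ N l hb := by
  induction w with
  | nil => exact ⟨by simpa [wordApp] using hxJ, by simpa [wordApp] using hi⟩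
  | cons c w ih =>
    obtain ⟨h', hh⟩ := wordApp_mem w hx
    rw [wordApp_cons]
    refine ⟨wordF_wordJ c ih.1, ?_⟩
    rw [wordE_comm h' i c _ hh]
    refine add_mem (wordF_wordJ c ih.2) ?_
    split_ifs
    · exact Submodule.smul_mem _ _ ih.1
    · exact zero_mem _

include hq in
/-- The space of relations is stable under the `e_i`: these commute with the Serre relations, and they
annihilate a word consisting of one letter of the Levi subalgebra, whose weight is zero. -/
theorem wordE_wordJ (hp : ∀ c, IsLevi N l c → p c = 0) (i : Fin (N / 2)) {x : WordSpace N}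
    (hx : x ∈ wordJ N l hb) : wordE N hb p i x ∈ wordJ N l hb := by
  refine (Submodule.span_le (p := (wordJ N l hb).comap (wordE N hb p i))).2 ?_ hx
  rintro _ (⟨w, S, u, hS, rfl⟩ | ⟨w, d, hd, rfl⟩)
  · obtain ⟨h', hh⟩ := hS.mem_wordW (p := p) (single_mem_wordW u 1)
    refine (wordE_wordApp hh (serre_mem_wordJ hS _) i ?_ w).2
    rw [SerreOp.comm hq (gram_comm N) (fun h j x hx => wordF_mem h j x hx)
      (fun h k l x hx => wordE_comm h k l x hx) hS (single_mem_wordW u 1)]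
    exact serre_mem_wordJ hS _
  · refine (wordE_wordApp (single_mem_wordW [d] 1)
      (Submodule.subset_span (Or.inr ⟨[], d, hd, by simp [wordApp]⟩)) i ?_ w).2
    rw [wordE_single_cons, wordE_single_nil, map_zero, zero_add]
    split_ifs with hid
    · subst hid
      simp [wordWt, hp i hd, qnum_zero]
    · exact zero_mem _

theorem wordK_wordJ (s : ℂ) (i : Fin (N / 2)) {x : WordSpace N}
    (hx : x ∈ wordJ N l hb) : wordK N hb p s i x ∈ wordJ N l hb := by
  refine (Submodule.span_le (p := (wordJ N l hb).comap (wordK N hb p s i))).2 ?_ hx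
  rintro y hy
  have hyJ : y ∈ wordJ N l hb := Submodule.subset_span hy
  obtain ⟨h, hh⟩ : ∃ h, y ∈ wordW N p h := by
    rcases hy with ⟨w, S, u, hS, rfl⟩ | ⟨w, d, hd, rfl⟩
    · obtain ⟨h', hh⟩ := hS.mem_wordW (p := p) (single_mem_wordW u 1)
      exact wordApp_mem w hh
    · exact wordApp_mem w (single_mem_wordW [d] 1)
  rw [SetLike.mem_coe, Submodule.mem_comap, wordK_of_mem hh]
  exact Submodule.smul_mem _ _ hyJ

/-- The empty word does not occur in the relations. -/
theorem wordJ_nil {x : WordSpace N} (hx : x ∈ wordJ N l hb) : x [] = 0 := by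
  have hF : ∀ c (y : WordSpace N), wordF N c y [] = 0 := fun c y => by
    refine Finsupp.mapDomain_of_notMem_range _ _ ?_
    simp
  refine (Submodule.span_le (p := LinearMap.ker (Finsupp.lapply (R := ℂ) ([] : List (Fin (N / 2)))
    : WordSpace N →ₗ[ℂ] ℂ))).2 ?_ hx
  rintro _ (⟨w, S, u, hS, rfl⟩ | ⟨w, d, hd, rfl⟩) <;>
    rw [SetLike.mem_coe, LinearMap.mem_ker, Finsupp.lapply_apply] <;> cases w with
    | nil => ?_
    | cons c w => rw [wordApp_cons, hF]
  · simp only [wordApp, List.map_nil, List.prod_nil, Module.End.one_apply]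
    cases hS <;> simp [hF, pow_succ]
  · simp [wordApp]

/-- The operators on words that correspond to the generators. -/
def wordGen (N : ℕ) (hb : ℂ) (p : Fin (N / 2) → ℂ) : Gen N → Module.End ℂ (WordSpace N)
  | .e i => wordE N hb p i
  | .f i => wordF N i
  | .k i => wordK N hb p 1 i
  | .kinv i => wordK N hb p (-1) i

/-- The action of the free algebra on words. -/
def wordRep (N : ℕ) (hb : ℂ) (p : Fin (N / 2) → ℂ) :
    FreeAlgebra ℂ (Gen N) →ₐ[ℂ] Module.End ℂ (WordSpace N) := FreeAlgebra.lift ℂ (wordGen N hb p)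

theorem wordRep_gen (g : Gen N) : wordRep N hb p (gen g) = wordGen N hb p g :=
  FreeAlgebra.lift_ι_apply _ _

include hq in
theorem wordRep_mem (hp : ∀ c, IsLevi N l c → p c = 0) (a : FreeAlgebra ℂ (Gen N)) :
    ∀ x ∈ wordJ N l hb, wordRep N hb p a x ∈ wordJ N l hb := by
  induction a using FreeAlgebra.induction with
  | grade0 r =>
    intro x hx
    rw [AlgHom.commutes, Module.algebraMap_end_apply]
    exact Submodule.smul_mem _ _ hx
  | grade1 g =>
    intro x hx
    have := wordRep_gen (hb := hb) (p := p) g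
    rw [gen] at this
    rw [this]
    cases g with
    | e i => exact wordE_wordJ hq hp i hx
    | f i => exact wordF_wordJ i hx
    | k i => exact wordK_wordJ 1 i hx
    | kinv i => exact wordK_wordJ (-1) i hx
  | mul a b ha hb => intro x hx; rw [map_mul]; exact ha _ (hb x hx)
  | add a b ha hb => intro x hx; rw [map_add]; exact add_mem (ha x hx) (hb x hx)

theorem word_ext {A B : Module.End ℂ (WordSpace N)}
    (h : ∀ (h : Fin (N / 2) → ℂ) x, x ∈ wordW N p h → A x = B x) : A = B := by
  refine Finsupp.lhom_ext fun w a => h _ _ (single_mem_wordW w a)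

include hq in
/-- The defining relations of the quantum group hold in the quotient of the space of words. -/
theorem wordRep_rel {a b : FreeAlgebra ℂ (Gen N)} (hr : Rel N hb a b) (x : WordSpace N) :
    wordRep N hb p a x - wordRep N hb p b x ∈ wordJ N l hb := by
  have of_eq : wordRep N hb p a = wordRep N hb p b →
      wordRep N hb p a x - wordRep N hb p b x ∈ wordJ N l hb := fun h => by
    rw [h, sub_self]; exact zero_mem _
  have qz := fun x y => qpow_add hb x y
  cases hr with
  | k_kinv i =>
    refine of_eq (word_ext (p := p) fun h x hx => ?_)
    simp only [map_mul, wordRep_gen, map_one, wordGen, Module.End.mul_apply, Module.End.one_apply]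
    rw [wordK_of_mem hx, map_smul, wordK_of_mem hx, smul_smul, ← qz]
    simp [qpow_zero]
  | kinv_k i =>
    refine of_eq (word_ext (p := p) fun h x hx => ?_)
    simp only [map_mul, wordRep_gen, map_one, wordGen, Module.End.mul_apply, Module.End.one_apply]
    rw [wordK_of_mem hx, map_smul, wordK_of_mem hx, smul_smul, ← qz]
    simp [qpow_zero]
  | k_k i j =>
    refine of_eq (word_ext (p := p) fun h x hx => ?_)
    simp only [map_mul, wordRep_gen, wordGen, Module.End.mul_apply]
    rw [wordK_of_mem hx, wordK_of_mem hx, map_smul, map_smul, wordK_of_mem hx, wordK_of_mem hx,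
      smul_comm]
  | k_e i j =>
    refine of_eq (word_ext (p := p) fun h x hx => ?_)
    simp only [map_mul, map_smul, wordRep_gen, wordGen, Module.End.mul_apply, LinearMap.smul_apply]
    rw [wordK_of_mem hx, wordK_of_mem (wordE_mem _ j _ hx), map_smul, smul_smul, ← qz]
    congr 2
    ring
  | k_f i j =>
    refine of_eq (word_ext (p := p) fun h x hx => ?_)
    simp only [map_mul, map_smul, wordRep_gen, wordGen, Module.End.mul_apply, LinearMap.smul_apply]
    rw [wordK_of_mem hx, wordK_of_mem (wordF_mem _ j _ hx), map_smul, smul_smul, ← qz]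
    congr 2
    ring
  | e_f i j =>
    refine of_eq (word_ext (p := p) fun h x hx => ?_)
    rw [apply_ite (wordRep N hb p)]
    simp only [map_mul, map_smul, map_sub, map_zero, wordRep_gen, wordGen, Module.End.mul_apply,
      LinearMap.sub_apply]
    rw [wordE_comm _ i j x hx, add_sub_cancel_left]
    split_ifs
    · rw [LinearMap.smul_apply, LinearMap.sub_apply, wordK_of_mem hx, wordK_of_mem hx, ← sub_smul,
        smul_smul, qnum, one_mul, neg_one_mul, div_eq_inv_mul]
    · rfl
  | serre_e_orth i j h0 =>
    refine of_eq (sub_eq_zero.1 ?_)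
    simpa only [map_mul, wordRep_gen, wordGen] using wordE_serre hq (p := p) (.orth i j h0)
  | serre_e_long i j h1 h2 =>
    refine of_eq ?_
    simpa only [map_mul, map_add, map_sub, map_smul, map_pow, map_zero, wordRep_gen, wordGen] using
      wordE_serre hq (p := p) (.long i j h1 h2)
  | serre_e_short i j h1 h2 =>
    refine of_eq ?_
    simpa only [map_mul, map_add, map_sub, map_smul, map_pow, map_zero, wordRep_gen, wordGen] using
      wordE_serre hq (p := p) (.short i j h1 h2)
  | serre_f_orth i j h0 =>
    rw [← LinearMap.sub_apply]
    simpa only [map_mul, wordRep_gen, wordGen] using serre_mem_wordJ (.orth i j h0) x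
  | serre_f_long i j h1 h2 =>
    simpa only [map_mul, map_add, map_sub, map_smul, map_pow, map_zero, wordRep_gen, wordGen,
      LinearMap.zero_apply, sub_zero] using serre_mem_wordJ (.long i j h1 h2) x
  | serre_f_short i j h1 h2 =>
    simpa only [map_mul, map_add, map_sub, map_smul, map_pow, map_zero, wordRep_gen, wordGen,
      LinearMap.zero_apply, sub_zero] using serre_mem_wordJ (.short i j h1 h2) x

end WordModule

section QuotientModule

variable {N : ℕ} {hb : ℂ} {p : Fin (N / 2) → ℂ} (hq : NotRoot hb) {l : ℕ}

/-- The action of the free algebra on the quotient of the space of words. -/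
def quotRep (hq : NotRoot hb) (hp : ∀ c, IsLevi N l c → p c = 0) :
    FreeAlgebra ℂ (Gen N) →ₐ[ℂ] Module.End ℂ (WordSpace N ⧸ wordJ N l hb) :=
  FreeAlgebra.lift ℂ fun g => (wordJ N l hb).mapQ (wordJ N l hb) (wordGen N hb p g)
    fun x hx => by
      have := wordRep_mem hq hp (gen g) x hx
      rwa [wordRep_gen] at this

theorem quotRep_mk (hp : ∀ c, IsLevi N l c → p c = 0) (a : FreeAlgebra ℂ (Gen N)) :
    ∀ x, quotRep hq hp a ((wordJ N l hb).mkQ x) = (wordJ N l hb).mkQ (wordRep N hb p a x) := by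
  induction a using FreeAlgebra.induction with
  | grade0 r =>
    intro x
    rw [AlgHom.commutes, AlgHom.commutes, Module.algebraMap_end_apply, Module.algebraMap_end_apply,
      map_smul]
  | grade1 g =>
    intro x
    have := wordRep_gen (hb := hb) (p := p) g
    rw [gen] at this
    rw [this, quotRep, FreeAlgebra.lift_ι_apply]
    rfl
  | mul a b ha hb => intro x; rw [map_mul, map_mul, Module.End.mul_apply, hb, ha]; rfl
  | add a b ha hb =>
    intro x
    rw [map_add, map_add, LinearMap.add_apply, ha, hb, LinearMap.add_apply, map_add]

/-- The quotient of the space of words is a module over the quantum group. -/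
def uqRep (hq : NotRoot hb) (hp : ∀ c, IsLevi N l c → p c = 0) :
    Uq N hb →ₐ[ℂ] Module.End ℂ (WordSpace N ⧸ wordJ N l hb) :=
  RingQuot.liftAlgHom ℂ ⟨quotRep hq hp, fun a b hr => by
    refine LinearMap.ext fun y => ?_
    obtain ⟨x, rfl⟩ := Submodule.mkQ_surjective _ y
    rw [quotRep_mk, quotRep_mk, ← sub_eq_zero, ← map_sub, Submodule.mkQ_apply,
      Submodule.Quotient.mk_eq_zero]
    exact wordRep_rel hq hr x⟩

theorem uqRep_gen (hp : ∀ c, IsLevi N l c → p c = 0) (g : Gen N) (x : WordSpace N) :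
    uqRep hq hp (uq N hb g) ((wordJ N l hb).mkQ x) = (wordJ N l hb).mkQ (wordGen N hb p g x) := by
  have : uqRep hq hp (uq N hb g) = quotRep hq hp (gen g) :=
    RingQuot.liftAlgHom_mkAlgHom_apply _ _ _ _
  rw [this, quotRep_mk, wordRep_gen]

/-- The element of `U_q(g_-)` that corresponds to a combination of words. -/
def wordElt (N : ℕ) (hb : ℂ) : WordSpace N →ₗ[ℂ] UqNeg N hb :=
  Finsupp.linearCombination ℂ fun w =>
    (w.map fun i => (⟨uq N hb (.f i), Algebra.subset_adjoin ⟨i, rfl⟩⟩ : UqNeg N hb)).prod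

/-- A generator of `U_q(g_-)`. -/
def fElt (N : ℕ) (hb : ℂ) (i : Fin (N / 2)) : UqNeg N hb :=
  ⟨uq N hb (.f i), Algebra.subset_adjoin ⟨i, rfl⟩⟩

theorem wordElt_single (w : List (Fin (N / 2))) (a : ℂ) :
    wordElt N hb (Finsupp.single w a) = a • (w.map (fElt N hb)).prod :=
  Finsupp.linearCombination_single _ _ _

theorem wordElt_wordF (i : Fin (N / 2)) (x : WordSpace N) :
    wordElt N hb (wordF N i x) = fElt N hb i * wordElt N hb x := by
  refine wordSpace_induction (S := LinearMap.eqLocus (wordElt N hb ∘ₗ wordF N i)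
    (LinearMap.mulLeft ℂ (fElt N hb i) ∘ₗ wordElt N hb)) (fun w => ?_) x
  rw [LinearMap.mem_eqLocus, LinearMap.comp_apply, LinearMap.comp_apply, wordF_single,
    wordElt_single, wordElt_single, LinearMap.mulLeft_apply, one_smul, one_smul, List.map_cons,
    List.prod_cons]

theorem wordElt_wordApp (w : List (Fin (N / 2))) (x : WordSpace N) :
    wordElt N hb (wordApp N w x) = (w.map (fElt N hb)).prod * wordElt N hb x := by
  induction w with
  | nil => simp [wordApp]
  | cons c w ih => rw [wordApp_cons, wordElt_wordF, ih, List.map_cons, List.prod_cons, mul_assoc]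

theorem wordElt_surjective : Function.Surjective (wordElt N hb) := by
  rintro ⟨x, hx⟩
  induction hx using Algebra.adjoin_induction with
  | mem x hx =>
    obtain ⟨i, rfl⟩ := hx
    exact ⟨Finsupp.single [i] 1, by rw [wordElt_single]; simp [fElt]⟩
  | algebraMap r =>
    exact ⟨Finsupp.single [] r, by
      rw [wordElt_single]; simp [Algebra.smul_def]⟩
  | add x y hx hy h1 h2 =>
    obtain ⟨a, ha⟩ := h1
    obtain ⟨b, hb⟩ := h2
    exact ⟨a + b, by rw [map_add, ha, hb]; rfl⟩
  | mul x y hx hy h1 h2 =>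
    obtain ⟨a, ha⟩ := h1
    obtain ⟨b, hb'⟩ := h2
    suffices ∃ c, wordElt N hb c = wordElt N hb a * wordElt N hb b by
      obtain ⟨c, hc⟩ := this
      exact ⟨c, by rw [hc, ha, hb']; rfl⟩
    refine wordSpace_induction (S := (LinearMap.range (wordElt N hb)).comap
      ((LinearMap.mulRight ℂ (wordElt N hb b)) ∘ₗ wordElt N hb)) (fun w => ?_) a
    exact ⟨wordApp N w b, by rw [wordElt_wordApp, LinearMap.comp_apply, wordElt_single]; simp⟩

/-- Defining relations hold in the quantum group. -/
theorem mkUq_rel {a b : FreeAlgebra ℂ (Gen N)} (h : Rel N hb a b) : mkUq N hb a = mkUq N hb b :=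
  RingQuot.mkAlgHom_rel ℂ h

theorem wordElt_serre {S : WordSpace N →ₗ[ℂ] WordSpace N}
    (hS : SerreOp (gram N) (qnum hb 2) (wordF N) S) (x : WordSpace N) : wordElt N hb (S x) = 0 := by
  rw [← Subtype.coe_inj]
  cases hS with
  | orth i j h0 =>
    have := mkUq_rel (hb := hb) (Rel.serre_f_orth i j h0)
    rw [← sub_eq_zero] at this
    simp only [map_mul] at this
    simp only [LinearMap.sub_apply, Module.End.mul_apply, map_sub, wordElt_wordF, ← mul_assoc,
      ← sub_mul, Subalgebra.coe_mul, Subalgebra.coe_sub, fElt, uq, this, zero_mul,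
      Subalgebra.coe_zero]
  | long i j h1 h2 =>
    have := mkUq_rel (hb := hb) (Rel.serre_f_long i j h1 h2)
    simp only [map_mul, map_add, map_sub, map_smul, map_zero, pow_two] at this
    simp only [LinearMap.sub_apply, LinearMap.add_apply, LinearMap.smul_apply, Module.End.mul_apply,
      map_sub, map_add, map_smul, wordElt_wordF, ← mul_assoc, pow_two, ← smul_mul_assoc,
      ← sub_mul, ← add_mul, Subalgebra.coe_mul, Subalgebra.coe_sub, Subalgebra.coe_add,
      Subalgebra.coe_smul, fElt, uq, Subalgebra.coe_zero]
    simp only [← mul_assoc] at this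
    simp only [smul_mul_assoc, this, zero_mul]
  | short i j h1 h2 =>
    have := mkUq_rel (hb := hb) (Rel.serre_f_short i j h1 h2)
    simp only [map_mul, map_add, map_sub, map_smul, map_zero, pow_succ, pow_zero, one_mul] at this
    simp only [LinearMap.sub_apply, LinearMap.add_apply, LinearMap.smul_apply, Module.End.mul_apply,
      map_sub, map_add, map_smul, wordElt_wordF, ← mul_assoc, pow_succ, pow_zero, one_mul,
      ← smul_mul_assoc,
      ← sub_mul, ← add_mul, Subalgebra.coe_mul, Subalgebra.coe_sub, Subalgebra.coe_add,
      Subalgebra.coe_smul, fElt, uq, Subalgebra.coe_zero]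
    simp only [← mul_assoc] at this
    simp only [smul_mul_assoc, this, zero_mul]

/-- The relations between words hold in `U_q(g_-)` modulo the ideal of the Levi subalgebra. -/
theorem wordElt_mem_leviIdeal {x : WordSpace N} (hx : x ∈ wordJ N l hb) :
    wordElt N hb x ∈ leviIdeal N l hb := by
  refine (Submodule.span_le (p := ((leviIdeal N l hb).restrictScalars ℂ).comap
    (wordElt N hb))).2 ?_ hx
  rintro _ (⟨w, S, u, hS, rfl⟩ | ⟨w, d, hd, rfl⟩) <;>
    rw [SetLike.mem_coe, Submodule.mem_comap, Submodule.restrictScalars_mem, wordElt_wordApp]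
  · rw [wordElt_serre hS, mul_zero]
    exact zero_mem _
  · rw [wordElt_single, one_smul, List.map_singleton, List.prod_singleton]
    exact Submodule.smul_mem _ _ (Submodule.subset_span ⟨d, hd, rfl⟩)

/-- The element of `U_q(g_-)` given by a combination of words acts on the empty word in the expected way. -/
theorem uqRep_wordElt (hp : ∀ c, IsLevi N l c → p c = 0) (x : WordSpace N) :
    uqRep hq hp (wordElt N hb x) ((wordJ N l hb).mkQ (Finsupp.single [] 1)) =
      (wordJ N l hb).mkQ x := by
  refine wordSpace_induction (S := LinearMap.eqLocus ((LinearMap.applyₗ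
    ((wordJ N l hb).mkQ (Finsupp.single [] 1))) ∘ₗ (uqRep hq hp).toLinearMap ∘ₗ
      (UqNeg N hb).val.toLinearMap ∘ₗ wordElt N hb) (wordJ N l hb).mkQ) (fun w => ?_) x
  rw [LinearMap.mem_eqLocus]
  change uqRep hq hp (wordElt N hb (Finsupp.single w 1)) _ = _
  induction w with
  | nil => rw [wordElt_single]; simp
  | cons c w ih =>
    rw [← wordF_single, wordElt_wordF, Subalgebra.coe_mul, map_mul, Module.End.mul_apply, ih]
    exact uqRep_gen hq hp (.f c) _

/-- The parabolic Verma module maps to the quotient of the space of words. -/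
theorem uqRep_vermaIdeal {lam : Fin (N / 2) → ℂ} (hp : ∀ c, IsLevi N l c → pairing N c lam = 0)
    {u : Uq N hb} (hu : u ∈ vermaIdeal N l hb lam) :
    uqRep hq hp u ((wordJ N l hb).mkQ (Finsupp.single [] 1)) = 0 := by
  induction hu using Submodule.span_induction with
  | mem u hu =>
    rcases hu with (⟨i, rfl⟩ | ⟨i, rfl⟩) | ⟨i, hi, rfl⟩
    · rw [uqRep_gen, wordGen, wordE_single_nil, map_zero]
    · rw [map_sub, LinearMap.sub_apply, uqRep_gen, wordGen,
        wordK_of_mem (single_mem_wordW [] 1), AlgHom.commutes, Module.algebraMap_end_apply,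
        map_smul]
      simp [wordWt]
    · rw [uqRep_gen, wordGen, wordF_single, Submodule.mkQ_apply, Submodule.Quotient.mk_eq_zero]
      exact Submodule.subset_span (Or.inr ⟨[], i, hi, by simp [wordApp]⟩)
  | zero => rw [map_zero, LinearMap.zero_apply]
  | add u v _ _ hu hv => rw [map_add, LinearMap.add_apply, hu, hv, add_zero]
  | smul a u _ hu => rw [smul_eq_mul, map_mul, Module.End.mul_apply, hu, map_zero]

theorem smul_vermaGen_eq_zero_iff {lam : Fin (N / 2) → ℂ} (x : Uq N hb) :
    x • vermaGen N l hb lam = 0 ↔ x ∈ vermaIdeal N l hb lam := by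
  rw [vermaGen, ← map_smul, Submodule.mkQ_apply, Submodule.Quotient.mk_eq_zero, smul_eq_mul,
    mul_one]

include hq in
/-- An element of `U_q(g_-)` that annihilates the canonical generator of a parabolic Verma module
belongs to the left ideal generated by the Levi subalgebra. -/
theorem mem_leviIdeal_of_smul_eq_zero {lam : Fin (N / 2) → ℂ}
    (hp : ∀ c, IsLevi N l c → pairing N c lam = 0) {x : UqNeg N hb}
    (hx : (x : Uq N hb) • vermaGen N l hb lam = 0) : x ∈ leviIdeal N l hb := by
  rw [smul_vermaGen_eq_zero_iff] at hx
  obtain ⟨c, rfl⟩ := wordElt_surjective x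
  have h1 := uqRep_vermaIdeal hq hp hx
  rw [uqRep_wordElt, Submodule.mkQ_apply, Submodule.Quotient.mk_eq_zero] at h1
  exact wordElt_mem_leviIdeal h1

include hq in
/-- A parabolic Verma module is nonzero, since the empty word survives in the quotient of the space of
words. -/
theorem vermaGen_ne_zero {lam : Fin (N / 2) → ℂ}
    (hp : ∀ c, IsLevi N l c → pairing N c lam = 0) : vermaGen N l hb lam ≠ 0 := by
  intro h0
  rw [← one_smul (Uq N hb) (vermaGen N l hb lam), smul_vermaGen_eq_zero_iff] at h0
  have h1 := uqRep_vermaIdeal hq hp h0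
  rw [map_one, Module.End.one_apply, Submodule.mkQ_apply, Submodule.Quotient.mk_eq_zero] at h1
  simpa using wordJ_nil h1

theorem smul_vermaGen_eq_zero {lam : Fin (N / 2) → ℂ} {x : UqNeg N hb}
    (hx : x ∈ leviIdeal N l hb) : (x : Uq N hb) • vermaGen N l hb lam = 0 := by
  induction hx using Submodule.span_induction with
  | mem x hx =>
    obtain ⟨i, hi, hx⟩ := hx
    rw [hx, smul_vermaGen_eq_zero_iff]
    exact Submodule.subset_span (Or.inr ⟨i, hi, rfl⟩)
  | zero => rw [Subalgebra.coe_zero, zero_smul]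
  | add x y _ _ hx hy => rw [Subalgebra.coe_add, add_smul, hx, hy, add_zero]
  | smul a x _ hx => rw [smul_eq_mul, Subalgebra.coe_mul, mul_smul, hx, smul_zero]

end QuotientModule

end

/-! ### The numbering of the simple roots by nodes -/

section

section Nodes

variable (N l : ℕ) (hb : ℂ) (M : Type) [AddCommGroup M] [Module ℂ M] [Module (Uq N hb) M]
  [IsScalarTower ℂ (Uq N hb) M]

/-- The action of the generators that belong to the simple root `α_m`, where the simple roots are
numbered by `1 - l, …`; it is zero for the other `m`. -/
def nodeAct (G : Fin (N / 2) → Gen N) (m : ℕ) : M →ₗ[ℂ] M :=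
  if h : 1 ≤ m + l ∧ m + l - 1 < N / 2 then genAct N hb M (G ⟨m + l - 1, h.2⟩) else 0

/-- The operators `f_m`. -/
abbrev nodeF : ℕ → M →ₗ[ℂ] M := nodeAct N l hb M .f

/-- The operators `e_m`. -/
abbrev nodeE : ℕ → M →ₗ[ℂ] M := nodeAct N l hb M .e

/-- The weight spaces, where the coordinates of weights are numbered by `1 - l, …`. -/
def nodeW (μ : ℕ → ℂ) : Submodule ℂ M := weightSpace N hb M fun k => μ (k + 1 - l)

end Nodes

section Roots

variable {N l r δ : ℕ} (hl : l ≤ 1) (hδ : δ = 0 ∨ δ = 1) (hN : N = 2 * l + 3 + 2 * r + δ)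
include hl hδ hN

theorem node_lt {i : ℕ} (_ : 1 - l ≤ i) (hi' : i ≤ r + 1 + δ) : i + l - 1 < N / 2 := by omega

/-- In the numbering by nodes, the inner product with a simple root is `pr`. -/
theorem pairing_node {i : ℕ} (hi : 1 - l ≤ i) (hi' : i ≤ r + 1 + δ) (μ : ℕ → ℂ) :
    pairing N ⟨i + l - 1, node_lt hl hδ hN hi hi'⟩ (fun k => μ (k + 1 - l)) = pr r δ i μ := by
  have hn : N / 2 = l + 1 + r + δ := by omega
  by_cases h1 : i ≤ r + δ
  · have e1 : i + l - 1 + 1 < N / 2 := by omega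
    rw [pr_of_le h1, pairing, Finset.sum_eq_add (⟨i + l - 1, by omega⟩ : Fin (N / 2))
      ⟨i + l - 1 + 1, e1⟩ (by simp) (fun k _ hk => ?_) (by simp) (by simp)]
    · simp only [simpleRoot, if_pos e1, if_true]
      rw [if_neg (by simp), show i + l - 1 + 1 - l = i by omega,
        show i + l - 1 + 1 + 1 - l = i + 1 by omega]
      push_cast
      ring
    · rw [simpleRoot, if_pos e1, if_neg hk.1, if_neg (fun h => hk.2 (Fin.ext h)), Int.cast_zero,
        zero_mul]
  · have e1 : ¬ (i + l - 1 + 1 < N / 2) := by omega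
    rw [pr, if_neg h1]
    rcases hδ with rfl | rfl
    · have ho : Odd N := by rw [Nat.odd_iff]; omega
      rw [if_pos rfl, pairing, Finset.sum_eq_single (⟨i + l - 1, by omega⟩ : Fin (N / 2))
        (fun k _ hk => ?_) (by simp)]
      · simp only [simpleRoot, if_neg e1, if_pos ho, if_true]
        rw [show i + l - 1 + 1 - l = i by omega]
        push_cast
        ring
      · simp only [simpleRoot, if_neg e1, if_pos ho, if_neg hk, Int.cast_zero, zero_mul]
    · have ho : ¬ Odd N := by rw [Nat.odd_iff]; omega
      rw [if_neg one_ne_zero, pairing, Finset.sum_eq_add (⟨i + l - 1 - 1, by omega⟩ : Fin (N / 2))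
        ⟨i + l - 1, by omega⟩ (by simp; omega) (fun k _ hk => ?_) (by simp) (by simp)]
      · simp only [simpleRoot, if_neg e1, if_neg ho, true_or, if_true]
        rw [if_pos (by right; omega), show i + l - 1 + 1 - l = i by omega,
          show i + l - 1 - 1 + 1 - l = i - 1 by omega]
        push_cast
        ring
      · simp only [simpleRoot, if_neg e1, if_neg ho]
        rw [if_neg, Int.cast_zero, zero_mul]
        rintro (h | h)
        · exact hk.2 h
        · exact hk.1 (Fin.ext (by simp only; omega))

theorem simpleRoot_node {i : ℕ} (hi : 1 - l ≤ i) (hi' : i ≤ r + 1 + δ) (k : Fin (N / 2)) :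
    (simpleRoot N ⟨i + l - 1, node_lt hl hδ hN hi hi'⟩ k : ℂ) = al r δ i (k + 1 - l) := by
  have := pairing_node hl hδ hN hi hi' (ep (k + 1 - l))
  rw [pairing, Finset.sum_eq_single k (fun j _ hj => ?_) (by simp)] at this
  · rw [ep, if_pos rfl, mul_one] at this
    rw [this]
    unfold pr al ep
    split_ifs <;> simp <;> grind
  · have : (j : ℕ) ≠ k := fun h => hj (Fin.ext h)
    rw [ep, if_neg (by omega), mul_zero]

theorem gram_node {i j : ℕ} (hi : 1 - l ≤ i) (hi' : i ≤ r + 1 + δ) (hj : 1 - l ≤ j)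
    (hj' : j ≤ r + 1 + δ) : (gram N ⟨i + l - 1, node_lt hl hδ hN hi hi'⟩
      ⟨j + l - 1, node_lt hl hδ hN hj hj'⟩ : ℂ) = pr r δ i (al r δ j) := by
  rw [← pairing_node hl hδ hN hi hi', gram, Int.cast_sum]
  refine Finset.sum_congr rfl fun k _ => ?_
  rw [Int.cast_mul, simpleRoot_node hl hδ hN hj hj']

end Roots

section PrAl

variable {r δ i j : ℕ}

theorem pr_al_far (hi : i < r) (hij : i + 1 < j) : pr r δ i (al r δ j) = 0 := by
  rw [pr_of_le (by omega)]
  unfold al ep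
  split_ifs <;> simp <;> grind

theorem pr_al_end : pr r 1 (r + 1) (al r 1 (r + 2)) = 0 := by
  rw [pr_of_le (by omega), al_long]
  simp [ep]

theorem pr_al_adj (h : Adj r δ i j ∨ Adj r δ j i) (hδ : δ = 0 ∨ δ = 1) :
    pr r δ i (al r δ j) = -1 := by
  unfold Adj at h
  unfold pr al ep
  rcases hδ with rfl | rfl <;> split_ifs <;> simp <;> grind

theorem pr_al_self (hδ : δ = 1 ∨ i ≤ r) (hi : i ≤ r + 1 + δ) : pr r δ i (al r δ i) = 2 := by
  unfold pr al ep
  split_ifs <;> simp <;>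
    first | omega | (rw [if_neg (by omega), if_neg (by omega)]; norm_num) | norm_num

theorem pr_al_short : pr r 0 (r + 1) (al r 0 (r + 1)) = 1 := by
  rw [pr_short, al_short]; simp [ep]

end PrAl

end

/-! ### Modules over the quantum group in the numbering by nodes -/

section

open ESys

section GenAct

variable {N : ℕ} {hb : ℂ} {M : Type} [AddCommGroup M] [Module ℂ M] [Module (Uq N hb) M]
  [IsScalarTower ℂ (Uq N hb) M]

theorem genAct_apply (g : Gen N) (x : M) : genAct N hb M g x = uq N hb g • x := rfl

theorem mem_weightSpace {μ : Fin (N / 2) → ℂ} {x : M} : x ∈ weightSpace N hb M μ ↔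
    ∀ i, genAct N hb M (.k i) x = qpow hb (pairing N i μ) • x := by
  simp [weightSpace, Submodule.mem_iInf, sub_eq_zero]

theorem pairing_add (i : Fin (N / 2)) (μ ν : Fin (N / 2) → ℂ) :
    pairing N i (μ + ν) = pairing N i μ + pairing N i ν := by
  simp [pairing, mul_add, Finset.sum_add_distrib]

theorem pairing_sub (i : Fin (N / 2)) (μ ν : Fin (N / 2) → ℂ) :
    pairing N i (μ - ν) = pairing N i μ - pairing N i ν := by
  simp [pairing, mul_sub, Finset.sum_sub_distrib]

theorem pairing_simpleRoot (i j : Fin (N / 2)) :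
    pairing N i (fun k => (simpleRoot N j k : ℂ)) = gram N i j := by
  simp [pairing, gram]

theorem genAct_f_mem {μ : Fin (N / 2) → ℂ} {x : M} (j : Fin (N / 2))
    (hx : x ∈ weightSpace N hb M μ) :
    genAct N hb M (.f j) x ∈ weightSpace N hb M (μ - fun k => (simpleRoot N j k : ℂ)) := by
  rw [mem_weightSpace] at *
  intro i
  have h := mkUq_rel (hb := hb) (Rel.k_f i j)
  rw [map_mul, map_smul, map_mul] at h
  have h2 := congrArg (· • x) h
  simp only [smul_assoc, mul_smul] at h2
  have h3 := hx i
  simp only [genAct_apply, uq] at *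
  rw [h2, h3, pairing_sub, pairing_simpleRoot, sub_eq_add_neg, qpow_add]
  have := (genAct N hb M (.f j)).map_smul (qpow hb (pairing N i μ)) x
  simp only [genAct_apply, uq] at this
  rw [this, smul_smul, mul_comm]

theorem genAct_e_mem {μ : Fin (N / 2) → ℂ} {x : M} (j : Fin (N / 2))
    (hx : x ∈ weightSpace N hb M μ) :
    genAct N hb M (.e j) x ∈ weightSpace N hb M (μ + fun k => (simpleRoot N j k : ℂ)) := by
  rw [mem_weightSpace] at *
  intro i
  have h := mkUq_rel (hb := hb) (Rel.k_e i j)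
  rw [map_mul, map_smul, map_mul] at h
  have h2 := congrArg (· • x) h
  simp only [smul_assoc, mul_smul] at h2
  have h3 := hx i
  simp only [genAct_apply, uq] at *
  rw [h2, h3, pairing_add, pairing_simpleRoot, qpow_add]
  have := (genAct N hb M (.e j)).map_smul (qpow hb (pairing N i μ)) x
  simp only [genAct_apply, uq] at this
  rw [this, smul_smul, mul_comm]

theorem genAct_e_f_ne {i j : Fin (N / 2)} (h : i ≠ j) (x : M) :
    genAct N hb M (.e i) (genAct N hb M (.f j) x) =
      genAct N hb M (.f j) (genAct N hb M (.e i) x) := by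
  have h1 := mkUq_rel (hb := hb) (Rel.e_f i j)
  rw [if_neg h, map_zero, map_sub, map_mul, map_mul] at h1
  have h2 := congrArg (· • x) h1
  simp only [sub_smul, mul_smul, zero_smul, sub_eq_zero] at h2
  exact h2

theorem genAct_kinv {μ : Fin (N / 2) → ℂ} {x : M} (hx : x ∈ weightSpace N hb M μ)
    (i : Fin (N / 2)) : genAct N hb M (.kinv i) x = qpow hb (-pairing N i μ) • x := by
  have h1 := mkUq_rel (hb := hb) (Rel.kinv_k i)
  rw [map_one, map_mul] at h1
  have h2 := congrArg (· • x) h1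
  simp only [mul_smul, one_smul] at h2
  change genAct N hb M (.kinv i) (genAct N hb M (.k i) x) = x at h2
  rw [mem_weightSpace.1 hx i, map_smul] at h2
  nth_rw 2 [← h2]
  rw [smul_smul, ← qpow_add, neg_add_cancel, qpow_zero, one_smul]

theorem genAct_e_f_self {μ : Fin (N / 2) → ℂ} {x : M} (hx : x ∈ weightSpace N hb M μ)
    (i : Fin (N / 2)) : genAct N hb M (.e i) (genAct N hb M (.f i) x) =
      genAct N hb M (.f i) (genAct N hb M (.e i) x) + qnum hb (pairing N i μ) • x := by
  have h1 := mkUq_rel (hb := hb) (Rel.e_f i i)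
  rw [if_pos rfl, map_smul, map_sub, map_sub, map_mul, map_mul] at h1
  have h2 := congrArg (· • x) h1
  simp only [sub_smul, mul_smul, smul_assoc] at h2
  rw [← sub_eq_iff_eq_add']
  refine h2.trans ?_
  change _ • (genAct N hb M (.k i) x - genAct N hb M (.kinv i) x) = _
  rw [mem_weightSpace.1 hx i, genAct_kinv hx, ← sub_smul, smul_smul, qnum, div_eq_inv_mul]

theorem genAct_serre_orth {i j : Fin (N / 2)} (h : gram N i j = 0) (x : M) :
    genAct N hb M (.f i) (genAct N hb M (.f j) x) =
      genAct N hb M (.f j) (genAct N hb M (.f i) x) := by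
  have h1 := mkUq_rel (hb := hb) (Rel.serre_f_orth i j h)
  rw [map_mul, map_mul] at h1
  have h2 := congrArg (· • x) h1
  simp only [mul_smul] at h2
  exact h2

theorem genAct_e_serre_orth {i j : Fin (N / 2)} (h : gram N i j = 0) (x : M) :
    genAct N hb M (.e i) (genAct N hb M (.e j) x) =
      genAct N hb M (.e j) (genAct N hb M (.e i) x) := by
  have h1 := mkUq_rel (hb := hb) (Rel.serre_e_orth i j h)
  rw [map_mul, map_mul] at h1
  have h2 := congrArg (· • x) h1
  simp only [mul_smul] at h2
  exact h2

theorem genAct_serre_long {i j : Fin (N / 2)} (h : gram N i j = -1) (hi : gram N i i = 2) (x : M) :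
    genAct N hb M (.f i) (genAct N hb M (.f i) (genAct N hb M (.f j) x)) =
      qnum hb 2 • genAct N hb M (.f i) (genAct N hb M (.f j) (genAct N hb M (.f i) x)) -
        genAct N hb M (.f j) (genAct N hb M (.f i) (genAct N hb M (.f i) x)) := by
  have h1 := mkUq_rel (hb := hb) (Rel.serre_f_long i j h hi)
  simp only [map_mul, map_add, map_sub, map_smul, map_zero, pow_two] at h1
  have h2 := congrArg (· • x) h1
  simp only [sub_smul, add_smul, mul_smul, smul_assoc, zero_smul] at h2
  rw [← sub_eq_zero]
  refine Eq.trans ?_ h2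
  simp only [genAct_apply, uq]
  abel

theorem genAct_serre_short {i j : Fin (N / 2)} (h : gram N i j = -1) (hi : gram N i i = 1) (x : M) :
    genAct N hb M (.f i) (genAct N hb M (.f i) (genAct N hb M (.f i) (genAct N hb M (.f j) x))) =
      (qnum hb 2 + 1) • genAct N hb M (.f i) (genAct N hb M (.f i)
        (genAct N hb M (.f j) (genAct N hb M (.f i) x))) -
      (qnum hb 2 + 1) • genAct N hb M (.f i) (genAct N hb M (.f j)
        (genAct N hb M (.f i) (genAct N hb M (.f i) x))) +
      genAct N hb M (.f j) (genAct N hb M (.f i) (genAct N hb M (.f i)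
        (genAct N hb M (.f i) x))) := by
  have h1 := mkUq_rel (hb := hb) (Rel.serre_f_short i j h hi)
  simp only [map_mul, map_add, map_sub, map_smul, map_zero, pow_succ, pow_zero, one_mul] at h1
  have h2 := congrArg (· • x) h1
  simp only [sub_smul (M := M) (R := Uq N hb), add_smul (M := M) (R := Uq N hb), mul_smul,
    smul_assoc, zero_smul] at h2
  rw [← sub_eq_zero]
  refine Eq.trans ?_ h2
  simp only [genAct_apply, uq]
  abel

end GenAct

section Instance

variable {N l r δ : ℕ} {hb : ℂ} {M : Type} [AddCommGroup M] [Module ℂ M] [Module (Uq N hb) M]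
  [IsScalarTower ℂ (Uq N hb) M] (hl : l ≤ 1) (hδ : δ = 0 ∨ δ = 1)
  (hN : N = 2 * l + 3 + 2 * r + δ)
include hl hδ hN

omit hδ hN in
theorem nodeAct_of_le (G : Fin (N / 2) → Gen N) {m : ℕ} (hm : 1 - l ≤ m) (h : m + l - 1 < N / 2) :
    nodeAct N l hb M G m = genAct N hb M (G ⟨m + l - 1, h⟩) :=
  dif_pos ⟨by omega, h⟩

omit hδ hN in
theorem nodeAct_of_lt (G : Fin (N / 2) → Gen N) {m : ℕ} (hm : m < 1 - l) :
    nodeAct N l hb M G m = 0 :=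
  dif_neg (by omega)

/-- The actions of the `f_m` satisfy the Serre relations. -/
theorem fSys (hq : NotRoot hb) : FSys (qnum hb 2) r δ (nodeF N l hb M) where
  c_ne := mod_cast hq.qnum_nat (n := 2) (by omega)
  c_ne' := hq.qnum_two_add_one
  hδ := hδ
  comm i j x hi hij hj := by
    rcases Nat.lt_or_ge i (1 - l) with h | h
    · rw [nodeF, nodeAct_of_lt hl _ h]; simp
    · rw [nodeF, nodeAct_of_le hl _ h (by omega), nodeAct_of_le hl _ (by omega) (by omega)]
      refine genAct_serre_orth ?_ x
      have := gram_node hl hδ hN h (by omega) (j := j) (by omega) hj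
      rw [pr_al_far hi hij] at this
      exact_mod_cast this
  comm_end x := by
    rcases hδ with rfl | rfl
    · rfl
    · rw [nodeF, nodeAct_of_le hl _ (by omega) (by omega),
        nodeAct_of_le hl _ (by omega) (by omega)]
      refine genAct_serre_orth ?_ x
      have := gram_node hl (Or.inr rfl) hN (i := r + 1) (j := r + 1 + 1) (by omega) (by omega)
        (by omega) (by omega)
      rw [pr_al_end] at this
      exact_mod_cast this
  serre i j x ha hi := by
    have hi' : i ≤ r + 1 + δ := by unfold Adj at ha; omega
    have hj' : j ≤ r + 1 + δ := by unfold Adj at ha; omega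
    rcases Nat.lt_or_ge i (1 - l) with h | h
    · rw [nodeF, nodeAct_of_lt hl _ h]; simp
    rcases Nat.lt_or_ge j (1 - l) with h' | h'
    · rw [nodeF, nodeAct_of_lt hl _ h']; simp
    rw [nodeF, nodeAct_of_le hl _ h (by omega), nodeAct_of_le hl _ h' (by omega)]
    refine genAct_serre_long ?_ ?_ x
    · have := gram_node hl hδ hN h hi' h' hj'
      rw [pr_al_adj ha hδ] at this
      exact_mod_cast this
    · have := gram_node hl hδ hN h hi' h hi'
      rw [pr_al_self hi hi'] at this
      exact_mod_cast this
  serre_short h0 x := by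
    subst h0
    rcases Nat.lt_or_ge r (1 - l) with h | h
    · rw [nodeF, nodeAct_of_lt hl _ h]; simp
    rw [nodeF, nodeAct_of_le hl _ h (by omega), nodeAct_of_le hl (m := r + 1) _ (by omega)
      (by omega)]
    refine genAct_serre_short ?_ ?_ x
    · have := gram_node hl hδ hN (i := r + 1) (by omega) (by omega) h (by omega)
      rw [pr_al_adj (by unfold Adj; omega) hδ] at this
      exact_mod_cast this
    · have := gram_node hl hδ hN (i := r + 1) (j := r + 1) (by omega) (by omega) (by omega)
        (by omega)
      rw [pr_al_short] at this
      exact_mod_cast this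

/-- A module over the quantum group, with the simple roots numbered by `1 - l, …, r + 1 + δ`. -/
theorem eSys (hq : NotRoot hb) :
    ESys hb (1 - l) r δ (nodeF N l hb M) (nodeE N l hb M) (nodeW N l hb M) where
  toF := fSys hl hδ hN hq
  one := hq.qnum_one
  ef i j x hi hi' hj' hij := by
    rcases Nat.lt_or_ge j (1 - l) with h | h
    · rw [nodeF, nodeAct_of_lt hl _ h]; simp
    · rw [nodeF, nodeE, nodeAct_of_le hl _ hi (by omega), nodeAct_of_le hl _ h (by omega)]
      exact genAct_e_f_ne (fun h => hij (by rw [Fin.mk.injEq] at h; omega)) x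
  efd i μ x hi hi' hx := by
    rw [nodeF, nodeE, nodeAct_of_le hl _ hi (by omega), nodeAct_of_le hl _ hi (by omega),
      genAct_e_f_self hx, pairing_node hl hδ hN hi hi']
  wf j μ x hj hj' hx := by
    rw [nodeF, nodeAct_of_le hl _ hj (by omega)]
    convert genAct_f_mem ⟨j + l - 1, by omega⟩ hx using 1
    rw [nodeW]
    congr 1
    funext k
    rw [Pi.sub_apply, Pi.sub_apply, simpleRoot_node hl hδ hN hj hj']

theorem nodeE_mem {i : ℕ} (hi : 1 - l ≤ i) (hi' : i ≤ r + 1 + δ) {μ : ℕ → ℂ} {x : M}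
    (hx : x ∈ nodeW N l hb M μ) : nodeE N l hb M i x ∈ nodeW N l hb M (μ + al r δ i) := by
  rw [nodeE, nodeAct_of_le hl _ hi (by omega)]
  convert genAct_e_mem ⟨i + l - 1, by omega⟩ hx using 1
  rw [nodeW]
  congr 1
  funext k
  rw [Pi.add_apply, Pi.add_apply, simpleRoot_node hl hδ hN hi hi']

theorem nodeE_comm (hr : 1 ≤ r) (h1 : l = 1) {i : ℕ} (hi : 2 ≤ i) (hi' : i ≤ r + 1 + δ) (x : M) :
    nodeE N l hb M i (nodeE N l hb M 0 x) = nodeE N l hb M 0 (nodeE N l hb M i x) := by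
  rw [nodeE, nodeAct_of_le hl _ (by omega) (by omega),
    nodeAct_of_le hl (m := 0) _ (by omega) (by omega)]
  refine genAct_e_serre_orth ?_ x
  rw [gram_comm]
  have := gram_node hl hδ hN (i := 0) (j := i) (by omega) (by omega) (by omega) hi'
  rw [pr_al_far hr (by omega)] at this
  exact_mod_cast this

end Instance

end

/-! ### The parabolic Verma modules -/

section

open ESys

section Verma

variable {N l r δ : ℕ} {hb : ℂ} (hl : l ≤ 1) (hδ : δ = 0 ∨ δ = 1)
  (hN : N = 2 * l + 3 + 2 * r + δ)

/-- The weight whose coordinates, numbered by `1 - l, …`, are given by `μ`. -/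
def toWt (N l : ℕ) (μ : ℕ → ℂ) : Fin (N / 2) → ℂ := fun k => μ (k + 1 - l)

theorem vermaGen_mem (lam : Fin (N / 2) → ℂ) :
    vermaGen N l hb lam ∈ weightSpace N hb (Verma N l hb lam) lam := by
  rw [mem_weightSpace]
  intro i
  rw [genAct_apply, ← sub_eq_zero, ← algebraMap_smul (Uq N hb), ← sub_smul,
    smul_vermaGen_eq_zero_iff]
  exact Submodule.subset_span (Or.inl (Or.inr ⟨i, rfl⟩))

theorem genAct_e_vermaGen (lam : Fin (N / 2) → ℂ) (i : Fin (N / 2)) :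
    genAct N hb _ (.e i) (vermaGen N l hb lam) = 0 :=
  (smul_vermaGen_eq_zero_iff _).2 (Submodule.subset_span (Or.inl (Or.inl ⟨i, rfl⟩)))

theorem genAct_f_vermaGen (lam : Fin (N / 2) → ℂ) {i : Fin (N / 2)} (hi : IsLevi N l i) :
    genAct N hb _ (.f i) (vermaGen N l hb lam) = 0 :=
  (smul_vermaGen_eq_zero_iff _).2 (Submodule.subset_span (Or.inr ⟨i, hi, rfl⟩))

theorem pairing_levi {μ : ℕ → ℂ} (_ : l ≤ 1) (hμ : ∀ i, 2 ≤ i → μ i = 0) (c : Fin (N / 2))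
    (hc : IsLevi N l c) : pairing N c (toWt N l μ) = 0 := by
  refine Finset.sum_eq_zero fun k _ => ?_
  by_cases hk : (k : ℕ) ≤ l
  · rw [hc k hk, Int.cast_zero, zero_mul]
  · rw [toWt, hμ _ (by omega), mul_zero]

include hl hδ hN

theorem isLevi_node (hr : 1 ≤ r) {i : ℕ} (hi : 2 ≤ i) (hi' : i ≤ r + 1 + δ) :
    IsLevi N l ⟨i + l - 1, node_lt hl hδ hN (by omega) hi'⟩ := by
  intro k hk
  have := simpleRoot_node hl hδ hN (i := i) (by omega) hi' k
  rw [al] at this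
  have h0 : (simpleRoot N ⟨i + l - 1, node_lt hl hδ hN (by omega) hi'⟩ k : ℂ) = 0 := by
    rw [this]
    split_ifs <;> simp [ep] <;> grind
  exact_mod_cast h0

/-- The canonical generator of a parabolic Verma module. -/
theorem vermaSys (hq : NotRoot hb) {μ : ℕ → ℂ} (hμ : ∀ i, 2 ≤ i → μ i = 0) :
    Sys hb (1 - l) r δ (nodeF N l hb (Verma N l hb (toWt N l μ))) (nodeE N l hb _)
      (nodeW N l hb _) μ (vermaGen N l hb (toWt N l μ)) where
  toE := eSys hl hδ hN hq
  hv := {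
    wt := vermaGen_mem _
    e_zero := fun i hi hi' => by
      rw [nodeE, nodeAct_of_le hl _ hi (by omega)]
      exact genAct_e_vermaGen _ _
    f_zero := fun hr i hi hi' => by
      rw [nodeF, nodeAct_of_le hl _ (by omega) (by omega)]
      exact genAct_f_vermaGen _ (isLevi_node hl hδ hN hr hi hi')
    μ_zero := hμ }
  ne := vermaGen_ne_zero hq (pairing_levi hl hμ)
  nr := hq

end Verma

section Monomials

variable {N l : ℕ} {hb : ℂ}

/-- The element `f_m` of `U_q(g_-)`, which is zero unless `α_m` is a simple root. -/
def nodeElt (N l : ℕ) (hb : ℂ) (m : ℕ) : UqNeg N hb :=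
  if h : 1 ≤ m + l ∧ m + l - 1 < N / 2 then fElt N hb ⟨m + l - 1, h.2⟩ else 0

variable {M : Type} [AddCommGroup M] [Module ℂ M] [Module (Uq N hb) M]
  [IsScalarTower ℂ (Uq N hb) M]

theorem nodeElt_smul (m : ℕ) (x : M) :
    (nodeElt N l hb m : Uq N hb) • x = nodeF N l hb M m x := by
  rw [nodeElt, nodeF, nodeAct]
  split_ifs
  · rfl
  · rw [Subalgebra.coe_zero, zero_smul, LinearMap.zero_apply]

theorem nodeElt_prod_smul (w : List ℕ) (x : M) :
    (((w.map (nodeElt N l hb)).prod : UqNeg N hb) : Uq N hb) • x = app (nodeF N l hb M) w x := by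
  induction w with
  | nil => rw [List.map_nil, List.prod_nil, Subalgebra.coe_one, one_smul]; rfl
  | cons a w ih =>
    rw [List.map_cons, List.prod_cons, Subalgebra.coe_mul, mul_smul, ih, nodeElt_smul, app_cons]

theorem negMonomial_smul {w : List ℕ} (hw : ∀ a ∈ w, 1 ≤ a + l) (x : M) :
    (negMonomial N l hb w : Uq N hb) • x = app (nodeF N l hb M) w x := by
  rw [negMonomial, ← nodeElt_prod_smul]
  congr 3
  refine List.map_congr_left fun a ha => ?_
  simp only [negGen, nodeElt, hw a ha, true_and]
  rfl

theorem coe_sum_smul {ι : Type*} (s : Finset ι) (A : ι → ℂ) (u : ι → UqNeg N hb) (x : M) :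
    ((∑ i ∈ s, A i • u i : UqNeg N hb) : Uq N hb) • x =
      ∑ i ∈ s, A i • ((u i : Uq N hb) • x) := by
  rw [AddSubmonoidClass.coe_finsetSum, Finset.sum_smul]
  refine Finset.sum_congr rfl fun i _ => ?_
  rw [Subalgebra.coe_smul, smul_assoc]

/-- The linear relations between the words in the `f_m` that are applied to the canonical generator
of a parabolic Verma module do not depend on the highest weight. -/
theorem verma_wRel (hl : l ≤ 1) (hq : NotRoot hb) {μ : ℕ → ℂ} (hμ : ∀ i, 2 ≤ i → μ i = 0)
    (lam' : Fin (N / 2) → ℂ) :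
    WRel (nodeF N l hb _) (vermaGen N l hb (toWt N l μ)) (nodeF N l hb _)
      (vermaGen N l hb lam') := by
  intro c h0
  have key : ∀ lam, Finsupp.linearCombination ℂ
      (fun w => app (nodeF N l hb _) w (vermaGen N l hb lam)) c =
      ((∑ w ∈ c.support, c w • (w.map (nodeElt N l hb)).prod : UqNeg N hb) : Uq N hb) •
        vermaGen N l hb lam := fun lam => by
    rw [coe_sum_smul, Finsupp.linearCombination_apply, Finsupp.sum]
    exact Finset.sum_congr rfl fun w _ => by rw [nodeElt_prod_smul]
  rw [key] at h0 ⊢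
  exact smul_vermaGen_eq_zero (mem_leviIdeal_of_smul_eq_zero hq (pairing_levi hl hμ) h0)

end Monomials

end

/-! ### Weight spaces are spanned by words -/

section

open ESys

/-- The sum of the simple roots along a word. -/
def wsum (r δ : ℕ) (w : List ℕ) : ℕ → ℂ := (w.map (al r δ)).sum

theorem wsum_nil (r δ : ℕ) : wsum r δ [] = 0 := rfl

theorem wsum_cons (r δ a : ℕ) (w : List ℕ) : wsum r δ (a :: w) = al r δ a + wsum r δ w := by
  simp [wsum]

theorem wsum_append (r δ : ℕ) (u w : List ℕ) : wsum r δ (u ++ w) = wsum r δ u + wsum r δ w := by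
  simp [wsum]

section Sys

variable {M : Type*} [AddCommGroup M] [Module ℂ M] {hb : ℂ} {lo r δ : ℕ} {f e : ℕ → M →ₗ[ℂ] M}
  {W : (ℕ → ℂ) → Submodule ℂ M} {μ : ℕ → ℂ} {v : M} (h : Sys hb lo r δ f e W μ v)
include h

/-- The weight of a word applied to the highest weight vector. -/
theorem app_mem_wsum {w : List ℕ} (hw : ∀ a ∈ w, lo ≤ a ∧ a ≤ r + 1 + δ) :
    app f w v ∈ W (μ - wsum r δ w) := by
  induction w with
  | nil => rw [wsum_nil, sub_zero]; exact h.hv.wt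
  | cons a w ih =>
    rw [wsum_cons, add_comm, ← sub_sub]
    exact h.toE.wf _ _ _ (hw a List.mem_cons_self).1 (hw a List.mem_cons_self).2
      (ih fun b hb => hw b (List.mem_cons_of_mem _ hb))

/-- The span of the words applied to the highest weight vector is stable under the `e_i`. -/
theorem e_app_mem_span {i : ℕ} (hi : lo ≤ i) (hi' : i ≤ r + 1 + δ) {w : List ℕ}
    (hw : ∀ a ∈ w, lo ≤ a ∧ a ≤ r + 1 + δ) : e i (app f w v) ∈
      Submodule.span ℂ {x | ∃ u, (∀ a ∈ u, lo ≤ a ∧ a ≤ r + 1 + δ) ∧ x = app f u v} := by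
  induction w with
  | nil => rw [app_nil, h.hv.e_zero i hi hi']; exact zero_mem _
  | cons a w ih =>
    have ha := hw a List.mem_cons_self
    have hw' : ∀ b ∈ w, lo ≤ b ∧ b ≤ r + 1 + δ := fun b hb => hw b (List.mem_cons_of_mem _ hb)
    have hf : f a (e i (app f w v)) ∈
        Submodule.span ℂ {x | ∃ u, (∀ a ∈ u, lo ≤ a ∧ a ≤ r + 1 + δ) ∧ x = app f u v} := by
      refine (Submodule.span_le (p := (Submodule.span ℂ _).comap (f a))).2 ?_ (ih hw')
      rintro _ ⟨u, hu, rfl⟩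
      exact Submodule.subset_span ⟨a :: u, by
        intro b hb
        rcases List.mem_cons.1 hb with rfl | hb
        exacts [ha, hu b hb], rfl⟩
    rw [app_cons]
    by_cases hia : i = a
    · subst hia
      rw [h.toE.efd i _ _ hi hi' (app_mem_wsum h hw')]
      exact add_mem hf (Submodule.smul_mem _ _ (Submodule.subset_span ⟨w, hw', rfl⟩))
    · rwa [h.toE.ef i a _ hi hi' ha.2 hia]

end Sys

/-- A vector with given eigenvalues in the span of joint eigenvectors is in the span of those of
them that have the same eigenvalues. -/
theorem mem_span_eigen {M ι κ : Type*} [AddCommGroup M] [Module ℂ M] (K : ι → M →ₗ[ℂ] M)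
    (b : κ → M) (c : κ → ι → ℂ) (hb : ∀ w i, K i (b w) = c w i • b w) (d : ι → ℂ) {y : M}
    (hy : y ∈ Submodule.span ℂ (Set.range b)) (hd : ∀ i, K i y = d i • y) :
    y ∈ Submodule.span ℂ (b '' {w | c w = d}) := by
  classical
  have hfin : ∃ s : Finset κ, y ∈ Submodule.span ℂ (b '' (↑s ∪ {w | c w = d})) := by
    obtain ⟨g, rfl⟩ := (Finsupp.mem_span_range_iff_exists_finsupp).1 hy
    refine ⟨g.support, Submodule.sum_mem _ fun w hw => Submodule.smul_mem _ _
      (Submodule.subset_span ⟨w, Or.inl hw, rfl⟩)⟩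
  obtain ⟨s, hs⟩ := hfin
  clear hy
  induction s using Finset.induction_on with
  | empty => simpa using hs
  | insert w s _ ih =>
    by_cases hw : c w = d
    · refine ih ?_
      refine Submodule.span_mono (Set.image_mono ?_) hs
      rintro x (hx | hx)
      · rcases Finset.mem_insert.1 (Finset.mem_coe.1 hx) with rfl | hx
        exacts [Or.inr hw, Or.inl hx]
      · exact Or.inr hx
    · obtain ⟨i, hi⟩ := Function.ne_iff.1 hw
      refine ih ?_
      set S := Submodule.span ℂ (b '' (↑s ∪ {w | c w = d})) with hS
      -- `K i - c w i` maps the span into the span without `b w`, and acts on `y` by a unit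
      have h1 : (K i - c w i • (LinearMap.id : M →ₗ[ℂ] M)) y ∈ S := by
        refine (Submodule.span_le (p := S.comap (K i - c w i • (LinearMap.id : M →ₗ[ℂ] M)))).2 ?_ hs
        rintro _ ⟨x, hx, rfl⟩
        have h2 : (K i - c w i • (LinearMap.id : M →ₗ[ℂ] M)) (b x) = (c x i - c w i) • b x := by
          rw [LinearMap.sub_apply, hb, LinearMap.smul_apply, LinearMap.id_apply, sub_smul]
        rw [SetLike.mem_coe, Submodule.mem_comap, h2]
        by_cases hxw : x = w
        · rw [hxw, sub_self, zero_smul]; exact zero_mem _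
        · refine Submodule.smul_mem _ _ (Submodule.subset_span ⟨x, ?_, rfl⟩)
          rcases hx with hx | hx
          · exact Or.inl ((Finset.mem_insert.1 (Finset.mem_coe.1 hx)).resolve_left hxw)
          · exact Or.inr hx
      have h3 : (K i - c w i • (LinearMap.id : M →ₗ[ℂ] M)) y = (d i - c w i) • y := by
        rw [LinearMap.sub_apply, hd, LinearMap.smul_apply, LinearMap.id_apply, sub_smul]
      rw [h3] at h1
      exact (Submodule.smul_mem_iff _ (sub_ne_zero.2 (Ne.symm hi))).1 h1

section Span

variable {N l r δ : ℕ} {hb : ℂ} (hl : l ≤ 1) (hδ : δ = 0 ∨ δ = 1)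
  (hN : N = 2 * l + 3 + 2 * r + δ) (hq : NotRoot hb) {μ : ℕ → ℂ} (hμ : ∀ i, 2 ≤ i → μ i = 0)
include hl hδ hN hq hμ

/-- A parabolic Verma module is spanned by words in the negative generators applied to the canonical
generator. -/
theorem verma_mem_span (y : Verma N l hb (toWt N l μ)) : y ∈ Submodule.span ℂ
    {x | ∃ u, (∀ a ∈ u, 1 - l ≤ a ∧ a ≤ r + 1 + δ) ∧
      x = app (nodeF N l hb _) u (vermaGen N l hb (toWt N l μ))} := by
  have h := vermaSys hl hδ hN hq hμ
  set T := Submodule.span ℂ {x | ∃ u, (∀ a ∈ u, 1 - l ≤ a ∧ a ≤ r + 1 + δ) ∧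
      x = app (nodeF N l hb _) u (vermaGen N l hb (toWt N l μ))} with hT
  have node : ∀ i : Fin (N / 2), ∃ m, ∃ _ : 1 - l ≤ m, ∃ _ : m ≤ r + 1 + δ,
      ∃ h3 : m + l - 1 < N / 2, i = ⟨m + l - 1, h3⟩ := fun i =>
    ⟨i + 1 - l, by omega, by omega, by omega, Fin.ext (by simp only; omega)⟩
  have stable : ∀ (A : Verma N l hb (toWt N l μ) →ₗ[ℂ] Verma N l hb (toWt N l μ)),
      (∀ u, (∀ a ∈ u, 1 - l ≤ a ∧ a ≤ r + 1 + δ) →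
        A (app (nodeF N l hb _) u (vermaGen N l hb (toWt N l μ))) ∈ T) → ∀ x ∈ T, A x ∈ T := by
    intro A hA x hx
    refine (Submodule.span_le (p := T.comap A)).2 ?_ hx
    rintro _ ⟨u, hu, rfl⟩
    exact hA u hu
  have gens : ∀ g : Gen N, ∀ x ∈ T, genAct N hb _ g x ∈ T := by
    intro g
    refine stable _ fun u hu => ?_
    have hw : app (nodeF N l hb _) u (vermaGen N l hb (toWt N l μ)) ∈ weightSpace N hb _ _ :=
      app_mem_wsum h hu
    have hu' : app (nodeF N l hb _) u (vermaGen N l hb (toWt N l μ)) ∈ T :=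
      Submodule.subset_span ⟨u, hu, rfl⟩
    cases g with
    | e i =>
      obtain ⟨m, h1, h2, h3, rfl⟩ := node i
      rw [← nodeAct_of_le hl Gen.e h1 h3]
      exact e_app_mem_span h h1 h2 hu
    | f i =>
      obtain ⟨m, h1, h2, h3, rfl⟩ := node i
      rw [← nodeAct_of_le hl Gen.f h1 h3, ← nodeF, ← app_cons]
      refine Submodule.subset_span ⟨m :: u, ?_, rfl⟩
      intro b hb
      rcases List.mem_cons.1 hb with rfl | hb
      exacts [⟨h1, h2⟩, hu b hb]
    | k i => rw [mem_weightSpace.1 hw i]; exact Submodule.smul_mem _ _ hu'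
    | kinv i => rw [genAct_kinv hw i]; exact Submodule.smul_mem _ _ hu'
  have main : ∀ a : FreeAlgebra ℂ (Gen N), ∀ x ∈ T, mkUq N hb a • x ∈ T := by
    intro a
    induction a using FreeAlgebra.induction with
    | grade0 c => intro x hx; rw [AlgHom.commutes, algebraMap_smul]; exact Submodule.smul_mem _ _ hx
    | grade1 g => exact gens g
    | mul a b ha hb => intro x hx; rw [map_mul, mul_smul]; exact ha _ (hb x hx)
    | add a b ha hb => intro x hx; rw [map_add, add_smul]; exact add_mem (ha x hx) (hb x hx)
  obtain ⟨u, rfl⟩ := Submodule.mkQ_surjective _ y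
  obtain ⟨a, rfl⟩ := RingQuot.mkAlgHom_surjective ℂ (Rel N hb) u
  have := main a (vermaGen N l hb (toWt N l μ)) (Submodule.subset_span ⟨[], by simp, rfl⟩)
  rwa [vermaGen, ← map_smul, smul_eq_mul, mul_one] at this

/-- The vectors of a weight space of a parabolic Verma module are combinations of words whose
weights have the same inner products with the simple roots. -/
theorem verma_mem_span_wt {u₀ : List ℕ} {y : Verma N l hb (toWt N l μ)}
    (hy : y ∈ nodeW N l hb _ (μ - wsum r δ u₀)) :
    y ∈ Submodule.span ℂ {x | ∃ u, (∀ a ∈ u, 1 - l ≤ a ∧ a ≤ r + 1 + δ) ∧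
      (∀ i : Fin (N / 2), qpow hb (pairing N i (toWt N l (μ - wsum r δ u))) =
        qpow hb (pairing N i (toWt N l (μ - wsum r δ u₀)))) ∧
      x = app (nodeF N l hb _) u (vermaGen N l hb (toWt N l μ))} := by
  have h := vermaSys hl hδ hN hq hμ
  have := mem_span_eigen (fun i : Fin (N / 2) => genAct N hb (Verma N l hb (toWt N l μ)) (.k i))
    (fun u : {u : List ℕ // ∀ a ∈ u, 1 - l ≤ a ∧ a ≤ r + 1 + δ} =>
      app (nodeF N l hb _) u.1 (vermaGen N l hb (toWt N l μ)))
    (fun u i => qpow hb (pairing N i (toWt N l (μ - wsum r δ u))))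
    (fun u i => mem_weightSpace.1 (app_mem_wsum h u.2) i)
    (fun i => qpow hb (pairing N i (toWt N l (μ - wsum r δ u₀)))) (y := y) (by
      refine Submodule.span_mono ?_ (verma_mem_span hl hδ hN hq hμ y)
      rintro _ ⟨u, hu, rfl⟩
      exact ⟨⟨u, hu⟩, rfl⟩) fun i => mem_weightSpace.1 hy i
  refine Submodule.span_mono ?_ this
  rintro _ ⟨u, hu, rfl⟩
  exact ⟨u, u.2, fun i => congrFun hu i, rfl⟩

end Span

end

/-! ### Words of equal weight are permutations of each other -/

section

open ESys

section Perm

variable {lo r δ : ℕ} {w u : List ℕ}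

theorem wsum_apply_zero : wsum r δ w 0 = w.count 0 := by
  induction w with
  | nil => simp [wsum_nil]
  | cons a w ih =>
    rw [wsum_cons, Pi.add_apply, ih, List.count_cons, Nat.cast_add, add_comm]
    congr 1
    unfold al ep
    split_ifs <;> simp <;> grind

theorem wsum_apply_succ {k : ℕ} (hk : k + 1 ≤ r) (hw : ∀ a ∈ w, a ≤ r + 1 + δ) :
    wsum r δ w (k + 1) = w.count (k + 1) - w.count k := by
  induction w with
  | nil => simp [wsum_nil]
  | cons a w ih =>
    have ha := hw a List.mem_cons_self
    rw [wsum_cons, Pi.add_apply, ih fun b hb => hw b (List.mem_cons_of_mem _ hb), List.count_cons,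
      List.count_cons]
    unfold al ep
    split_ifs <;> simp_all <;> grind

theorem wsum_apply_short (hw : ∀ a ∈ w, a ≤ r + 1) :
    wsum r 0 w (r + 1) = w.count (r + 1) - w.count r := by
  induction w with
  | nil => simp [wsum_nil]
  | cons a w ih =>
    have ha := hw a List.mem_cons_self
    rw [wsum_cons, Pi.add_apply, ih fun b hb => hw b (List.mem_cons_of_mem _ hb), List.count_cons,
      List.count_cons]
    unfold al ep
    split_ifs <;> simp_all <;> grind

theorem wsum_apply_long (hw : ∀ a ∈ w, a ≤ r + 2) :
    wsum r 1 w (r + 1) = w.count (r + 1) - w.count r + w.count (r + 2) := by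
  induction w with
  | nil => simp [wsum_nil]
  | cons a w ih =>
    have ha := hw a List.mem_cons_self
    rw [wsum_cons, Pi.add_apply, ih fun b hb => hw b (List.mem_cons_of_mem _ hb), List.count_cons,
      List.count_cons, List.count_cons]
    unfold al ep
    split_ifs <;> simp_all <;> grind

theorem wsum_apply_last (hw : ∀ a ∈ w, a ≤ r + 2) :
    wsum r 1 w (r + 2) = w.count (r + 2) - w.count (r + 1) := by
  induction w with
  | nil => simp [wsum_nil]
  | cons a w ih =>
    have ha := hw a List.mem_cons_self
    rw [wsum_cons, Pi.add_apply, ih fun b hb => hw b (List.mem_cons_of_mem _ hb), List.count_cons,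
      List.count_cons]
    unfold al ep
    split_ifs <;> simp_all <;> grind

/-- The inner products with the simple roots determine a weight. -/
theorem eq_of_pr_eq (hδ : δ = 0 ∨ δ = 1) {γ γ' : ℕ → ℂ} (h : ∀ i, lo ≤ i → i ≤ r + 1 + δ →
    pr r δ i γ = pr r δ i γ') (hlo : lo ≤ 1) {k : ℕ} (hk : lo ≤ k) (hk' : k ≤ r + 1 + δ) :
    γ k = γ' k := by
  have last : γ (r + 1 + δ) = γ' (r + 1 + δ) ∧ γ (r + 1) = γ' (r + 1) := by
    rcases hδ with rfl | rfl
    · have := h (r + 1) (by omega) le_rfl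
      rw [pr_short, pr_short] at this
      exact ⟨this, this⟩
    · have h1 := h (r + 1) (by omega) (by omega)
      have h2 := h (r + 2) (by omega) le_rfl
      rw [pr_of_le le_rfl, pr_of_le le_rfl] at h1
      rw [pr_long, pr_long] at h2
      constructor
      · linear_combination (1 / 2) * h2 - (1 / 2) * h1
      · linear_combination (1 / 2) * h2 + (1 / 2) * h1
  rcases Nat.lt_or_ge (r + 1) k with h1 | h1
  · obtain rfl : k = r + 1 + δ := by omega
    exact last.1
  · induction h1 using Nat.decreasingInduction with
    | self => exact last.2
    | of_succ j hj ih =>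
      have h1 := h j hk (by omega)
      rw [pr_of_le (by omega), pr_of_le (by omega), ih (by omega) (by omega)] at h1
      exact sub_left_injective h1

/-- Words in the simple roots with equal sums are permutations of each other. -/
theorem perm_of_wsum (hδ : δ = 0 ∨ δ = 1) (hlo : lo ≤ 1) (hw : ∀ a ∈ w, lo ≤ a ∧ a ≤ r + 1 + δ)
    (hu : ∀ a ∈ u, lo ≤ a ∧ a ≤ r + 1 + δ) (h : ∀ i, lo ≤ i → i ≤ r + 1 + δ →
      pr r δ i (wsum r δ w) = pr r δ i (wsum r δ u)) : w.Perm u := by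
  have hg := fun k => eq_of_pr_eq hδ h hlo (k := k)
  have hw' : ∀ a ∈ w, a ≤ r + 1 + δ := fun a ha => (hw a ha).2
  have hu' : ∀ a ∈ u, a ≤ r + 1 + δ := fun a ha => (hu a ha).2
  have hlow : ∀ a, a < lo → w.count a = u.count a := fun a ha => by
    rw [List.count_eq_zero_of_not_mem fun h => absurd (hw a h).1 (by omega),
      List.count_eq_zero_of_not_mem fun h => absurd (hu a h).1 (by omega)]
  have h0 : w.count 0 = u.count 0 := by
    rcases Nat.eq_zero_or_pos lo with h0 | h0
    · have := hg 0 (by omega) (by omega)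
      rw [wsum_apply_zero, wsum_apply_zero] at this
      exact_mod_cast this
    · exact hlow 0 h0
  have hmid : ∀ k, k ≤ r → w.count k = u.count k := by
    intro k hk
    induction k with
    | zero => exact h0
    | succ k ih =>
      have := hg (k + 1) (by omega) (by omega)
      rw [wsum_apply_succ hk hw', wsum_apply_succ hk hu', ih (by omega)] at this
      exact_mod_cast sub_left_injective this
  rw [List.perm_iff_count]
  intro a
  rcases Nat.lt_or_ge r a with ha | ha
  swap
  · exact hmid a ha
  rcases Nat.lt_or_ge (r + 1 + δ) a with ha' | ha'
  · rw [List.count_eq_zero_of_not_mem fun h => absurd (hw' a h) (by omega),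
      List.count_eq_zero_of_not_mem fun h => absurd (hu' a h) (by omega)]
  have hr := hmid r le_rfl
  rcases hδ with rfl | rfl
  · obtain rfl : a = r + 1 := by omega
    have := hg (r + 1) (by omega) (by omega)
    rw [wsum_apply_short hw', wsum_apply_short hu', hr] at this
    exact_mod_cast sub_left_injective this
  · have h1 := hg (r + 1) (by omega) (by omega)
    have h2 := hg (r + 2) (by omega) (by omega)
    rw [wsum_apply_long hw', wsum_apply_long hu', hr] at h1
    rw [wsum_apply_last hw', wsum_apply_last hu'] at h2
    have e1 : (w.count (r + 1) : ℂ) = u.count (r + 1) := by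
      linear_combination (1 / 2) * h1 - (1 / 2) * h2
    have e2 : (w.count (r + 2) : ℂ) = u.count (r + 2) := by
      linear_combination (1 / 2) * h1 + (1 / 2) * h2
    obtain rfl | rfl : a = r + 1 ∨ a = r + 2 := by omega
    · exact_mod_cast e1
    · exact_mod_cast e2

/-- The inner product of a simple root with a sum of simple roots is an integer. -/
theorem exists_int_pr (i : ℕ) (w : List ℕ) : ∃ n : ℤ, pr r δ i (wsum r δ w) = n := by
  have key : ∀ k, ∃ n : ℤ, wsum r δ w k = n := by
    intro k
    induction w with
    | nil => exact ⟨0, by simp [wsum_nil]⟩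
    | cons a w ih =>
      obtain ⟨n, hn⟩ := ih
      have : ∃ m : ℤ, al r δ a k = m := by
        unfold al ep
        split_ifs
        · exact ⟨(if k = a then 1 else 0) - (if k = a + 1 then 1 else 0), by push_cast; rfl⟩
        · exact ⟨if k = a then 1 else 0, by push_cast; rfl⟩
        · exact ⟨(if k = a - 1 then 1 else 0) + (if k = a then 1 else 0), by push_cast; rfl⟩
      obtain ⟨m, hm⟩ := this
      exact ⟨m + n, by rw [wsum_cons, Pi.add_apply, hm, hn]; push_cast; rfl⟩
  choose n hn using key
  unfold pr
  rw [hn, hn, hn]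
  split_ifs
  · exact ⟨n i - n (i + 1), by push_cast; rfl⟩
  · exact ⟨n i, rfl⟩
  · exact ⟨n (i - 1) + n i, by push_cast; rfl⟩

end Perm

theorem pr_sub (r δ i : ℕ) (μ ν : ℕ → ℂ) : pr r δ i (μ - ν) = pr r δ i μ - pr r δ i ν := by
  unfold pr
  split_ifs <;> simp only [Pi.sub_apply] <;> ring

section Span

variable {N l r δ : ℕ} {hb : ℂ} (hl : l ≤ 1) (hδ : δ = 0 ∨ δ = 1)
  (hN : N = 2 * l + 3 + 2 * r + δ) (hq : NotRoot hb) {μ : ℕ → ℂ} (hμ : ∀ i, 2 ≤ i → μ i = 0)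
include hl hδ hN hq hμ

/-- A weight space of a parabolic Verma module is spanned by the permutations of a word. -/
theorem verma_mem_span_perm {u₀ : List ℕ} (h0 : ∀ a ∈ u₀, 1 - l ≤ a ∧ a ≤ r + 1 + δ)
    {y : Verma N l hb (toWt N l μ)} (hy : y ∈ nodeW N l hb _ (μ - wsum r δ u₀)) :
    y ∈ Submodule.span ℂ {x | ∃ u, u.Perm u₀ ∧
      x = app (nodeF N l hb _) u (vermaGen N l hb (toWt N l μ))} := by
  refine Submodule.span_mono ?_ (verma_mem_span_wt hl hδ hN hq hμ hy)
  rintro _ ⟨u, hu, hwt, rfl⟩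
  refine ⟨u, perm_of_wsum hδ (by omega) hu h0 fun i hi hi' => ?_, rfl⟩
  have := hwt ⟨i + l - 1, by omega⟩
  unfold toWt at this
  rw [pairing_node hl hδ hN hi hi', pairing_node hl hδ hN hi hi', pr_sub, pr_sub] at this
  obtain ⟨n, hn⟩ := exists_int_pr (r := r) (δ := δ) i u
  obtain ⟨m, hm⟩ := exists_int_pr (r := r) (δ := δ) i u₀
  rw [hn, hm] at this ⊢
  -- The weights are given through powers of `q`; the two pairings differ by an integer, and `q` is not a root
  -- of unity.
  have h2 : qpow hb ((m - n : ℤ) : ℂ) = 1 := by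
    have h3 : pr r δ i μ - n = (pr r δ i μ - m) + ((m - n : ℤ) : ℂ) := by push_cast; ring
    rw [h3, qpow_add] at this
    exact mul_left_cancel₀ (qpow_ne hb _) (this.trans (mul_one _).symm)
  have h3 := hq.int h2
  have : n = m := by omega
  rw [this]

end Span

end

/-! ### Words of the weight of `φ_m` and `φ^i_m` -/

section

open ESys

section Words

variable {r δ : ℕ}

theorem wsum_perm {w u : List ℕ} (h : w.Perm u) : wsum r δ w = wsum r δ u := (h.map _).sum_eq

theorem wsum_desc {k : ℕ} (hk : k ≤ r + δ) : wsum r δ (desc k) = ep 1 - ep (k + 1) := by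
  induction k with
  | zero => rw [desc_zero, wsum_nil, sub_self]
  | succ k ih =>
    rw [desc_succ, wsum_cons, ih (by omega), al_of_le hk]
    abel

theorem wsum_dn {k : ℕ} (hk1 : 1 ≤ k) (hk : k ≤ r + δ) : wsum r δ (dn k) = ep 2 - ep (k + 1) := by
  have := wsum_desc hk
  rw [desc_eq_dn k hk1, wsum_append, wsum_cons, wsum_nil, al_of_le (by omega)] at this
  rw [eq_sub_of_add_eq this]
  abel

theorem al_end (hδ : δ = 0 ∨ δ = 1) : al r δ (r + 1) + al r δ (r + 1 + δ) = 2 • ep (r + 1) := by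
  rcases hδ with rfl | rfl
  · rw [add_zero, al_short]; abel
  · rw [al_of_le (by omega), show r + 1 + 1 = r + 2 from rfl, al_long]; abel

theorem wsum_up (hδ : δ = 0 ∨ δ = 1) {m : ℕ} (hr : 1 ≤ r) (hm : m ≤ r) :
    wsum r δ (up r δ m) = ep (m + 1) + ep 2 := by
  induction hm using Nat.decreasingInduction with
  | self =>
    rw [up_self, wsum_cons, wsum_cons, wsum_dn hr (by omega), ← add_assoc, al_end hδ]
    abel
  | of_succ j hj ih =>
    rw [up_cons _ _ _ hj, wsum_cons, ih, al_of_le (by omega)]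
    abel

theorem wsum_phiWord (hδ : δ = 0 ∨ δ = 1) {m : ℕ} (hm : 1 ≤ m) (hm' : m ≤ r + 1 + δ) :
    wsum r δ (phiWord (2 * r + 1 + δ) m) = 2 • ep 1 := by
  rcases Nat.eq_zero_or_pos r with rfl | hr
  · rcases hδ with rfl | rfl
    · obtain rfl : m = 1 := by omega
      rw [show phiWord (2 * 0 + 1 + 0) 1 = [1, 1] from rfl, wsum_cons, wsum_cons, wsum_nil, add_zero]
      exact al_end (r := 0) (Or.inl rfl)
    · have h1 := al_end (r := 0) (δ := 1) (Or.inr rfl)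
      obtain rfl | rfl : m = 1 ∨ m = 2 := by omega
      · rw [show phiWord (2 * 0 + 1 + 1) 1 = [1, 2] from rfl, wsum_cons, wsum_cons, wsum_nil,
          add_zero]
        exact h1
      · rw [show phiWord (2 * 0 + 1 + 1) 2 = [2, 1] from rfl, wsum_cons, wsum_cons, wsum_nil,
          add_zero, add_comm]
        exact h1
  · have h1 := al_end (r := r) hδ
    have h2 : wsum r δ [1] = ep 1 - ep 2 := by rw [wsum_cons, wsum_nil, al_of_le (by omega), add_zero]
    rw [phiWord_eq hr hδ hm hm', phiPair]
    split_ifs with c1 c2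
    · rw [wsum_append, wsum_append, wsum_desc (by omega), wsum_up hδ hr c1, h2]
      abel
    · rw [wsum_append, wsum_append, wsum_cons, wsum_cons, wsum_desc (by omega),
        wsum_dn hr (by omega), h2, eq_sub_of_add_eq h1]
      abel
    · rw [wsum_append, wsum_append, wsum_cons, wsum_cons, wsum_desc (by omega),
        wsum_dn hr (by omega), h2, eq_sub_of_add_eq h1]
      abel

theorem phiWord'_perm (P i m : ℕ) : (phiWord' P i m).Perm (0 :: phiWord P m) := by
  rw [phiWord']
  split_ifs
  · exact List.Perm.refl _
  · have := List.take_append_drop ((phiWord P m).length - 1) (phiWord P m)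
    rw [← List.dropLast_eq_take] at this
    rw [List.append_assoc]
    refine List.perm_middle.trans ?_
    exact List.Perm.of_eq (congrArg (0 :: ·) this)
  · exact List.perm_append_singleton _ _

theorem wsum_phiWord' (hδ : δ = 0 ∨ δ = 1) (i : ℕ) {m : ℕ} (hm : 1 ≤ m) (hm' : m ≤ r + 1 + δ) :
    wsum r δ (phiWord' (2 * r + 1 + δ) i m) = ep 0 + ep 1 := by
  rw [wsum_perm (phiWord'_perm _ _ _), wsum_cons, wsum_phiWord hδ hm hm', al_of_le (by omega)]
  abel

theorem le_of_mem_phiWord (hδ : δ = 0 ∨ δ = 1) {m a : ℕ} (hm1 : 1 ≤ m) (hm : m ≤ r + 1 + δ)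
    (ha : a ∈ phiWord (2 * r + 1 + δ) m) : 1 ≤ a ∧ a ≤ r + 1 + δ := by
  rcases Nat.eq_zero_or_pos r with rfl | hr
  · rcases hδ with rfl | rfl
    · obtain rfl : m = 1 := by omega
      have : a ∈ [1, 1] := ha
      simp at this; omega
    · obtain rfl | rfl : m = 1 ∨ m = 2 := by omega
      · have : a ∈ [1, 2] := ha
        simp at this; omega
      · have : a ∈ [2, 1] := ha
        simp at this; omega
  · rw [phiWord_eq hr hδ hm1 hm, phiPair] at ha
    split_ifs at ha <;> simp [mem_desc, mem_dn, up, mem_asc] at ha <;> omega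

theorem le_of_mem_phiWord' (hδ : δ = 0 ∨ δ = 1) {i m a : ℕ} (hm1 : 1 ≤ m) (hm : m ≤ r + 1 + δ)
    (ha : a ∈ phiWord' (2 * r + 1 + δ) i m) : a ≤ r + 1 + δ := by
  rw [(phiWord'_perm _ _ _).mem_iff, List.mem_cons] at ha
  rcases ha with rfl | ha
  · omega
  · exact (le_of_mem_phiWord hδ hm1 hm ha).2

theorem phiWord'_two_eq (hr : 1 ≤ r) (hδ : δ = 0 ∨ δ = 1) {m : ℕ} (hm : 1 ≤ m)
    (hm' : m ≤ r + 1 + δ) : phiWord' (2 * r + 1 + δ) 2 m =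
      (phiPair r δ m).1 ++ ((phiPair r δ m).2 ++ [0, 1]) := by
  rw [phiWord', if_neg (by omega), if_pos rfl, phiWord_eq hr hδ hm hm', ← List.append_assoc,
    List.dropLast_concat, List.length_append, List.length_singleton, Nat.add_sub_cancel,
    List.drop_left]
  simp

theorem count_phiWord (hr : 1 ≤ r) (hδ : δ = 0 ∨ δ = 1) (a : ℕ) :
    (phiWord (2 * r + 1 + δ) 1).count a = (if 1 ≤ a ∧ a ≤ r then 2 else 0) +
      (if r + 1 = a then 1 else 0) + (if r + 1 + δ = a then 1 else 0) := by
  rw [phiWord_eq hr hδ le_rfl (by omega), phiPair, if_pos hr, List.count_append, List.count_append,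
    count_up, count_desc, List.count_singleton]
  simp only [beq_iff_eq]
  split_ifs <;> omega

theorem length_phiWord (hr : 1 ≤ r) (hδ : δ = 0 ∨ δ = 1) :
    (phiWord (2 * r + 1 + δ) 1).length = 2 * r + 2 := by
  rw [phiWord_eq hr hδ le_rfl (by omega), phiPair, if_pos hr]
  simp [up, length_desc, length_asc, length_dn]
  omega

theorem exists_phiPair (hr : 1 ≤ r) (hδ : δ = 0 ∨ δ = 1) {z w : List ℕ} (hp : FSys.IsPair r δ z w)
    (hl : 2 * r + 1 ≤ z.length + w.length) : z.length + w.length = 2 * r + 1 ∧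
      ∃ m, 1 ≤ m ∧ m ≤ r + 1 + δ ∧ phiPair r δ m = (z, w) := by
  rcases FSys.IsPair.of_length hr hp hl with ⟨m, h1, h2, rfl, rfl⟩ | ⟨rfl, rfl⟩ | ⟨rfl, rfl⟩
  · refine ⟨?_, m, h1, by omega, if_pos h2⟩
    simp [up, length_desc, length_asc, length_dn]
    omega
  · refine ⟨?_, r + 1, by omega, by omega, by rw [phiPair, if_neg (by omega), if_pos rfl]⟩
    simp [length_desc, length_dn]
    omega
  · refine ⟨?_, r + 1 + δ, by omega, by omega, ?_⟩
    · simp [length_desc, length_dn]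
      omega
    · rw [phiPair, if_neg (by omega)]
      split_ifs with h
      · obtain rfl : δ = 0 := by omega
        rfl
      · rfl

/-- A normal form of the weight `- 2 ε_1` is one of the words `φ_m`. -/
theorem nf_phiWord (hr : 1 ≤ r) (hδ : δ = 0 ∨ δ = 1) {u : List ℕ} (hu : FSys.NF r δ u)
    (hp : u.Perm (phiWord (2 * r + 1 + δ) 1)) :
    ∃ m, 1 ≤ m ∧ m ≤ r + 1 + δ ∧ u = phiWord (2 * r + 1 + δ) m := by
  have c0 := hp.count_eq 0
  have c1 := hp.count_eq 1
  have hl := hp.length_eq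
  rw [count_phiWord hr hδ] at c0 c1
  rw [length_phiWord hr hδ] at hl
  rw [if_neg (by omega), if_neg (by omega), if_neg (by omega)] at c0
  rw [if_pos (by omega), if_neg (by omega), if_neg (by omega)] at c1
  cases hu with
  | nil => simp at c1
  | zero => simp at c1
  | one w b hw hb =>
    have h1 : w.count 1 = 0 := List.count_eq_zero_of_not_mem fun h =>
      absurd (FSys.IsV.two_le hr hw 1 h).1 (by omega)
    rw [List.count_append, h1, (FSys.IsB.cases_count hb).1] at c1
    omega
  | two z w b hw hb =>
    rcases (FSys.IsB.cases_count hb).2 with rfl | h1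
    · simp at hl
      obtain ⟨-, m, h1, h2, h3⟩ := exists_phiPair hr hδ hw (by omega)
      exact ⟨m, h1, h2, by rw [phiWord_eq hr hδ h1 h2, h3]⟩
    · rw [List.count_append, List.count_append, h1] at c0
      omega
  | two0 z w hw => simp at c0

/-- A normal form of the weight `- ε_0 - ε_1` is one of the words `φ^i_m`. -/
theorem nf_phiWord' (hr : 1 ≤ r) (hδ : δ = 0 ∨ δ = 1) {u : List ℕ} (hu : FSys.NF r δ u)
    (hp : u.Perm (phiWord' (2 * r + 1 + δ) 1 1)) :
    ∃ i m, 1 ≤ i ∧ i ≤ 3 ∧ 1 ≤ m ∧ m ≤ r + 1 + δ ∧ u = phiWord' (2 * r + 1 + δ) i m := by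
  have hp := hp.trans (phiWord'_perm _ _ _)
  have c1 := hp.count_eq 1
  have hl := hp.length_eq
  rw [List.count_cons, count_phiWord hr hδ] at c1
  rw [List.length_cons, length_phiWord hr hδ] at hl
  rw [if_pos (by omega), if_neg (by omega), if_neg (by omega), if_neg (by simp)] at c1
  cases hu with
  | nil => simp at c1
  | zero => simp at c1
  | one w b hw hb =>
    have h1 : w.count 1 = 0 := List.count_eq_zero_of_not_mem fun h =>
      absurd (FSys.IsV.two_le hr hw 1 h).1 (by omega)
    rw [List.count_append, h1, (FSys.IsB.cases_count hb).1] at c1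
    omega
  | two z w b hw hb =>
    rw [List.length_append, List.length_append] at hl
    have hb' : b.length ≤ 2 := by rcases hb with rfl | rfl | rfl <;> simp
    obtain ⟨h0, m, h1, h2, h3⟩ := exists_phiPair hr hδ hw (by omega)
    rcases hb with rfl | rfl | rfl
    · simp only [List.length_singleton] at hl
      omega
    · exact ⟨2, m, by omega, by omega, h1, h2, by rw [phiWord'_two_eq hr hδ h1 h2, h3]⟩
    · refine ⟨3, m, by omega, by omega, h1, h2, ?_⟩
      rw [phiWord', if_neg (by omega), if_neg (by omega), phiWord_eq hr hδ h1 h2, h3]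
      simp
  | two0 z w hw =>
    simp at hl
    obtain ⟨-, m, h1, h2, h3⟩ := exists_phiPair hr hδ hw (by omega)
    exact ⟨1, m, le_rfl, by omega, h1, h2, by
      rw [phiWord', if_pos rfl, phiWord_eq hr hδ h1 h2, h3]⟩

end Words

section Span

variable {M : Type*} [AddCommGroup M] [Module ℂ M] {hb : ℂ} {lo r δ : ℕ} {f e : ℕ → M →ₗ[ℂ] M}
  {W : (ℕ → ℂ) → Submodule ℂ M} {μ : ℕ → ℂ} {v : M} (h : Sys hb lo r δ f e W μ v)
include h

/-- For even `P`, the last two of the `φ_m u` coincide. -/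
theorem phiV_last (hr : 1 ≤ r) (h1 : δ = 1) {u : M}
    (hu : ∀ i, 2 ≤ i → i ≤ r + 1 + δ → f i u = 0) :
    phiV f r δ (r + 2) (f 1 u) = phiV f r δ (r + 1) (f 1 u) := by
  have := h.toE.toF.fin_eq hr h1 (h.toE.toF.vType_f_one hr hu) (h.toE.toF.exch_one hr hu)
  rw [phiV, phiV, phiPair, phiPair, if_neg (by omega), if_neg (by omega), if_neg (by omega),
    if_pos rfl]
  exact this

/-- Every permutation of the word `φ_1` is a combination of the `φ_m`, when applied to `v`. -/
theorem app_mem_span_phiWord {w : List ℕ} (hp : w.Perm (phiWord (2 * r + 1 + δ) 1)) :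
    app f w v ∈ Submodule.span ℂ {x | ∃ m ∈ indices0 (2 * r + 1 + δ),
      x = app f (phiWord (2 * r + 1 + δ) m) v} := by
  have hδ := h.toE.toF.hδ
  rw [indices0_eq hδ]
  rcases Nat.eq_zero_or_pos r with rfl | hr
  · suffices hs : app f w v = app f (phiWord (2 * 0 + 1 + δ) 1) v from
      Submodule.subset_span ⟨1, by simp, hs⟩
    rcases hδ with rfl | rfl
    · have hp : w.Perm (List.replicate 2 1) := hp
      rw [List.perm_replicate.1 hp]
      rfl
    · have hp : w.Perm [1, 2] := hp
      obtain ⟨a, b, rfl⟩ := List.length_eq_two.1 hp.length_eq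
      have h1 := hp.count_eq 1
      have h2 := hp.count_eq 2
      simp [List.count_cons] at h1 h2
      by_cases ha : a = 1
      · subst ha
        have hb : b = 2 := by split_ifs at h1 h2 <;> omega
        subst hb
        rfl
      · have hb : b = 1 ∧ a = 2 := by split_ifs at h1 h2 <;> omega
        obtain ⟨rfl, rfl⟩ := hb
        exact (h.toE.toF.comm_end v).symm
  · have h1 := h.toE.toF.app_mem_span_nf hr (h.hv.f_zero hr) w
      (fun a ha => (le_of_mem_phiWord hδ le_rfl (by omega) (hp.mem_iff.1 ha)).2) fun a => by
        rw [hp.count_eq, count_phiWord hr hδ, FSys.maxCount]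
        split_ifs <;> omega
    refine (Submodule.span_le.2 ?_) h1
    rintro _ ⟨u, hu, hup, rfl⟩
    obtain ⟨m, m1, m2, rfl⟩ := nf_phiWord hr hδ hu (hup.trans hp)
    rcases Nat.lt_or_ge (r + 1) m with h2 | h2
    · have h1 : δ = 1 := by omega
      obtain rfl : m = r + 2 := by omega
      rw [app_phiWord f v hr hδ (by omega) (by omega), phiV_last h hr h1 (h.hv.f_zero hr),
        ← app_phiWord f v hr hδ (by omega) (by omega)]
      exact Submodule.subset_span ⟨r + 1, by simp, rfl⟩
    · exact Submodule.subset_span ⟨m, by rw [Finset.mem_Icc]; omega, rfl⟩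

/-- Every permutation of the word `φ^1_1` is a combination of the `φ^i_m`, when applied to `v`. -/
theorem app_mem_span_phiWord' {w : List ℕ} (hp : w.Perm (phiWord' (2 * r + 1 + δ) 1 1)) :
    app f w v ∈ Submodule.span ℂ {y | ∃ x ∈ indices1 (2 * r + 1 + δ),
      y = app f (phiWord' (2 * r + 1 + δ) x.1 x.2) v} := by
  have hδ := h.toE.toF.hδ
  rcases Nat.eq_zero_or_pos r with rfl | hr
  · have key : ∀ x ∈ indices1 (2 * 0 + 1 + δ), ∀ u,
        app f u v = app f (phiWord' (2 * 0 + 1 + δ) x.1 x.2) v →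
        app f u v ∈ Submodule.span ℂ {y | ∃ x ∈ indices1 (2 * 0 + 1 + δ),
          y = app f (phiWord' (2 * 0 + 1 + δ) x.1 x.2) v} := fun x hx u hu =>
      Submodule.subset_span ⟨x, hx, hu⟩
    have mem : ∀ i m, 1 ≤ i → i ≤ 3 → 1 ≤ m → m ≤ 0 + 1 + δ → (m ≤ 0 + 1 ∨ i = 2) →
        (i, m) ∈ indices1 (2 * 0 + 1 + δ) := fun i m h1 h2 h3 h4 h5 =>
      (mem_indices1 hδ).2 ⟨⟨h1, h2⟩, ⟨h3, h4⟩, h5⟩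
    rcases hδ with rfl | rfl
    · have hp : w.Perm [0, 1, 1] := hp
      obtain ⟨a, b, c, rfl⟩ := List.length_eq_three.1 hp.length_eq
      have h0 := hp.count_eq 0
      have h1 := hp.count_eq 1
      simp [List.count_cons] at h0 h1
      have : (a = 0 ∧ b = 1 ∧ c = 1) ∨ (a = 1 ∧ b = 0 ∧ c = 1) ∨ (a = 1 ∧ b = 1 ∧ c = 0) := by
        split_ifs at h0 h1 <;> omega
      rcases this with ⟨rfl, rfl, rfl⟩ | ⟨rfl, rfl, rfl⟩ | ⟨rfl, rfl, rfl⟩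
      · exact key (1, 1) (mem _ _ (by omega) (by omega) (by omega) (by omega) (by omega)) _ rfl
      · exact key (2, 1) (mem _ _ (by omega) (by omega) (by omega) (by omega) (by omega)) _ rfl
      · exact key (3, 1) (mem _ _ (by omega) (by omega) (by omega) (by omega) (by omega)) _ rfl
    · have hp : w.Perm [0, 1, 2] := hp
      have hc := h.toE.toF.comm_end
      obtain ⟨a, b, c, rfl⟩ := List.length_eq_three.1 hp.length_eq
      have h0 := hp.count_eq 0
      have h1 := hp.count_eq 1
      have h2 := hp.count_eq 2
      simp [List.count_cons] at h0 h1 h2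
      have : (a = 0 ∧ b = 1 ∧ c = 2) ∨ (a = 0 ∧ b = 2 ∧ c = 1) ∨ (a = 1 ∧ b = 0 ∧ c = 2) ∨
          (a = 2 ∧ b = 0 ∧ c = 1) ∨ (a = 1 ∧ b = 2 ∧ c = 0) ∨ (a = 2 ∧ b = 1 ∧ c = 0) := by
        split_ifs at h0 h1 h2 <;> omega
      rcases this with ⟨rfl, rfl, rfl⟩ | ⟨rfl, rfl, rfl⟩ | ⟨rfl, rfl, rfl⟩ | ⟨rfl, rfl, rfl⟩ |
        ⟨rfl, rfl, rfl⟩ | ⟨rfl, rfl, rfl⟩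
      · exact key (1, 1) (mem _ _ (by omega) (by omega) (by omega) (by omega) (by omega)) _ rfl
      · exact key (1, 1) (mem _ _ (by omega) (by omega) (by omega) (by omega) (by omega)) _
          (congrArg (f 0) (hc v).symm)
      · exact key (2, 1) (mem _ _ (by omega) (by omega) (by omega) (by omega) (by omega)) _ rfl
      · exact key (2, 2) (mem _ _ (by omega) (by omega) (by omega) (by omega) (by omega)) _ rfl
      · exact key (3, 1) (mem _ _ (by omega) (by omega) (by omega) (by omega) (by omega)) _ rfl
      · exact key (3, 1) (mem _ _ (by omega) (by omega) (by omega) (by omega) (by omega)) _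
          (hc (f 0 v)).symm
  · have h1 := h.toE.toF.app_mem_span_nf hr (h.hv.f_zero hr) w
      (fun a ha => le_of_mem_phiWord' hδ le_rfl (by omega) (hp.mem_iff.1 ha)) fun a => by
        rw [hp.count_eq, (phiWord'_perm _ _ _).count_eq, List.count_cons, count_phiWord hr hδ,
          FSys.maxCount]
        simp only [beq_iff_eq]
        split_ifs <;> omega
    refine (Submodule.span_le.2 ?_) h1
    rintro _ ⟨u, hu, hup, rfl⟩
    obtain ⟨i, m, i1, i2, m1, m2, rfl⟩ := nf_phiWord' hr hδ hu (hup.trans hp)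
    by_cases h2 : m ≤ r + 1 ∨ i = 2
    · exact Submodule.subset_span ⟨(i, m), (mem_indices1 hδ).2 ⟨⟨i1, i2⟩, ⟨m1, m2⟩, h2⟩, rfl⟩
    · push Not at h2
      have h1 : δ = 1 := by omega
      obtain rfl : m = r + 2 := by omega
      refine Submodule.subset_span ⟨(i, r + 1), (mem_indices1 hδ).2 ⟨⟨i1, i2⟩, by simp⟩, ?_⟩
      obtain rfl | rfl : i = 1 ∨ i = 3 := by omega
      · rw [app_phiWord_one f v hr hδ (by omega) (by omega), phiV_last h hr h1 (h.hv.f_zero hr)]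
        exact (app_phiWord_one f v hr hδ (by omega) (by omega)).symm
      · rw [app_phiWord_three f v hr hδ (by omega) (by omega), phiV_last h hr h1 fun i hi hi' => by
          rw [← h.toE.toF.comm 0 i v hr (by omega) hi', h.hv.f_zero hr i hi hi', map_zero]]
        exact (app_phiWord_three f v hr hδ (by omega) (by omega)).symm

end Span

end

/-! ### The coefficients of a singular vector -/

section

open ESys

section Tensor

variable {N : ℕ} {hb : ℂ} {M : Type} [AddCommGroup M] [Module ℂ M]

/-- The coefficient at the `j`-th basis vector. -/
def coord (N : ℕ) (M : Type) [AddCommGroup M] [Module ℂ M] (j : Fin N) :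
    (Fin N → ℂ) ⊗[ℂ] M →ₗ[ℂ] M :=
  TensorProduct.lid ℂ M ∘ₗ TensorProduct.map (LinearMap.proj j) LinearMap.id

theorem coord_tmul (j : Fin N) (x : Fin N → ℂ) (y : M) : coord N M j (x ⊗ₜ y) = x j • y := rfl

theorem sum_coord (t : (Fin N → ℂ) ⊗[ℂ] M) :
    ∑ j, (Pi.single j (1 : ℂ) : Fin N → ℂ) ⊗ₜ[ℂ] coord N M j t = t := by
  induction t using TensorProduct.induction_on with
  | zero => simp
  | tmul x y =>
    simp only [coord_tmul, ← TensorProduct.smul_tmul, ← TensorProduct.sum_tmul]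
    congr 1
    funext k
    simp [Finset.sum_apply, Pi.single_apply]
  | add s t hs ht =>
    simp only [map_add, TensorProduct.tmul_add, Finset.sum_add_distrib, hs, ht]

theorem tensor_ext {s t : (Fin N → ℂ) ⊗[ℂ] M} (h : ∀ j, coord N M j s = coord N M j t) : s = t := by
  rw [← sum_coord s, ← sum_coord t]
  exact Finset.sum_congr rfl fun j _ => by rw [h j]

theorem coord_sum (Y : Fin N → M) (a : Fin N) :
    coord N M a (∑ j, (Pi.single j (1 : ℂ) : Fin N → ℂ) ⊗ₜ[ℂ] Y j) = Y a := by
  simp only [map_sum, coord_tmul]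
  rw [Finset.sum_eq_single a (fun j _ hj => by rw [Pi.single_eq_of_ne (Ne.symm hj), zero_smul])
    (by simp), Pi.single_eq_same, one_smul]

theorem coord_map (A : Matrix (Fin N) (Fin N) ℂ) (B : M →ₗ[ℂ] M) (Y : Fin N → M) (a : Fin N) :
    coord N M a (TensorProduct.map (Matrix.toLin' A) B
      (∑ j, (Pi.single j (1 : ℂ) : Fin N → ℂ) ⊗ₜ[ℂ] Y j)) = ∑ j, A a j • B (Y j) := by
  simp only [map_sum, TensorProduct.map_tmul, coord_tmul]
  refine Finset.sum_congr rfl fun j _ => ?_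
  rw [Matrix.toLin'_apply, Matrix.mulVec_single_one]
  rfl

variable [Module (Uq N hb) M] [IsScalarTower ℂ (Uq N hb) M]

theorem coord_tensorK (Y : Fin N → M) (i : Fin (N / 2)) (a : Fin N) :
    coord N M a (tensorK N hb M i (∑ j, (Pi.single j (1 : ℂ) : Fin N → ℂ) ⊗ₜ[ℂ] Y j)) =
      qpow hb (pairing N i (natWeight N a)) • genAct N hb M (.k i) (Y a) := by
  rw [tensorK, coord_map, Finset.sum_eq_single a (fun j _ hj => by
    rw [natK, Matrix.diagonal_apply_ne _ (Ne.symm hj), zero_smul]) (by simp), natK,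
    Matrix.diagonal_apply_eq]

theorem coord_tensorE (Y : Fin N → M) (i : Fin (N / 2)) (a : Fin N) :
    coord N M a (tensorE N hb M i (∑ j, (Pi.single j (1 : ℂ) : Fin N → ℂ) ⊗ₜ[ℂ] Y j)) =
      (if a = natTarget N i then Y (natSource N i) else 0)
        - (if a = (natSource N i).rev then Y (natTarget N i).rev else 0)
        + qpow hb (pairing N i (natWeight N a)) • genAct N hb M (.e i) (Y a) := by
  rw [tensorE, LinearMap.add_apply, map_add, coord_map, coord_map]
  congr 1
  · have h1 : ∀ (s t : Fin N), ∑ j, (Matrix.single s t 1 : Matrix (Fin N) (Fin N) ℂ) a j • Y j =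
        if a = s then Y t else 0 := fun s t => by
      simp [Matrix.single_apply, ite_and, eq_comm]
    simp only [natE, Matrix.sub_apply, sub_smul, LinearMap.id_apply, Finset.sum_sub_distrib, h1]
  · rw [Finset.sum_eq_single a (fun j _ hj => by
      rw [natK, Matrix.diagonal_apply_ne _ (Ne.symm hj), zero_smul]) (by simp), natK,
      Matrix.diagonal_apply_eq]

/-- The coefficients of a singular vector. -/
theorem isSingular_sum_iff {ν : Fin (N / 2) → ℂ} {Y : Fin N → M} :
    IsSingular N hb M ν (∑ j, (Pi.single j (1 : ℂ) : Fin N → ℂ) ⊗ₜ[ℂ] Y j) ↔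
      (∃ j, Y j ≠ 0) ∧ (∀ a, Y a ∈ weightSpace N hb M (ν - natWeight N a)) ∧
      ∀ i a, (if a = natTarget N i then Y (natSource N i) else 0)
        - (if a = (natSource N i).rev then Y (natTarget N i).rev else 0)
        + qpow hb (pairing N i (natWeight N a)) • genAct N hb M (.e i) (Y a) = 0 := by
  refine and_congr ?_ (and_congr ?_ ?_)
  · rw [← not_iff_not]
    push Not
    constructor
    · intro h j
      rw [← coord_sum Y j, h, map_zero]
    · intro h
      simp [h]
  · simp only [mem_weightSpace, pairing_sub]
    rw [forall_comm]
    refine forall_congr' fun i => ?_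
    rw [← (show (∀ a, coord N M a (tensorK N hb M i (∑ j, Pi.single j (1 : ℂ) ⊗ₜ[ℂ] Y j)) =
      coord N M a (qpow hb (pairing N i ν) • ∑ j, Pi.single j (1 : ℂ) ⊗ₜ[ℂ] Y j)) ↔ _ from
        ⟨tensor_ext, fun h a => by rw [h]⟩)]
    refine forall_congr' fun a => ?_
    rw [coord_tensorK, map_smul, coord_sum, sub_eq_add_neg, qpow_add, qpow_neg, mul_comm,
      ← smul_smul, eq_inv_smul_iff₀ (qpow_ne _ _)]
  · refine forall_congr' fun i => ?_
    rw [← (show (∀ a, coord N M a (tensorE N hb M i (∑ j, Pi.single j (1 : ℂ) ⊗ₜ[ℂ] Y j)) =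
      coord N M a 0) ↔ _ from ⟨tensor_ext, fun h a => by rw [h]⟩)]
    refine forall_congr' fun a => ?_
    rw [coord_tensorE, map_zero]

end Tensor

section Necessary

variable {N : ℕ} {hb : ℂ} {M : Type} [AddCommGroup M] [Module ℂ M] [Module (Uq N hb) M]
  [IsScalarTower ℂ (Uq N hb) M]

/-- All coefficients of a singular vector are determined by the first one: if it is zero, so are all
the others. -/
theorem eq_zero_of_first (h3 : 3 ≤ N) {Y : Fin N → M}
    (hE : ∀ i a, (if a = natTarget N i then Y (natSource N i) else 0)
        - (if a = (natSource N i).rev then Y (natTarget N i).rev else 0)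
        + qpow hb (pairing N i (natWeight N a)) • genAct N hb M (.e i) (Y a) = 0)
    (h0 : Y ⟨0, by omega⟩ = 0) (j : Fin N) : Y j = 0 := by
  obtain ⟨j, hj⟩ := j
  induction j using Nat.strong_induction_on with
  | _ j ih =>
    rcases Nat.eq_zero_or_pos j with rfl | hpos
    · exact h0
    -- The equation of a suitable `e_i` at a suitable row expresses the coefficient with index `j` through earlier
    -- ones; `e_i` is chosen separately in the two halves of the basis.
    rcases Nat.lt_or_ge (N / 2) j with hjn | hjn
    · have hi : N - 1 - j < N / 2 := by omega
      have ht : natTarget N ⟨N - 1 - j, hi⟩ = ⟨N - 1 - j, by omega⟩ := by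
        rw [natTarget]
        refine Fin.ext (if_pos ?_)
        rw [Nat.odd_iff]
        simp only
        omega
      have := hE ⟨N - 1 - j, hi⟩ (natSource N ⟨N - 1 - j, hi⟩).rev
      rw [if_pos rfl, if_neg (by rw [ht, natSource, Fin.ext_iff, Fin.val_rev]; simp only; omega),
        show (natSource N ⟨N - 1 - j, hi⟩).rev = ⟨j - 1, by omega⟩ by
          rw [natSource, Fin.ext_iff, Fin.val_rev]; simp only; omega,
        ih (j - 1) (by omega) _, map_zero, smul_zero, zero_sub, add_zero, neg_eq_zero, ht] at this
      rw [← this]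
      congr 1
      rw [Fin.ext_iff, Fin.val_rev]
      simp only
      omega
    · have hi : j - 1 < N / 2 := by omega
      have ht : (natTarget N ⟨j - 1, hi⟩ : ℕ) < j ∧ (natTarget N ⟨j - 1, hi⟩ : ℕ) < N - 1 - j := by
        rw [natTarget]
        by_cases hc : j - 1 + 1 < N / 2 ∨ Odd N
        · simp only [if_pos hc]
          rw [Nat.odd_iff] at hc
          omega
        · simp only [if_neg hc]
          rw [Nat.odd_iff] at hc
          omega
      have := hE ⟨j - 1, hi⟩ (natTarget N ⟨j - 1, hi⟩)
      rw [if_pos rfl, if_neg (by rw [natSource, Fin.ext_iff, Fin.val_rev]; simp only; omega),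
        ih _ ht.1 _, map_zero, smul_zero, sub_zero, add_zero] at this
      rw [← this]
      congr 1
      rw [natSource, Fin.ext_iff]
      simp only
      omega

/-- A generating coefficient is a nonzero weight vector annihilated by those `e_i` that do not move a
vector of the natural representation to the first basis vector. -/
theorem IsGeneratingCoefficient.necessary (h3 : 3 ≤ N) {μ : Fin (N / 2) → ℂ} {y : M}
    (hy : IsGeneratingCoefficient N hb M μ y) :
    y ≠ 0 ∧ y ∈ weightSpace N hb M μ ∧
      ∀ i : Fin (N / 2), (natTarget N i : ℕ) ≠ 0 → genAct N hb M (.e i) y = 0 := by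
  obtain ⟨Y, h0, hs⟩ := hy
  obtain ⟨⟨j, hj⟩, hK, hE⟩ := isSingular_sum_iff.1 hs
  have hY := h0 ⟨0, by omega⟩ rfl
  refine ⟨fun h => hj (eq_zero_of_first h3 hE (hY.trans h) j), ?_, fun i hi => ?_⟩
  · have := hK ⟨0, by omega⟩
    rw [hY] at this
    convert this using 2
    funext k
    simp only [Pi.sub_apply, Pi.add_apply, eps, natWeight]
    have hk := k.isLt
    by_cases hk0 : (k : ℕ) = 0
    · simp [hk0]
    · rw [if_neg hk0, if_neg (by omega), if_neg (by omega)]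
      ring
  · have := hE i ⟨0, by omega⟩
    have hi' := i.isLt
    rw [if_neg (fun h => hi (by rw [← h])), if_neg (fun h => by
      rw [natSource, Fin.ext_iff, Fin.val_rev] at h; simp only at h; omega), sub_zero, zero_add, hY]
      at this
    exact (smul_eq_zero.1 this).resolve_left (qpow_ne _ _)

end Necessary

end

/-! ### The singular vector of a string -/

section

open ESys

section Sufficient

variable {M : Type} [AddCommGroup M] [Module ℂ M] {l r δ : ℕ} {q : ℂ} {D U : ℕ → M} {m m' : M}

/-- The coefficients of the singular vector that belongs to a string: the `j`-th one for the `j`-th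
basis vector of the natural representation. -/
def stringY (l r δ : ℕ) (q : ℂ) (D U : ℕ → M) (m m' : M) (j : ℕ) : M :=
  if j ≤ r + l then (-q) ^ j • D (j + 1 - l)
  else if j = r + 1 + l ∧ δ = 1 then (-q) ^ (r + 1 + l) • m'
  else if j = r + 1 + l + δ then (-q) ^ (r + 1 + l) • m
  else (q ^ δ * q ^ (j - (r + 2 + l + δ)) * (-q) ^ (r + 1 + l)) •
    U (2 * l + 3 + 2 * r + δ - l - j)

theorem stringY_D (_ : l ≤ 1) {k : ℕ} (hk : 1 - l ≤ k) (hk' : k ≤ r + 1) :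
    stringY l r δ q D U m m' (k + l - 1) = (-q) ^ (k + l - 1) • D k := by
  rw [stringY, if_pos (by omega), show k + l - 1 + 1 - l = k by omega]

theorem stringY_m' (h1 : δ = 1) :
    stringY l r δ q D U m m' (r + 1 + l) = (-q) ^ (r + 1 + l) • m' := by
  rw [stringY, if_neg (by omega), if_pos ⟨rfl, h1⟩]

theorem stringY_m (_ : δ = 0 ∨ δ = 1) :
    stringY l r δ q D U m m' (r + 1 + l + δ) = (-q) ^ (r + 1 + l) • m := by
  rw [stringY, if_neg (by omega), if_neg (by omega), if_pos rfl]

theorem stringY_U {k j : ℕ} (hk' : k ≤ r + 1)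
    (hj : j + k + l = 2 * l + 3 + 2 * r + δ) : stringY l r δ q D U m m' j =
      (q ^ δ * q ^ (r + 1 - k) * (-q) ^ (r + 1 + l)) • U k := by
  rw [stringY, if_neg (by omega), if_neg (by omega), if_neg (by omega),
    show j - (r + 2 + l + δ) = r + 1 - k by omega,
    show 2 * l + 3 + 2 * r + δ - l - j = k by omega]

end Sufficient

section Sufficient

variable {N l r δ : ℕ} (hl : l ≤ 1) (hδ : δ = 0 ∨ δ = 1) (hN : N = 2 * l + 3 + 2 * r + δ)
include hl hδ hN

/-- The four kinds of basis vectors of the natural representation, and their weights. -/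
theorem natWeight_cases (j : Fin N) :
    (∃ k, 1 - l ≤ k ∧ k ≤ r + 1 ∧ (j : ℕ) = k + l - 1 ∧ natWeight N j = toWt N l (ep k)) ∨
    (δ = 1 ∧ (j : ℕ) = r + 1 + l ∧ natWeight N j = toWt N l (ep (r + 2))) ∨
    ((j : ℕ) = r + 1 + l + δ ∧ natWeight N j = toWt N l (-(δ • ep (r + 2)))) ∨
    (∃ k, 1 - l ≤ k ∧ k ≤ r + 1 ∧ (j : ℕ) + k + l = N ∧ natWeight N j = toWt N l (-ep k)) := by
  have hj := j.isLt
  have hpos : ∀ a, (j : ℕ) < N / 2 → a = (j : ℕ) + 1 - l → natWeight N j = toWt N l (ep a) := by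
    intro a ha hja
    funext k
    have hk := k.isLt
    simp only [natWeight, toWt, ep]
    by_cases h : (j : ℕ) = k
    · rw [if_pos h, if_pos (by omega)]
    · rw [if_neg h, if_neg (by omega), if_neg (by omega)]
  have hneg : ∀ a, 1 - l ≤ a → N ≤ (j : ℕ) + N / 2 → (j : ℕ) + a + l = N →
      natWeight N j = toWt N l (-ep a) := by
    intro a ha' ha hja
    funext k
    have hk := k.isLt
    simp only [natWeight, toWt, ep, Pi.neg_apply]
    rw [if_neg (by omega)]
    by_cases h : (j : ℕ) + k + 1 = N
    · rw [if_pos h, if_pos (by omega)]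
    · rw [if_neg h, if_neg (by omega), neg_zero]
  rcases Nat.lt_or_ge (r + l) j with h1 | h1
  · by_cases h2 : (j : ℕ) = r + 1 + l + δ
    · refine Or.inr (Or.inr (Or.inl ⟨h2, ?_⟩))
      rcases hδ with rfl | rfl
      · funext k
        have hk := k.isLt
        simp only [natWeight, toWt, zero_smul, Pi.neg_apply, Pi.zero_apply, neg_zero]
        rw [if_neg (by omega), if_neg (by omega)]
      · rw [one_smul]
        exact hneg _ (by omega) (by omega) (by omega)
    · rcases Nat.lt_or_ge (r + 1 + l) j with h3 | h3
      · exact Or.inr (Or.inr (Or.inr ⟨N - l - j, by omega, by omega, by omega,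
          hneg _ (by omega) (by omega) (by omega)⟩))
      · exact Or.inr (Or.inl ⟨by omega, by omega, hpos _ (by omega) (by omega)⟩)
  · exact Or.inl ⟨j + 1 - l, by omega, by omega, by omega, hpos _ (by omega) (by omega)⟩

/-- The row of the matrix of `e_i` that contains its first entry. -/
theorem natTarget_node {i : ℕ} (hi : 1 - l ≤ i) (hi' : i ≤ r + 1 + δ) :
    (natTarget N ⟨i + l - 1, node_lt hl hδ hN hi hi'⟩ : ℕ) =
      if i ≤ r + 1 then i + l - 1 else r + l := by
  rw [natTarget]
  simp only [Nat.odd_iff]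
  split_ifs <;> omega

variable {hb : ℂ} {M : Type} [AddCommGroup M] [Module ℂ M] [Module (Uq N hb) M]
  [IsScalarTower ℂ (Uq N hb) M] {D U : ℕ → M} {m m' : M}
  (hs : EString (1 - l) (1 - l) r δ (nodeE N l hb M) D U m m')
include hs

/-- The vector whose coefficients form the string, with powers of `-q` and `q` as factors, is annihilated
by the `Δ e_i`. -/
theorem stringY_row (i : Fin (N / 2)) (a : Fin N) :
    (if a = natTarget N i then stringY l r δ (qpow hb 1) D U m m' (natSource N i) else 0)
        - (if a = (natSource N i).rev then
          stringY l r δ (qpow hb 1) D U m m' (natTarget N i).rev else 0)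
        + qpow hb (pairing N i (natWeight N a)) •
          genAct N hb M (.e i) (stringY l r δ (qpow hb 1) D U m m' a) = 0 := by
  set q := qpow hb 1 with hq
  obtain ⟨k, hk1, hk2, hk3, rfl⟩ : ∃ k, ∃ _ : 1 - l ≤ k, ∃ _ : k ≤ r + 1 + δ,
      ∃ h3 : k + l - 1 < N / 2, i = ⟨k + l - 1, h3⟩ :=
    ⟨i + 1 - l, by omega, by omega, by omega, Fin.ext (by simp only; omega)⟩
  have hsrc : ((natSource N ⟨k + l - 1, hk3⟩ : Fin N) : ℕ) = k + l := by
    rw [natSource]; simp only; omega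
  have htgt := natTarget_node hl hδ hN hk1 hk2
  rw [← nodeAct_of_le hl Gen.e hk1 hk3]
  change _ + _ • nodeE N l hb M k _ = 0
  have hp := fun μ => pairing_node hl hδ hN hk1 hk2 μ
  have hrs : ((natSource N ⟨k + l - 1, hk3⟩).rev : ℕ) = N - (k + l + 1) := by
    rw [Fin.val_rev, hsrc]
  have hrt : ((natTarget N ⟨k + l - 1, hk3⟩).rev : ℕ) =
      N - ((if k ≤ r + 1 then k + l - 1 else r + l) + 1) := by
    rw [Fin.val_rev, htgt]
  simp only [Fin.ext_iff, hrs, hrt, hsrc, htgt]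
  have hno : ∀ b, b ≤ r + 1 → ¬ b + l - 1 = N - (k + l + 1) := fun b hb => by omega
  have ht : (if k ≤ r + 1 then k + l - 1 else r + l) ≤ r + l := by split_ifs <;> omega
  rcases natWeight_cases hl hδ hN a with ⟨b, b1, b2, b3, b4⟩ | ⟨b1, b2, b3⟩ | ⟨b1, b2⟩ |
    ⟨b, b1, b2, b3, b4⟩
  · rw [b4, b3, stringY_D hl b1 b2, map_smul]
    unfold toWt
    rw [hp, if_neg (hno b b2), sub_zero]
    by_cases hb : b = r + 1
    · subst hb
      rw [show r + 1 + l - 1 = r + l by omega]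
      by_cases hk : k = r + 1
      · subst hk
        have hp1 : pr r δ (r + 1) (ep (r + 1)) = 1 := by
          unfold pr
          split_ifs <;> simp [ep]
        rw [if_pos (by rw [if_pos le_rfl]; omega), hs.e_D_end, hp1, ← hq]
        have : stringY l r δ q D U m m' (r + 1 + l) = (-q) ^ (r + 1 + l) • m' := by
          rcases hδ with rfl | rfl
          · rw [← hs.e_D_end, hs.e_D_end']
            exact stringY_m (Or.inl rfl)
          · exact stringY_m' rfl
        rw [this, show r + 1 + l = (r + l) + 1 by omega, pow_succ]
        module
      · by_cases hk' : k = r + 1 + δ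
        · have h1 : δ = 1 := by omega
          subst h1
          subst hk'
          have hp1 : pr r 1 (r + 2) (ep (r + 1)) = 1 := by
            rw [pr_long]; simp [ep]
          rw [if_pos (by rw [if_neg (by omega)]), hs.e_D_end', hp1, ← hq,
            show r + 1 + 1 + l = r + 1 + l + 1 by omega, stringY_m (Or.inr rfl),
            show r + 1 + l = (r + l) + 1 by omega, pow_succ]
          module
        · rw [hs.e_D_last k hk1 hk2 hk hk', smul_zero, smul_zero, add_zero, if_neg]
          rw [if_pos (by omega)]
          omega
    · rw [hs.e_D k b hk1 hk2 b1 (by omega)]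
      by_cases hkb : k = b
      · subst hkb
        have h1 := stringY_D (r := r) (δ := δ) (q := q) (D := D) (U := U) (m := m) (m' := m') hl
          (k := k + 1) (by omega) (by omega)
        rw [show k + 1 + l - 1 = k + l by omega] at h1
        rw [if_pos rfl, if_pos (by rw [if_pos b2]), h1,
          pr_of_le (i := k) (r := r) (δ := δ) (by omega),
          show k + l = (k + l - 1) + 1 by omega, pow_succ, Nat.add_sub_cancel]
        simp only [ep, if_true]
        rw [if_neg (by omega), sub_zero, ← hq]
        module
      · rw [if_neg hkb, smul_zero, smul_zero, add_zero, if_neg]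
        split_ifs <;> omega
  · subst b1
    rw [b3, b2, stringY_m' rfl, map_smul]
    unfold toWt
    rw [hp, if_neg (by omega), zero_sub, hs.e_m' k hk1 hk2]
    by_cases hk : k = r + 2
    · subst hk
      have hp1 : pr r 1 (r + 2) (ep (r + 2)) = 1 := by
        rw [pr_long]; simp [ep]
      rw [if_pos rfl, if_pos (by omega), stringY_U (k := r + 1) le_rfl (by
        rw [if_neg (by omega)]; omega), hp1, ← hq, Nat.sub_self]
      module
    · rw [if_neg hk, if_neg (by omega), neg_zero, smul_zero, smul_zero, add_zero]
  · rw [b2, b1, stringY_m hδ, map_smul]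
    unfold toWt
    rw [hp, if_neg (by omega), zero_sub, hs.e_m k hk1 hk2]
    by_cases hk : k = r + 1
    · subst hk
      have hp1 : qpow hb (pr r δ (r + 1) (-(δ • ep (r + 2)))) = q ^ δ := by
        rcases hδ with rfl | rfl
        · rw [pr_short, zero_smul, neg_zero, Pi.zero_apply, qpow_zero, pow_zero]
        · rw [pr_of_le le_rfl, pow_one, hq]
          congr 1
          simp [ep]
      rw [if_pos rfl, if_pos (by omega), stringY_U (k := r + 1) le_rfl (by
        rw [if_pos le_rfl]; omega), hp1, Nat.sub_self]
      module
    · rw [if_neg hk, if_neg (by omega), neg_zero, smul_zero, smul_zero, add_zero]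
  · rw [b4, stringY_U (j := a) b2 (by omega), map_smul]
    unfold toWt
    rw [hp, if_neg (by omega), zero_sub]
    by_cases hb : b = 1 - l
    · rw [hb, hs.e_U_last k hk1 hk2, if_neg (by omega), neg_zero, smul_zero, smul_zero, add_zero]
    · obtain ⟨c, rfl⟩ : ∃ c, b = c + 1 := ⟨b - 1, by omega⟩
      rw [hs.e_U k c hk1 hk2 (by omega) (by omega)]
      by_cases hkc : k = c
      · subst hkc
        have hp1 : pr r δ k (-ep (k + 1)) = 1 := by
          rw [pr_of_le (by omega)]; simp [ep]
        rw [if_pos rfl, if_pos (by omega), stringY_U (k := k) (by omega) (by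
          rw [if_pos (by omega)]; omega), hp1, ← hq, show r + 1 - k = (r + 1 - (k + 1)) + 1 by omega,
          pow_succ]
        module
      · rw [if_neg hkc, if_neg (by omega), neg_zero, smul_zero, smul_zero, add_zero]

/-- The coefficients of this vector have the required weights. -/
theorem stringY_mem {μ : ℕ → ℂ} (h0 : D (1 - l) ∈ nodeW N l hb M μ) (a : Fin N) :
    stringY l r δ (qpow hb 1) D U m m' a ∈
      weightSpace N hb M (toWt N l (μ + ep (1 - l)) - natWeight N a) := by
  have key : ∀ {ν ν' : ℕ → ℂ} {x y : M} {i : ℕ}, 1 - l ≤ i → i ≤ r + 1 + δ → x ∈ nodeW N l hb M ν →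
      nodeE N l hb M i x = y → ν + al r δ i = ν' → y ∈ nodeW N l hb M ν' := by
    rintro ν _ x _ i hi hi' hx rfl rfl
    exact nodeE_mem hl hδ hN hi hi' hx
  have hD : ∀ k, 1 - l ≤ k → k ≤ r + 1 → D k ∈ nodeW N l hb M (μ + ep (1 - l) - ep k) := by
    intro k hk
    induction k, hk using Nat.le_induction with
    | base => intro _; rwa [add_sub_cancel_right]
    | succ k hk ih =>
      intro hk'
      refine key (by omega) (by omega) (ih (by omega)) ((hs.e_D k k hk (by omega) hk (by omega)).trans
        (if_pos rfl)) ?_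
      rw [al_of_le (by omega)]
      abel
  have hm' : δ = 1 → m' ∈ nodeW N l hb M (μ + ep (1 - l) - ep (r + 2)) := fun h1 => by
    refine key (by omega) (by omega) (hD (r + 1) (by omega) le_rfl) hs.e_D_end ?_
    rw [al_of_le (by omega)]
    abel
  have hm : m ∈ nodeW N l hb M (μ + ep (1 - l) + δ • ep (r + 2)) := by
    refine key (by omega) (by omega) (hD (r + 1) (by omega) le_rfl) hs.e_D_end' ?_
    rcases hδ with rfl | rfl
    · rw [zero_smul, add_zero, add_zero, al_short]
      abel
    · rw [show r + 1 + 1 = r + 2 from rfl, al_long, one_smul]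
      abel
  have hU : ∀ k, k ≤ r + 1 → 1 - l ≤ k → U k ∈ nodeW N l hb M (μ + ep (1 - l) + ep k) := by
    intro k hk
    induction hk using Nat.decreasingInduction with
    | self =>
      intro _
      refine key (by omega) (by omega) hm ((hs.e_m (r + 1) (by omega) (by omega)).trans
        (if_pos rfl)) ?_
      rcases hδ with rfl | rfl
      · rw [zero_smul, add_zero, al_short]
      · rw [al_of_le (by omega), one_smul]
        abel
    | of_succ j hj ih =>
      intro hj'
      refine key hj' (by omega) (ih (by omega)) ((hs.e_U j j hj' (by omega) hj' (by omega)).trans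
        (if_pos rfl)) ?_
      rw [al_of_le (by omega)]
      abel
  rcases natWeight_cases hl hδ hN a with ⟨b, b1, b2, b3, b4⟩ | ⟨b1, b2, b3⟩ | ⟨b1, b2⟩ |
    ⟨b, b1, b2, b3, b4⟩
  · rw [b4, b3, stringY_D hl b1 b2]
    exact Submodule.smul_mem _ _ (hD b b1 b2)
  · rw [b3, b2, stringY_m' b1]
    exact Submodule.smul_mem _ _ (hm' b1)
  · rw [b2, b1, stringY_m hδ]
    refine Submodule.smul_mem _ _ ?_
    have := hm
    rw [← sub_neg_eq_add] at this
    exact this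
  · rw [b4, stringY_U b2 (by omega)]
    refine Submodule.smul_mem _ _ ?_
    have := hU b b2 b1
    rw [← sub_neg_eq_add] at this
    exact this

/-- A nonzero weight vector that starts a string is a generating coefficient. -/
theorem EString.isGeneratingCoefficient {μ : ℕ → ℂ} (h0 : D (1 - l) ∈ nodeW N l hb M μ)
    (hne : D (1 - l) ≠ 0) : IsGeneratingCoefficient N hb M (toWt N l μ) (D (1 - l)) := by
  have hY0 : stringY l r δ (qpow hb 1) D U m m' 0 = D (1 - l) := by
    rw [stringY, if_pos (by omega), pow_zero, one_smul, zero_add]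
  refine ⟨fun j => stringY l r δ (qpow hb 1) D U m m' j, fun j hj => by
    change stringY l r δ (qpow hb 1) D U m m' j = _
    rw [hj, hY0], ?_⟩
  rw [isSingular_sum_iff]
  refine ⟨⟨⟨0, by omega⟩, by rwa [hY0]⟩, fun a => ?_, stringY_row hl hδ hN hs⟩
  convert stringY_mem hl hδ hN hs h0 a using 3
  funext k
  simp only [Pi.add_apply, toWt, eps, ep]
  congr 1
  exact if_congr (by omega) rfl rfl

end Sufficient

end

/-! ### The weight space and the generating coefficients for `l = 0` -/

section

open ESys

section Common

variable {N l r δ : ℕ} {hb : ℂ} (hl : l ≤ 1) (hδ : δ = 0 ∨ δ = 1)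
  (hN : N = 2 * l + 3 + 2 * r + δ)

theorem leviIdeal_mkQ_smul (c : ℂ) (x : UqNeg N hb) :
    (leviIdeal N l hb).mkQ (c • x) = c • (leviIdeal N l hb).mkQ x :=
  ((leviIdeal N l hb).mkQ.restrictScalars ℂ).map_smul c x

theorem mem_negWeightSpace {ν : Fin (N / 2) → ℂ} {x : UqNeg N hb} : x ∈ negWeightSpace N hb ν ↔
    ∀ i, uq N hb (.k i) * (x : Uq N hb) =
      qpow hb (pairing N i ν) • ((x : Uq N hb) * uq N hb (.k i)) := Iff.rfl

theorem smul_mem_weightSpace {M : Type} [AddCommGroup M] [Module ℂ M] [Module (Uq N hb) M]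
    [IsScalarTower ℂ (Uq N hb) M] {ν lam : Fin (N / 2) → ℂ} {x : UqNeg N hb} {v : M}
    (hx : x ∈ negWeightSpace N hb ν) (hv : v ∈ weightSpace N hb M lam) :
    (x : Uq N hb) • v ∈ weightSpace N hb M (lam + ν) := by
  rw [mem_weightSpace] at *
  intro i
  have h1 : uq N hb (.k i) • v = algebraMap ℂ (Uq N hb) (qpow hb (pairing N i lam)) • v := by
    rw [algebraMap_smul]; exact hv i
  rw [genAct_apply, ← mul_smul, mem_negWeightSpace.1 hx i, smul_assoc, mul_smul, h1, ← mul_smul,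
    ← Algebra.commutes, mul_smul, algebraMap_smul, smul_smul, pairing_add, qpow_add, mul_comm]

include hl hδ hN in
/-- The weight of a monomial in the negative generators. -/
theorem negMonomial_mem {w : List ℕ} (hw : ∀ a ∈ w, 1 - l ≤ a ∧ a ≤ r + 1 + δ) :
    negMonomial N l hb w ∈ negWeightSpace N hb (toWt N l (-wsum r δ w)) := by
  rw [mem_negWeightSpace]
  intro i
  induction w with
  | nil =>
    have : pairing N i (toWt N l (-wsum r δ [])) = 0 := by
      rw [wsum_nil]; simp [pairing, toWt]
    rw [this, qpow_zero, one_smul, negMonomial, List.map_nil, List.prod_nil, Subalgebra.coe_one,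
      mul_one, one_mul]
  | cons a w ih =>
    have ha := hw a List.mem_cons_self
    have ih := ih fun b hb => hw b (List.mem_cons_of_mem _ hb)
    have h1 : pairing N i (toWt N l (-wsum r δ (a :: w))) =
        -gram N i ⟨a + l - 1, node_lt hl hδ hN ha.1 ha.2⟩ +
          pairing N i (toWt N l (-wsum r δ w)) := by
      rw [gram, wsum_cons, pairing, pairing, Int.cast_sum, ← Finset.sum_neg_distrib,
        ← Finset.sum_add_distrib]
      refine Finset.sum_congr rfl fun k _ => ?_
      rw [Int.cast_mul, simpleRoot_node hl hδ hN ha.1 ha.2]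
      simp only [toWt, Pi.neg_apply, Pi.add_apply]
      ring
    have h2 : ((negGen N l hb a : UqNeg N hb) : Uq N hb) =
        uq N hb (.f ⟨a + l - 1, node_lt hl hδ hN ha.1 ha.2⟩) := by
      rw [negGen, dif_pos (node_lt hl hδ hN ha.1 ha.2)]
    have h3 := mkUq_rel (hb := hb) (Rel.k_f i ⟨a + l - 1, node_lt hl hδ hN ha.1 ha.2⟩)
    rw [map_mul, map_smul, map_mul] at h3
    change uq N hb _ * uq N hb _ = _ • (uq N hb _ * uq N hb _) at h3
    have h4 : negMonomial N l hb (a :: w) = negGen N l hb a * negMonomial N l hb w := by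
      rw [negMonomial, List.map_cons, List.prod_cons, negMonomial]
    rw [h4, Subalgebra.coe_mul, h2, ← mul_assoc, h3, h1, qpow_add, smul_mul_assoc, mul_assoc, ih,
      mul_smul_comm, smul_smul, mul_assoc]

theorem exists_sum_of_mem_span {ι M : Type*} [AddCommGroup M] [Module ℂ M] {s : Finset ι}
    {g : ι → M} {y : M} (hy : y ∈ Submodule.span ℂ {x | ∃ i ∈ s, x = g i}) :
    ∃ A : ι → ℂ, y = ∑ i ∈ s, A i • g i := by
  have : {x | ∃ i ∈ s, x = g i} = g '' s := by
    ext x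
    simp [eq_comm]
  rw [this, Submodule.mem_span_image_finset_iff_exists_fun] at hy
  obtain ⟨A, rfl⟩ := hy
  classical
  refine ⟨fun i => if h : i ∈ s then A ⟨i, h⟩ else 0, ?_⟩
  refine Eq.trans (Finset.sum_congr rfl fun i _ => ?_)
    (Finset.sum_coe_sort s fun i => (if h : i ∈ s then A ⟨i, h⟩ else 0) • g i)
  rw [dif_pos i.2]

theorem qpow_sub_eq_one (hq : NotRoot hb) {x y : ℂ} (hx : qnum hb x = 0) (hy : qnum hb y = 0) :
    qpow hb (2 * (x - y)) = 1 := by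
  have h1 := hq.qnum_eq_zero hx
  have h2 := hq.qnum_eq_zero hy
  rw [mul_sub, sub_eq_add_neg, qpow_add, qpow_neg, h1, h2]
  simp

/-- The coefficients `A^i_m` do not all vanish: if one of `[λ_1 + P/2]` and `[λ_1 + P/2 - 1]` is zero,
then `A^3_1` or `A^1_1` is not, because `q^P ≠ 1`. -/
theorem exists_coeff1_ne (hq : NotRoot hb) (hδ : δ = 0 ∨ δ = 1) (b : ℂ) :
    ∃ x ∈ indices1 (2 * r + 1 + δ), coeff1 (2 * r + 1 + δ) hb b x ≠ 0 := by
  set P := 2 * r + 1 + δ with hP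
  have hPc : (P : ℂ) = 2 * r + 1 + δ := by rw [hP]; push_cast; ring
  have absurd' : qpow hb (P : ℂ) = 1 → False := fun h => by
    have := hq.nat h
    omega
  have sgn : ∀ n : ℕ, (-1 : ℂ) ^ n ≠ 0 := fun n => pow_ne_zero _ (by norm_num)
  have hm : ∀ i, 1 ≤ i → i ≤ 3 → (i, 1) ∈ indices1 P := fun i h1 h2 =>
    (mem_indices1 hδ).2 ⟨⟨h1, h2⟩, by simp; omega⟩
  by_cases h1 : qnum hb (b + (P : ℂ) / 2) = 0
  · have h2 : qnum hb (b + (P : ℂ) / 2 - 1) ≠ 0 := fun h => by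
      have := hq.qnum_succ h
      rw [sub_add_cancel] at this
      exact this h1
    refine ⟨(3, 1), hm 3 (by omega) le_rfl, ?_⟩
    rw [coeff1, if_neg (by simp), if_neg (by simp)]
    refine mul_ne_zero (mul_ne_zero (sgn _) fun h => absurd' ?_) h2
    have := qpow_sub_eq_one hq h1 h
    rw [← this]
    congr 1
    push_cast
    ring
  by_cases h2 : qnum hb (b + (P : ℂ) / 2 - 1) = 0
  · refine ⟨(1, 1), hm 1 le_rfl (by omega), ?_⟩
    rw [coeff1, if_pos rfl]
    refine mul_ne_zero (mul_ne_zero (sgn _) fun h => absurd' ?_) h1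
    have := qpow_sub_eq_one hq h h2
    rw [← this]
    congr 1
    push_cast
    ring
  · refine ⟨(2, r + 1 + δ), (mem_indices1 hδ).2 ⟨by simp, by simp; omega, Or.inr rfl⟩, ?_⟩
    rw [coeff1, if_neg (by simp), if_pos rfl]
    split_ifs with h3
    · exact mul_ne_zero (mul_ne_zero (sgn _) h2) h1
    · have h0 : δ = 0 := by
        rw [Nat.even_iff] at h3
        simp only at h3
        omega
      subst h0
      refine mul_ne_zero (mul_ne_zero (mul_ne_zero (sgn _) ?_) h2) h1
      have := seqE_last_ne (P := (P : ℂ)) (r := r) (δ := 0) hq (by rw [hPc]) (Or.inl rfl)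
      exact (mul_ne_zero_iff.1 this).2

end Common

section Zero

variable {r δ : ℕ} {hb : ℂ} (hδ : δ = 0 ∨ δ = 1) (hq : NotRoot hb)

/-- The weights of the case `l = 0`. -/
def muZero (a : ℂ) : ℕ → ℂ := fun k => if k = 1 then a else 0

theorem muZero_zero (a : ℂ) : ∀ i, 2 ≤ i → muZero a i = 0 := fun i hi => if_neg (by omega)

theorem toWt_muZero (P : ℕ) (a : ℂ) : toWt (P + 2) 0 (muZero a) = a • eps (P + 2) 0 := by
  funext k
  simp [toWt, muZero, eps]

theorem toWt_muZero_sub (P : ℕ) (a : ℂ) : toWt (P + 2) 0 (muZero a - 2 • ep 1) =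
    toWt (P + 2) 0 (muZero a) - (2 : ℂ) • eps (P + 2) 0 := by
  funext k
  simp [toWt, muZero, eps, ep]

include hδ

theorem phi_smul {m : ℕ} (hm : m ∈ indices0 (2 * r + 1 + δ)) {M : Type} [AddCommGroup M]
    [Module ℂ M] [Module (Uq (2 * r + 1 + δ + 2) hb) M]
    [IsScalarTower ℂ (Uq (2 * r + 1 + δ + 2) hb) M] (x : M) :
    (phi (2 * r + 1 + δ) hb m : Uq (2 * r + 1 + δ + 2) hb) • x =
      app (nodeF (2 * r + 1 + δ + 2) 0 hb M) (phiWord (2 * r + 1 + δ) m) x := by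
  rw [indices0_eq hδ, Finset.mem_Icc] at hm
  exact negMonomial_smul (fun a ha => (le_of_mem_phiWord hδ hm.1 (by omega) ha).1) x

theorem dynRoot0_smul {M : Type} [AddCommGroup M]
    [Module ℂ M] [Module (Uq (2 * r + 1 + δ + 2) hb) M]
    [IsScalarTower ℂ (Uq (2 * r + 1 + δ + 2) hb) M] (x : M) :
    (dynRoot0 (2 * r + 1 + δ) hb : Uq (2 * r + 1 + δ + 2) hb) • x =
      combZero (2 * r + 1 + δ) (coeff0 (2 * r + 1 + δ) hb)
        (nodeF (2 * r + 1 + δ + 2) 0 hb M) x := by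
  rw [dynRoot0, coe_sum_smul, combZero]
  exact Finset.sum_congr rfl fun m hm => by rw [phi_smul hδ hm]

include hq

theorem verma_zero_indep (a : ℂ) {A : ℕ → ℂ}
    (hA : combZero (2 * r + 1 + δ) A (nodeF (2 * r + 1 + δ + 2) 0 hb _)
      (vermaGen (2 * r + 1 + δ + 2) 0 hb (toWt _ 0 (muZero a))) = 0) {m : ℕ}
    (hm : m ∈ indices0 (2 * r + 1 + δ)) : A m = 0 := by
  have hN : 2 * r + 1 + δ + 2 = 2 * 0 + 3 + 2 * r + δ := by omega
  exact zero_indep le_rfl (vermaSys (by omega) hδ hN hq (muZero_zero 2)) rfl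
    (verma_wRel (by omega) hq (muZero_zero a) _) hA hm

/-- The vectors `φ_m v_λ` are linearly independent. -/
theorem linearIndependent_phi (a : ℂ) :
    LinearIndependent ℂ (fun m : indices0 (2 * r + 1 + δ) =>
      (phi (2 * r + 1 + δ) hb m : Uq (2 * r + 1 + δ + 2) hb) •
        vermaGen (2 * r + 1 + δ + 2) 0 hb (toWt _ 0 (muZero a))) := by
  rw [Fintype.linearIndependent_iff]
  intro g hg i
  have := verma_zero_indep hδ hq a (A := fun m => if h : m ∈ indices0 (2 * r + 1 + δ) then g ⟨m, h⟩
    else 0) (m := i) ?_ i.2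
  · rwa [dif_pos i.2] at this
  · rw [← hg, combZero, ← Finset.sum_coe_sort]
    refine Finset.sum_congr rfl fun m _ => ?_
    rw [dif_pos m.2, phi_smul hδ m.2]

/-- The vectors `φ_m v_λ` span the weight space. -/
theorem mem_weightSpace_zero_iff (a : ℂ)
    {y : Verma (2 * r + 1 + δ + 2) 0 hb (toWt _ 0 (muZero a))} :
    y ∈ weightSpace (2 * r + 1 + δ + 2) hb _
      (toWt (2 * r + 1 + δ + 2) 0 (muZero a) - (2 : ℂ) • eps (2 * r + 1 + δ + 2) 0) ↔
    y ∈ Submodule.span ℂ {x | ∃ m ∈ indices0 (2 * r + 1 + δ),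
      x = app (nodeF (2 * r + 1 + δ + 2) 0 hb _) (phiWord (2 * r + 1 + δ) m)
        (vermaGen (2 * r + 1 + δ + 2) 0 hb (toWt _ 0 (muZero a)))} := by
  have hN : 2 * r + 1 + δ + 2 = 2 * 0 + 3 + 2 * r + δ := by omega
  have h := vermaSys (by omega) hδ hN hq (muZero_zero a)
  rw [← toWt_muZero_sub]
  constructor
  · intro hy
    rw [← wsum_phiWord hδ le_rfl (by omega)] at hy
    refine (Submodule.span_le.2 ?_) (verma_mem_span_perm (by omega) hδ hN hq (muZero_zero a)
      (fun b hb => le_of_mem_phiWord hδ le_rfl (by omega) hb) hy)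
    rintro _ ⟨u, hu, rfl⟩
    exact app_mem_span_phiWord h hu
  · intro hy
    refine (Submodule.span_le.2 ?_) hy
    rintro _ ⟨m, hm, rfl⟩
    rw [indices0_eq hδ, Finset.mem_Icc] at hm
    have := app_mem_wsum h (w := phiWord (2 * r + 1 + δ) m) fun b hb =>
      le_of_mem_phiWord hδ hm.1 (by omega) hb
    rw [wsum_phiWord hδ hm.1 (by omega)] at this
    exact this

theorem span_phi (a : ℂ) : Submodule.span ℂ (Set.range fun m : indices0 (2 * r + 1 + δ) =>
      (phi (2 * r + 1 + δ) hb m : Uq (2 * r + 1 + δ + 2) hb) •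
        vermaGen (2 * r + 1 + δ + 2) 0 hb (toWt _ 0 (muZero a))) =
    weightSpace (2 * r + 1 + δ + 2) hb (Verma (2 * r + 1 + δ + 2) 0 hb (toWt _ 0 (muZero a)))
      (toWt (2 * r + 1 + δ + 2) 0 (muZero a) - (2 : ℂ) • eps (2 * r + 1 + δ + 2) 0) := by
  ext y
  rw [mem_weightSpace_zero_iff hδ hq]
  have : (Set.range fun m : indices0 (2 * r + 1 + δ) =>
      (phi (2 * r + 1 + δ) hb m : Uq (2 * r + 1 + δ + 2) hb) •
        vermaGen (2 * r + 1 + δ + 2) 0 hb (toWt _ 0 (muZero a))) =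
      {x | ∃ m ∈ indices0 (2 * r + 1 + δ),
      x = app (nodeF (2 * r + 1 + δ + 2) 0 hb _) (phiWord (2 * r + 1 + δ) m)
        (vermaGen (2 * r + 1 + δ + 2) 0 hb (toWt _ 0 (muZero a)))} := by
    ext x
    constructor
    · rintro ⟨m, rfl⟩
      exact ⟨m, m.2, phi_smul hδ m.2 _⟩
    · rintro ⟨m, hm, rfl⟩
      exact ⟨⟨m, hm⟩, phi_smul hδ hm _⟩
  rw [this]

/-- The generating coefficients in the case `l = 0`: a generating coefficient is annihilated by the
`e_i`, `i ≥ 2`, hence given by `zero_unique`; conversely the vector of `zero_kill` starts a string. -/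
theorem isGeneratingCoefficient_zero_iff (a : ℂ)
    (y : Verma (2 * r + 1 + δ + 2) 0 hb (toWt _ 0 (muZero a))) :
    IsGeneratingCoefficient (2 * r + 1 + δ + 2) hb _
      (toWt (2 * r + 1 + δ + 2) 0 (muZero a) - (2 : ℂ) • eps (2 * r + 1 + δ + 2) 0) y ↔
    ∃ c : ℂ, c ≠ 0 ∧ y = c • ((dynRoot0 (2 * r + 1 + δ) hb : Uq (2 * r + 1 + δ + 2) hb) •
      vermaGen (2 * r + 1 + δ + 2) 0 hb (toWt _ 0 (muZero a))) := by
  have hN : 2 * r + 1 + δ + 2 = 2 * 0 + 3 + 2 * r + δ := by omega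
  have h := vermaSys (by omega) hδ hN hq (muZero_zero a)
  have h2 := vermaSys (by omega) hδ hN hq (muZero_zero 2)
  rw [dynRoot0_smul hδ]
  constructor
  · intro hy
    obtain ⟨y0, yW, yE⟩ := hy.necessary (by omega)
    obtain ⟨A, hA⟩ := exists_sum_of_mem_span ((mem_weightSpace_zero_iff hδ hq a).1 yW)
    change y = combZero _ A _ _ at hA
    obtain ⟨κ, hκ⟩ := zero_unique h le_rfl h2 rfl
      (verma_wRel (by omega) hq (muZero_zero a) _) (A := A) fun hr i hi hi' => by
        rw [← hA, nodeE, nodeAct_of_le (by omega) _ (by omega) (by omega)]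
        refine yE _ ?_
        rw [natTarget_node (l := 0) (by omega) hδ hN (by omega) hi']
        split_ifs <;> omega
    have hy' : y = κ • combZero (2 * r + 1 + δ) (coeff0 (2 * r + 1 + δ) hb)
        (nodeF (2 * r + 1 + δ + 2) 0 hb _)
        (vermaGen (2 * r + 1 + δ + 2) 0 hb (toWt _ 0 (muZero a))) := by
      rw [hA, combZero, combZero, Finset.smul_sum]
      exact Finset.sum_congr rfl fun m hm => by rw [hκ m hm, mul_smul]
    exact ⟨κ, fun h0 => y0 (by rw [hy', h0, zero_smul]), hy'⟩
  · rintro ⟨c, hc, rfl⟩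
    set z := combZero (2 * r + 1 + δ) (coeff0 (2 * r + 1 + δ) hb)
        (nodeF (2 * r + 1 + δ + 2) 0 hb _)
        (vermaGen (2 * r + 1 + δ + 2) 0 hb (toWt _ 0 (muZero a))) with hz
    have hz0 : z ≠ 0 := fun h0 => by
      have := verma_zero_indep hδ hq a h0 (m := r + 1) (by
        rw [indices0_eq hδ, Finset.mem_Icc]; omega)
      rw [coeff0_eq _ (by omega)] at this
      exact seqG_last_ne (r := r) (δ := δ) hq (by push_cast; ring) this
    have hzW := (mem_weightSpace_zero_iff hδ hq a (y := c • z)).2 (Submodule.smul_mem _ _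
      (Submodule.sum_mem _ fun m hm => Submodule.smul_mem _ _ (Submodule.subset_span ⟨m, hm, rfl⟩)))
    rw [← toWt_muZero_sub] at hzW ⊢
    obtain ⟨D, U, m, m', hD, hs⟩ := exists_eString h le_rfl
      (a := fun m => c * cut r (coeff0 (2 * r + 1 + δ) hb) m) (z := c • z) (by
        rw [hz, combZero, indices0_eq hδ, Finset.smul_sum]
        have : ∀ m ∈ Finset.Icc 1 (r + 1), c • coeff0 (2 * r + 1 + δ) hb m •
            app (nodeF (2 * r + 1 + δ + 2) 0 hb _) (phiWord (2 * r + 1 + δ) m)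
              (vermaGen (2 * r + 1 + δ + 2) 0 hb (toWt _ 0 (muZero a))) =
            (c * cut r (coeff0 (2 * r + 1 + δ) hb) m) •
            app (nodeF (2 * r + 1 + δ + 2) 0 hb _) (phiWord (2 * r + 1 + δ) m)
              (vermaGen (2 * r + 1 + δ + 2) 0 hb (toWt _ 0 (muZero a))) := fun m hm => by
          rw [cut, if_pos (Finset.mem_Icc.1 hm).2, mul_smul]
        rw [Finset.sum_congr rfl this]
        refine Finset.sum_subset (Finset.Icc_subset_Icc le_rfl (by omega)) fun m _ hm' => ?_
        simp only [Finset.mem_Icc] at *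
        rw [cut, if_neg (by omega), mul_zero, zero_smul])
      fun hr i hi hi' => by rw [map_smul, zero_kill h le_rfl hr hi hi', smul_zero]
    rw [← hD] at hzW ⊢
    exact hs.isGeneratingCoefficient (l := 0) (by omega) hδ hN hzW
      (by change D 1 ≠ 0; rw [hD]; exact smul_ne_zero hc hz0)

end Zero

end

/-! ### The weight space and the generating coefficients for `l = 1` -/

section

open ESys

section One

variable {r δ : ℕ} {hb : ℂ} (hδ : δ = 0 ∨ δ = 1) (hq : NotRoot hb)

/-- The weights of the case `l = 1`. -/
def muOne (a b : ℂ) : ℕ → ℂ := fun k => if k = 0 then a else if k = 1 then b else 0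

theorem muOne_zero (a b : ℂ) : ∀ i, 2 ≤ i → muOne a b i = 0 := fun i hi => by
  rw [muOne, if_neg (by omega), if_neg (by omega)]

theorem toWt_muOne (P : ℕ) (a b : ℂ) :
    toWt (P + 4) 1 (muOne a b) = a • eps (P + 4) 0 + b • eps (P + 4) 1 := by
  funext k
  simp only [toWt, muOne, eps, Nat.add_sub_cancel, Pi.add_apply, Pi.smul_apply, smul_eq_mul]
  split_ifs <;> simp
  omega

theorem toWt_muOne_sub (P : ℕ) (a b : ℂ) : toWt (P + 4) 1 (muOne a b - (ep 0 + ep 1)) =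
    toWt (P + 4) 1 (muOne a b) - eps (P + 4) 0 - eps (P + 4) 1 := by
  rw [← sub_sub]
  rfl

theorem phi'_smul (x : ℕ × ℕ) {M : Type} [AddCommGroup M]
    [Module ℂ M] [Module (Uq (2 * r + 1 + δ + 4) hb) M]
    [IsScalarTower ℂ (Uq (2 * r + 1 + δ + 4) hb) M] (v : M) :
    (phi' (2 * r + 1 + δ) hb x : Uq (2 * r + 1 + δ + 4) hb) • v =
      app (nodeF (2 * r + 1 + δ + 4) 1 hb M) (phiWord' (2 * r + 1 + δ) x.1 x.2) v :=
  negMonomial_smul (fun a _ => by omega) v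

theorem sum_phi'_smul (A : ℕ × ℕ → ℂ) {M : Type} [AddCommGroup M]
    [Module ℂ M] [Module (Uq (2 * r + 1 + δ + 4) hb) M]
    [IsScalarTower ℂ (Uq (2 * r + 1 + δ + 4) hb) M] (v : M) :
    ((∑ x ∈ indices1 (2 * r + 1 + δ), A x • phi' (2 * r + 1 + δ) hb x :
      UqNeg (2 * r + 1 + δ + 4) hb) : Uq (2 * r + 1 + δ + 4) hb) • v =
      combOne (2 * r + 1 + δ) A (nodeF (2 * r + 1 + δ + 4) 1 hb M) v := by
  rw [coe_sum_smul, combOne]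
  exact Finset.sum_congr rfl fun x _ => by rw [phi'_smul]

include hδ hq

theorem verma_one_indep (a b : ℂ) {A : ℕ × ℕ → ℂ}
    (hA : combOne (2 * r + 1 + δ) A (nodeF (2 * r + 1 + δ + 4) 1 hb _)
      (vermaGen (2 * r + 1 + δ + 4) 1 hb (toWt _ 1 (muOne a b))) = 0) {x : ℕ × ℕ}
    (hx : x ∈ indices1 (2 * r + 1 + δ)) : A x = 0 := by
  have hN : 2 * r + 1 + δ + 4 = 2 * 1 + 3 + 2 * r + δ := by omega
  have h21 := vermaSys le_rfl hδ hN hq (muOne_zero 2 1)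
  have h32 := vermaSys le_rfl hδ hN hq (muOne_zero 3 2)
  have wr : ∀ (a b : ℂ) lam, _ := fun a b lam =>
    verma_wRel (N := 2 * r + 1 + δ + 4) (l := 1) le_rfl hq (muOne_zero a b) lam
  exact one_indep h21 rfl rfl (wr _ _ _) h32 rfl rfl (wr _ _ _) (wr _ _ _) (wr _ _ _) hA hx

/-- The `φ^i_m` are linearly independent in the quotient of `U_q(g_-)`, since they are so when they are
applied to the canonical generator of a parabolic Verma module. -/
theorem linearIndependent_phi' :
    LinearIndependent ℂ (fun x : indices1 (2 * r + 1 + δ) =>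
      (leviIdeal (2 * r + 1 + δ + 4) 1 hb).mkQ (phi' (2 * r + 1 + δ) hb x)) := by
  rw [Fintype.linearIndependent_iff]
  intro g hg i
  have := verma_one_indep hδ hq 0 0 (A := fun x => if h : x ∈ indices1 (2 * r + 1 + δ) then g ⟨x, h⟩
    else 0) (x := i) ?_ i.2
  · rwa [dif_pos i.2] at this
  · rw [← sum_phi'_smul]
    refine smul_vermaGen_eq_zero ?_
    rw [← Submodule.Quotient.mk_eq_zero, ← Submodule.mkQ_apply, ← hg, ← Finset.sum_coe_sort, map_sum]
    refine Finset.sum_congr rfl fun x _ => ?_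
    rw [dif_pos x.2]
    exact leviIdeal_mkQ_smul _ _

theorem verma_mem_span_one (a b : ℂ)
    {y : Verma (2 * r + 1 + δ + 4) 1 hb (toWt _ 1 (muOne a b))}
    (hy : y ∈ weightSpace (2 * r + 1 + δ + 4) hb _
      (toWt (2 * r + 1 + δ + 4) 1 (muOne a b - (ep 0 + ep 1)))) :
    ∃ A, y = combOne (2 * r + 1 + δ) A (nodeF (2 * r + 1 + δ + 4) 1 hb _)
      (vermaGen (2 * r + 1 + δ + 4) 1 hb (toWt _ 1 (muOne a b))) := by
  have hN : 2 * r + 1 + δ + 4 = 2 * 1 + 3 + 2 * r + δ := by omega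
  have h := vermaSys le_rfl hδ hN hq (muOne_zero a b)
  rw [← wsum_phiWord' (r := r) hδ 1 le_rfl (by omega)] at hy
  refine exists_sum_of_mem_span ((Submodule.span_le.2 ?_) (verma_mem_span_perm le_rfl hδ hN hq
    (muOne_zero a b) (fun b hb => ⟨by omega, le_of_mem_phiWord' hδ le_rfl (by omega) hb⟩) hy))
  rintro _ ⟨u, hu, rfl⟩
  exact app_mem_span_phiWord' h hu

theorem span_phi' : Submodule.span ℂ (Set.range fun x : indices1 (2 * r + 1 + δ) =>
      (leviIdeal (2 * r + 1 + δ + 4) 1 hb).mkQ (phi' (2 * r + 1 + δ) hb x)) =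
    leviWeightSpace (2 * r + 1 + δ + 4) 1 hb
      (-eps (2 * r + 1 + δ + 4) 0 - eps (2 * r + 1 + δ + 4) 1) := by
  have hN : 2 * r + 1 + δ + 4 = 2 * 1 + 3 + 2 * r + δ := by omega
  have hw : toWt (2 * r + 1 + δ + 4) 1 (-(ep 0 + ep 1)) =
      -eps (2 * r + 1 + δ + 4) 0 - eps (2 * r + 1 + δ + 4) 1 := by
    rw [neg_add']
    rfl
  rw [← hw]
  refine le_antisymm (Submodule.span_le.2 ?_) ?_
  · rintro _ ⟨⟨x, hx⟩, rfl⟩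
    refine ⟨phi' (2 * r + 1 + δ) hb x, ?_, rfl⟩
    rw [mem_indices1 hδ] at hx
    have := negMonomial_mem (hb := hb) le_rfl hδ hN
      (w := phiWord' (2 * r + 1 + δ) x.1 x.2) fun a ha =>
        ⟨by omega, le_of_mem_phiWord' hδ hx.2.1.1 hx.2.1.2 ha⟩
    rw [wsum_phiWord' hδ _ hx.2.1.1 hx.2.1.2] at this
    exact this
  · rintro _ ⟨u, hu, rfl⟩
    -- the action on the canonical generator of a parabolic Verma module is injective
    have h1 := smul_mem_weightSpace hu (vermaGen_mem (hb := hb) (l := 1) (toWt _ 1 (muOne 0 0)))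
    obtain ⟨A, hA⟩ := verma_mem_span_one hδ hq 0 0 h1
    rw [← sum_phi'_smul, ← sub_eq_zero, ← sub_smul, ← Subalgebra.coe_sub] at hA
    have h2 := mem_leviIdeal_of_smul_eq_zero hq (pairing_levi le_rfl (muOne_zero 0 0)) hA
    rw [← Submodule.Quotient.mk_eq_zero, ← Submodule.mkQ_apply, map_sub, sub_eq_zero, map_sum] at h2
    change (leviIdeal (2 * r + 1 + δ + 4) 1 hb).mkQ u ∈ _
    rw [h2]
    refine Submodule.sum_mem _ fun x hx => ?_
    rw [leviIdeal_mkQ_smul]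
    exact Submodule.smul_mem _ _ (Submodule.subset_span ⟨⟨x, hx⟩, rfl⟩)

/-- The generating coefficients in the case `l = 1`: a generating coefficient is annihilated by the
`e_i`, `i ≥ 1`, hence given by `one_unique`; conversely the vector of `one_kill` starts a string. -/
theorem isGeneratingCoefficient_one_iff (a b : ℂ)
    (y : Verma (2 * r + 1 + δ + 4) 1 hb (toWt _ 1 (muOne a b))) :
    IsGeneratingCoefficient (2 * r + 1 + δ + 4) hb _
      (toWt (2 * r + 1 + δ + 4) 1 (muOne a b) - eps (2 * r + 1 + δ + 4) 0
        - eps (2 * r + 1 + δ + 4) 1) y ↔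
    ∃ c : ℂ, c ≠ 0 ∧ y = c • ((dynRoot1 (2 * r + 1 + δ) hb b : Uq (2 * r + 1 + δ + 4) hb) •
      vermaGen (2 * r + 1 + δ + 4) 1 hb (toWt _ 1 (muOne a b))) := by
  have hN : 2 * r + 1 + δ + 4 = 2 * 1 + 3 + 2 * r + δ := by omega
  have h := vermaSys le_rfl hδ hN hq (muOne_zero a b)
  have h21 := vermaSys le_rfl hδ hN hq (muOne_zero 2 1)
  have h32 := vermaSys le_rfl hδ hN hq (muOne_zero 3 2)
  have hb1 : muOne a b 1 = b := rfl
  have wr : ∀ lam, _ := fun lam =>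
    verma_wRel (N := 2 * r + 1 + δ + 4) (l := 1) le_rfl hq (muOne_zero a b) lam
  rw [dynRoot1, sum_phi'_smul, ← toWt_muOne_sub]
  have smul_comb : ∀ κ : ℂ, κ • combOne (2 * r + 1 + δ) (coeff1 (2 * r + 1 + δ) hb b)
      (nodeF (2 * r + 1 + δ + 4) 1 hb _)
      (vermaGen (2 * r + 1 + δ + 4) 1 hb (toWt _ 1 (muOne a b))) =
      combOne (2 * r + 1 + δ) (fun x => κ * coeff1 (2 * r + 1 + δ) hb b x)
      (nodeF (2 * r + 1 + δ + 4) 1 hb _)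
      (vermaGen (2 * r + 1 + δ + 4) 1 hb (toWt _ 1 (muOne a b))) := fun κ => by
    rw [combOne, combOne, Finset.smul_sum]
    exact Finset.sum_congr rfl fun x _ => by rw [mul_smul]
  constructor
  · intro hy
    obtain ⟨y0, yW, yE⟩ := hy.necessary (by omega)
    obtain ⟨A, hA⟩ := verma_mem_span_one hδ hq a b yW
    obtain ⟨κ, hκ⟩ := one_unique h h21 rfl rfl (wr _) h32 rfl rfl (wr _) (A := A)
      fun i hi hi' => by
        rw [← hA, nodeE, nodeAct_of_le le_rfl _ (by omega) (by omega)]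
        refine yE _ ?_
        rw [natTarget_node (l := 1) le_rfl hδ hN (by omega) hi']
        split_ifs <;> omega
    have hy' : y = κ • combOne (2 * r + 1 + δ) (coeff1 (2 * r + 1 + δ) hb b)
        (nodeF (2 * r + 1 + δ + 4) 1 hb _)
        (vermaGen (2 * r + 1 + δ + 4) 1 hb (toWt _ 1 (muOne a b))) := by
      rw [smul_comb, hA]
      exact Finset.sum_congr rfl fun x hx => by rw [hκ x hx, hb1]
    exact ⟨κ, fun h0 => y0 (by rw [hy', h0, zero_smul]), hy'⟩
  · rintro ⟨c, hc, rfl⟩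
    have hz0 : combOne (2 * r + 1 + δ) (coeff1 (2 * r + 1 + δ) hb b)
        (nodeF (2 * r + 1 + δ + 4) 1 hb _)
        (vermaGen (2 * r + 1 + δ + 4) 1 hb (toWt _ 1 (muOne a b))) ≠ 0 := fun h0 => by
      obtain ⟨x, hx, hx'⟩ := exists_coeff1_ne (r := r) hq hδ b
      exact hx' (verma_one_indep hδ hq a b h0 hx)
    have hk : ∀ i, 1 ≤ i → i ≤ r + 1 + δ → nodeE (2 * r + 1 + δ + 4) 1 hb _ i
        (combOne (2 * r + 1 + δ) (fun x => c * coeff1 (2 * r + 1 + δ) hb b x)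
          (nodeF (2 * r + 1 + δ + 4) 1 hb _)
          (vermaGen (2 * r + 1 + δ + 4) 1 hb (toWt _ 1 (muOne a b)))) = 0 := fun i hi hi' => by
      rw [← smul_comb, map_smul]
      exact (congrArg (c • ·) (one_kill h hi hi')).trans (smul_zero _)
    obtain ⟨D, U, m, m', hD, hs⟩ := exists_eString_one h rfl
      (fun hr i x hi hi' => nodeE_comm le_rfl hδ hN hr rfl hi hi' x) hk
    rw [smul_comb, ← hD]
    refine hs.isGeneratingCoefficient (l := 1) le_rfl hδ hN ?_ ?_
    · change D 0 ∈ _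
      rw [hD]
      refine Submodule.sum_mem _ fun x hx => Submodule.smul_mem _ _ ?_
      rw [mem_indices1 hδ] at hx
      have := app_mem_wsum h (w := phiWord' (2 * r + 1 + δ) x.1 x.2) fun a ha =>
        ⟨by omega, le_of_mem_phiWord' hδ hx.2.1.1 hx.2.1.2 ha⟩
      rwa [wsum_phiWord' hδ _ hx.2.1.1 hx.2.1.2] at this
    · change D 0 ≠ 0
      rw [hD, ← smul_comb]
      exact smul_ne_zero hc hz0

end One

end

end QuantumSO

end

theorem mainTheorem7 (P : ℕ) (hP : 1 ≤ P) (hb : ℂ)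
    (hq : ∀ k : ℕ, 0 < k → Complex.exp hb ^ k ≠ 1) :
    -- the case `l = 1`, `N = P + 4`
    (LinearIndependent ℂ (fun x : QuantumSO.indices1 P =>
        (QuantumSO.leviIdeal (P + 4) 1 hb).mkQ (QuantumSO.phi' P hb x)) ∧
      Submodule.span ℂ (Set.range fun x : QuantumSO.indices1 P =>
        (QuantumSO.leviIdeal (P + 4) 1 hb).mkQ (QuantumSO.phi' P hb x)) =
        QuantumSO.leviWeightSpace (P + 4) 1 hb
          (-QuantumSO.eps (P + 4) 0 - QuantumSO.eps (P + 4) 1)) ∧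
    (∀ (a b : ℂ) (lam : Fin ((P + 4) / 2) → ℂ),
      lam = a • QuantumSO.eps (P + 4) 0 + b • QuantumSO.eps (P + 4) 1 →
      ∀ y : QuantumSO.Verma (P + 4) 1 hb lam,
        QuantumSO.IsGeneratingCoefficient (P + 4) hb (QuantumSO.Verma (P + 4) 1 hb lam)
            (lam - QuantumSO.eps (P + 4) 0 - QuantumSO.eps (P + 4) 1) y ↔
          ∃ c : ℂ, c ≠ 0 ∧
            y = c • ((QuantumSO.dynRoot1 P hb b : QuantumSO.Uq (P + 4) hb) •
              QuantumSO.vermaGen (P + 4) 1 hb lam)) ∧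
    -- the case `l = 0`, `N = P + 2`
    (∀ (a : ℂ) (lam : Fin ((P + 2) / 2) → ℂ), lam = a • QuantumSO.eps (P + 2) 0 →
      (LinearIndependent ℂ (fun m : QuantumSO.indices0 P =>
          (QuantumSO.phi P hb m : QuantumSO.Uq (P + 2) hb) •
            QuantumSO.vermaGen (P + 2) 0 hb lam) ∧
        Submodule.span ℂ (Set.range fun m : QuantumSO.indices0 P =>
          (QuantumSO.phi P hb m : QuantumSO.Uq (P + 2) hb) •
            QuantumSO.vermaGen (P + 2) 0 hb lam) =
          QuantumSO.weightSpace (P + 2) hb (QuantumSO.Verma (P + 2) 0 hb lam)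
            (lam - (2 : ℂ) • QuantumSO.eps (P + 2) 0)) ∧
      ∀ y : QuantumSO.Verma (P + 2) 0 hb lam,
        QuantumSO.IsGeneratingCoefficient (P + 2) hb (QuantumSO.Verma (P + 2) 0 hb lam)
            (lam - (2 : ℂ) • QuantumSO.eps (P + 2) 0) y ↔
          ∃ c : ℂ, c ≠ 0 ∧
            y = c • ((QuantumSO.dynRoot0 P hb : QuantumSO.Uq (P + 2) hb) •
              QuantumSO.vermaGen (P + 2) 0 hb lam)) := by
  obtain ⟨r, δ, hδ, rfl⟩ : ∃ r δ, (δ = 0 ∨ δ = 1) ∧ P = 2 * r + 1 + δ :=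
    ⟨(P - 1) / 2, (P - 1) % 2, by omega, by omega⟩
  refine ⟨⟨QuantumSO.linearIndependent_phi' hδ hq, QuantumSO.span_phi' hδ hq⟩, ?_, ?_⟩
  · intro a b lam hlam
    have h := hlam.trans (QuantumSO.toWt_muOne _ a b).symm
    clear hlam
    subst h
    exact QuantumSO.isGeneratingCoefficient_one_iff hδ hq a b
  · intro a lam hlam
    have h := hlam.trans (QuantumSO.toWt_muZero _ a).symm
    clear hlam
    subst h
    exact ⟨⟨QuantumSO.linearIndependent_phi hδ hq a, QuantumSO.span_phi hδ hq a⟩,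
      QuantumSO.isGeneratingCoefficient_zero_iff hδ hq a⟩
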